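/- Let $2\le m<n$ be integers and let either $G_k=Spin(1,k)$ for $k=m,n$, or $G_k=SO(1,k)_0$ for $k=m,n$, with the standard inclusion $G_m\subset G_n$. Let $P_k=M_kA_kN_k\subset G_k$ be compatible minimal parabolic subgroups (so that $P_m\subset P_n$, $M_m\subset M_n$ and $A_m\cong A_n=:A$), and let $\partial X^k=G_k/P_k\cong S^{k-1}$. Let $\rho^k=\frac{k-1}{2}\alpha$, where $\alpha\in\mathfrak a^*$ is the positive root. For a finite-dimensional irreducible continuous complex representation $\sigma$ of $M_k$ and $\lambda\in\mathfrak a^*_{\mathbb C}$ let $V^k(\sigma_\lambda)=G_k\times_{P_k}V_\sigma$ be the homogeneous bundle given by $\sigma_\lambda(man)=\sigma(m)a^{\rho^k-\lambda}$, and for a finite-dimensional complex vector space $F$ (the space of a twist) put $V^k(\sigma_\lambda,F)=V^k(\sigma_\lambda)\otimes F$. Its space of distribution sections is $$C^{-\infty}(\partial X^k,V^k(\sigma_\lambda,F))=C^\infty(\partial X^k,V^k(\tilde\sigma_{-\lambda},F^*))^*,$$ where $\tilde\sigma$ is the dual representation. For $q\in(1,\infty)$ and $k'\in\mathbb N_0$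 let $H^{q,k'}$ denote the usual Sobolev space of sections with all derivatives up to order $k'$ in $L^q$; for non-integral $s>0$ define $H^{q,s}$ by complex interpolation between the spaces of integral order; for $s\le 0$ let $H^{p,s}(\partial X^k,V^k(\sigma_\lambda,F))$ be the dual of $H^{q,-s}(\partial X^k,V^k(\tilde\sigma_{-\lambda},F^*))$, where $\frac1p+\frac1q=1$, regarded as a subspace of $C^{-\infty}(\partial X^k,V^k(\sigma_\lambda,F))$. Put $H^{p,<r}:=\bigcap_{s<r}H^{p,s}$. Let $\sigma_m$, $\sigma_n$ be finite-dimensional irreducible continuous complex representations of $M_m$, $M_n$, let $T:V_{\sigma_m}\to V_{\sigma_n}$ be an injective $M_m$-equivariant linear map, and let $\lambda\in\mathfrak a^*_{\mathbb C}$. Let $$i_*:C^{-\infty}(\partial X^m,V^m((\sigma_m)_\lambda,F))\to C^{-\infty}(\partial X^n,V^n((\sigma_n)_{\lambda+\rho^m-\rho^n},F))$$ be the adjoint of the map $f\mapsto (T^*\otimes 1)\circ f|_{G_m}$ on smooth sections (viewed as equivariant functions on $G_n$ and $G_m$). Let $r\in(-\infty,0]$, $p\in(1,\infty)$, and let $q$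 be given by $\frac1p+\frac1q=1$. If $\phi\in C^{-\infty}(\partial X^m,V^m((\sigma_m)_\lambda,F))$ satisfies $$i_*\phi\in H^{p,<r-\frac{n-m}{q}}(\partial X^n,V^n((\sigma_n)_{\lambda+\rho^m-\rho^n},F)),$$ then $\phi\in H^{p,<r}(\partial X^m,V^m((\sigma_m)_\lambda,F))$. -/

import Mathlib

open scoped ENNReal NNReal ContDiff Topology

noncomputable section

namespace HypSob

/-! ## Lorentz space and its isometries -/

/-- The coordinate space `ℝ^d` of the big cell charts. -/
abbrev E (d : ℕ) : Type := EuclideanSpace ℝ (Fin d)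

/-- The Lorentz space `ℝ^{1,n}` (for `n ≥ 1`) with coordinates `(t, s, x)`, `x ∈ ℝ^{n-1}`. -/
abbrev V (n : ℕ) : Type := ℝ × ℝ × E (n - 1)

/-- The Lorentz form `-t² + s² + |x|²`. -/
def Q (n : ℕ) : QuadraticForm ℝ (V n) :=
  (-QuadraticMap.sq).prod
    (QuadraticMap.sq.prod (LinearMap.BilinMap.toQuadraticMap (innerₗ (E (n - 1)))))

theorem Q_apply (n : ℕ) (v : V n) :
    Q n v = -(v.1 * v.1) + (v.2.1 * v.2.1 + inner ℝ v.2.2 v.2.2) := by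
  simp [Q]

theorem polar_apply (n : ℕ) (v w : V n) :
    QuadraticMap.polar (Q n) v w
      = 2 * (-(v.1 * w.1) + (v.2.1 * w.2.1 + inner ℝ v.2.2 w.2.2)) := by
  simp only [QuadraticMap.polar, Q_apply, Prod.fst_add, Prod.snd_add, inner_add_left,
    inner_add_right]
  rw [real_inner_comm v.2.2 w.2.2]
  ring

/-- `SO(1,n)_0`: the linear isometries of the Lorentz form which have determinant one and map
the open forward light cone into itself. -/
def SO (n : ℕ) : Subgroup (V n ≃ₗ[ℝ] V n) where
  carrier := {g | (∀ v, Q n (g v) = Q n v) ∧ LinearEquiv.det g = 1 ∧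
    ∀ v, Q n v < 0 → 0 < v.1 → 0 < (g v).1}
  mul_mem' := by
    rintro g h ⟨g1, g2, g3⟩ ⟨h1, h2, h3⟩
    refine ⟨fun v => ?_, ?_, fun v hv ht => ?_⟩
    · rw [LinearEquiv.mul_apply, g1, h1]
    · rw [map_mul, g2, h2, one_mul]
    · rw [LinearEquiv.mul_apply]
      exact g3 _ (by rwa [h1]) (h3 v hv ht)
  one_mem' := ⟨fun v => rfl, map_one _, fun v _ h => h⟩
  inv_mem' := by
    rintro g ⟨g1, g2, g3⟩
    have key : ∀ v, g (g⁻¹ v) = v := fun v => by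
      rw [← LinearEquiv.mul_apply, mul_inv_cancel, LinearEquiv.coe_one, id]
    have hQ : ∀ v, Q n (g⁻¹ v) = Q n v := fun v => by rw [← g1, key]
    refine ⟨hQ, by rw [map_inv, g2, inv_one], fun v hv ht => ?_⟩
    by_contra hcon
    have hneg : Q n (g⁻¹ v) < 0 := by rwa [hQ]
    have hne : (g⁻¹ v).1 ≠ 0 := by
      intro h0
      rw [Q_apply, h0] at hneg
      nlinarith [mul_self_nonneg (g⁻¹ v).2.1, real_inner_self_nonneg (x := (g⁻¹ v).2.2)]
    have hlt : (g⁻¹ v).1 < 0 := lt_of_le_of_ne (not_lt.mp hcon) hne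
    have h4 := g3 (-(g⁻¹ v)) (by rwa [QuadraticMap.map_neg]) (by simpa using hlt)
    rw [map_neg, key] at h4
    simp only [Prod.fst_neg] at h4
    linarith

/-- Topology of pointwise convergence (equivalently, of matrix entries). -/
instance (n : ℕ) : TopologicalSpace (SO n) :=
  TopologicalSpace.induced (fun g (v : V n) => (g : V n ≃ₗ[ℝ] V n) v) inferInstance

theorem det_eq_one_of_conj {n : ℕ} (g h r : V n ≃ₗ[ℝ] V n) (hg : g = h * h)
    (hr : h * (r * h * r⁻¹) = 1) : LinearEquiv.det g = 1 := by
  have h1 := congrArg LinearEquiv.det hr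
  rw [map_mul, map_mul, map_mul, map_inv, map_one, mul_comm (LinearEquiv.det r),
    mul_inv_cancel_right] at h1
  rw [hg, map_mul, h1]

theorem Q_lt (n : ℕ) (v : V n) (h : Q n v < 0) (ht : 0 < v.1) :
    |v.2.1| < v.1 ∧ inner ℝ v.2.2 v.2.2 < (v.1 - v.2.1) * (v.1 + v.2.1) := by
  rw [Q_apply] at h
  constructor
  · apply abs_lt_of_sq_lt_sq _ ht.le
    nlinarith [real_inner_self_nonneg (x := v.2.2)]
  · nlinarith

/-- The boost `a_τ` in the `(t, s)`-plane. -/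
def boostEquiv (n : ℕ) (τ : ℝ) : V n ≃ₗ[ℝ] V n where
  toFun v := (Real.cosh τ * v.1 + Real.sinh τ * v.2.1,
    Real.sinh τ * v.1 + Real.cosh τ * v.2.1, v.2.2)
  invFun v := (Real.cosh τ * v.1 - Real.sinh τ * v.2.1,
    -(Real.sinh τ * v.1) + Real.cosh τ * v.2.1, v.2.2)
  map_add' v w := by
    ext <;> simp <;> ring
  map_smul' c v := by
    ext <;> simp <;> ring
  left_inv v := by
    have := Real.cosh_sq τ
    ext
    · simp only; linear_combination v.1 * this
    · simp only; linear_combination v.2.1 * this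
    · simp
  right_inv v := by
    have := Real.cosh_sq τ
    ext
    · simp only; linear_combination v.1 * this
    · simp only; linear_combination v.2.1 * this
    · simp

/-- The unipotent isometry `n_x`, which fixes the null vector `(1, 1, 0)`. -/
def nilpEquiv (n : ℕ) (x : E (n - 1)) : V n ≃ₗ[ℝ] V n where
  toFun v := (v.1 + inner ℝ x v.2.2 + inner ℝ x x / 2 * (v.1 - v.2.1),
    v.2.1 + inner ℝ x v.2.2 + inner ℝ x x / 2 * (v.1 - v.2.1), v.2.2 + (v.1 - v.2.1) • x)
  invFun v := (v.1 - inner ℝ x v.2.2 + inner ℝ x x / 2 * (v.1 - v.2.1),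
    v.2.1 - inner ℝ x v.2.2 + inner ℝ x x / 2 * (v.1 - v.2.1), v.2.2 - (v.1 - v.2.1) • x)
  map_add' v w := by
    ext <;> simp [inner_add_right] <;> ring
  map_smul' c v := by
    ext <;> simp [inner_smul_right] <;> ring
  left_inv v := by
    ext <;> simp [inner_add_right, inner_smul_right] <;> ring
  right_inv v := by
    ext <;> simp [inner_sub_right, inner_smul_right] <;> ring

/-- The opposite unipotent isometry `n̄_x`, which fixes the null vector `(1, -1, 0)`; it maps
`(1, 1, 0)` to `(1 + |x|², 1 - |x|², 2 x)`. -/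
def oppEquiv (n : ℕ) (x : E (n - 1)) : V n ≃ₗ[ℝ] V n where
  toFun v := (v.1 + inner ℝ x v.2.2 + inner ℝ x x / 2 * (v.1 + v.2.1),
    v.2.1 - inner ℝ x v.2.2 - inner ℝ x x / 2 * (v.1 + v.2.1), v.2.2 + (v.1 + v.2.1) • x)
  invFun v := (v.1 - inner ℝ x v.2.2 + inner ℝ x x / 2 * (v.1 + v.2.1),
    v.2.1 + inner ℝ x v.2.2 - inner ℝ x x / 2 * (v.1 + v.2.1), v.2.2 - (v.1 + v.2.1) • x)
  map_add' v w := by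
    ext <;> simp [inner_add_right] <;> ring
  map_smul' c v := by
    ext <;> simp [inner_smul_right] <;> ring
  left_inv v := by
    ext <;> simp [inner_add_right, inner_smul_right] <;> ring
  right_inv v := by
    ext <;> simp [inner_sub_right, inner_smul_right] <;> ring

/-- `(t, s, x) ↦ (t, -s, x)` -/
def flipS (n : ℕ) : V n ≃ₗ[ℝ] V n where
  toFun v := (v.1, -v.2.1, v.2.2)
  invFun v := (v.1, -v.2.1, v.2.2)
  map_add' v w := by ext <;> simp; ring
  map_smul' c v := by ext <;> simp
  left_inv v := by simp
  right_inv v := by simp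

/-- `(t, s, x) ↦ (t, s, -x)` -/
def flipX (n : ℕ) : V n ≃ₗ[ℝ] V n where
  toFun v := (v.1, v.2.1, -v.2.2)
  invFun v := (v.1, v.2.1, -v.2.2)
  map_add' v w := by ext <;> simp; ring
  map_smul' c v := by ext <;> simp
  left_inv v := by simp
  right_inv v := by simp

theorem boost_mem (n : ℕ) (τ : ℝ) : boostEquiv n τ ∈ SO n := by
  have hc := Real.cosh_sq τ
  refine ⟨fun v => ?_, ?_, fun v hv ht => ?_⟩
  · simp only [Q_apply, boostEquiv, LinearEquiv.coe_mk, LinearMap.coe_mk, AddHom.coe_mk]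
    linear_combination (-v.1 * v.1 + v.2.1 * v.2.1) * hc
  · have e : τ = τ / 2 + τ / 2 := by ring
    have h2 := Real.cosh_sq (τ / 2)
    apply det_eq_one_of_conj _ (boostEquiv n (τ / 2)) (flipS n)
    · have h3 : Real.cosh τ = _ := (congrArg _ e).trans (Real.cosh_add _ _)
      have h4 : Real.sinh τ = _ := (congrArg _ e).trans (Real.sinh_add _ _)
      ext v : 1
      rw [LinearEquiv.mul_apply]
      ext
      · simp only [boostEquiv, LinearEquiv.coe_mk, LinearMap.coe_mk, AddHom.coe_mk, h3, h4]; ring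
      · simp only [boostEquiv, LinearEquiv.coe_mk, LinearMap.coe_mk, AddHom.coe_mk, h3, h4]; ring
      · simp [boostEquiv]
    · ext v : 1
      change boostEquiv n (τ / 2) (flipS n (boostEquiv n (τ / 2) ((flipS n).symm v))) = v
      ext
      · simp [boostEquiv, flipS]; linear_combination v.1 * h2
      · simp [boostEquiv, flipS]; linear_combination v.2.1 * h2
      · simp [boostEquiv, flipS]
  · obtain ⟨h1, -⟩ := Q_lt n v hv ht
    obtain ⟨h1, h2⟩ := abs_lt.mp h1
    simp only [boostEquiv, LinearEquiv.coe_mk, LinearMap.coe_mk, AddHom.coe_mk]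
    have e1 := Real.exp_pos τ
    have e2 := Real.exp_pos (-τ)
    rw [Real.cosh_eq, Real.sinh_eq]
    nlinarith [mul_pos e1 (by linarith : 0 < v.1 + v.2.1),
      mul_pos e2 (by linarith : 0 < v.1 - v.2.1)]

theorem quad_pos {a b X y i : ℝ} (ha : 0 < a) (hy : y < a * b)
    (hn : 0 ≤ y + 2 * a * i + a ^ 2 * X) : 0 < (a + b) / 2 + i + X / 2 * a := by
  have : 0 < 2 * a * ((a + b) / 2 + i + X / 2 * a) := by nlinarith
  exact pos_of_mul_pos_right this (by linarith)

theorem inner_expand {d : ℕ} (x y : E d) (a : ℝ) :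
    inner ℝ (y + a • x) (y + a • x)
      = inner ℝ y y + 2 * a * inner ℝ x y + a ^ 2 * inner ℝ x x := by
  simp only [inner_add_left, inner_add_right, inner_smul_left, inner_smul_right,
    real_inner_comm x y, RCLike.conj_to_real]
  ring

theorem nilp_mem (n : ℕ) (x : E (n - 1)) : nilpEquiv n x ∈ SO n := by
  refine ⟨fun v => ?_, ?_, fun v hv ht => ?_⟩
  · simp only [Q_apply, nilpEquiv, LinearEquiv.coe_mk, LinearMap.coe_mk, AddHom.coe_mk,
      inner_expand]
    ring
  · apply det_eq_one_of_conj _ (nilpEquiv n ((1 / 2 : ℝ) • x)) (flipX n)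
    · ext v : 1
      rw [LinearEquiv.mul_apply]
      ext <;> simp [nilpEquiv, inner_smul_left, inner_smul_right, inner_add_right,
        norm_smul, mul_pow] <;> ring
    · ext v : 1
      change nilpEquiv n _ (flipX n (nilpEquiv n _ ((flipX n).symm v))) = v
      ext <;> simp [nilpEquiv, flipX, inner_smul_left, inner_smul_right, inner_add_right,
        norm_smul, mul_pow] <;> ring
  · obtain ⟨h1, h3⟩ := Q_lt n v hv ht
    obtain ⟨h1, h2⟩ := abs_lt.mp h1
    have := quad_pos (a := v.1 - v.2.1) (b := v.1 + v.2.1) (X := inner ℝ x x)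
      (y := inner ℝ v.2.2 v.2.2) (i := inner ℝ x v.2.2) (by linarith) h3
      (by rw [← inner_expand]; exact real_inner_self_nonneg)
    simp only [nilpEquiv, LinearEquiv.coe_mk, LinearMap.coe_mk, AddHom.coe_mk]
    linarith

theorem opp_mem (n : ℕ) (x : E (n - 1)) : oppEquiv n x ∈ SO n := by
  refine ⟨fun v => ?_, ?_, fun v hv ht => ?_⟩
  · simp only [Q_apply, oppEquiv, LinearEquiv.coe_mk, LinearMap.coe_mk, AddHom.coe_mk,
      inner_expand]
    ring
  · apply det_eq_one_of_conj _ (oppEquiv n ((1 / 2 : ℝ) • x)) (flipX n)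
    · ext v : 1
      rw [LinearEquiv.mul_apply]
      ext <;> simp [oppEquiv, inner_smul_left, inner_smul_right, inner_add_right,
        norm_smul, mul_pow] <;> ring
    · ext v : 1
      change oppEquiv n _ (flipX n (oppEquiv n _ ((flipX n).symm v))) = v
      ext <;> simp [oppEquiv, flipX, inner_smul_left, inner_smul_right, inner_add_right,
        norm_smul, mul_pow] <;> ring
  · obtain ⟨h1, h3⟩ := Q_lt n v hv ht
    obtain ⟨h1, h2⟩ := abs_lt.mp h1
    have := quad_pos (a := v.1 + v.2.1) (b := v.1 - v.2.1) (X := inner ℝ x x)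
      (y := inner ℝ v.2.2 v.2.2) (i := inner ℝ x v.2.2) (by linarith) (by linarith)
      (by rw [← inner_expand]; exact real_inner_self_nonneg)
    simp only [oppEquiv, LinearEquiv.coe_mk, LinearMap.coe_mk, AddHom.coe_mk]
    linarith

/-! ## The spin group -/

open CliffordAlgebra in
theorem mul_ι_mem_spin {n : ℕ} (u v : V n) (hu : IsUnit (Q n u)) (hv : IsUnit (Q n v))
    (huv : Q n u * Q n v = 1) : ι (Q n) u * ι (Q n) v ∈ spinGroup (Q n) := by
  have hu' := (isUnit_ι_iff (Q := Q n) (m := u)).mpr hu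
  have hv' := (isUnit_ι_iff (Q := Q n) (m := v)).mpr hv
  rw [spinGroup.mem_iff, pinGroup.mem_iff]
  refine ⟨⟨⟨hu'.unit * hv'.unit, ?_, rfl⟩, ?_⟩, ?_⟩
  · exact mul_mem (Subgroup.subset_closure ⟨u, rfl⟩) (Subgroup.subset_closure ⟨v, rfl⟩)
  · rw [Unitary.mem_iff, star_mul, star_ι, star_ι, neg_mul_neg]
    constructor
    · rw [mul_assoc, ← mul_assoc (ι (Q n) u), ι_sq_scalar, Algebra.commutes, ← mul_assoc,
        ι_sq_scalar, ← map_mul, mul_comm, huv, map_one]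
    · rw [mul_assoc, ← mul_assoc (ι (Q n) v), ι_sq_scalar, Algebra.commutes, ← mul_assoc,
        ι_sq_scalar, ← map_mul, huv, map_one]
  · exact ι_mul_ι_mem_evenOdd_zero _ _ _

/-- `Spin(1,n)` with the topology of the finite dimensional algebra containing it. -/
instance (n : ℕ) : TopologicalSpace (spinGroup (Q n)) :=
  TopologicalSpace.induced Subtype.val (moduleTopology ℝ (CliffordAlgebra (Q n)))

/-- `a_τ = cosh(τ/2) + sinh(τ/2) e₀ e₁`, a lift of the boost to the spin group. -/
def spinBoost (n : ℕ) (τ : ℝ) : CliffordAlgebra (Q n) :=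
  algebraMap ℝ _ (Real.cosh (τ / 2)) +
    Real.sinh (τ / 2) • (CliffordAlgebra.ι (Q n) (1, 0, 0) * CliffordAlgebra.ι (Q n) (0, 1, 0))

/-- `n_x = 1 + ½ (e₀ + e₁) x`. -/
def spinNilp (n : ℕ) (x : E (n - 1)) : CliffordAlgebra (Q n) :=
  1 + (1 / 2 : ℝ) •
    (CliffordAlgebra.ι (Q n) (1, 1, 0) * CliffordAlgebra.ι (Q n) (0, 0, x))

/-- `n̄_x = 1 + ½ (e₀ - e₁) x`. -/
def spinOpp (n : ℕ) (x : E (n - 1)) : CliffordAlgebra (Q n) :=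
  1 + (1 / 2 : ℝ) •
    (CliffordAlgebra.ι (Q n) (1, -1, 0) * CliffordAlgebra.ι (Q n) (0, 0, x))

open CliffordAlgebra in
theorem spinBoost_mem (n : ℕ) (τ : ℝ) : spinBoost n τ ∈ spinGroup (Q n) := by
  have h1 : Q n (Real.sinh (τ / 2), Real.cosh (τ / 2), 0) = 1 := by
    rw [Q_apply]; simp only [inner_zero_left]
    linear_combination Real.cosh_sq (τ / 2)
  have h2 : Q n (0, 1, 0) = 1 := by rw [Q_apply]; simp
  have h3 := mul_ι_mem_spin (n := n) (Real.sinh (τ / 2), Real.cosh (τ / 2), 0) (0, 1, 0)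
    (by rw [h1]; exact isUnit_one) (by rw [h2]; exact isUnit_one) (by rw [h1, h2, one_mul])
  convert h3 using 1
  have e : ((Real.sinh (τ / 2), Real.cosh (τ / 2), 0) : V n)
      = Real.cosh (τ / 2) • (0, 1, 0) + Real.sinh (τ / 2) • (1, 0, 0) := by
    ext <;> simp
  rw [e, map_add, map_smul, map_smul, add_mul, smul_mul_assoc, smul_mul_assoc, ι_sq_scalar, h2,
    map_one, spinBoost, Algebra.algebraMap_eq_smul_one]

open CliffordAlgebra in
theorem spinUnip_mem (n : ℕ) (ε : ℝ) (hε : ε * ε = 1) (x : E (n - 1)) :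
    1 + (1 / 2 : ℝ) • (ι (Q n) (1, ε, 0) * ι (Q n) (0, 0, x)) ∈ spinGroup (Q n) := by
  by_cases hx : x = 0
  · have : ((0, 0, x) : V n) = 0 := by rw [hx]; rfl
    rw [this, map_zero, mul_zero, smul_zero, add_zero]
    exact one_mem _
  · have hx2 : (inner ℝ x x : ℝ) ≠ 0 := by simpa using hx
    set u : V n := (inner ℝ x x : ℝ)⁻¹ • (0, 0, x) + (1 / 2 : ℝ) • (1, ε, 0) with hu
    have h1 : Q n (0, 0, x) = inner ℝ x x := by rw [Q_apply]; simp
    have h2 : Q n u = (inner ℝ x x : ℝ)⁻¹ := by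
      rw [Q_apply, hu]
      simp only [Prod.fst_add, Prod.snd_add, Prod.smul_fst, Prod.smul_snd, smul_zero, add_zero,
        smul_eq_mul, inner_smul_left, inner_smul_right, RCLike.conj_to_real]
      field_simp
      linear_combination inner ℝ x x ^ 2 * hε
    have h3 := mul_ι_mem_spin (n := n) u (0, 0, x) (by rw [h2]; simpa using hx)
      (by rw [h1]; simpa using hx) (by rw [h1, h2, inv_mul_cancel₀ hx2])
    convert h3 using 1
    rw [hu, map_add, map_smul, map_smul, add_mul, smul_mul_assoc, smul_mul_assoc, ι_sq_scalar, h1,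
      Algebra.algebraMap_eq_smul_one, smul_smul, inv_mul_cancel₀ hx2, one_smul]

theorem spinNilp_mem (n : ℕ) (x : E (n - 1)) : spinNilp n x ∈ spinGroup (Q n) :=
  spinUnip_mem n 1 (by norm_num) x

theorem spinOpp_mem (n : ℕ) (x : E (n - 1)) : spinOpp n x ∈ spinGroup (Q n) :=
  spinUnip_mem n (-1) (by norm_num) x

/-! ## The inclusions `G_m ⊂ G_n` -/

/-- The coordinate inclusion `ℝ^k → ℝ^d`, `k ≤ d`. -/
def pad (k d : ℕ) : E k →ₗ[ℝ] E d where
  toFun x := WithLp.toLp 2 fun i => if h : i.val < k then x ⟨i.val, h⟩ else 0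
  map_add' x y := by ext i; simp only [PiLp.add_apply]; split_ifs <;> simp
  map_smul' c x := by ext i; simp only [PiLp.smul_apply, RingHom.id_apply]; split_ifs <;> simp

theorem inner_pad {k d : ℕ} (h : k ≤ d) (x : E k) (y : E d) :
    inner ℝ (pad k d x) y = inner ℝ x (pad d k y) := by
  obtain ⟨c, rfl⟩ := Nat.exists_eq_add_of_le h
  simp only [PiLp.inner_apply, pad, LinearMap.coe_mk, AddHom.coe_mk, Fin.sum_univ_add]
  simp
  refine Finset.sum_congr rfl fun i _ => ?_
  rw [dif_pos (by omega)]
  rfl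

theorem pad_pad {k d : ℕ} (h : k ≤ d) (x : E k) : pad d k (pad k d x) = x := by
  ext i
  simp only [pad, LinearMap.coe_mk, AddHom.coe_mk]
  rw [dif_pos (by omega), dif_pos i.2]

theorem norm_pad {k d : ℕ} (h : k ≤ d) (x : E k) : ‖pad k d x‖ = ‖x‖ := by
  rw [norm_eq_sqrt_real_inner, norm_eq_sqrt_real_inner, inner_pad h, pad_pad h]

/-- `(t, s, x) ↦ (t, s, pad x)`: for `m ≤ n` the standard inclusion `ℝ^{1,m} ⊂ ℝ^{1,n}`, for
`n ≤ m` the orthogonal projection. -/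
def padV (m n : ℕ) : V m →ₗ[ℝ] V n :=
  LinearMap.prodMap LinearMap.id (LinearMap.prodMap LinearMap.id (pad (m - 1) (n - 1)))

theorem padV_apply (m n : ℕ) (v : V m) :
    padV m n v = (v.1, v.2.1, pad (m - 1) (n - 1) v.2.2) := rfl

theorem padV_padV {m n : ℕ} (h : m ≤ n) (v : V m) : padV n m (padV m n v) = v := by
  simp only [padV_apply, pad_pad (Nat.sub_le_sub_right h 1)]

theorem Q_padV {m n : ℕ} (h : m ≤ n) (v : V m) : Q n (padV m n v) = Q m v := by
  simp only [padV_apply, Q_apply, inner_pad (Nat.sub_le_sub_right h 1),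
    pad_pad (Nat.sub_le_sub_right h 1)]

theorem polar_padV {m n : ℕ} (h : m ≤ n) (v : V n) (w : V m) :
    QuadraticMap.polar (Q n) v (padV m n w) = QuadraticMap.polar (Q m) (padV n m v) w := by
  simp only [padV_apply, polar_apply]
  rw [real_inner_comm, inner_pad (Nat.sub_le_sub_right h 1), real_inner_comm]

/-- The extension of a linear automorphism of `ℝ^{1,m}` to `ℝ^{1,n}` by the identity on the
orthogonal complement. -/
def extEquiv {m n : ℕ} (h : m ≤ n) (g : V m ≃ₗ[ℝ] V m) : V n ≃ₗ[ℝ] V n where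
  toFun v := v + padV m n (g (padV n m v) - padV n m v)
  invFun v := v + padV m n (g.symm (padV n m v) - padV n m v)
  map_add' v w := by simp only [map_add, map_sub]; abel
  map_smul' c v := by
    simp only [map_smul, map_sub, RingHom.id_apply, smul_add, smul_sub]
  left_inv v := by
    simp only [map_add, padV_padV h, map_sub, add_sub_cancel, LinearEquiv.symm_apply_apply]
    abel
  right_inv v := by
    simp only [map_add, padV_padV h, map_sub, add_sub_cancel, LinearEquiv.apply_symm_apply]
    abel

theorem extEquiv_apply {m n : ℕ} (h : m ≤ n) (g : V m ≃ₗ[ℝ] V m) (v : V n) :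
    extEquiv h g v = v + padV m n (g (padV n m v) - padV n m v) := rfl

theorem det_one_add_comp_comm {X Y : Type*} [AddCommGroup X] [Module ℝ X] [FiniteDimensional ℝ X]
    [AddCommGroup Y] [Module ℝ Y] [FiniteDimensional ℝ Y] (A : X →ₗ[ℝ] Y) (B : Y →ₗ[ℝ] X) :
    LinearMap.det (1 + A ∘ₗ B) = LinearMap.det (1 + B ∘ₗ A) := by
  classical
  let bX := Module.finBasis ℝ X
  let bY := Module.finBasis ℝ Y
  rw [← LinearMap.det_toMatrix bY, ← LinearMap.det_toMatrix bX, map_add, map_add,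
    LinearMap.toMatrix_one, LinearMap.toMatrix_one, LinearMap.toMatrix_comp bY bX bY,
    LinearMap.toMatrix_comp bX bY bX, Matrix.det_one_add_mul_comm]

theorem ext_mem {m n : ℕ} (h : m ≤ n) {g : V m ≃ₗ[ℝ] V m} (hg : g ∈ SO m) :
    extEquiv h g ∈ SO n := by
  obtain ⟨g1, g2, g3⟩ := hg
  refine ⟨fun v => ?_, ?_, fun v hv ht => ?_⟩
  · have e1 := QuadraticMap.map_add (Q n) v (padV m n (g (padV n m v) - padV n m v))
    have e2 := QuadraticMap.map_add (Q m) (padV n m v) (g (padV n m v) - padV n m v)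
    rw [polar_padV h, Q_padV h] at e1
    rw [add_sub_cancel, g1] at e2
    rw [extEquiv_apply, e1]
    linarith
  · apply Units.ext
    rw [LinearEquiv.coe_det, Units.val_one]
    have e1 : ((extEquiv h g : V n ≃ₗ[ℝ] V n) : V n →ₗ[ℝ] V n)
        = 1 + padV m n ∘ₗ (((g : V m →ₗ[ℝ] V m) - 1) ∘ₗ padV n m) := by
      apply LinearMap.ext
      intro v
      rfl
    have e2 : 1 + (((g : V m →ₗ[ℝ] V m) - 1) ∘ₗ padV n m) ∘ₗ padV m n
        = (g : V m →ₗ[ℝ] V m) := by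
      apply LinearMap.ext
      intro v
      simp [padV_padV h]
    rw [e1, det_one_add_comp_comm, e2, ← LinearEquiv.coe_det, g2, Units.val_one]
  · have e1 : (extEquiv h g v).1 = (g (padV n m v)).1 := by
      simp [extEquiv_apply, padV_apply]
    rw [e1]
    apply g3 _ _ ht
    refine lt_of_le_of_lt ?_ hv
    have e2 := QuadraticMap.map_add (Q n) (v - padV m n (padV n m v)) (padV m n (padV n m v))
    rw [polar_padV h, map_sub (padV n m), padV_padV h, sub_self, QuadraticMap.polar_zero_left, add_zero,
      sub_add_cancel, Q_padV h] at e2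
    rw [e2, Q_apply n]
    simp only [padV_apply, Prod.fst_sub, Prod.snd_sub, sub_self]
    have := real_inner_self_nonneg
      (x := v.2.2 - pad (m - 1) (n - 1) (pad (n - 1) (m - 1) v.2.2))
    linarith

/-- The inclusion `SO(1,m)_0 ⊂ SO(1,n)_0`. -/
def soHom {m n : ℕ} (h : m ≤ n) : SO m →* SO n where
  toFun g := ⟨extEquiv h g.1, ext_mem h g.2⟩
  map_one' := by
    apply Subtype.ext
    ext v : 1
    simp [extEquiv_apply]
  map_mul' g g' := by
    apply Subtype.ext
    ext v : 1
    change _ = extEquiv h g.1 (extEquiv h g'.1 v)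
    simp only [extEquiv_apply, map_add, map_sub, padV_padV h, Subgroup.coe_mul,
      LinearEquiv.mul_apply, add_sub_cancel]
    abel

/-- The isometric inclusion `ℝ^{1,m} ⊂ ℝ^{1,n}`. -/
def padIsom {m n : ℕ} (h : m ≤ n) : Q m →qᵢ Q n where
  toLinearMap := padV m n
  map_app' := Q_padV h

open CliffordAlgebra in
theorem map_mem_spin {m n : ℕ} (h : m ≤ n) {x : CliffordAlgebra (Q m)}
    (hx : x ∈ spinGroup (Q m)) : CliffordAlgebra.map (padIsom h) x ∈ spinGroup (Q n) := by
  have hstar : ∀ y : CliffordAlgebra (Q m),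
      star (CliffordAlgebra.map (padIsom h) y) = CliffordAlgebra.map (padIsom h) (star y) := by
    intro y
    induction y using CliffordAlgebra.induction with
    | algebraMap r => rw [AlgHom.commutes, star_algebraMap, star_algebraMap, AlgHom.commutes]
    | ι v => rw [map_apply_ι, star_ι, star_ι, map_neg, map_apply_ι]
    | mul a b ha hb => rw [map_mul, star_mul, ha, hb, star_mul, map_mul]
    | add a b ha hb => rw [map_add, star_add, ha, hb, star_add, map_add]
  rw [spinGroup.mem_iff, pinGroup.mem_iff] at hx ⊢
  obtain ⟨⟨⟨u, hu, rfl⟩, hx2⟩, hx3⟩ := hx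
  refine ⟨⟨?_, ?_⟩, ?_⟩
  · refine ⟨Units.map (CliffordAlgebra.map (padIsom h)).toMonoidHom u, ?_, rfl⟩
    have hu' : u ∈ lipschitzGroup (Q m) := hu
    change Units.map (CliffordAlgebra.map (padIsom h)).toMonoidHom u ∈ lipschitzGroup (Q n)
    have : lipschitzGroup (Q m) ≤ (lipschitzGroup (Q n)).comap
        (Units.map (CliffordAlgebra.map (padIsom h)).toMonoidHom) := by
      refine (Subgroup.closure_le _).mpr ?_
      rintro y ⟨v, hv⟩
      apply Subgroup.subset_closure
      refine ⟨padIsom h v, ?_⟩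
      rw [← map_apply_ι, hv]
      rfl
    exact this hu'
  · rw [Unitary.mem_iff] at hx2 ⊢
    rw [hstar, ← map_mul, ← map_mul, hx2.1, hx2.2, map_one]
    exact ⟨rfl, rfl⟩
  · have : (evenOdd (Q m) 0).map (CliffordAlgebra.map (padIsom h)).toLinearMap
        ≤ evenOdd (Q n) 0 := by
      simp only [evenOdd, Submodule.map_iSup, Submodule.map_pow]
      refine iSup_mono fun i => pow_le_pow_left' ?_ _
      rw [Submodule.map_le_iff_le_comap]
      rintro _ ⟨v, rfl⟩
      exact ⟨padIsom h v, (map_apply_ι _ _).symm⟩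
    exact this ⟨_, hx3, rfl⟩

/-- The inclusion `Spin(1,m) ⊂ Spin(1,n)`. -/
def spinHom {m n : ℕ} (h : m ≤ n) : spinGroup (Q m) →* spinGroup (Q n) where
  toFun g := ⟨CliffordAlgebra.map (padIsom h) g.1, map_mem_spin h g.2⟩
  map_one' := Subtype.ext (map_one _)
  map_mul' _ _ := Subtype.ext (map_mul _ _ _)

/-! ## The two families of groups with their parabolic subgroups -/

/-- A group `G` with the ingredients of its minimal parabolic subgroup `P = M A N`: the subgroup
`M`, the one-parameter group `a_τ` (parametrised so that `α(log a_τ) = τ`), the maps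
`x ↦ n_x ∈ N` and `x ↦ n̄_x ∈ N̄` from `ℝ^d`. It is used only for the two groups below. -/
structure CellData (d : ℕ) where
  G : Type
  [group : Group G]
  [topology : TopologicalSpace G]
  M : Subgroup G
  a : ℝ → G
  nilp : E d → G
  opp : E d → G

attribute [instance] CellData.group CellData.topology

/-- `G = SO(1,n)_0`. Here `M` is the pointwise stabilizer of the `(t, s)`-plane, that is, the
centralizer of `A` in the maximal compact subgroup; `M ≅ SO(n-1)`. -/
def soCell (n : ℕ) : CellData (n - 1) where
  G := SO n
  M :=
    { carrier := {g | g.1 (1, 0, 0) = (1, 0, 0) ∧ g.1 (0, 1, 0) = (0, 1, 0)}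
      mul_mem' := by
        rintro g h ⟨g1, g2⟩ ⟨h1, h2⟩
        constructor
        · rw [Subgroup.coe_mul, LinearEquiv.mul_apply, h1, g1]
        · rw [Subgroup.coe_mul, LinearEquiv.mul_apply, h2, g2]
      one_mem' := ⟨rfl, rfl⟩
      inv_mem' := by
        rintro g ⟨g1, g2⟩
        constructor
        · change g.1.symm _ = _
          rw [LinearEquiv.symm_apply_eq, g1]
        · change g.1.symm _ = _
          rw [LinearEquiv.symm_apply_eq, g2] }
  a τ := ⟨boostEquiv n τ, boost_mem n τ⟩
  nilp x := ⟨nilpEquiv n x, nilp_mem n x⟩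
  opp x := ⟨oppEquiv n x, opp_mem n x⟩

/-- `G = Spin(1,n)`. Here `M` is the group of all elements which commute with the vectors
`e₀ = (1,0,0)` and `e₁ = (0,1,0)`; `M ≅ Spin(n-1)`. -/
def spinCell (n : ℕ) : CellData (n - 1) where
  G := spinGroup (Q n)
  M :=
    { carrier := {g | Commute g.1 (CliffordAlgebra.ι (Q n) (1, 0, 0)) ∧
        Commute g.1 (CliffordAlgebra.ι (Q n) (0, 1, 0))}
      mul_mem' := by
        rintro g h ⟨g1, g2⟩ ⟨h1, h2⟩
        exact ⟨g1.mul_left h1, g2.mul_left h2⟩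
      one_mem' := ⟨Commute.one_left _, Commute.one_left _⟩
      inv_mem' := by
        rintro g ⟨g1, g2⟩
        have e1 : (g⁻¹).1 * g.1 = 1 := congrArg Subtype.val (inv_mul_cancel g)
        have e2 : g.1 * (g⁻¹).1 = 1 := congrArg Subtype.val (mul_inv_cancel g)
        have key : ∀ y, Commute g.1 y → Commute (g⁻¹).1 y := by
          intro y hy
          calc (g⁻¹).1 * y = (g⁻¹).1 * (y * g.1) * (g⁻¹).1 := by
                rw [mul_assoc, mul_assoc, e2, mul_one]
            _ = y * (g⁻¹).1 := by rw [← hy.eq, ← mul_assoc, e1, one_mul]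
        exact ⟨key _ g1, key _ g2⟩ }
  a τ := ⟨spinBoost n τ, spinBoost_mem n τ⟩
  nilp x := ⟨spinNilp n x, spinNilp_mem n x⟩
  opp x := ⟨spinOpp n x, spinOpp_mem n x⟩

/-- The choice between the two families of groups. -/
inductive Kind
  | so
  | spin

/-- `G_n = SO(1,n)_0` or `G_n = Spin(1,n)`, with `∂X^n = G_n / P_n` of dimension `n - 1`. -/
def cell : Kind → (n : ℕ) → CellData (n - 1)
  | .so, n => soCell n
  | .spin, n => spinCell n

/-- A homomorphism compatible with the parabolic subgroups. -/
structure CellHom {k d : ℕ} (D : CellData k) (D' : CellData d) where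
  hom : D.G →* D'.G
  inc : E k →ₗ[ℝ] E d
  map_M : ∀ g ∈ D.M, hom g ∈ D'.M
  map_a : ∀ τ, hom (D.a τ) = D'.a τ
  map_nilp : ∀ x, hom (D.nilp x) = D'.nilp (inc x)
  map_opp : ∀ x, hom (D.opp x) = D'.opp (inc x)

/-- The inclusion `SO(1,m)_0 ⊂ SO(1,n)_0`. -/
def soIncl {m n : ℕ} (h : m ≤ n) : CellHom (soCell m) (soCell n) where
  hom := soHom h
  inc := pad (m - 1) (n - 1)
  map_M := by
    rintro g ⟨g1, g2⟩
    have e1 : padV n m (1, 0, 0) = (1, 0, 0) := by simp [padV_apply]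
    have e2 : padV n m (0, 1, 0) = (0, 1, 0) := by simp [padV_apply]
    constructor
    · change extEquiv h g.1 _ = _
      rw [extEquiv_apply, e1, g1, sub_self, map_zero, add_zero]
    · change extEquiv h g.1 _ = _
      rw [extEquiv_apply, e2, g2, sub_self, map_zero, add_zero]
  map_a τ := by
    apply Subtype.ext
    ext v : 1
    change extEquiv h (boostEquiv m τ) v = boostEquiv n τ v
    rw [extEquiv_apply]
    ext <;> simp [padV_apply, boostEquiv]
  map_nilp x := by
    apply Subtype.ext
    ext v : 1
    change extEquiv h (nilpEquiv m x) v = nilpEquiv n _ v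
    have h' := Nat.sub_le_sub_right h 1
    rw [extEquiv_apply]
    ext <;> simp [padV_apply, nilpEquiv, inner_pad h', norm_pad h']
  map_opp x := by
    apply Subtype.ext
    ext v : 1
    change extEquiv h (oppEquiv m x) v = oppEquiv n _ v
    have h' := Nat.sub_le_sub_right h 1
    rw [extEquiv_apply]
    ext <;> simp [padV_apply, oppEquiv, inner_pad h', norm_pad h']

theorem padIsom_apply {m n : ℕ} (h : m ≤ n) (t s : ℝ) (x : E (m - 1)) :
    padIsom h (t, s, x) = (t, s, pad (m - 1) (n - 1) x) := rfl

/-- The inclusion `Spin(1,m) ⊂ Spin(1,n)`. -/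
def spinIncl {m n : ℕ} (h : m ≤ n) : CellHom (spinCell m) (spinCell n) where
  hom := spinHom h
  inc := pad (m - 1) (n - 1)
  map_M := by
    rintro g ⟨g1, g2⟩
    have g1' := g1.map (CliffordAlgebra.map (padIsom h))
    have g2' := g2.map (CliffordAlgebra.map (padIsom h))
    rw [CliffordAlgebra.map_apply_ι, padIsom_apply, map_zero] at g1' g2'
    exact ⟨g1', g2'⟩
  map_a τ := by
    apply Subtype.ext
    change CliffordAlgebra.map (padIsom h) (spinBoost m τ) = spinBoost n τ
    simp only [spinBoost, map_add, map_smul, map_mul, AlgHom.commutes,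
      CliffordAlgebra.map_apply_ι, padIsom_apply, map_zero]
  map_nilp x := by
    apply Subtype.ext
    change CliffordAlgebra.map (padIsom h) (spinNilp m x) = spinNilp n _
    simp only [spinNilp, map_add, map_smul, map_mul, map_one,
      CliffordAlgebra.map_apply_ι, padIsom_apply, map_zero]
  map_opp x := by
    apply Subtype.ext
    change CliffordAlgebra.map (padIsom h) (spinOpp m x) = spinOpp n _
    simp only [spinOpp, map_add, map_smul, map_mul, map_one,
      CliffordAlgebra.map_apply_ι, padIsom_apply, map_zero]

/-- The standard inclusion `G_m ⊂ G_n`, `m ≤ n`. -/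
def incl : (κ : Kind) → {m n : ℕ} → m ≤ n → CellHom (cell κ m) (cell κ n)
  | .so, _, _, h => soIncl h
  | .spin, _, _, h => spinIncl h

/-! ## Sections of homogeneous bundles -/

namespace CellData

variable {d : ℕ} (D : CellData d)

/-- `ρ` in units of `α`; linear forms on the complexified Lie algebra of `A` are identified with
complex numbers by `z ↦ z α`. -/
def rho (_ : CellData d) : ℂ := (d : ℂ) / 2

variable {W : Type*} [NormedAddCommGroup W] [NormedSpace ℂ W]

/-- The restriction of a function on `G` to the translate `g N̄` of the big cell, i.e. the
expression of a section in the chart `x ↦ g n̄_x P` and the trivialization belonging to it. -/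
def chart (f : D.G → W) (g : D.G) : E d → W := fun x => f (g * D.opp x)

/-- All (not necessarily continuous) sections of the bundle `V(τ_μ) = G ×_P W` over `G/P`, where
`τ_μ(m a n) = τ(m) a^{ρ-μ}`, as functions on `G` with `f(g p) = τ_μ(p)⁻¹ f(g)`. -/
def Sec (τ : Representation ℂ D.M W) (μ : ℂ) : Submodule ℂ (D.G → W) where
  carrier := {f | (∀ g (b : D.M), f (g * b) = τ b⁻¹ (f g)) ∧
    (∀ g (t : ℝ), f (g * D.a t) = Complex.exp ((μ - D.rho) * t) • f g) ∧
    ∀ g x, f (g * D.nilp x) = f g}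
  add_mem' := by
    rintro f f' ⟨h1, h2, h3⟩ ⟨h1', h2', h3'⟩
    exact ⟨fun g b => by simp [h1, h1'], fun g t => by simp [h2, h2'],
      fun g x => by simp [h3, h3']⟩
  zero_mem' := ⟨fun g b => by simp, fun g t => by simp, fun g x => by simp⟩
  smul_mem' := by
    rintro c f ⟨h1, h2, h3⟩
    exact ⟨fun g b => by simp [h1], fun g t => by simp [h2, smul_comm c],
      fun g x => by simp [h3]⟩

/-- The smooth sections: those which are smooth in all charts `x ↦ g n̄_x P`. -/
def SmoothSec (τ : Representation ℂ D.M W) (μ : ℂ) : Submodule ℂ (D.Sec τ μ) where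
  carrier := {f | ∀ g, ContDiff ℝ ∞ (D.chart f.1 g)}
  add_mem' h h' g := (h g).add (h' g)
  zero_mem' _ := contDiff_const
  smul_mem' c _ h g := (h g).const_smul c

/-- The Weyl group representative `n_e n̄_{-e} n_e`, with `e` the first basis vector of `ℝ^d`. For
`d ≥ 1` it acts on Lorentz space as the rotation `(t, s, x) ↦ (t, -s, x - 2 ⟨x, e⟩ e)`. Hence the
transition from the chart `n̄_x P` to the chart `w n̄_x P` is the inversion at the unit sphere
followed by a reflection, and the balls of radius `2` in these two charts cover `G/P`. -/
def weyl : D.G :=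
  let e : E d := WithLp.toLp 2 fun i => if i.val = 0 then 1 else 0
  D.nilp e * D.opp (-e) * D.nilp e

end CellData

/-! ## Sobolev norms -/

section Sobolev

variable {d : ℕ} {W : Type*} [NormedAddCommGroup W] [NormedSpace ℂ W]

/-- On the open set `Ω` the function `v` is the weak derivative `∂_{a 0} ⋯ ∂_{a (j-1)} u`. -/
def IsWeakDeriv (Ω : Set (E d)) {j : ℕ} (a : Fin j → Fin d) (u v : E d → W) : Prop :=
  MeasureTheory.LocallyIntegrableOn u Ω ∧ MeasureTheory.LocallyIntegrableOn v Ω ∧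
    ∀ η : E d → ℝ, ContDiff ℝ ∞ η → HasCompactSupport η → tsupport η ⊆ Ω →
      ∫ x, iteratedFDeriv ℝ j η x (fun i => EuclideanSpace.single (a i) 1) • u x
        = (-1 : ℝ) ^ j • ∫ x, η x • v x

/-- The norm of `W^{k,q}(Ω)`; it is `⊤` if `u` is not in this space. -/
def localNorm (Ω : Set (E d)) (k : ℕ) (q : ℝ) (u : E d → W) : ℝ≥0∞ :=
  ∑ j ∈ Finset.range (k + 1), ∑ a : Fin j → Fin d,
    ⨅ (v : E d → W) (_ : IsWeakDeriv Ω a u v),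
      MeasureTheory.eLpNorm v (ENNReal.ofReal q) (MeasureTheory.volume.restrict Ω)

/-- A norm of the Sobolev space `H^{q,k}`, `k ∈ ℕ`, of sections which have all derivatives up to
order `k` in `L^q`; it is `⊤` outside of this space. -/
def intNorm (D : CellData d) (τ : Representation ℂ D.M W) (μ : ℂ) (q : ℝ) (k : ℕ)
    (u : D.Sec τ μ) : ℝ≥0∞ :=
  localNorm (Metric.ball 0 2) k q (D.chart u.1 1) +
    localNorm (Metric.ball 0 2) k q (D.chart u.1 D.weyl)

end Sobolev

/-! ## Complex interpolation

A couple of Banach spaces is given by a complex vector space `S` and two norms with values in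
`[0, ∞]` on it, which are finite exactly on the respective space. -/

section Interpolation

variable {S : Type*} [AddCommGroup S] [Module ℂ S]

/-- The norm of the sum `X₀ + X₁`. -/
def sumNorm (N₀ N₁ : S → ℝ≥0∞) (u : S) : ℝ≥0∞ := ⨅ y : S, N₀ y + N₁ (u - y)

/-- The functions on the strip `0 ≤ Re z ≤ 1` used in complex interpolation: bounded and
continuous with values in `X₀ + X₁`, holomorphic in the interior, and such that
`t ↦ h(it)` and `t ↦ h(1+it)` are bounded and continuous with values in `X₀` and `X₁`. -/
structure IsInterpFun (N₀ N₁ : S → ℝ≥0∞) (h : ℂ → S) : Prop where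
  bounded : ∃ C : ℝ≥0, ∀ z : ℂ, 0 ≤ z.re → z.re ≤ 1 → sumNorm N₀ N₁ (h z) ≤ C
  continuous : ∀ z : ℂ, 0 ≤ z.re → z.re ≤ 1 →
    Filter.Tendsto (fun z' => sumNorm N₀ N₁ (h z' - h z))
      (𝓝[{z' | 0 ≤ z'.re ∧ z'.re ≤ 1}] z) (𝓝 0)
  holomorphic : ∀ z : ℂ, 0 < z.re → z.re < 1 → ∃ h' : S, sumNorm N₀ N₁ h' < ⊤ ∧
    Filter.Tendsto (fun z' => sumNorm N₀ N₁ ((z' - z)⁻¹ • (h z' - h z) - h')) (𝓝[≠] z) (𝓝 0)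
  left_bounded : ∃ C : ℝ≥0, ∀ t : ℝ, N₀ (h (t * Complex.I)) ≤ C
  right_bounded : ∃ C : ℝ≥0, ∀ t : ℝ, N₁ (h (1 + t * Complex.I)) ≤ C
  left_continuous : ∀ t : ℝ, Filter.Tendsto
    (fun t' : ℝ => N₀ (h (t' * Complex.I) - h (t * Complex.I))) (𝓝 t) (𝓝 0)
  right_continuous : ∀ t : ℝ, Filter.Tendsto
    (fun t' : ℝ => N₁ (h (1 + t' * Complex.I) - h (1 + t * Complex.I))) (𝓝 t) (𝓝 0)

/-- The norm of the complex interpolation space `[X₀, X₁]_θ`. -/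
def interpNorm (N₀ N₁ : S → ℝ≥0∞) (θ : ℝ) (u : S) : ℝ≥0∞ :=
  ⨅ (h : ℂ → S) (_ : IsInterpFun N₀ N₁ h) (_ : h θ = u),
    ⨆ t : ℝ, max (N₀ (h (t * Complex.I))) (N₁ (h (1 + t * Complex.I)))

end Interpolation

/-- The norm of `H^{q,s}` for real `s ≥ 0`: for integral `s` see `intNorm`, else `H^{q,s}` is the
complex interpolation space `[H^{q,k}, H^{q,k+1}]_θ` with `s = k + θ`, `k ∈ ℕ`, `0 < θ < 1`. -/
def sobolevNorm {d : ℕ} {W : Type*} [NormedAddCommGroup W] [NormedSpace ℂ W] (D : CellData d)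
    (τ : Representation ℂ D.M W) (μ : ℂ) (q s : ℝ) (u : D.Sec τ μ) : ℝ≥0∞ :=
  open Classical in
  if Int.fract s = 0 then intNorm D τ μ q ⌊s⌋₊ u
  else interpNorm (intNorm D τ μ q ⌊s⌋₊) (intNorm D τ μ q (⌊s⌋₊ + 1)) (Int.fract s) u

/-! ## Distribution sections and their push-forward -/

section Auxiliary

variable {X Y W₁ W₂ : Type*} [NormedAddCommGroup X] [NormedSpace ℝ X] [NormedAddCommGroup Y]
  [NormedSpace ℝ Y] [NormedAddCommGroup W₁] [NormedSpace ℂ W₁] [NormedAddCommGroup W₂]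
  [NormedSpace ℂ W₂]

theorem contDiff_aux (L : W₂ →L[ℂ] W₁) (J : X →L[ℝ] Y) {u : Y → W₂} (hu : ContDiff ℝ ∞ u) :
    ContDiff ℝ ∞ fun x => L (u (J x)) :=
  (L.restrictScalars ℝ).contDiff.comp (hu.comp J.contDiff)

theorem norm_iteratedFDeriv_aux (L : W₂ →L[ℂ] W₁) (J : X →L[ℝ] Y) {u : Y → W₂}
    (hu : ContDiff ℝ ∞ u) (j : ℕ) (x : X) :
    ‖iteratedFDeriv ℝ j (fun x => L (u (J x))) x‖
      ≤ ‖L‖ * (‖J‖ ^ j * ‖iteratedFDeriv ℝ j u (J x)‖) := by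
  have hj : (j : WithTop ℕ∞) ≤ (∞ : WithTop ℕ∞) := by exact_mod_cast le_top
  have e := (L.restrictScalars ℝ).norm_iteratedFDeriv_comp_left
    (hu.comp J.contDiff).contDiffAt (x := x) hj
  rw [ContinuousLinearMap.norm_restrictScalars] at e
  refine e.trans (mul_le_mul_of_nonneg_left ?_ (norm_nonneg _))
  rw [J.iteratedFDeriv_comp_right hu x hj]
  refine (ContinuousMultilinearMap.norm_compContinuousLinearMap_le _ _).trans_eq ?_
  rw [Finset.prod_const, Finset.card_univ, Fintype.card_fin, mul_comm]

end Auxiliary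

section Distributions

variable {k d : ℕ} {V₁ V₂ : Type*} [NormedAddCommGroup V₁] [NormedSpace ℂ V₁]
  [FiniteDimensional ℂ V₁] [NormedAddCommGroup V₂] [NormedSpace ℂ V₂] [FiniteDimensional ℂ V₂]
  (F : Type*) [NormedAddCommGroup F] [NormedSpace ℂ F]

/-- The fibre of the bundle dual to `V(σ_λ) ⊗ F`: the bilinear forms on `V_σ × F`, i.e. the space
`V_σ^* ⊗ F^*`. -/
def DualFibre (V₁ F : Type*) [NormedAddCommGroup V₁] [NormedSpace ℂ V₁]
    [NormedAddCommGroup F] [NormedSpace ℂ F] : Type _ := V₁ →L[ℂ] F →L[ℂ] ℂ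

instance : NormedAddCommGroup (DualFibre V₁ F) :=
  inferInstanceAs (NormedAddCommGroup (V₁ →L[ℂ] F →L[ℂ] ℂ))

instance : NormedSpace ℂ (DualFibre V₁ F) :=
  inferInstanceAs (NormedSpace ℂ (V₁ →L[ℂ] F →L[ℂ] ℂ))

/-- The value `B(v, ·)`. -/
def DualFibre.eval {V₁ F : Type*} [NormedAddCommGroup V₁] [NormedSpace ℂ V₁]
    [NormedAddCommGroup F] [NormedSpace ℂ F] (B : DualFibre V₁ F) : V₁ →L[ℂ] F →L[ℂ] ℂ := B

/-- The map `B ↦ B(T ·, ·)`, that is `T^* ⊗ 1`. -/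
def precomp (T : V₁ →ₗ[ℂ] V₂) : DualFibre V₂ F →L[ℂ] DualFibre V₁ F :=
  LinearMap.mkContinuous
    { toFun := fun B => B.eval.comp (LinearMap.toContinuousLinearMap T)
      map_add' := fun _ _ => rfl
      map_smul' := fun _ _ => rfl } ‖LinearMap.toContinuousLinearMap T‖
    (fun B => (ContinuousLinearMap.opNorm_comp_le B.eval _).trans_eq (mul_comm _ _))

theorem precomp_apply (T : V₁ →ₗ[ℂ] V₂) (B : DualFibre V₂ F) (v : V₁) :
    (precomp F T B).eval v = B.eval (T v) := rfl

/-- The action `σ̃ ⊗ 1` of `M` on `V_σ^* ⊗ F^*`: `(b B)(v, w) = B(σ(b)⁻¹ v, w)`. -/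
def dualRep {M : Type*} [Group M] (σ : Representation ℂ M V₁) :
    Representation ℂ M (DualFibre V₁ F) where
  toFun b := precomp F (σ b⁻¹)
  map_one' := by
    ext1 B
    refine ContinuousLinearMap.ext (f := (_ : DualFibre V₁ F).eval) fun v => ?_
    rw [inv_one, map_one]
    rfl
  map_mul' b b' := by
    ext1 B
    refine ContinuousLinearMap.ext (f := (_ : DualFibre V₁ F).eval) fun v => ?_
    rw [mul_inv_rev, map_mul]
    rfl

theorem dualRep_apply {M : Type*} [Group M] (σ : Representation ℂ M V₁) (b : M)
    (B : DualFibre V₁ F) (v : V₁) : (dualRep F σ b B).eval v = B.eval (σ b⁻¹ v) := rfl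

/-- The smooth sections of the bundle `V(σ̃_{-λ}) ⊗ F^*`. -/
abbrev TestSec (D : CellData d) (σ : Representation ℂ D.M V₁) (lam : ℂ) : Type _ :=
  D.SmoothSec (dualRep F σ) (-lam)

/-- The space `C^{-∞}(∂X, V(σ_λ) ⊗ F)` of distribution sections: the continuous linear functionals
on the Fréchet space of smooth sections of the bundle `V(σ̃_{-λ}) ⊗ F^*`, whose topology is that of
uniform convergence of all derivatives on compact subsets of the charts. -/
structure Distr (D : CellData d) (σ : Representation ℂ D.M V₁) (lam : ℂ) where
  toLin : TestSec F D σ lam →ₗ[ℂ] ℂ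
  cont : ∃ (A : Finset D.G) (R : ℝ) (l : ℕ) (C : ℝ), ∀ f, ∀ B : ℝ,
    (∀ g ∈ A, ∀ x ∈ Metric.closedBall (0 : E d) R, ∀ j ≤ l,
      ‖iteratedFDeriv ℝ j (D.chart f.1.1 g) x‖ ≤ B) → ‖toLin f‖ ≤ C * B

/-- The restriction `i^* f = T^* (f |_{G_m})` of smooth sections. -/
def pullback {D : CellData k} {D' : CellData d} (i : CellHom D D')
    (σ : Representation ℂ D.M V₁) (σ' : Representation ℂ D'.M V₂) (lam : ℂ) (T : V₁ →ₗ[ℂ] V₂)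
    (hT : ∀ (b : D.M) (v : V₁), T (σ b v) = σ' ⟨i.hom b, i.map_M b b.2⟩ (T v)) :
    TestSec F D' σ' (lam + D.rho - D'.rho) →ₗ[ℂ]
      TestSec F D σ lam where
  toFun f := ⟨⟨fun g => precomp F T (f.1.1 (i.hom g)), by
      obtain ⟨⟨f, h1, h2, h3⟩, hf⟩ := f
      refine ⟨fun g b => ?_, fun g t => ?_, fun g x => ?_⟩
      · have e := h1 (i.hom g) ⟨i.hom b, i.map_M b b.2⟩
        refine ContinuousLinearMap.ext (f := (_ : DualFibre V₁ F).eval) fun v => ?_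
        change _ = DualFibre.eval _ v
        simp only [map_mul] at e ⊢
        rw [e, dualRep_apply, precomp_apply, precomp_apply, dualRep_apply, inv_inv, inv_inv, hT]
      · have e := h2 (i.hom g) t
        have e2 : -(lam + D.rho - D'.rho) - D'.rho = -lam - D.rho := by ring
        rw [e2] at e
        simp only [map_mul, i.map_a, e, map_smul]
      · simp only [map_mul, i.map_nilp]
        rw [h3]⟩, fun g => by
      have e := contDiff_aux (precomp F T) (LinearMap.toContinuousLinearMap i.inc)
        (f.2 (i.hom g))
      have e2 : D.chart (fun g => precomp F T (f.1.1 (i.hom g))) g = fun x => precomp F T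
          (D'.chart f.1.1 (i.hom g) (LinearMap.toContinuousLinearMap i.inc x)) := by
        funext x
        simp only [CellData.chart, map_mul, i.map_opp, LinearMap.coe_toContinuousLinearMap']
      exact e2 ▸ e⟩
  map_add' f f' := rfl
  map_smul' c f := rfl

theorem chart_pullback {D : CellData k} {D' : CellData d} (i : CellHom D D')
    (σ : Representation ℂ D.M V₁) (σ' : Representation ℂ D'.M V₂) (lam : ℂ) (T : V₁ →ₗ[ℂ] V₂)
    (hT : ∀ (b : D.M) (v : V₁), T (σ b v) = σ' ⟨i.hom b, i.map_M b b.2⟩ (T v))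
    (f : TestSec F D' σ' (lam + D.rho - D'.rho)) (g : D.G) :
    D.chart (pullback F i σ σ' lam T hT f).1.1 g
      = fun x => precomp F T
          (D'.chart f.1.1 (i.hom g) (LinearMap.toContinuousLinearMap i.inc x)) := by
  funext x
  change precomp F T (f.1.1 (i.hom (g * D.opp x))) = _
  simp only [CellData.chart, map_mul, i.map_opp, LinearMap.coe_toContinuousLinearMap']

/-- The push-forward `i_*`, the adjoint of `i^*`. -/
def pushforward {D : CellData k} {D' : CellData d} (i : CellHom D D')
    (σ : Representation ℂ D.M V₁) (σ' : Representation ℂ D'.M V₂) (lam : ℂ) (T : V₁ →ₗ[ℂ] V₂)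
    (hT : ∀ (b : D.M) (v : V₁), T (σ b v) = σ' ⟨i.hom b, i.map_M b b.2⟩ (T v))
    (φ : Distr F D σ lam) : Distr F D' σ' (lam + D.rho - D'.rho) where
  toLin := φ.toLin ∘ₗ pullback F i σ σ' lam T hT
  cont := by
    classical
    obtain ⟨A, R, l, C, h⟩ := φ.cont
    set J := LinearMap.toContinuousLinearMap i.inc with hJ
    set K : ℝ := ‖precomp F T‖ * max 1 ‖J‖ ^ l with hK
    refine ⟨A.image i.hom, ‖J‖ * |R|, l, C * K, fun f B hB => ?_⟩
    rw [mul_assoc]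
    refine h _ _ fun g hg x hx j hj => ?_
    have hsm := f.2 (i.hom g)
    have e1 : ‖iteratedFDeriv ℝ j (D'.chart f.1.1 (i.hom g)) (J x)‖ ≤ B := by
      refine hB _ (Finset.mem_image_of_mem _ hg) _ ?_ j hj
      rw [mem_closedBall_zero_iff] at hx ⊢
      exact (J.le_opNorm x).trans
        (mul_le_mul_of_nonneg_left (hx.trans (le_abs_self R)) (norm_nonneg _))
    have hB0 : 0 ≤ B := (norm_nonneg _).trans e1
    rw [chart_pullback]
    refine (norm_iteratedFDeriv_aux (precomp F T) J hsm j x).trans ?_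
    rw [hK, mul_assoc]
    refine mul_le_mul_of_nonneg_left ?_ (norm_nonneg _)
    refine mul_le_mul ?_ e1 (norm_nonneg _) (by positivity)
    exact (pow_le_pow_left₀ (norm_nonneg _) (le_max_right _ _) j).trans
      (pow_le_pow_right₀ (le_max_left _ _) hj)

/-- Membership in `H^{p,s}(∂X, V(σ_λ) ⊗ F)` for orders `s ≤ 0` (only these occur below): it is
the dual space of `H^{q,-s}(∂X, V(σ̃_{-λ}) ⊗ F^*)`, where `1/p + 1/q = 1`. Since the smooth
sections are dense in the latter space, its dual space consists of the distributions which are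
bounded with respect to the norm of that space. -/
def MemH {D : CellData d} {σ : Representation ℂ D.M V₁} {lam : ℂ} (p s : ℝ)
    (φ : Distr F D σ lam) : Prop :=
  ∃ C : ℝ≥0, ∀ f : TestSec F D σ lam,
    ‖φ.toLin f‖ₑ ≤ C * sobolevNorm D (dualRep F σ) (-lam) p.conjExponent (-s) f.1

/-- `H^{p,<r} = ⋂_{s<r} H^{p,s}` for `r ≤ 0`. -/
def MemHLt {D : CellData d} {σ : Representation ℂ D.M V₁} {lam : ℂ} (p r : ℝ)
    (φ : Distr F D σ lam) : Prop := ∀ s < r, MemH F p s φ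

end Distributions

end HypSob

/-!
The statement to be proved is a bound `|φ(f)| ≤ C ‖f‖_{q,t}` for smooth sections `f` on the small
sphere, `t = -s > 0`, and it is given such a bound for the push-forward of `φ`: that is, `|φ(g|)|`
is bounded by `‖g‖_{q,S}` for sections `g` on the large sphere, where `S < t + c / q` and
`c = n - m` is the codimension. The idea is that a function `v` on `ℝ^{m-1}` which oscillates at the
scale `δ` has an extension to `ℝ^{n-1}` which lives in the `δ`-neighbourhood of `ℝ^{m-1}`. Its
derivatives of order `l` have `L^q` norms of size `δ^{c/q - l} ‖v‖_q`, where the gain `δ^{c/q}` is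
due to the small support (`exists_derNorm_extFun_le`).

* Any section with support in a cell is the restriction of sections which are constructed from such
  extensions (`pullback_cellSec`), and since `T` is injective, `T^* ⊗ 1` has a right inverse. By the
  logarithmic convexity of the interpolation norm (`interpNorm_le`) the hypothesis yields the scaled
  bound `|φ(v)| ≤ C δ^{c/q - S} ∑_l δ^l ‖D^l v‖_q` for all `δ ≤ 1`, for sections with expression `v`
  in a cell (`ScaledBound`, `scaledBound_of_pushforward`).

* Smooth sections are decomposed into two pieces, supported in the big cell and in its translate by
  the Weyl element (`Geom.eq_add_cellSec`), and the expression of each piece is decomposed into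
  Littlewood–Paley components (`dyadicOp`). The component at the scale `δ = 2^{-j}` of a function
  with `κ` derivatives in `L^q` satisfies `‖D^l v_j‖_q ≤ C δ^{κ - l}`
  (`exists_eLpNorm_dyadicOp_cutoff`). By the scaled bound its image under `φ` is at most
  `C δ^{κ + c/q - S} ‖f‖_{q,κ}`. This linear functional of `f` is estimated for the two integers
  adjacent to `t`, and the three lines theorem (`enorm_le_interpNorm`) replaces `κ` by `t`. Since
  `t + c/q - S > 0`, the sum over `j` is a geometric series
  (`ScaledBound.exists_enorm_le_sobolevNorm`).

The Sobolev norms on the spheres are defined in terms of the charts `x ↦ γ n̄_x P` with `γ = 1` and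
`γ = w`. To compare them with norms on the Euclidean space one needs that the transition functions
are smooth. The only point which is not explicit is the factor in `M` of `γ n̄_x`, to which a
representation is applied that is merely assumed to be continuous. This factor is, up to constants,
a product of two Weyl group representatives `k(u) = n_u n̄_{-u} n_u` for unit vectors `u`
(`Geom.mpart_local`), and these satisfy `k(2 ⟨u, v⟩ u - v) = k(u) k(v)⁻¹ k(u)`, up to signs. So the
operators in question form a continuous map from the sphere which is compatible with the structures
of symmetric spaces, and such maps are smooth by a regularization argument
(`contDiffAt_of_symmetric`). The relations in the groups `SO(1,n)_0` and `Spin(1,n)` which are used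
are collected in the structure `Geom`.
-/

/-! ### Relations in the groups -/

namespace HypSob

/-- The reflection `x ↦ x - 2 ⟨u, x⟩ u`, for unit vectors `u`. -/
def refl {d : ℕ} (u x : E d) : E d := x - (2 * inner ℝ u x) • u

/-- The element `n_u n̄_{-u} n_u`; for a unit vector `u` it represents the nontrivial Weyl group
element and acts on Lorentz space by `(t, s, x) ↦ (t, -s, x - 2 ⟨u, x⟩ u)`. -/
def CellData.inversion {d : ℕ} (D : CellData d) (u : E d) : D.G :=
  D.nilp u * D.opp (-u) * D.nilp u

/-- The facts about the groups `SO(1,n)_0` and `Spin(1,n)` and their parabolic subgroups on which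
the analysis relies: the action on Lorentz space, and relations between the generators. -/
structure Geom (n : ℕ) (D : CellData (n - 1)) where
  /-- The action on Lorentz space. -/
  act : D.G →* (V n ≃ₗ[ℝ] V n)
  act_Q : ∀ g v, Q n (act g v) = Q n v
  act_pos : ∀ g, 0 < (act g (1, 1, 0)).1
  act_a : ∀ t, act (D.a t) = boostEquiv n t
  act_nilp : ∀ x, act (D.nilp x) = nilpEquiv n x
  act_opp : ∀ x, act (D.opp x) = oppEquiv n x
  mem_M : ∀ g, g ∈ D.M ↔ act g (1, 0, 0) = (1, 0, 0) ∧ act g (0, 1, 0) = (0, 1, 0)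
  a_add : ∀ s t, D.a (s + t) = D.a s * D.a t
  nilp_add : ∀ x y, D.nilp (x + y) = D.nilp x * D.nilp y
  opp_add : ∀ x y, D.opp (x + y) = D.opp x * D.opp y
  M_a : ∀ b ∈ D.M, ∀ t, b * D.a t = D.a t * b
  M_nilp : ∀ b ∈ D.M, ∀ x, b * D.nilp x = D.nilp (act b (0, 0, x)).2.2 * b
  M_opp : ∀ b ∈ D.M, ∀ x, b * D.opp x = D.opp (act b (0, 0, x)).2.2 * b
  a_nilp : ∀ t x, D.a t * D.nilp x = D.nilp (Real.exp t • x) * D.a t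
  a_opp : ∀ t x, D.a t * D.opp x = D.opp (Real.exp (-t) • x) * D.a t
  inversion_a : ∀ u, ‖u‖ = 1 → ∀ t, D.inversion u * D.a t = D.a (-t) * D.inversion u
  inversion_nilp : ∀ u, ‖u‖ = 1 → ∀ x,
    D.inversion u * D.nilp x = D.opp (refl u x) * D.inversion u
  inversion_mem : ∀ u v, ‖u‖ = 1 → ‖v‖ = 1 → D.inversion u * D.inversion (-v) ∈ D.M
  inversion_neg : ∀ u, ‖u‖ = 1 → D.inversion u * D.inversion (-u) = 1
  inversion_symm : ∀ u v, ‖u‖ = 1 → ‖v‖ = 1 →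
    D.inversion (-refl u v) = D.inversion u * D.inversion (-v) * D.inversion u
  inversion_cont : ∀ u (hu : ‖u‖ = 1), Continuous fun v : Metric.sphere (0 : E (n - 1)) 1 =>
    (⟨D.inversion v.1 * D.inversion (-u), inversion_mem v.1 u (by simp) hu⟩ : D.M)

theorem inner_refl_right {d : ℕ} {u : E d} (x y : E d) :
    inner ℝ x (refl u y) = inner ℝ x y - 2 * inner ℝ u y * inner ℝ x u := by
  rw [refl, inner_sub_right, inner_smul_right]

theorem refl_refl {d : ℕ} {u : E d} (hu : ‖u‖ = 1) (x : E d) : refl u (refl u x) = x := by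
  have h : inner ℝ u u = (1 : ℝ) := by rw [real_inner_self_eq_norm_sq, hu, one_pow]
  have : inner ℝ u (refl u x) = - inner ℝ u x := by
    rw [inner_refl_right, h]; ring
  rw [refl, this, refl]
  module

theorem norm_refl {d : ℕ} {u : E d} (hu : ‖u‖ = 1) (x : E d) : ‖refl u x‖ = ‖x‖ := by
  have h : inner ℝ u u = (1 : ℝ) := by rw [real_inner_self_eq_norm_sq, hu, one_pow]
  have : inner ℝ (refl u x) (refl u x) = inner ℝ x x := by
    rw [inner_refl_right, refl, inner_sub_left, inner_sub_left, inner_smul_left, inner_smul_left,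
      h, real_inner_comm u x]
    simp; ring
  rw [real_inner_self_eq_norm_sq, real_inner_self_eq_norm_sq] at this
  exact (sq_eq_sq₀ (norm_nonneg _) (norm_nonneg _)).mp this

theorem refl_neg {d : ℕ} (u x : E d) : refl (-u) x = refl u x := by
  simp [refl]

theorem norm_neg_refl {d : ℕ} {u v : E d} (hu : ‖u‖ = 1) (hv : ‖v‖ = 1) : ‖-refl u v‖ = 1 := by
  rw [norm_neg, norm_refl hu, hv]

theorem refl_symm {d : ℕ} {u v : E d} (hu : ‖u‖ = 1) (x : E d) :
    refl (refl u v) x = refl u (refl v (refl u x)) := by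
  have h : inner ℝ u u = (1 : ℝ) := by rw [real_inner_self_eq_norm_sq, hu, one_pow]
  have h2 : ∀ z y, inner ℝ (refl u z) y = inner ℝ z (refl u y) := fun z y => by
    rw [inner_refl_right, refl, inner_sub_left, inner_smul_left, real_inner_comm u z]
    simp; ring
  have h3 : ∀ z (c : ℝ) y, refl u (z - c • y) = refl u z - c • refl u y := fun z c y => by
    simp only [refl, inner_sub_right, inner_smul_right]
    module
  rw [refl.eq_def (refl u v), refl.eq_def v, h3, refl_refl hu, h2]

theorem soInversion_apply {n : ℕ} {u : E (n - 1)} (hu : ‖u‖ = 1) (v : V n) :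
    ((soCell n).inversion u : SO n).1 v = (v.1, -v.2.1, refl u v.2.2) := by
  have h : inner ℝ u u = (1 : ℝ) := by rw [real_inner_self_eq_norm_sq, hu, one_pow]
  change nilpEquiv n u (oppEquiv n (-u) (nilpEquiv n u v)) = _
  simp only [nilpEquiv, oppEquiv, LinearEquiv.coe_mk, LinearMap.coe_mk, AddHom.coe_mk,
    inner_add_right, inner_neg_left, inner_neg_right, inner_smul_right, h, refl, neg_neg]
  refine Prod.ext ?_ (Prod.ext ?_ ?_)
  · simp only; ring
  · simp only; ring
  · simp only; module

/-- An isometry of Lorentz space which fixes `e₀` and `e₁` acts on the orthogonal complement of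
these vectors only. -/
theorem act_M_aux {n : ℕ} {b : V n ≃ₗ[ℝ] V n} (hQ : ∀ v, Q n (b v) = Q n v)
    (h0 : b (1, 0, 0) = (1, 0, 0)) (h1 : b (0, 1, 0) = (0, 1, 0)) (t s : ℝ) (x : E (n - 1)) :
    b (t, s, x) = (t, s, (b (0, 0, x)).2.2) := by
  have hp : ∀ v w, QuadraticMap.polar (Q n) (b v) (b w) = QuadraticMap.polar (Q n) v w := by
    intro v w
    simp only [QuadraticMap.polar, ← map_add, hQ]
  have e0 := hp (0, 0, x) (1, 0, 0)
  have e1 := hp (0, 0, x) (0, 1, 0)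
  rw [h0, polar_apply, polar_apply] at e0
  rw [h1, polar_apply, polar_apply] at e1
  simp at e0 e1
  have : ((t, s, x) : V n) = t • (1, 0, 0) + (s • (0, 1, 0) + (0, 0, x)) := by
    ext <;> simp
  rw [this, map_add, map_add, map_smul, map_smul, h0, h1]
  refine Prod.ext ?_ (Prod.ext ?_ ?_)
  · simp [e0]
  · simp [e1]
  · simp

theorem inner_act_M {n : ℕ} {b : V n ≃ₗ[ℝ] V n} (hQ : ∀ v, Q n (b v) = Q n v)
    (h0 : b (1, 0, 0) = (1, 0, 0)) (h1 : b (0, 1, 0) = (0, 1, 0)) (x y : E (n - 1)) :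
    inner ℝ (b (0, 0, x)).2.2 (b (0, 0, y)).2.2 = (inner ℝ x y : ℝ) := by
  have hp : QuadraticMap.polar (Q n) (b (0, 0, x)) (b (0, 0, y))
      = QuadraticMap.polar (Q n) (0, 0, x) (0, 0, y) := by
    simp only [QuadraticMap.polar, ← map_add, hQ]
  rw [act_M_aux hQ h0 h1 0 0 x, act_M_aux hQ h0 h1 0 0 y, polar_apply, polar_apply] at hp
  simpa using hp

theorem so_ext {n : ℕ} {g h : SO n} (H : ∀ v, g.1 v = h.1 v) : g = h :=
  Subtype.ext (LinearEquiv.ext H)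

theorem soInversion_mem {n : ℕ} (u v : E (n - 1)) (hu : ‖u‖ = 1) (hv : ‖v‖ = 1) :
    (soCell n).inversion u * (soCell n).inversion (-v) ∈ (soCell n).M := by
  have hv' : ‖-v‖ = 1 := by rw [norm_neg, hv]
  constructor
  · change ((soCell n).inversion u : SO n).1 (((soCell n).inversion (-v) : SO n).1 _) = _
    rw [soInversion_apply hu, soInversion_apply hv']
    simp [refl]
  · change ((soCell n).inversion u : SO n).1 (((soCell n).inversion (-v) : SO n).1 _) = _
    rw [soInversion_apply hu, soInversion_apply hv']
    simp [refl]

theorem soInversion_symm_aux {n : ℕ} {a b c d : SO n} {u v : E (n - 1)} (hu : ‖u‖ = 1)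
    (ha : ∀ x, a.1 x = (x.1, -x.2.1, refl (-refl u v) x.2.2))
    (hb : ∀ x, b.1 x = (x.1, -x.2.1, refl u x.2.2))
    (hc : ∀ x, c.1 x = (x.1, -x.2.1, refl (-v) x.2.2)) (hd : d = b * c * b) : a = d := by
  subst hd
  refine so_ext fun x => ?_
  change a.1 x = b.1 (c.1 (b.1 x))
  rw [ha, hb, hc, hb]
  simp only [neg_neg, refl_neg, refl_symm hu]

theorem soInversion_symm {n : ℕ} (u v : E (n - 1)) (hu : ‖u‖ = 1) (hv : ‖v‖ = 1) :
    (soCell n).inversion (-refl u v)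
      = (soCell n).inversion u * (soCell n).inversion (-v) * (soCell n).inversion u :=
  soInversion_symm_aux hu (soInversion_apply (norm_neg_refl hu hv)) (soInversion_apply hu)
    (soInversion_apply (by rw [norm_neg, hv])) rfl

/-- The geometric facts for `SO(1,n)_0`. -/
def soGeom (n : ℕ) : Geom n (soCell n) where
  act := (SO n).subtype
  act_Q g v := g.2.1 v
  act_pos g := by
    change 0 < ((g : SO n).1 (1, 1, 0)).1
    have h1 := g.2.2.2 (1, 0, 0) (by rw [Q_apply]; simp) (by simp)
    -- the null vector is a limit of timelike ones, so its image has nonnegative time component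
    have h2 : ∀ ε : ℝ, 0 < ε → 0 ≤ (g.1 (1, 1, 0)).1 + ε * (g.1 (1, 0, 0)).1 := by
      intro ε hε
      have := g.2.2.2 ((1, 1, 0) + ε • (1, 0, 0)) (by rw [Q_apply]; simp; nlinarith)
        (by simp; linarith)
      rw [map_add, map_smul] at this
      exact this.le
    have h3 : 0 ≤ (g.1 (1, 1, 0)).1 := by
      by_contra hneg
      push Not at hneg
      have := h2 (-(g.1 (1, 1, 0)).1 / (2 * (g.1 (1, 0, 0)).1))
        (div_pos (by linarith) (by linarith))
      have e : -(g.1 (1, 1, 0)).1 / (2 * (g.1 (1, 0, 0)).1) * (g.1 (1, 0, 0)).1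
        = -(g.1 (1, 1, 0)).1 / 2 := by
        field_simp
      rw [e] at this
      linarith
    refine lt_of_le_of_ne h3 fun h0 => ?_
    have hq := g.2.1 (1, 1, 0)
    rw [Q_apply, Q_apply, ← h0] at hq
    simp only [mul_zero, neg_zero, zero_add, mul_one, inner_zero_left, add_zero,
      neg_add_cancel] at hq
    have a1 := mul_self_nonneg (g.1 (1, 1, 0)).2.1
    have a2 := real_inner_self_nonneg (x := (g.1 (1, 1, 0)).2.2)
    have b1 : (g.1 (1, 1, 0)).2.1 = 0 := by
      apply mul_self_eq_zero.mp; linarith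
    have b2 : (g.1 (1, 1, 0)).2.2 = 0 := by
      apply (inner_self_eq_zero (𝕜 := ℝ)).mp; linarith
    have : g.1 (1, 1, 0) = 0 := Prod.ext h0.symm (Prod.ext b1 b2)
    have := (LinearEquiv.map_eq_zero_iff g.1).mp this
    simp [Prod.ext_iff] at this
  act_a t := rfl
  act_nilp x := rfl
  act_opp x := rfl
  mem_M g := Iff.rfl
  a_add s t := so_ext fun v => by
    change boostEquiv n _ _ = boostEquiv n _ (boostEquiv n _ _)
    simp only [boostEquiv, LinearEquiv.coe_mk, LinearMap.coe_mk, AddHom.coe_mk, Real.cosh_add,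
      Real.sinh_add]
    refine Prod.ext ?_ (Prod.ext ?_ rfl) <;> simp only <;> ring
  nilp_add x y := so_ext fun v => by
    change nilpEquiv n _ _ = nilpEquiv n _ (nilpEquiv n _ _)
    simp only [nilpEquiv, LinearEquiv.coe_mk, LinearMap.coe_mk, AddHom.coe_mk, inner_add_right,
      inner_add_left, inner_smul_right, real_inner_comm x y]
    refine Prod.ext ?_ (Prod.ext ?_ ?_) <;> simp only
    · ring
    · ring
    · module
  opp_add x y := so_ext fun v => by
    change oppEquiv n _ _ = oppEquiv n _ (oppEquiv n _ _)
    simp only [oppEquiv, LinearEquiv.coe_mk, LinearMap.coe_mk, AddHom.coe_mk, inner_add_right,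
      inner_add_left, inner_smul_right, real_inner_comm x y]
    refine Prod.ext ?_ (Prod.ext ?_ ?_) <;> simp only
    · ring
    · ring
    · module
  M_a b hb t := so_ext fun v => by
    change b.1 (boostEquiv n _ v) = boostEquiv n _ (b.1 v)
    obtain ⟨t, s, x⟩ := v
    rw [act_M_aux b.2.1 hb.1 hb.2 t s x]
    simp only [boostEquiv, LinearEquiv.coe_mk, LinearMap.coe_mk, AddHom.coe_mk]
    rw [act_M_aux b.2.1 hb.1 hb.2]
  M_nilp b hb x := so_ext fun v => by
    change b.1 (nilpEquiv n _ v) = nilpEquiv n (b.1 (0, 0, x)).2.2 (b.1 v)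
    obtain ⟨t, s, y⟩ := v
    have hl : ∀ c : ℝ, (b.1 (0, 0, y + c • x)).2.2
        = (b.1 (0, 0, y)).2.2 + c • (b.1 (0, 0, x)).2.2 := fun c => by
      have : ((0, 0, y + c • x) : V n) = (0, 0, y) + c • (0, 0, x) := by ext <;> simp
      rw [this, map_add, map_smul]; simp
    rw [act_M_aux b.2.1 hb.1 hb.2 t s y]
    simp only [nilpEquiv, LinearEquiv.coe_mk, LinearMap.coe_mk, AddHom.coe_mk]
    rw [act_M_aux b.2.1 hb.1 hb.2, hl, inner_act_M b.2.1 hb.1 hb.2, inner_act_M b.2.1 hb.1 hb.2]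
  M_opp b hb x := so_ext fun v => by
    change b.1 (oppEquiv n _ v) = oppEquiv n (b.1 (0, 0, x)).2.2 (b.1 v)
    obtain ⟨t, s, y⟩ := v
    have hl : ∀ c : ℝ, (b.1 (0, 0, y + c • x)).2.2
        = (b.1 (0, 0, y)).2.2 + c • (b.1 (0, 0, x)).2.2 := fun c => by
      have : ((0, 0, y + c • x) : V n) = (0, 0, y) + c • (0, 0, x) := by ext <;> simp
      rw [this, map_add, map_smul]; simp
    rw [act_M_aux b.2.1 hb.1 hb.2 t s y]
    simp only [oppEquiv, LinearEquiv.coe_mk, LinearMap.coe_mk, AddHom.coe_mk]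
    rw [act_M_aux b.2.1 hb.1 hb.2, hl, inner_act_M b.2.1 hb.1 hb.2, inner_act_M b.2.1 hb.1 hb.2]
  a_nilp t x := so_ext fun v => by
    change boostEquiv n _ (nilpEquiv n _ _) = nilpEquiv n _ (boostEquiv n _ _)
    simp only [boostEquiv, nilpEquiv, LinearEquiv.coe_mk, LinearMap.coe_mk, AddHom.coe_mk,
      inner_smul_left, inner_smul_right, RCLike.conj_to_real, smul_smul, Real.cosh_eq,
      Real.sinh_eq]
    have e : Real.exp (-t) * Real.exp t = 1 := by rw [← Real.exp_add]; simp
    refine Prod.ext ?_ (Prod.ext ?_ ?_) <;> simp only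
    · linear_combination (-(Real.exp t * (inner ℝ x x * (v.1 - v.2.1)) / 2)) * e
    · linear_combination (-(Real.exp t * (inner ℝ x x * (v.1 - v.2.1)) / 2)) * e
    · congr 2
      linear_combination (-(v.1 - v.2.1)) * e
  a_opp t x := so_ext fun v => by
    change boostEquiv n _ (oppEquiv n _ _) = oppEquiv n _ (boostEquiv n _ _)
    simp only [boostEquiv, oppEquiv, LinearEquiv.coe_mk, LinearMap.coe_mk, AddHom.coe_mk,
      inner_smul_left, inner_smul_right, RCLike.conj_to_real, smul_smul, Real.cosh_eq,
      Real.sinh_eq]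
    have e : Real.exp (-t) * Real.exp t = 1 := by rw [← Real.exp_add]; simp
    refine Prod.ext ?_ (Prod.ext ?_ ?_) <;> simp only
    · linear_combination (-(Real.exp (-t) * (inner ℝ x x * (v.1 + v.2.1)) / 2)) * e
    · linear_combination ((Real.exp (-t) * (inner ℝ x x * (v.1 + v.2.1)) / 2)) * e
    · congr 2
      linear_combination (-(v.1 + v.2.1)) * e
  inversion_a u hu t := so_ext fun v => by
    change ((soCell n).inversion u : SO n).1 (boostEquiv n _ v)
      = boostEquiv n _ (((soCell n).inversion u : SO n).1 v)
    rw [soInversion_apply hu, soInversion_apply hu]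
    simp only [boostEquiv, LinearEquiv.coe_mk, LinearMap.coe_mk, AddHom.coe_mk, Real.cosh_neg,
      Real.sinh_neg]
    refine Prod.ext ?_ (Prod.ext ?_ rfl) <;> simp only <;> ring
  inversion_nilp u hu x := so_ext fun v => by
    have h : inner ℝ u u = (1 : ℝ) := by rw [real_inner_self_eq_norm_sq, hu, one_pow]
    change ((soCell n).inversion u : SO n).1 (nilpEquiv n _ v)
      = oppEquiv n _ (((soCell n).inversion u : SO n).1 v)
    rw [soInversion_apply hu, soInversion_apply hu]
    simp only [nilpEquiv, oppEquiv, LinearEquiv.coe_mk, LinearMap.coe_mk, AddHom.coe_mk, refl,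
      inner_add_right, inner_sub_right, inner_sub_left, inner_smul_left, inner_smul_right,
      RCLike.conj_to_real, h, real_inner_comm u x]
    refine Prod.ext ?_ (Prod.ext ?_ ?_) <;> simp only
    · ring
    · ring
    · module
  inversion_mem := soInversion_mem
  inversion_neg u hu := so_ext fun v => by
    change ((soCell n).inversion u : SO n).1 (((soCell n).inversion (-u) : SO n).1 _) = v
    have hu' : ‖-u‖ = 1 := by rw [norm_neg, hu]
    rw [soInversion_apply hu, soInversion_apply hu']
    simp only [neg_neg, refl_neg, refl_refl hu]
  inversion_symm := soInversion_symm
  inversion_cont u hu := by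
    refine Continuous.subtype_mk ?_ _
    refine continuous_induced_rng.mpr ?_
    refine continuous_pi fun x => ?_
    have hu' : ‖-u‖ = 1 := by rw [norm_neg, hu]
    have : ∀ v : Metric.sphere (0 : E (n - 1)) 1,
        ((soCell n).inversion v.1 : SO n).1 (((soCell n).inversion (-u) : SO n).1 x)
          = (x.1, x.2.1, refl v.1 (refl u x.2.2)) := fun v => by
      have hv : ‖v.1‖ = 1 := by simp
      rw [soInversion_apply hv, soInversion_apply hu']
      simp only [neg_neg, refl_neg]
    change Continuous fun v : Metric.sphere (0 : E (n - 1)) 1 =>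
      ((soCell n).inversion v.1 : SO n).1 (((soCell n).inversion (-u) : SO n).1 x)
    simp only [this, refl]
    fun_prop

end HypSob

/-! ### The spin group acts on Lorentz space -/

namespace HypSob

open CliffordAlgebra

instance invertibleTwoReal : Invertible (2 : ℝ) := invertibleOfNonzero two_ne_zero

/-- A linear left inverse of the inclusion of the vectors into the Clifford algebra. -/
def cliffordProj (n : ℕ) : CliffordAlgebra (Q n) →ₗ[ℝ] V n :=
  ExteriorAlgebra.ιInv ∘ₗ (equivExterior (Q n)).toLinearMap

theorem cliffordProj_ι {n : ℕ} (v : V n) : cliffordProj n (ι (Q n) v) = v := by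
  change ExteriorAlgebra.ιInv (changeForm changeForm.associated_neg_proof (ι (Q n) v)) = v
  rw [changeForm_ι]
  exact ExteriorAlgebra.ι_leftInverse v

theorem clifford_ι_injective (n : ℕ) : Function.Injective (ι (Q n)) :=
  Function.LeftInverse.injective cliffordProj_ι

theorem algebraMap_clifford_injective (n : ℕ) :
    Function.Injective (algebraMap ℝ (CliffordAlgebra (Q n))) :=
  (algebraMap ℝ _).injective

/-- For `v` in the forward cone the vector `Q a • v - polar a v • a` has a positive time component.
It is `Q a` times the reflection of `v` at the hyperplane orthogonal to `a`, so that this reflection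
preserves the forward cone if `Q a` is positive, and reverses it if `Q a` is negative. -/
theorem timelike_pos_aux {n : ℕ} {a v : V n} (ha : Q n a ≠ 0) (hv : Q n v ≤ 0) (hv1 : 0 < v.1) :
    0 < Q n a * v.1 - QuadraticMap.polar (Q n) a v * a.1 := by
  rw [polar_apply]
  rw [Q_apply] at ha hv ⊢
  -- with the spatial parts `A`, `B` the expression is `(a₁² + |A|²) v₁ - 2 a₁ ⟨A, B⟩`
  set A : ℝ := a.2.1 * a.2.1 + inner ℝ a.2.2 a.2.2 with hA
  set B : ℝ := v.2.1 * v.2.1 + inner ℝ v.2.2 v.2.2 with hB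
  set I : ℝ := a.2.1 * v.2.1 + inner ℝ a.2.2 v.2.2 with hI
  have hA0 : 0 ≤ A := by
    have := mul_self_nonneg a.2.1
    have := real_inner_self_nonneg (x := a.2.2)
    linarith
  have hCS : I * I ≤ A * B := by
    have h0 := real_inner_mul_inner_self_le a.2.2 v.2.2
    have hx := real_inner_self_nonneg (x := a.2.2)
    have hy := real_inner_self_nonneg (x := v.2.2)
    set p : ℝ := inner ℝ a.2.2 a.2.2
    set r : ℝ := inner ℝ v.2.2 v.2.2
    set i : ℝ := inner ℝ a.2.2 v.2.2
    have h3 : 2 * (a.2.1 * v.2.1) * i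
        ≤ a.2.1 * a.2.1 * r + v.2.1 * v.2.1 * p := by
      have h4 : (2 * (a.2.1 * v.2.1) * i) ^ 2
          ≤ (a.2.1 * a.2.1 * r + v.2.1 * v.2.1 * p) ^ 2 := by
        nlinarith [sq_nonneg (a.2.1 * a.2.1 * r - v.2.1 * v.2.1 * p),
          mul_nonneg (sq_nonneg (a.2.1 * v.2.1)) (sub_nonneg.mpr h0)]
      have h5 : 0 ≤ a.2.1 * a.2.1 * r + v.2.1 * v.2.1 * p := add_nonneg
        (mul_nonneg (mul_self_nonneg _) hy) (mul_nonneg (mul_self_nonneg _) hx)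
      exact (le_abs_self _).trans (abs_le_of_sq_le_sq h4 h5)
    nlinarith
  have hB1 : A * B ≤ A * (v.1 * v.1) := mul_le_mul_of_nonneg_left (by linarith) hA0
  have hne : (a.1 * a.1 - A) ^ 2 > 0 := by
    apply sq_pos_of_ne_zero
    intro h; apply ha; linarith
  have hS : (2 * a.1 * I) ^ 2 < ((a.1 * a.1 + A) * v.1) ^ 2 := by
    have h1 : (2 * a.1 * I) ^ 2 ≤ 4 * (a.1 * a.1) * (A * (v.1 * v.1)) := by
      have := mul_le_mul_of_nonneg_left (hCS.trans hB1) (mul_self_nonneg a.1)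
      nlinarith
    have h2 : 0 < (a.1 * a.1 - A) ^ 2 * (v.1 * v.1) := mul_pos hne (mul_pos hv1 hv1)
    nlinarith
  have h0 : 0 ≤ (a.1 * a.1 + A) * v.1 :=
    mul_nonneg (add_nonneg (mul_self_nonneg _) hA0) hv1.le
  have := lt_of_pow_lt_pow_left₀ 2 h0 hS
  nlinarith

/-- The conjugate by `y` of a vector with respect to a multiple `y = r a` of a vector `a`. -/
theorem conj_ι_eq {n : ℕ} (y : (CliffordAlgebra (Q n))ˣ) (a : V n) (r : ℝ)
    (ha : Q n a ≠ 0) (hy : (y : CliffordAlgebra (Q n)) = r • ι (Q n) a) (v : V n) :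
    (y : CliffordAlgebra (Q n)) * ι (Q n) v * (y⁻¹ : (CliffordAlgebra (Q n))ˣ)
      = ι (Q n) ((Q n a)⁻¹ • (QuadraticMap.polar (Q n) a v • a - Q n a • v)) := by
  rw [Units.mul_inv_eq_iff_eq_mul, hy, mul_smul_comm, smul_mul_assoc, map_smul, ← ι_mul_ι_mul_ι,
    smul_mul_assoc, mul_assoc, ι_sq_scalar, ← Algebra.commutes, ← Algebra.smul_def,
    inv_smul_smul₀ ha]

/-- An element of the Lipschitz group preserves the forward light cone if and only if its spinor
norm `star x * x` is positive. -/
theorem lipschitz_orientation {n : ℕ} {x : (CliffordAlgebra (Q n))ˣ}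
    (hx : x ∈ lipschitzGroup (Q n)) :
    ∃ c : ℝ, c ≠ 0 ∧ star (x : CliffordAlgebra (Q n)) * x = algebraMap ℝ _ c ∧
      ∀ v : V n, ∃ w : V n, (x : CliffordAlgebra (Q n)) * ι (Q n) v
        * (x⁻¹ : (CliffordAlgebra (Q n))ˣ) = ι (Q n) w ∧
        (Q n v ≤ 0 → 0 < v.1 → 0 < c * w.1) := by
  have base : ∀ (y : (CliffordAlgebra (Q n))ˣ) (a : V n) (r : ℝ), r ≠ 0 → Q n a ≠ 0 →
      (y : CliffordAlgebra (Q n)) = r • ι (Q n) a →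
      ∃ c : ℝ, c ≠ 0 ∧ star (y : CliffordAlgebra (Q n)) * y = algebraMap ℝ _ c ∧
      ∀ v : V n, ∃ w : V n, (y : CliffordAlgebra (Q n)) * ι (Q n) v
        * (y⁻¹ : (CliffordAlgebra (Q n))ˣ) = ι (Q n) w ∧
        (Q n v ≤ 0 → 0 < v.1 → 0 < c * w.1) := by
    intro y a r hr ha hy
    refine ⟨-(r ^ 2 * Q n a), neg_ne_zero.mpr (mul_ne_zero (pow_ne_zero _ hr) ha), ?_,
      fun v => ⟨_, conj_ι_eq y a r ha hy v, fun hv hv1 => ?_⟩⟩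
    · rw [hy, CliffordAlgebra.star_smul, star_ι, smul_mul_smul_comm, neg_mul, ι_sq_scalar,
        map_neg, map_mul,
        ← Algebra.smul_def, smul_neg, sq]
    · have := timelike_pos_aux ha hv hv1
      have e : -(r ^ 2 * Q n a) * ((Q n a)⁻¹ • (QuadraticMap.polar (Q n) a v • a - Q n a • v)).1
          = r ^ 2 * (Q n a * v.1 - QuadraticMap.polar (Q n) a v * a.1) := by
        simp only [Prod.smul_fst, Prod.fst_sub, smul_eq_mul]
        field_simp
        ring
      rw [e]
      positivity
  unfold lipschitzGroup at hx
  have hunit : ∀ (y : (CliffordAlgebra (Q n))ˣ) (a : V n), ι (Q n) a = y → Q n a ≠ 0 := by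
    intro y a h
    have : IsUnit (ι (Q n) a) := h ▸ y.isUnit
    exact ((isUnit_ι_iff (Q := Q n) (m := a)).mp this).ne_zero
  induction hx using Subgroup.closure_induction'' with
  | mem y hy =>
    obtain ⟨a, ha⟩ := hy
    exact base y a 1 one_ne_zero (hunit y a ha) (by rw [one_smul, ha])
  | inv_mem y hy =>
    obtain ⟨a, ha⟩ := hy
    have h0 := hunit y a ha
    refine base y⁻¹ a (Q n a)⁻¹ (inv_ne_zero h0) h0 ?_
    rw [Units.inv_eq_of_mul_eq_one_right]
    rw [← ha, mul_smul_comm, ι_sq_scalar, Algebra.smul_def, ← map_mul, inv_mul_cancel₀ h0, map_one]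
  | one =>
    refine ⟨1, one_ne_zero, by simp, fun v => ⟨v, by simp, fun _ h => by simpa using h⟩⟩
  | mul y z _ _ hy hz =>
    obtain ⟨c, hc, hc1, hc2⟩ := hy
    obtain ⟨c', hc', hc1', hc2'⟩ := hz
    refine ⟨c * c', mul_ne_zero hc hc', ?_, fun v => ?_⟩
    · rw [Units.val_mul, star_mul, mul_assoc, ← mul_assoc (star (y : CliffordAlgebra (Q n))), hc1,
        Algebra.commutes, ← mul_assoc, hc1', ← map_mul, mul_comm]
    · obtain ⟨w, hw, hw2⟩ := hc2' v
      have hQ : Q n w = Q n v := by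
        apply algebraMap_clifford_injective n
        rw [← ι_sq_scalar, ← ι_sq_scalar, ← hw]
        simp only [mul_assoc, Units.inv_mul_cancel_left]
        rw [← mul_assoc (ι (Q n) v), ι_sq_scalar, ← mul_assoc, ← Algebra.commutes, mul_assoc,
          Units.mul_inv, mul_one]
      by_cases hs : 0 < c' * (1:ℝ)
      · obtain ⟨w', hw', hw2'⟩ := hc2 w
        refine ⟨w', ?_, fun hv hv1 => ?_⟩
        · rw [← hw', ← hw, mul_inv_rev, Units.val_mul, Units.val_mul]
          simp only [mul_assoc]
        · have hc3 : 0 < c' := by linarith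
          have h1 : 0 < w.1 := (mul_pos_iff_of_pos_left hc3).mp (hw2 hv hv1)
          have := hw2' (hQ ▸ hv) h1
          have := mul_pos hc3 this
          linarith
      · obtain ⟨w', hw', hw2'⟩ := hc2 (-w)
        refine ⟨-w', ?_, fun hv hv1 => ?_⟩
        · rw [map_neg, ← hw', map_neg, ← hw, mul_inv_rev, Units.val_mul, Units.val_mul]
          simp only [mul_assoc, neg_mul, mul_neg, neg_neg]
        · have h1 : 0 < (-w).1 := by
            have := hw2 hv hv1
            have hc3 : c' < 0 := lt_of_le_of_ne (by linarith) hc'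
            simp only [Prod.fst_neg]
            nlinarith
          have := hw2' (by rw [QuadraticMap.map_neg]; exact hQ ▸ hv) h1
          have hc3 : c' < 0 := lt_of_le_of_ne (by linarith) hc'
          have := mul_pos (neg_pos.mpr hc3) this
          simp only [Prod.fst_neg]
          linarith

theorem spin_star_mul {n : ℕ} (g : spinGroup (Q n)) : star g.1 * g.1 = 1 := g.2.1.2.1

theorem spin_mul_star {n : ℕ} (g : spinGroup (Q n)) : g.1 * star g.1 = 1 := g.2.1.2.2

theorem spin_conj {n : ℕ} (g : spinGroup (Q n)) (v : V n) :
    ∃ w : V n, g.1 * ι (Q n) v * star g.1 = ι (Q n) w ∧ (Q n v ≤ 0 → 0 < v.1 → 0 < w.1) := by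
  obtain ⟨x, hx, hxg⟩ := g.2.1.1
  obtain ⟨c, hc, h1, h2⟩ := lipschitz_orientation hx
  have hxg' : (x : CliffordAlgebra (Q n)) = g.1 := hxg
  have e : ((x⁻¹ : (CliffordAlgebra (Q n))ˣ) : CliffordAlgebra (Q n)) = star g.1 :=
    Units.inv_eq_of_mul_eq_one_right (by rw [hxg', spin_mul_star])
  rw [hxg', spin_star_mul] at h1
  have hc1 : 1 = c := algebraMap_clifford_injective n (by rw [map_one, h1])
  obtain ⟨w, hw, hw2⟩ := h2 v
  refine ⟨w, by rw [← hw, e, hxg'], fun hv hv1 => ?_⟩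
  have := hw2 hv hv1
  rwa [← hc1, one_mul] at this

/-- The action of the spin group on Lorentz space by conjugation. -/
def spinActLin {n : ℕ} (g : spinGroup (Q n)) : V n →ₗ[ℝ] V n :=
  cliffordProj n ∘ₗ LinearMap.mulLeft ℝ g.1 ∘ₗ LinearMap.mulRight ℝ (star g.1) ∘ₗ ι (Q n)

theorem ι_spinActLin {n : ℕ} (g : spinGroup (Q n)) (v : V n) :
    ι (Q n) (spinActLin g v) = g.1 * ι (Q n) v * star g.1 := by
  obtain ⟨w, hw, -⟩ := spin_conj g v
  change ι (Q n) (cliffordProj n (g.1 * (ι (Q n) v * star g.1))) = _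
  rw [← mul_assoc, hw, cliffordProj_ι]

theorem spinActLin_eq {n : ℕ} {g : spinGroup (Q n)} {v w : V n}
    (h : g.1 * ι (Q n) v = ι (Q n) w * g.1) : spinActLin g v = w := by
  apply clifford_ι_injective n
  rw [ι_spinActLin, h, mul_assoc, spin_mul_star, mul_one]

theorem ι_spinActLin_mul {n : ℕ} (g : spinGroup (Q n)) (v : V n) :
    ι (Q n) (spinActLin g v) * g.1 = g.1 * ι (Q n) v := by
  rw [ι_spinActLin, mul_assoc, spin_star_mul, mul_one]

theorem spinActLin_mul {n : ℕ} (g h : spinGroup (Q n)) (v : V n) :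
    spinActLin (g * h) v = spinActLin g (spinActLin h v) := by
  apply spinActLin_eq
  change g.1 * h.1 * _ = _ * (g.1 * h.1)
  rw [mul_assoc, ← ι_spinActLin_mul h, ← mul_assoc, ← ι_spinActLin_mul g, mul_assoc]

theorem spinActLin_one {n : ℕ} (v : V n) : spinActLin (1 : spinGroup (Q n)) v = v :=
  spinActLin_eq (by simp)

/-- The action of the spin group on Lorentz space as a homomorphism. -/
def spinAct (n : ℕ) : spinGroup (Q n) →* (V n ≃ₗ[ℝ] V n) where
  toFun g := LinearEquiv.ofLinearMap (spinActLin g) (spinActLin g⁻¹)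
    (LinearMap.ext fun v => by
      rw [LinearMap.comp_apply, ← spinActLin_mul, mul_inv_cancel, spinActLin_one]; rfl)
    (LinearMap.ext fun v => by
      rw [LinearMap.comp_apply, ← spinActLin_mul, inv_mul_cancel, spinActLin_one]; rfl)
  map_one' := LinearEquiv.ext fun v => by
    change spinActLin (1 : spinGroup (Q n)) v = v
    exact spinActLin_one v
  map_mul' g h := LinearEquiv.ext fun v => by
    change spinActLin (g * h) v = spinActLin g (spinActLin h v)
    exact spinActLin_mul g h v

end HypSob

/-! ### Relations in the spin group -/

namespace HypSob

open CliffordAlgebra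

section Spin

variable {n : ℕ}

/-- The null vector `e₀ + e₁` in the Clifford algebra. -/
def cN (n : ℕ) : CliffordAlgebra (Q n) := ι (Q n) (1, 1, 0)

/-- The null vector `e₀ - e₁` in the Clifford algebra. -/
def cN' (n : ℕ) : CliffordAlgebra (Q n) := ι (Q n) (1, -1, 0)

/-- The vector `x ∈ ℝ^{n-1}` in the Clifford algebra. -/
def cX (x : E (n - 1)) : CliffordAlgebra (Q n) := ι (Q n) (0, 0, x)

theorem cN_sq : cN n * cN n = 0 := by
  rw [cN, ι_sq_scalar, Q_apply]; simp

theorem cN'_sq : cN' n * cN' n = 0 := by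
  rw [cN', ι_sq_scalar, Q_apply]; simp

theorem cN_cN' : cN n * cN' n + cN' n * cN n = -4 := by
  rw [cN, cN', ι_mul_ι_add_swap, polar_apply]
  have : (2 * (-(1 * 1) + (1 * -1 + inner ℝ (0 : E (n - 1)) 0)) : ℝ) = -4 := by simp; norm_num
  simp only [this, map_neg, map_ofNat]

theorem cX_cN (x : E (n - 1)) : cX x * cN n + cN n * cX x = 0 := by
  rw [cN, cX, ι_mul_ι_add_swap, polar_apply]; simp

theorem cX_cN' (x : E (n - 1)) : cX x * cN' n + cN' n * cX x = 0 := by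
  rw [cN', cX, ι_mul_ι_add_swap, polar_apply]; simp

theorem cX_cX (x y : E (n - 1)) :
    cX x * cX y + cX y * cX x = algebraMap ℝ (CliffordAlgebra (Q n)) (2 * inner ℝ x y) := by
  rw [cX, cX, ι_mul_ι_add_swap, polar_apply]; simp

theorem cX_add (x y : E (n - 1)) : (cX (x + y) : CliffordAlgebra (Q n)) = cX x + cX y := by
  rw [cX, cX, cX, ← map_add]; simp

theorem cX_smul (c : ℝ) (x : E (n - 1)) : (cX (c • x) : CliffordAlgebra (Q n)) = c • cX x := by
  rw [cX, cX, ← map_smul]; simp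

theorem cX_neg (x : E (n - 1)) : (cX (-x) : CliffordAlgebra (Q n)) = -cX x := by
  rw [cX, cX, ← map_neg]; simp

theorem ι_decomp (t s : ℝ) (x : E (n - 1)) :
    ι (Q n) (t, s, x) = ((t + s) / 2) • cN n + ((t - s) / 2) • cN' n + cX x := by
  rw [cN, cN', cX, ← map_smul, ← map_smul, ← map_add, ← map_add]
  congr 1
  refine Prod.ext ?_ (Prod.ext ?_ ?_) <;> simp <;> ring

theorem cX_zero : (cX (0 : E (n - 1)) : CliffordAlgebra (Q n)) = 0 := map_zero (ι (Q n))

theorem ι_e0 : ι (Q n) (1, 0, 0) = (1 / 2 : ℝ) • (cN n + cN' n) := by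
  rw [ι_decomp, smul_add, cX_zero]; simp

theorem ι_e1 : ι (Q n) (0, 1, 0) = (1 / 2 : ℝ) • (cN n - cN' n) := by
  rw [ι_decomp, smul_sub, cX_zero]; module

theorem spinNilp_eq (x : E (n - 1)) : spinNilp n x = 1 + cN n * cX ((1 / 2 : ℝ) • x) := by
  rw [spinNilp, cX_smul, mul_smul_comm]; rfl

theorem spinOpp_eq (x : E (n - 1)) : spinOpp n x = 1 + cN' n * cX ((1 / 2 : ℝ) • x) := by
  rw [spinOpp, cX_smul, mul_smul_comm]; rfl

/-- For a null vector `N` in a Clifford algebra, `X ↦ 1 + N X` is a homomorphism from the additive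
group of the vectors orthogonal to `N`. -/
theorem unip_mul {A : Type*} [Ring A] {N X Y : A} (hN : N * N = 0) (hX : X * N + N * X = 0) :
    (1 + N * X) * (1 + N * Y) = 1 + N * (X + Y) := by
  linear_combination (norm := noncomm_ring) N * hX * Y - hN * X * Y

/-- The product `e₀ e₁` in terms of null vectors, with respect to which its commutation relations
are simple. -/
theorem ι_e0_mul_e1 : (ι (Q n) (1, 0, 0) * ι (Q n) (0, 1, 0) : CliffordAlgebra (Q n))
    = -1 - (1 / 2 : ℝ) • (cN n * cN' n) := by
  have h := cN_cN' (n := n)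
  have h2 : cN' n * cN n = -4 - cN n * cN' n := eq_sub_of_add_eq' h
  rw [ι_e0, ι_e1, smul_mul_smul_comm, mul_sub, add_mul, add_mul, cN_sq, cN'_sq, h2]
  have : (4 : CliffordAlgebra (Q n)) = (4 : ℝ) • 1 := by
    rw [← Algebra.algebraMap_eq_smul_one, map_ofNat]
  rw [this]
  module

theorem e01_cN : (ι (Q n) (1, 0, 0) * ι (Q n) (0, 1, 0)) * cN n = cN n := by
  have h := cN_cN' (n := n)
  have h2 : cN' n * cN n = -4 - cN n * cN' n := eq_sub_of_add_eq' h
  have h3 : cN n * cN' n * cN n = -4 * cN n := by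
    rw [mul_assoc, h2, mul_sub, ← mul_assoc, cN_sq]; noncomm_ring
  have : (4 : CliffordAlgebra (Q n)) = (4 : ℝ) • 1 := by
    rw [← Algebra.algebraMap_eq_smul_one, map_ofNat]
  rw [ι_e0_mul_e1, sub_mul, smul_mul_assoc, h3, this, neg_mul, neg_mul, one_mul, smul_mul_assoc,
    one_mul]
  module

theorem cN_e01 : cN n * (ι (Q n) (1, 0, 0) * ι (Q n) (0, 1, 0)) = -cN n := by
  rw [ι_e0_mul_e1, mul_sub, mul_smul_comm, ← mul_assoc, cN_sq]; simp

theorem e01_cN' : (ι (Q n) (1, 0, 0) * ι (Q n) (0, 1, 0)) * cN' n = -cN' n := by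
  rw [ι_e0_mul_e1, sub_mul, smul_mul_assoc, mul_assoc, cN'_sq]; simp

theorem cN'_e01 : cN' n * (ι (Q n) (1, 0, 0) * ι (Q n) (0, 1, 0)) = cN' n := by
  have h2 : cN' n * cN n = -4 - cN n * cN' n := eq_sub_of_add_eq' cN_cN'
  have h3 : cN' n * (cN n * cN' n) = -4 * cN' n := by
    rw [← mul_assoc, h2, sub_mul, mul_assoc, cN'_sq]; noncomm_ring
  have : (4 : CliffordAlgebra (Q n)) = (4 : ℝ) • 1 := by
    rw [← Algebra.algebraMap_eq_smul_one, map_ofNat]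
  rw [ι_e0_mul_e1, mul_sub, mul_smul_comm, h3, this, neg_mul, mul_neg, mul_one, smul_mul_assoc,
    one_mul]
  module

theorem e01_cX (x : E (n - 1)) : (ι (Q n) (1, 0, 0) * ι (Q n) (0, 1, 0)) * cX x
    = cX x * (ι (Q n) (1, 0, 0) * ι (Q n) (0, 1, 0)) := by
  have h1 := cX_cN x
  have h2 := cX_cN' x
  have : cN n * cN' n * cX x = cX x * (cN n * cN' n) := by
    linear_combination (norm := noncomm_ring) cN n * h2 - h1 * cN' n
  rw [ι_e0_mul_e1, sub_mul, mul_sub, smul_mul_assoc, mul_smul_comm, this]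
  noncomm_ring

theorem e01_sq : (ι (Q n) (1, 0, 0) * ι (Q n) (0, 1, 0) : CliffordAlgebra (Q n))
    * (ι (Q n) (1, 0, 0) * ι (Q n) (0, 1, 0)) = 1 := by
  conv_lhs => enter [1]; rw [ι_e0_mul_e1]
  rw [sub_mul, smul_mul_assoc, mul_assoc, cN'_e01, ι_e0_mul_e1]
  simp

theorem spinBoost_eq (τ : ℝ) : spinBoost n τ = Real.cosh (τ / 2) • 1
    + Real.sinh (τ / 2) • (ι (Q n) (1, 0, 0) * ι (Q n) (0, 1, 0)) := by
  rw [spinBoost, Algebra.algebraMap_eq_smul_one]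

theorem exp_half_split (τ : ℝ) : Real.exp (τ / 2) = Real.exp τ * Real.exp (-(τ / 2)) := by
  rw [← Real.exp_add]; congr 1; ring

theorem spinBoost_cN (τ : ℝ) : spinBoost n τ * cN n = Real.exp τ • (cN n * spinBoost n τ) := by
  rw [spinBoost_eq, add_mul, mul_add, smul_mul_assoc, smul_mul_assoc, e01_cN, mul_smul_comm,
    mul_smul_comm, cN_e01, one_mul, mul_one, ← add_smul, Real.cosh_add_sinh, smul_neg,
    ← sub_eq_add_neg, ← sub_smul, Real.cosh_sub_sinh, smul_smul, ← exp_half_split]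

theorem spinBoost_cN' (τ : ℝ) :
    spinBoost n τ * cN' n = Real.exp (-τ) • (cN' n * spinBoost n τ) := by
  rw [spinBoost_eq, add_mul, mul_add, smul_mul_assoc, smul_mul_assoc, e01_cN', mul_smul_comm,
    mul_smul_comm, cN'_e01, one_mul, mul_one, ← add_smul, Real.cosh_add_sinh, smul_neg,
    ← sub_eq_add_neg, ← sub_smul, Real.cosh_sub_sinh, smul_smul, ← Real.exp_add]
  congr 2; ring

theorem spinBoost_cX (τ : ℝ) (x : E (n - 1)) : spinBoost n τ * cX x = cX x * spinBoost n τ := by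
  rw [spinBoost_eq, add_mul, mul_add, smul_mul_assoc, smul_mul_assoc, e01_cX, mul_smul_comm,
    mul_smul_comm, one_mul, mul_one]

theorem spinBoost_add (s t : ℝ) : spinBoost n (s + t) = spinBoost n s * spinBoost n t := by
  rw [spinBoost_eq, spinBoost_eq, spinBoost_eq, add_div, Real.cosh_add, Real.sinh_add, add_mul,
    mul_add, mul_add, smul_mul_smul_comm, smul_mul_smul_comm, smul_mul_smul_comm,
    smul_mul_smul_comm, e01_sq, one_mul, mul_one, one_mul]
  module

theorem cX_sq_unit {u : E (n - 1)} (hu : ‖u‖ = 1) :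
    (cX u * cX u : CliffordAlgebra (Q n)) = 1 := by
  rw [cX, ι_sq_scalar, Q_apply]; simp [hu]

theorem cX_refl {u : E (n - 1)} (hu : ‖u‖ = 1) (x : E (n - 1)) :
    (cX u * cX x : CliffordAlgebra (Q n)) = -(cX (refl u x) * cX u) := by
  have h := cX_cX u x
  have h1 := cX_sq_unit hu
  rw [refl, sub_eq_add_neg, cX_add, cX_neg, cX_smul, add_mul, neg_mul, smul_mul_assoc, h1,
    ← Algebra.algebraMap_eq_smul_one, ← h]
  abel

theorem spin_ext {g h : spinGroup (Q n)} (H : g.1 = h.1) : g = h := Subtype.ext H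

theorem spinInversion_val {u : E (n - 1)} (hu : ‖u‖ = 1) :
    ((spinCell n).inversion u : spinGroup (Q n)).1
      = ι (Q n) (0, 1, 0) * cX u := by
  change spinNilp n u * spinOpp n (-u) * spinNilp n u = _
  have h1 := cX_cN u
  have h2 := cX_cN' u
  have h3 := cX_sq_unit hu
  have h4 := cN_cN' (n := n)
  have h5 := cN_sq (n := n)
  rw [spinNilp_eq, spinOpp_eq, smul_neg, cX_neg, cX_smul, ι_e1, mul_smul_comm, mul_neg,
    mul_smul_comm]
  set a := cN n
  set b := cN' n
  set X : CliffordAlgebra (Q n) := cX u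
  have p1 : a * X * (b * X) = -(a * b) := by
    linear_combination (norm := noncomm_ring) a * h2 * X - a * b * h3
  have p2 : b * X * (a * X) = -(b * a) := by
    linear_combination (norm := noncomm_ring) b * h1 * X - b * a * h3
  have p3 : a * X * (a * X) = 0 := by
    linear_combination (norm := noncomm_ring) a * h1 * X - h5 * X * X
  have p4 : a * b * (a * X) = -(4 : ℝ) • (a * X) := by
    have : (-(4 : ℝ)) • (a * X) = (-4) * (a * X) := by
      rw [Algebra.smul_def, map_neg, map_ofNat]
    rw [this]
    linear_combination (norm := noncomm_ring) h4 * a * X - b * h5 * X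
  have p5 : b * a = (-4 : ℝ) • 1 - a * b := by
    have : ((-4 : ℝ)) • (1 : CliffordAlgebra (Q n)) = -4 := by
      rw [← Algebra.algebraMap_eq_smul_one, map_neg, map_ofNat]
    rw [this]
    exact eq_sub_of_add_eq' h4
  simp only [mul_add, add_mul, one_mul, mul_one, smul_mul_assoc, mul_smul_comm, mul_neg, neg_mul,
    p1, p2, p3, p4, smul_neg, smul_zero, sub_mul]
  rw [p5]
  module

theorem e1_cX (x : E (n - 1)) : ι (Q n) (0, 1, 0) * cX x = -(cX x * ι (Q n) (0, 1, 0)) := by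
  have h1 := cX_cN x
  have h2 := cX_cN' x
  rw [ι_e1, smul_mul_assoc, mul_smul_comm, sub_mul, mul_sub, eq_neg_of_add_eq_zero_left h1,
    eq_neg_of_add_eq_zero_left h2]
  module

theorem e0_cX (x : E (n - 1)) : ι (Q n) (1, 0, 0) * cX x = -(cX x * ι (Q n) (1, 0, 0)) := by
  have h1 := cX_cN x
  have h2 := cX_cN' x
  rw [ι_e0, smul_mul_assoc, mul_smul_comm, add_mul, mul_add, eq_neg_of_add_eq_zero_left h1,
    eq_neg_of_add_eq_zero_left h2]
  module

theorem e1_sq : (ι (Q n) (0, 1, 0) * ι (Q n) (0, 1, 0) : CliffordAlgebra (Q n)) = 1 := by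
  rw [ι_sq_scalar, Q_apply]; simp

theorem spinInversion_mul_val {u v : E (n - 1)} (hu : ‖u‖ = 1) (hv : ‖v‖ = 1) :
    ((spinCell n).inversion u * (spinCell n).inversion (-v) : spinGroup (Q n)).1
      = cX u * cX v := by
  change ((spinCell n).inversion u : spinGroup (Q n)).1
    * ((spinCell n).inversion (-v) : spinGroup (Q n)).1 = _
  rw [spinInversion_val hu, spinInversion_val (by rw [norm_neg, hv]), cX_neg]
  have h1 := e1_cX u
  have h2 := e1_sq (n := n)
  rw [h1]
  linear_combination (norm := noncomm_ring) cX u * h2 * cX v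

theorem spinInversion_mem (u v : E (n - 1)) (hu : ‖u‖ = 1) (hv : ‖v‖ = 1) :
    (spinCell n).inversion u * (spinCell n).inversion (-v) ∈ (spinCell n).M := by
  have e := spinInversion_mul_val hu hv
  constructor
  · change ((spinCell n).inversion u * (spinCell n).inversion (-v) : spinGroup (Q n)).1 * _ =
      _ * ((spinCell n).inversion u * (spinCell n).inversion (-v) : spinGroup (Q n)).1
    rw [e]
    have h1 := e0_cX u
    have h2 := e0_cX v
    linear_combination (norm := noncomm_ring) cX u * h2 - h1 * cX v
  · change ((spinCell n).inversion u * (spinCell n).inversion (-v) : spinGroup (Q n)).1 * _ =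
      _ * ((spinCell n).inversion u * (spinCell n).inversion (-v) : spinGroup (Q n)).1
    rw [e]
    have h1 := e1_cX u
    have h2 := e1_cX v
    linear_combination (norm := noncomm_ring) cX u * h2 - h1 * cX v

theorem spinInversion_neg (u : E (n - 1)) (hu : ‖u‖ = 1) :
    (spinCell n).inversion u * (spinCell n).inversion (-u) = 1 :=
  spin_ext ((spinInversion_mul_val hu hu).trans (cX_sq_unit hu))

theorem spinInversion_symm (u v : E (n - 1)) (hu : ‖u‖ = 1) (hv : ‖v‖ = 1) :
    (spinCell n).inversion (-refl u v)
      = (spinCell n).inversion u * (spinCell n).inversion (-v) * (spinCell n).inversion u := by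
  apply spin_ext
  change ((spinCell n).inversion (-refl u v) : spinGroup (Q n)).1
    = ((spinCell n).inversion u * (spinCell n).inversion (-v) : spinGroup (Q n)).1
      * ((spinCell n).inversion u : spinGroup (Q n)).1
  rw [spinInversion_mul_val hu hv, spinInversion_val hu,
    spinInversion_val (norm_neg_refl hu hv), cX_neg]
  have h1 := e1_cX u
  have h2 := e1_cX v
  have h3 := cX_refl hu v
  have h4 := cX_sq_unit hu
  linear_combination (norm := noncomm_ring) h1 * cX v * cX u - cX u * h2 * cX u
    + ι (Q n) (0, 1, 0) * cX (refl u v) * h4 - ι (Q n) (0, 1, 0) * h3 * cX u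

theorem spinInversion_a (u : E (n - 1)) (hu : ‖u‖ = 1) (t : ℝ) :
    (spinCell n).inversion u * (spinCell n).a t
      = (spinCell n).a (-t) * (spinCell n).inversion u := by
  apply spin_ext
  change ((spinCell n).inversion u : spinGroup (Q n)).1 * spinBoost n t
    = spinBoost n (-t) * ((spinCell n).inversion u : spinGroup (Q n)).1
  have h : ι (Q n) (0, 1, 0) * (ι (Q n) (1, 0, 0) * ι (Q n) (0, 1, 0))
      = -(ι (Q n) (1, 0, 0) * ι (Q n) (0, 1, 0) * ι (Q n) (0, 1, 0)) := by
    have h0 := ι_mul_ι_add_swap (Q := Q n) (0, 1, 0) (1, 0, 0)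
    rw [polar_apply] at h0
    simp only [mul_zero, inner_zero_left, add_zero, neg_zero, mul_one, map_zero] at h0
    linear_combination (norm := noncomm_ring) h0 * ι (Q n) (0, 1, 0)
  rw [spinInversion_val hu, mul_assoc, ← spinBoost_cX, spinBoost_eq, spinBoost_eq, ← mul_assoc,
    ← mul_assoc, neg_div, Real.cosh_neg, Real.sinh_neg, mul_add,
    add_mul (_ • (1 : CliffordAlgebra (Q n))), mul_smul_comm, mul_smul_comm,
    h, smul_mul_assoc, smul_mul_assoc, mul_one, one_mul, neg_smul, smul_neg]

theorem spinInversion_nilp (u : E (n - 1)) (hu : ‖u‖ = 1) (x : E (n - 1)) :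
    (spinCell n).inversion u * (spinCell n).nilp x
      = (spinCell n).opp (refl u x) * (spinCell n).inversion u := by
  apply spin_ext
  change ((spinCell n).inversion u : spinGroup (Q n)).1 * spinNilp n x
    = spinOpp n _ * ((spinCell n).inversion u : spinGroup (Q n)).1
  rw [spinInversion_val hu, spinNilp_eq, spinOpp_eq, cX_smul, cX_smul, mul_smul_comm,
    mul_smul_comm, mul_add, add_mul, mul_smul_comm, smul_mul_assoc, mul_one, one_mul]
  congr 2
  have h1 := cX_cN u
  have h2 := e1_cX (refl u x)
  have h3 := cX_refl hu x
  -- `e₁ (e₀ + e₁) = -(e₀ - e₁) e₁`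
  have h4 : ι (Q n) (0, 1, 0) * cN n + cN' n * ι (Q n) (0, 1, 0) = 0 := by
    have h := cN_cN' (n := n)
    rw [ι_e1, smul_mul_assoc, mul_smul_comm, sub_mul, mul_sub, cN_sq, cN'_sq]
    module
  linear_combination (norm := noncomm_ring) ι (Q n) (0, 1, 0) * h1 * cX x
    - ι (Q n) (0, 1, 0) * cN n * h3 + h4 * cX (refl u x) * cX u
    - cN' n * h2 * cX u

theorem spinM_cX {b : spinGroup (Q n)} (x : E (n - 1))
    (hb : spinAct n b (1, 0, 0) = (1, 0, 0) ∧ spinAct n b (0, 1, 0) = (0, 1, 0)) :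
    b.1 * cX x = cX (spinAct n b (0, 0, x)).2.2 * b.1 := by
  have e := act_M_aux (b := spinAct n b) (fun v => by
    apply algebraMap_clifford_injective n
    change algebraMap ℝ _ (Q n (spinActLin b v)) = _
    rw [← ι_sq_scalar, ← ι_sq_scalar, ι_spinActLin]
    calc b.1 * ι (Q n) v * star b.1 * (b.1 * ι (Q n) v * star b.1)
        = b.1 * ι (Q n) v * (star b.1 * b.1) * ι (Q n) v * star b.1 := by
          simp only [mul_assoc]
      _ = _ := by
          rw [spin_star_mul, mul_one, mul_assoc b.1, ι_sq_scalar, ← Algebra.commutes, mul_assoc,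
            spin_mul_star, mul_one]) hb.1 hb.2 0 0 x
  have h2 : ι (Q n) (spinAct n b (0, 0, x)) * b.1 = b.1 * ι (Q n) (0, 0, x) :=
    ι_spinActLin_mul b _
  rw [e] at h2
  exact h2.symm

theorem cX_half_sq (x : E (n - 1)) :
    (4 * (cX ((1 / 2 : ℝ) • x) * cX ((1 / 2 : ℝ) • x)) : CliffordAlgebra (Q n))
      = algebraMap ℝ _ (inner ℝ x x) := by
  have h := cX_cX (n := n) x x
  rw [cX_smul, smul_mul_smul_comm]
  have h4 : (4 : CliffordAlgebra (Q n)) = algebraMap ℝ _ 4 := (map_ofNat _ 4).symm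
  rw [h4, ← Algebra.smul_def, smul_smul]
  have : (cX x * cX x : CliffordAlgebra (Q n)) = (1 / 2 : ℝ) • (cX x * cX x + cX x * cX x) := by
    module
  rw [this, h, Algebra.algebraMap_eq_smul_one, Algebra.algebraMap_eq_smul_one]
  module

theorem cX_half_mul (x y : E (n - 1)) :
    (cX ((1 / 2 : ℝ) • x) * cX y + cX y * cX ((1 / 2 : ℝ) • x) : CliffordAlgebra (Q n))
      = algebraMap ℝ _ (inner ℝ x y) := by
  have h := cX_cX (n := n) x y
  rw [cX_smul, smul_mul_assoc, mul_smul_comm, ← smul_add, h, Algebra.algebraMap_eq_smul_one,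
    Algebra.algebraMap_eq_smul_one]
  module

theorem spinAct_boost (t : ℝ) : spinAct n ⟨spinBoost n t, spinBoost_mem n t⟩ = boostEquiv n t := by
  refine LinearEquiv.ext fun v => ?_
  refine spinActLin_eq ?_
  obtain ⟨r, s, x⟩ := v
  change spinBoost n t * ι (Q n) (r, s, x) = ι (Q n) (boostEquiv n t (r, s, x)) * spinBoost n t
  simp only [boostEquiv, LinearEquiv.coe_mk, LinearMap.coe_mk, AddHom.coe_mk, ι_decomp]
  rw [mul_add, mul_add, add_mul, add_mul, mul_smul_comm, mul_smul_comm, spinBoost_cN,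
    spinBoost_cN', spinBoost_cX, smul_mul_assoc, smul_mul_assoc, smul_smul, smul_smul,
    Real.cosh_eq, Real.sinh_eq]
  congr 3 <;> ring

theorem unip_conj {A : Type*} [Ring A] {a b X Y : A} (h1 : X * a + a * X = 0)
    (h2 : X * b + b * X = 0) (h3 : a * a = 0) (h4 : a * b + b * a = -4) (h5 : Y * a + a * Y = 0) :
    (1 + a * X) * a = a * (1 + a * X) ∧
    (1 + a * X) * b = (b + 4 * (X * X) * a + 4 * X) * (1 + a * X) ∧
    (1 + a * X) * Y = ((X * Y + Y * X) * a + Y) * (1 + a * X) := by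
  refine ⟨?_, ?_, ?_⟩
  · linear_combination (norm := noncomm_ring) a * h1 - 2 * h3 * X
  · linear_combination (norm := noncomm_ring) a * h2 - h4 * X - 4 * X * X * h3 * X - 4 * X * h1
  · linear_combination (norm := noncomm_ring) - X * Y * h3 * X - Y * X * h3 * X
      - X * h5 - Y * h1 + h1 * Y

theorem spinAct_nilp (x : E (n - 1)) :
    spinAct n ⟨spinNilp n x, spinNilp_mem n x⟩ = nilpEquiv n x := by
  refine LinearEquiv.ext fun v => ?_
  refine spinActLin_eq ?_
  obtain ⟨r, s, y⟩ := v
  change spinNilp n x * ι (Q n) (r, s, y) = ι (Q n) (nilpEquiv n x (r, s, y)) * spinNilp n x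
  have e : ι (Q n) (nilpEquiv n x (r, s, y)) = ((r + s) / 2) • cN n
      + ((r - s) / 2) • (cN' n + (algebraMap ℝ _ (inner ℝ x x)) * cN n
        + cX ((4 : ℝ) • (1 / 2 : ℝ) • x))
      + (algebraMap ℝ _ (inner ℝ x y) * cN n + cX y) := by
    simp only [nilpEquiv, LinearEquiv.coe_mk, LinearMap.coe_mk, AddHom.coe_mk, ι_decomp, cX_add,
      cX_smul, ← Algebra.smul_def]
    module
  rw [e, ← cX_half_sq x, ← cX_half_mul x y, ι_decomp, spinNilp_eq, cX_smul _ ((1 / 2 : ℝ) • x)]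
  have h1 := cX_cN ((1 / 2 : ℝ) • x)
  have h2 := cX_cN' ((1 / 2 : ℝ) • x)
  have h3 := cN_sq (n := n)
  have h4 := cN_cN' (n := n)
  have h5 := cX_cN y
  have f0 : (4 : ℝ) • (cX ((1 / 2 : ℝ) • x) : CliffordAlgebra (Q n))
      = 4 * cX ((1 / 2 : ℝ) • x) := by rw [Algebra.smul_def, map_ofNat]
  rw [f0]
  obtain ⟨f1, f2, f3⟩ := unip_conj h1 h2 h3 h4 h5
  set g : CliffordAlgebra (Q n) := 1 + cN n * cX ((1 / 2 : ℝ) • x)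
  rw [mul_add g, mul_add g, add_mul _ _ g, add_mul _ _ g, mul_smul_comm, mul_smul_comm,
    smul_mul_assoc,
    smul_mul_assoc, f1, f2, f3]

theorem spinAct_opp (x : E (n - 1)) :
    spinAct n ⟨spinOpp n x, spinOpp_mem n x⟩ = oppEquiv n x := by
  refine LinearEquiv.ext fun v => ?_
  refine spinActLin_eq ?_
  obtain ⟨r, s, y⟩ := v
  change spinOpp n x * ι (Q n) (r, s, y) = ι (Q n) (oppEquiv n x (r, s, y)) * spinOpp n x
  have e : ι (Q n) (oppEquiv n x (r, s, y)) = ((r + s) / 2) • (cN n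
      + (algebraMap ℝ _ (inner ℝ x x)) * cN' n + cX ((4 : ℝ) • (1 / 2 : ℝ) • x))
      + ((r - s) / 2) • cN' n
      + (algebraMap ℝ _ (inner ℝ x y) * cN' n + cX y) := by
    simp only [oppEquiv, LinearEquiv.coe_mk, LinearMap.coe_mk, AddHom.coe_mk, ι_decomp, cX_add,
      cX_smul, ← Algebra.smul_def]
    module
  rw [e, ← cX_half_sq x, ← cX_half_mul x y, ι_decomp, spinOpp_eq, cX_smul _ ((1 / 2 : ℝ) • x)]
  have h1 := cX_cN' ((1 / 2 : ℝ) • x)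
  have h2 := cX_cN ((1 / 2 : ℝ) • x)
  have h3 := cN'_sq (n := n)
  have h4 : cN' n * cN n + cN n * cN' n = -4 := by rw [add_comm, cN_cN']
  have h5 := cX_cN' y
  have f0 : (4 : ℝ) • (cX ((1 / 2 : ℝ) • x) : CliffordAlgebra (Q n))
      = 4 * cX ((1 / 2 : ℝ) • x) := by rw [Algebra.smul_def, map_ofNat]
  rw [f0]
  obtain ⟨f1, f2, f3⟩ := unip_conj h1 h2 h3 h4 h5
  set g : CliffordAlgebra (Q n) := 1 + cN' n * cX ((1 / 2 : ℝ) • x)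
  rw [mul_add g, mul_add g, add_mul _ _ g, add_mul _ _ g, mul_smul_comm, mul_smul_comm,
    smul_mul_assoc,
    smul_mul_assoc, f1, f2, f3]

end Spin

end HypSob

/-! ### The geometric facts for the spin group -/

namespace HypSob

open CliffordAlgebra

section Spin

variable {n : ℕ}

theorem spinAct_eq_iff (g : spinGroup (Q n)) (v : V n) :
    spinAct n g v = v ↔ Commute g.1 (ι (Q n) v) := by
  constructor
  · intro h
    have h2 : ι (Q n) (spinAct n g v) * g.1 = g.1 * ι (Q n) v := ι_spinActLin_mul g v
    rw [h] at h2
    exact h2.symm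
  · intro h
    exact spinActLin_eq (g := g) h.eq

theorem spinAct_Q (g : spinGroup (Q n)) (v : V n) : Q n (spinAct n g v) = Q n v := by
  apply algebraMap_clifford_injective n
  change algebraMap ℝ _ (Q n (spinActLin g v)) = _
  rw [← ι_sq_scalar, ← ι_sq_scalar, ι_spinActLin]
  calc g.1 * ι (Q n) v * star g.1 * (g.1 * ι (Q n) v * star g.1)
      = g.1 * ι (Q n) v * (star g.1 * g.1) * ι (Q n) v * star g.1 := by
        simp only [mul_assoc]
    _ = _ := by
        rw [spin_star_mul, mul_one, mul_assoc g.1, ι_sq_scalar, ← Algebra.commutes, mul_assoc,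
          spin_mul_star, mul_one]

theorem spinAct_pos (g : spinGroup (Q n)) : 0 < (spinAct n g (1, 1, 0)).1 := by
  obtain ⟨w, hw, hw2⟩ := spin_conj g (1, 1, 0)
  have : spinActLin g (1, 1, 0) = w := clifford_ι_injective n (by rw [ι_spinActLin, hw])
  change 0 < (spinActLin g (1, 1, 0)).1
  rw [this]
  exact hw2 (by rw [Q_apply]; simp) (by simp)

theorem spin_mem_M_iff (g : spinGroup (Q n)) :
    g ∈ (spinCell n).M ↔ spinAct n g (1, 0, 0) = (1, 0, 0) ∧ spinAct n g (0, 1, 0) = (0, 1, 0) := by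
  rw [spinAct_eq_iff, spinAct_eq_iff]
  rfl

theorem spinM_cN (b : spinGroup (Q n)) (hb : b ∈ (spinCell n).M) :
    Commute b.1 (cN n) ∧ Commute b.1 (cN' n) := by
  obtain ⟨h0, h1⟩ := hb
  have e : cN n = ι (Q n) (1, 0, 0) + ι (Q n) (0, 1, 0) := by
    rw [cN, ← map_add]; simp
  have e' : cN' n = ι (Q n) (1, 0, 0) - ι (Q n) (0, 1, 0) := by
    rw [cN', ← map_sub]; simp
  exact ⟨e ▸ Commute.add_right h0 h1, e' ▸ Commute.sub_right h0 h1⟩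

theorem spinM_nilp (b : spinGroup (Q n)) (hb : b ∈ (spinCell n).M) (x : E (n - 1)) :
    b.1 * spinNilp n x = spinNilp n (spinAct n b (0, 0, x)).2.2 * b.1 := by
  have h1 := (spinM_cN b hb).1
  have h2 := spinM_cX x ((spin_mem_M_iff b).mp hb)
  rw [spinNilp_eq, spinNilp_eq, cX_smul, cX_smul, mul_add, add_mul, mul_one, one_mul, ← mul_assoc,
    h1.eq, mul_assoc, mul_smul_comm, h2, mul_assoc, smul_mul_assoc]

theorem spinM_opp (b : spinGroup (Q n)) (hb : b ∈ (spinCell n).M) (x : E (n - 1)) :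
    b.1 * spinOpp n x = spinOpp n (spinAct n b (0, 0, x)).2.2 * b.1 := by
  have h1 := (spinM_cN b hb).2
  have h2 := spinM_cX x ((spin_mem_M_iff b).mp hb)
  rw [spinOpp_eq, spinOpp_eq, cX_smul, cX_smul, mul_add, add_mul, mul_one, one_mul, ← mul_assoc,
    h1.eq, mul_assoc, mul_smul_comm, h2, mul_assoc, smul_mul_assoc]

theorem spinInversion_cont (u : E (n - 1)) (hu : ‖u‖ = 1) :
    Continuous fun v : Metric.sphere (0 : E (n - 1)) 1 =>
      (⟨(spinCell n).inversion v.1 * (spinCell n).inversion (-u),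
        spinInversion_mem v.1 u (by simp) hu⟩ : (spinCell n).M) := by
  refine Continuous.subtype_mk ?_ _
  refine continuous_induced_rng.mpr ?_
  let _ : TopologicalSpace (CliffordAlgebra (Q n)) := moduleTopology ℝ (CliffordAlgebra (Q n))
  have _ : IsModuleTopology ℝ (CliffordAlgebra (Q n)) := ⟨rfl⟩
  have _ : IsTopologicalAddGroup (CliffordAlgebra (Q n)) :=
    IsModuleTopology.topologicalAddGroup ℝ _
  let L : E (n - 1) →ₗ[ℝ] CliffordAlgebra (Q n) :=
    LinearMap.mulRight ℝ (cX u) ∘ₗ ι (Q n) ∘ₗ LinearMap.inr ℝ ℝ (ℝ × E (n - 1))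
      ∘ₗ LinearMap.inr ℝ ℝ (E (n - 1))
  have hL : Continuous L := L.continuous_of_finiteDimensional
  refine (hL.comp continuous_subtype_val).congr fun v => ?_
  exact (spinInversion_mul_val (by simp) hu).symm

/-- The geometric facts for `Spin(1,n)`. -/
def spinGeom (n : ℕ) : Geom n (spinCell n) where
  act := spinAct n
  act_Q := spinAct_Q
  act_pos := spinAct_pos
  act_a := spinAct_boost
  act_nilp := spinAct_nilp
  act_opp := spinAct_opp
  mem_M := spin_mem_M_iff
  a_add s t := spin_ext (spinBoost_add s t)
  nilp_add x y := spin_ext (by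
    change spinNilp n (x + y) = spinNilp n x * spinNilp n y
    rw [spinNilp_eq, spinNilp_eq, spinNilp_eq, smul_add, cX_add, unip_mul cN_sq (cX_cN _)])
  opp_add x y := spin_ext (by
    change spinOpp n (x + y) = spinOpp n x * spinOpp n y
    rw [spinOpp_eq, spinOpp_eq, spinOpp_eq, smul_add, cX_add, unip_mul cN'_sq (cX_cN' _)])
  M_a b hb t := spin_ext (by
    change b.1 * spinBoost n t = spinBoost n t * b.1
    have h := Commute.mul_right hb.1 hb.2
    rw [spinBoost_eq, mul_add, add_mul, mul_smul_comm, mul_smul_comm, h.eq, smul_mul_assoc,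
      smul_mul_assoc, mul_one, one_mul])
  M_nilp b hb x := spin_ext (spinM_nilp b hb x)
  M_opp b hb x := spin_ext (spinM_opp b hb x)
  a_nilp t x := spin_ext (by
    change spinBoost n t * spinNilp n x = spinNilp n _ * spinBoost n t
    rw [spinNilp_eq, spinNilp_eq, mul_add, add_mul, ← mul_assoc, spinBoost_cN, smul_mul_assoc,
      mul_assoc, spinBoost_cX, smul_comm, cX_smul, cX_smul _ ((1 / 2 : ℝ) • x), cX_smul]
    simp only [mul_smul_comm, smul_mul_assoc, mul_assoc, one_mul, mul_one])
  a_opp t x := spin_ext (by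
    change spinBoost n t * spinOpp n x = spinOpp n _ * spinBoost n t
    rw [spinOpp_eq, spinOpp_eq, mul_add, add_mul, ← mul_assoc, spinBoost_cN', smul_mul_assoc,
      mul_assoc, spinBoost_cX, smul_comm, cX_smul, cX_smul _ ((1 / 2 : ℝ) • x), cX_smul]
    simp only [mul_smul_comm, smul_mul_assoc, mul_assoc, one_mul, mul_one])
  inversion_a := spinInversion_a
  inversion_nilp := spinInversion_nilp
  inversion_mem := spinInversion_mem
  inversion_neg := spinInversion_neg
  inversion_symm := spinInversion_symm
  inversion_cont := spinInversion_cont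

end Spin

/-- The geometric facts for both families. -/
def geom : (κ : Kind) → (n : ℕ) → Geom n (cell κ n)
  | .so, n => soGeom n
  | .spin, n => spinGeom n

end HypSob

/-! ### The big cell -/

namespace HypSob

namespace Geom

variable {n : ℕ} {D : CellData (n - 1)} (X : Geom n D)

/-- The image of the null vector `(1, 1, 0)`, whose ray is stabilized by `P`. -/
def null (g : D.G) : V n := X.act g (1, 1, 0)

/-- The number `e^t` in the decomposition `g = n̄_x b a_t n_z`; it is positive exactly on the big
cell. -/
def den (g : D.G) : ℝ := ((X.null g).1 + (X.null g).2.1) / 2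

/-- The coordinate `x` in the decomposition `g = n̄_x b a_t n_z`. -/
def pos (g : D.G) : E (n - 1) := (2 * X.den g)⁻¹ • (X.null g).2.2

theorem act_mul_apply (g h : D.G) (v : V n) : X.act (g * h) v = X.act g (X.act h v) := by
  rw [map_mul]; rfl

theorem act_M_null {b : D.G} (hb : b ∈ D.M) : X.act b (1, 1, 0) = (1, 1, 0) := by
  obtain ⟨h0, h1⟩ := (X.mem_M b).mp hb
  have : ((1, 1, 0) : V n) = (1, 0, 0) + (0, 1, 0) := by ext <;> simp
  rw [this, map_add, h0, h1]

theorem act_M_null' {b : D.G} (hb : b ∈ D.M) : X.act b (1, -1, 0) = (1, -1, 0) := by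
  obtain ⟨h0, h1⟩ := (X.mem_M b).mp hb
  have : ((1, -1, 0) : V n) = (1, 0, 0) - (0, 1, 0) := by ext <;> simp
  rw [this, map_sub, h0, h1]

theorem act_a_null (t : ℝ) : X.act (D.a t) (1, 1, 0) = Real.exp t • (1, 1, 0) := by
  rw [X.act_a]
  ext <;> simp [boostEquiv, Real.cosh_add_sinh, Real.sinh_add_cosh]

theorem act_nilp_null (x : E (n - 1)) : X.act (D.nilp x) (1, 1, 0) = (1, 1, 0) := by
  rw [X.act_nilp]
  ext <;> simp [nilpEquiv]

theorem act_nilp_null' (x : E (n - 1)) : X.act (D.nilp x) (1, -1, 0)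
    = (1 + inner ℝ x x, -1 + inner ℝ x x, (2 : ℝ) • x) := by
  rw [X.act_nilp]
  simp only [nilpEquiv, LinearEquiv.coe_mk, LinearMap.coe_mk, AddHom.coe_mk, inner_zero_right,
    zero_add, add_zero]
  refine Prod.ext ?_ (Prod.ext ?_ ?_) <;> simp only
  · ring
  · ring
  · norm_num

theorem act_opp_null (x : E (n - 1)) : X.act (D.opp x) (1, 1, 0)
    = (1 + inner ℝ x x, 1 - inner ℝ x x, (2 : ℝ) • x) := by
  rw [X.act_opp]
  simp only [oppEquiv, LinearEquiv.coe_mk, LinearMap.coe_mk, AddHom.coe_mk, inner_zero_right,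
    zero_add, add_zero, sub_zero]
  refine Prod.ext ?_ (Prod.ext ?_ ?_) <;> simp only
  · ring
  · ring
  · norm_num

theorem null_cell {b : D.G} (hb : b ∈ D.M) (x z : E (n - 1)) (t : ℝ) :
    X.null (D.opp x * b * D.a t * D.nilp z)
      = Real.exp t • (1 + inner ℝ x x, 1 - inner ℝ x x, (2 : ℝ) • x) := by
  rw [null, act_mul_apply, act_nilp_null, act_mul_apply, act_a_null, map_smul, act_mul_apply,
    X.act_M_null hb, act_opp_null]

theorem den_cell {b : D.G} (hb : b ∈ D.M) (x z : E (n - 1)) (t : ℝ) :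
    X.den (D.opp x * b * D.a t * D.nilp z) = Real.exp t := by
  rw [den, X.null_cell hb]
  simp only [Prod.smul_mk, smul_eq_mul]
  ring

theorem pos_cell {b : D.G} (hb : b ∈ D.M) (x z : E (n - 1)) (t : ℝ) :
    X.pos (D.opp x * b * D.a t * D.nilp z) = x := by
  rw [pos, X.den_cell hb, X.null_cell hb]
  simp only [Prod.smul_mk, smul_smul]
  have : (2 * Real.exp t)⁻¹ * (Real.exp t * 2) = 1 := by
    field_simp
  rw [this, one_smul]

theorem null_Q (g : D.G) : inner ℝ (X.null g).2.2 (X.null g).2.2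
    = ((X.null g).1 - (X.null g).2.1) * ((X.null g).1 + (X.null g).2.1) := by
  have h := X.act_Q g (1, 1, 0)
  rw [Q_apply, Q_apply] at h
  simp only [mul_one, inner_zero_left, add_zero, neg_add_cancel] at h
  change -((X.null g).1 * (X.null g).1) + ((X.null g).2.1 * (X.null g).2.1
    + inner ℝ (X.null g).2.2 (X.null g).2.2) = 0 at h
  linarith

theorem null_pos (g : D.G) : 0 < (X.null g).1 := X.act_pos g

theorem den_nonneg (g : D.G) : 0 ≤ X.den g := by
  have h := X.null_Q g
  have h1 := X.null_pos g
  have h2 := real_inner_self_nonneg (x := (X.null g).2.2)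
  rw [den]
  by_contra hneg
  push Not at hneg
  nlinarith

theorem opp_zero (X : Geom n D) : D.opp 0 = 1 := by
  have := X.opp_add 0 0
  rw [add_zero] at this
  exact left_eq_mul.mp this

theorem nilp_zero (X : Geom n D) : D.nilp 0 = 1 := by
  have := X.nilp_add 0 0
  rw [add_zero] at this
  exact left_eq_mul.mp this

theorem a_zero (X : Geom n D) : D.a 0 = 1 := by
  have := X.a_add 0 0
  rw [add_zero] at this
  exact left_eq_mul.mp this

theorem nilp_inv (X : Geom n D) (x : E (n - 1)) : (D.nilp x)⁻¹ = D.nilp (-x) := by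
  rw [inv_eq_iff_mul_eq_one, ← X.nilp_add, add_neg_cancel, X.nilp_zero]

theorem a_inv (X : Geom n D) (t : ℝ) : (D.a t)⁻¹ = D.a (-t) := by
  rw [inv_eq_iff_mul_eq_one, ← X.a_add, add_neg_cancel, X.a_zero]

/-- Every element on which `den` is positive lies in the big cell `N̄ M A N`. -/
theorem exists_decomp {g : D.G} (hg : 0 < X.den g) : ∃ b ∈ D.M, ∃ z,
    g = D.opp (X.pos g) * b * D.a (Real.log (X.den g)) * D.nilp z := by
  set t := Real.log (X.den g) with ht
  set y := X.pos g with hy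
  have het : Real.exp t = X.den g := Real.exp_log hg
  set h := (D.a t)⁻¹ * (D.opp y)⁻¹ * g with hh
  have hnull : X.null g = X.den g • (1 + inner ℝ y y, 1 - inner ℝ y y, (2 : ℝ) • y) := by
    have hq := X.null_Q g
    have e2 : (X.null g).2.2 = (2 * X.den g) • y := by
      rw [hy, pos, smul_smul, mul_inv_cancel₀ (by positivity), one_smul]
    have hs : (X.null g).1 + (X.null g).2.1 = 2 * X.den g := by rw [den]; ring
    rw [e2, hs, inner_smul_left, inner_smul_right, RCLike.conj_to_real] at hq
    have hd : (X.null g).1 - (X.null g).2.1 = 2 * X.den g * inner ℝ y y := by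
      have : (2 * X.den g) ≠ 0 := by positivity
      apply mul_right_cancel₀ this
      rw [← hq]; ring
    refine Prod.ext ?_ (Prod.ext ?_ ?_)
    · simp only [Prod.smul_mk, smul_eq_mul]; linarith
    · simp only [Prod.smul_mk, smul_eq_mul]; linarith
    · simp only [Prod.smul_mk, smul_smul]; rw [e2, mul_comm]
  have hv0 : X.act h (1, 1, 0) = (1, 1, 0) := by
    have e1 : g = D.opp y * (D.a t * h) := by rw [hh]; group
    have e2 : X.act (D.opp y * D.a t) (X.act h (1, 1, 0))
        = X.act (D.opp y * D.a t) (1, 1, 0) := by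
      rw [← act_mul_apply, mul_assoc, ← e1]
      change X.null g = _
      rw [hnull, act_mul_apply, act_a_null, map_smul, act_opp_null, het]
    exact (X.act _).injective e2
  -- the image of the second null vector determines the factor in `N`
  set w := X.act h (1, -1, 0) with hw
  set c := (1 / 2 : ℝ) • w.2.2 with hc
  have hpol : QuadraticMap.polar (Q n) w (1, 1, 0)
      = QuadraticMap.polar (Q n) (1, -1, 0) (1, 1, 0) := by
    rw [hw]
    nth_rewrite 1 [← hv0]
    simp only [QuadraticMap.polar, ← map_add, X.act_Q]
  have hwQ : Q n w = 0 := by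
    rw [hw, X.act_Q, Q_apply]; simp
  rw [polar_apply, polar_apply] at hpol
  rw [Q_apply] at hwQ
  simp only [mul_one, inner_zero_right, add_zero] at hpol
  have hw' : w = (1 + inner ℝ c c, -1 + inner ℝ c c, (2 : ℝ) • c) := by
    have e2 : w.2.2 = (2 : ℝ) • c := by rw [hc, smul_smul]; norm_num
    have e3 : inner ℝ w.2.2 w.2.2 = 4 * inner ℝ c c := by
      rw [e2, inner_smul_left, inner_smul_right, RCLike.conj_to_real]; ring
    rw [e3] at hwQ
    have e4 : w.2.1 = w.1 - 2 := by linarith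
    rw [e4] at hwQ
    refine Prod.ext ?_ (Prod.ext ?_ e2) <;> simp only <;> nlinarith
  set b := (D.nilp c)⁻¹ * h with hb
  have hb0 : X.act b (1, 1, 0) = (1, 1, 0) := by
    rw [hb, act_mul_apply, hv0, X.nilp_inv, act_nilp_null]
  have hb1 : X.act b (1, -1, 0) = (1, -1, 0) := by
    apply (X.act (D.nilp c)).injective
    rw [← act_mul_apply, hb, mul_inv_cancel_left, ← hw, hw', act_nilp_null']
  have hbM : b ∈ D.M := by
    rw [X.mem_M]
    have e0 : ((1, 0, 0) : V n) = (1 / 2 : ℝ) • ((1, 1, 0) + (1, -1, 0)) := by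
      ext <;> norm_num
    have e1 : ((0, 1, 0) : V n) = (1 / 2 : ℝ) • ((1, 1, 0) - (1, -1, 0)) := by
      ext <;> norm_num
    constructor
    · rw [e0, map_smul, map_add, hb0, hb1]
    · rw [e1, map_smul, map_sub, hb0, hb1]
  have hbM' : b⁻¹ ∈ D.M := inv_mem hbM
  refine ⟨b, hbM, (X.act b⁻¹ (0, 0, c)).2.2, ?_⟩
  have e1 : D.nilp (X.act b⁻¹ (0, 0, c)).2.2 = b⁻¹ * D.nilp c * b := by
    rw [X.M_nilp _ hbM', mul_assoc, inv_mul_cancel, mul_one]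
  rw [e1, mul_assoc (D.opp y), X.M_a b hbM t, hb, hh]
  group

/-- The factor in `M` of the decomposition of the big cell is unique: the element `b⁻¹ b'` lies in
`M` and in the nilpotent group `N`. -/
theorem M_unique (X : Geom n D) {b b' : D.G} (hb : b ∈ D.M) (hb' : b' ∈ D.M)
    {x z z' : E (n - 1)} {t : ℝ}
    (h : D.opp x * b * D.a t * D.nilp z = D.opp x * b' * D.a t * D.nilp z') : b = b' := by
  have h1 : b * D.a t * D.nilp z = b' * D.a t * D.nilp z' := by
    simpa only [mul_assoc, mul_right_inj] using h
  rw [X.M_a b hb, X.M_a b' hb', mul_assoc, mul_assoc, mul_right_inj, X.M_nilp b hb,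
    X.M_nilp b' hb'] at h1
  have h2 := congrArg (fun g => (X.act g (1, -1, 0)).2.2) h1
  simp only [act_mul_apply, X.act_M_null' hb, X.act_M_null' hb', act_nilp_null'] at h2
  have h3 := smul_right_injective (E (n - 1)) (two_ne_zero (α := ℝ)) h2
  rw [h3] at h1
  exact mul_left_cancel h1

open Classical in
/-- The factor in `M` in the decomposition `g = n̄_x b a_t n_z`. -/
def mpart (g : D.G) : D.M :=
  if h : 0 < X.den g then ⟨(X.exists_decomp h).choose, (X.exists_decomp h).choose_spec.1⟩ else 1

theorem mpart_cell (b : D.M) (x z : E (n - 1)) (t : ℝ) :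
    X.mpart (D.opp x * b * D.a t * D.nilp z) = b := by
  have hden := X.den_cell b.2 x z t
  have h : 0 < X.den (D.opp x * b * D.a t * D.nilp z) := by rw [hden]; positivity
  rw [mpart, dif_pos h]
  apply Subtype.ext
  have key : ∀ b' ∈ D.M, (∃ z', D.opp x * b * D.a t * D.nilp z
      = D.opp (X.pos (D.opp x * b * D.a t * D.nilp z)) * b'
        * D.a (Real.log (X.den (D.opp x * b * D.a t * D.nilp z))) * D.nilp z') → b' = b := by
    rintro b' hb' ⟨z', hz'⟩
    rw [X.pos_cell b.2, hden, Real.log_exp] at hz'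
    exact (X.M_unique b.2 hb' hz').symm
  exact key _ (X.exists_decomp h).choose_spec.1 (X.exists_decomp h).choose_spec.2

theorem eq_cell {g : D.G} (hg : 0 < X.den g) : ∃ z,
    g = D.opp (X.pos g) * X.mpart g * D.a (Real.log (X.den g)) * D.nilp z := by
  obtain ⟨b, hb, z, h⟩ := X.exists_decomp hg
  refine ⟨z, ?_⟩
  have : (X.mpart g : D.G) = b := by
    rw [h]
    exact congrArg Subtype.val (X.mpart_cell ⟨b, hb⟩ _ z _)
  rw [this]
  exact h

theorem act_inversion {u : E (n - 1)} (hu : ‖u‖ = 1) (v : V n) :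
    X.act (D.inversion u) v = (v.1, -v.2.1, refl u v.2.2) := by
  rw [CellData.inversion, act_mul_apply, act_mul_apply, X.act_nilp, X.act_opp]
  exact soInversion_apply hu v

theorem inversion_inv (X : Geom n D) {u : E (n - 1)} (hu : ‖u‖ = 1) :
    (D.inversion u)⁻¹ = D.inversion (-u) :=
  inv_eq_of_mul_eq_one_right (X.inversion_neg u hu)

theorem null_inversion_inv_mul {u : E (n - 1)} (hu : ‖u‖ = 1) (g : D.G) :
    X.null ((D.inversion u)⁻¹ * g)
      = ((X.null g).1, -(X.null g).2.1, refl u (X.null g).2.2) := by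
  have hu' : ‖-u‖ = 1 := by rw [norm_neg, hu]
  rw [null, act_mul_apply, X.inversion_inv hu, X.act_inversion hu', refl_neg]
  rfl

/-- Off the big cell `g` lies in `w P`: the translate `w⁻¹ g` has the coordinate zero. -/
theorem den_inversion_inv_mul {u : E (n - 1)} (hu : ‖u‖ = 1) {g : D.G} (hg : X.den g = 0) :
    0 < X.den ((D.inversion u)⁻¹ * g) ∧ X.pos ((D.inversion u)⁻¹ * g) = 0 := by
  have h1 := X.null_pos g
  have h2 : (X.null g).1 + (X.null g).2.1 = 0 := by rw [den] at hg; linarith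
  have h3 := X.null_Q g
  rw [h2, mul_zero, inner_self_eq_zero] at h3
  constructor
  · rw [den, X.null_inversion_inv_mul hu]; simp only; linarith
  · rw [pos, X.null_inversion_inv_mul hu, h3]; simp [refl]

theorem den_inversion {u : E (n - 1)} (hu : ‖u‖ = 1) : X.den (D.inversion u) = 0 := by
  rw [den, null, X.act_inversion hu]; simp

theorem den_inversion_inv {u : E (n - 1)} (hu : ‖u‖ = 1) : X.den (D.inversion u)⁻¹ = 0 := by
  rw [X.inversion_inv hu, X.den_inversion (by rw [norm_neg, hu])]

theorem inversion_inv_opp {u : E (n - 1)} (hu : ‖u‖ = 1) {x : E (n - 1)} (hx : x ≠ 0) :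
    0 < X.den ((D.inversion u)⁻¹ * D.opp x) ∧
      ‖X.pos ((D.inversion u)⁻¹ * D.opp x)‖ = ‖x‖⁻¹ := by
  have hn : X.null ((D.inversion u)⁻¹ * D.opp x)
      = (1 + inner ℝ x x, -(1 - inner ℝ x x), refl u ((2 : ℝ) • x)) := by
    rw [X.null_inversion_inv_mul hu, null, act_opp_null]
  have hd : X.den ((D.inversion u)⁻¹ * D.opp x) = ‖x‖ ^ 2 := by
    rw [den, hn, ← real_inner_self_eq_norm_sq]; simp only; ring
  have hx' : 0 < ‖x‖ := norm_pos_iff.mpr hx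
  refine ⟨by rw [hd]; positivity, ?_⟩
  rw [pos, hd, hn, norm_smul, norm_refl hu, norm_smul, norm_inv, norm_mul, norm_pow, norm_norm]
  simp only [Real.norm_ofNat]
  field_simp

section Local

/-- For `w = λ u` with `λ > 0` and `|u| = 1`: `n_w n̄_{-w/|w|²} n_w = k(u) a_{-2 log λ}`. -/
theorem nilp_opp_nilp (X : Geom n D) {u : E (n - 1)} (hu : ‖u‖ = 1) {l : ℝ} (hl : 0 < l) :
    D.nilp (l • u) * D.opp (-(l⁻¹ • u)) * D.nilp (l • u)
      = D.inversion u * D.a (-(2 * Real.log l)) := by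
  have e1 : D.nilp (l • u) = D.a (Real.log l) * D.nilp u * D.a (-Real.log l) := by
    rw [X.a_nilp, Real.exp_log hl, mul_assoc, ← X.a_add, add_neg_cancel, X.a_zero, mul_one]
  have e2 : D.opp (-(l⁻¹ • u)) = D.a (Real.log l) * D.opp (-u) * D.a (-Real.log l) := by
    rw [X.a_opp, Real.exp_neg, Real.exp_log hl, mul_assoc, ← X.a_add, add_neg_cancel, X.a_zero,
      mul_one, smul_neg]
  have e3 : D.a (-Real.log l) = (D.a (Real.log l))⁻¹ := (X.a_inv _).symm
  have e4 : D.a (Real.log l) * D.inversion u = D.inversion u * D.a (-Real.log l) := by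
    rw [X.inversion_a u hu, neg_neg]
  have e5 : D.a (-(2 * Real.log l)) = D.a (-Real.log l) * D.a (-Real.log l) := by
    rw [← X.a_add]; congr 1; ring
  rw [e5, ← mul_assoc, ← e4, e1, e2, e3, CellData.inversion]
  group

/-- The factor in `M` of `n_w n̄_ξ`, for `w = λ u`. -/
theorem nilp_mul_opp (X : Geom n D) {u v : E (n - 1)} (hu : ‖u‖ = 1) (hv : ‖v‖ = 1) {l m : ℝ}
    (hl : 0 < l) (hm : 0 < m) {ξ : E (n - 1)} (hξ : l⁻¹ • u + ξ = m • v) :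
    ∃ y z t, D.nilp (l • u) * D.opp ξ
      = D.opp y * (D.inversion u * D.inversion (-v)) * D.a t * D.nilp z := by
  have hv' : ‖-v‖ = 1 := by rw [norm_neg, hv]
  have hW := X.nilp_opp_nilp hu hl
  have hW' := X.nilp_opp_nilp hv' (inv_pos.mpr hm)
  rw [inv_inv, smul_neg, smul_neg, neg_neg] at hW'
  have e1 : D.opp ξ = D.opp (-(l⁻¹ • u)) * D.opp (m • v) := by
    rw [← X.opp_add, ← hξ]; congr 1; abel
  have e2 : D.opp (m • v) = D.nilp (m⁻¹ • v)
      * (D.inversion (-v) * D.a (-(2 * Real.log m⁻¹))) * D.nilp (m⁻¹ • v) := by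
    rw [← hW', ← X.nilp_inv]; group
  have e3 : D.nilp (l • u) * D.opp (-(l⁻¹ • u))
      = D.inversion u * D.a (-(2 * Real.log l)) * D.nilp (-(l • u)) := by
    rw [← hW, ← X.nilp_inv]; group
  set s := -(2 * Real.log l)
  set s' := -(2 * Real.log m⁻¹)
  refine ⟨refl u (Real.exp s • (-(l • u) + m⁻¹ • v)), m⁻¹ • v, -s + s', ?_⟩
  calc D.nilp (l • u) * D.opp ξ
      = D.inversion u * (D.a s * D.nilp (-(l • u) + m⁻¹ • v))
          * (D.inversion (-v) * D.a s') * D.nilp (m⁻¹ • v) := by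
        rw [e1, ← mul_assoc, e3, e2, X.nilp_add]; simp only [mul_assoc]
    _ = (D.inversion u * D.nilp (Real.exp s • (-(l • u) + m⁻¹ • v)))
          * (D.a s * D.inversion (-v)) * D.a s' * D.nilp (m⁻¹ • v) := by
        rw [X.a_nilp]; simp only [mul_assoc]
    _ = _ := by
        have : D.a s * D.inversion (-v) = D.inversion (-v) * D.a (-s) := by
          rw [X.inversion_a _ hv', neg_neg]
        rw [X.inversion_nilp u hu, this, X.a_add]
        simp only [mul_assoc]

/-- The product of an element of `N̄ M A` with an element of the big cell. -/
theorem mul_cell (X : Geom n D) {b : D.G} (hb : b ∈ D.M) (c : D.G) (y x z : E (n - 1)) (t s : ℝ) :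
    ∃ y', D.opp y * b * D.a t * (D.opp x * c * D.a s * D.nilp z)
      = D.opp y' * (b * (D.a t * c * D.a (-t))) * D.a (t + s) * D.nilp z := by
  refine ⟨y + (X.act b (0, 0, Real.exp (-t) • x)).2.2, ?_⟩
  rw [X.opp_add, X.a_add, ← X.a_inv]
  have h1 := X.a_opp t x
  have h2 := X.M_opp b hb (Real.exp (-t) • x)
  calc _ = D.opp y * b * (D.a t * D.opp x) * c * D.a s * D.nilp z := by simp only [mul_assoc]
    _ = D.opp y * (b * D.opp (Real.exp (-t) • x)) * D.a t * c * D.a s * D.nilp z := by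
        rw [h1]; simp only [mul_assoc]
    _ = _ := by rw [h2]; group

/-- The factor in `M` of `γ n̄_x` for `x` near `x₀`: up to a constant factor it is trivial, or a
product of two inversions in unit vectors, of which one is constant and the other one depends
smoothly on `x`. -/
theorem mpart_local {γ : D.G} {x₀ : E (n - 1)} (h : 0 < X.den (γ * D.opp x₀)) :
    ∃ b₀ : D.M, (∀ x, X.mpart (γ * D.opp x) = b₀) ∨
      ∃ u c : E (n - 1), ∃ hu : ‖u‖ = 1, c ≠ 0 ∧ ∀ x (v : E (n - 1)) (hv : ‖v‖ = 1) (m : ℝ),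
        0 < m → c + (x - x₀) = m • v →
          X.mpart (γ * D.opp x)
            = b₀ * ⟨D.inversion u * D.inversion (-v), X.inversion_mem u v hu hv⟩ := by
  obtain ⟨w, hw⟩ := X.eq_cell h
  set y₀ := X.pos (γ * D.opp x₀)
  set b₀ := X.mpart (γ * D.opp x₀)
  set t₀ := Real.log (X.den (γ * D.opp x₀))
  have hx : ∀ x, γ * D.opp x = D.opp y₀ * b₀ * D.a t₀ * (D.nilp w * D.opp (x - x₀)) := by
    intro x
    rw [← mul_assoc, ← hw, mul_assoc, ← X.opp_add, add_sub_cancel]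
  refine ⟨b₀, ?_⟩
  by_cases hw0 : w = 0
  · left
    intro x
    obtain ⟨y', hy'⟩ := X.mul_cell b₀.2 1 y₀ (x - x₀) 0 t₀ 0
    rw [hx, hw0, X.nilp_zero, one_mul]
    simp only [X.nilp_zero, X.a_zero, mul_one, ← X.a_inv, mul_inv_cancel, add_zero] at hy'
    have := X.mpart_cell b₀ y' 0 t₀
    rw [X.nilp_zero, mul_one] at this
    rw [hy', this]
  · right
    have hl : 0 < ‖w‖ := norm_pos_iff.mpr hw0
    have hu : ‖‖w‖⁻¹ • w‖ = 1 := by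
      rw [norm_smul, norm_inv, norm_norm, inv_mul_cancel₀ hl.ne']
    have hwu : w = ‖w‖ • (‖w‖⁻¹ • w) := by rw [smul_smul, mul_inv_cancel₀ hl.ne', one_smul]
    refine ⟨‖w‖⁻¹ • w, ‖w‖⁻¹ • (‖w‖⁻¹ • w), hu, ?_, fun x v hv m hm hc => ?_⟩
    · exact smul_ne_zero (inv_ne_zero hl.ne') (smul_ne_zero (inv_ne_zero hl.ne') hw0)
    · obtain ⟨y, z, t, h1⟩ := X.nilp_mul_opp hu hv hl hm hc
      rw [← hwu] at h1
      obtain ⟨y', hy'⟩ := X.mul_cell b₀.2 (D.inversion (‖w‖⁻¹ • w) * D.inversion (-v)) y₀ y z t₀ t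
      have hM := X.inversion_mem _ v hu hv
      have e : D.a t₀ * (D.inversion (‖w‖⁻¹ • w) * D.inversion (-v)) * D.a (-t₀)
          = D.inversion (‖w‖⁻¹ • w) * D.inversion (-v) := by
        rw [← X.M_a _ hM, mul_assoc, ← X.a_add, add_neg_cancel, X.a_zero, mul_one]
      rw [hx, h1, hy', e]
      exact X.mpart_cell (b₀ * ⟨_, hM⟩) y' z (t₀ + t)

end Local

end Geom

end HypSob

/-! ### Smoothness of representations -/

namespace HypSob

open MeasureTheory

/-- A smooth radial bump function, equal to one on the ball of radius `ε` and to zero outside of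
the ball of radius `2 ε`. -/
def radialBump {d : ℕ} (ε : ℝ) (x : E d) : ℝ :=
  Real.smoothTransition ((4 - ‖ε⁻¹ • x‖ ^ 2) / 3)

theorem contDiff_radialBump {d : ℕ} (ε : ℝ) : ContDiff ℝ ∞ (radialBump ε : E d → ℝ) :=
  Real.smoothTransition.contDiff.comp
    ((contDiff_const.sub ((contDiff_norm_sq ℝ).comp (contDiff_id.const_smul ε⁻¹))).div_const 3)

theorem radialBump_congr {d d' : ℕ} (ε : ℝ) {x : E d} {y : E d'} (h : ‖x‖ = ‖y‖) :
    radialBump ε x = radialBump ε y := by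
  rw [radialBump, radialBump, norm_smul, norm_smul, h]

theorem radialBump_nonneg {d : ℕ} (ε : ℝ) (x : E d) : 0 ≤ radialBump ε x :=
  Real.smoothTransition.nonneg _

theorem radialBump_eq_one {d : ℕ} {ε : ℝ} (hε : 0 < ε) {x : E d} (hx : ‖x‖ ≤ ε) :
    radialBump ε x = 1 := by
  apply Real.smoothTransition.one_of_one_le
  rw [norm_smul, norm_inv, Real.norm_of_nonneg hε.le, ← div_eq_inv_mul]
  have h1 : ‖x‖ / ε ≤ 1 := (div_le_one hε).mpr hx
  have h2 : 0 ≤ ‖x‖ / ε := by positivity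
  nlinarith

theorem radialBump_eq_zero {d : ℕ} {ε : ℝ} (hε : 0 < ε) {x : E d} (hx : 2 * ε ≤ ‖x‖) :
    radialBump ε x = 0 := by
  apply Real.smoothTransition.zero_of_nonpos
  rw [norm_smul, norm_inv, Real.norm_of_nonneg hε.le, ← div_eq_inv_mul]
  have h1 : 2 ≤ ‖x‖ / ε := (le_div_iff₀ hε).mpr hx
  nlinarith

theorem norm_lt_of_radialBump {d : ℕ} {ε : ℝ} (hε : 0 < ε) {x : E d} (hx : radialBump ε x ≠ 0) :
    ‖x‖ < 2 * ε := by
  by_contra h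
  exact hx (radialBump_eq_zero hε (not_lt.mp h))

theorem hasCompactSupport_radialBump {d : ℕ} {ε : ℝ} (hε : 0 < ε) :
    HasCompactSupport (radialBump ε : E d → ℝ) :=
  HasCompactSupport.intro (isCompact_closedBall (0 : E d) (2 * ε)) fun x hx =>
    radialBump_eq_zero hε (by simpa using (not_le.mp (by simpa using hx)).le)

theorem integrable_radialBump {d : ℕ} {ε : ℝ} (hε : 0 < ε) :
    Integrable (radialBump ε : E d → ℝ) :=
  (contDiff_radialBump ε).continuous.integrable_of_hasCompactSupport
    (hasCompactSupport_radialBump hε)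

theorem integral_radialBump_pos {d : ℕ} {ε : ℝ} (hε : 0 < ε) :
    0 < ∫ x : E d, radialBump ε x := by
  refine (contDiff_radialBump ε).continuous.integral_pos_of_hasCompactSupport_nonneg_nonzero
    (hasCompactSupport_radialBump hε) (radialBump_nonneg ε) (x := 0) ?_
  rw [radialBump_eq_one hε (by simpa using hε.le)]
  exact one_ne_zero

section Symmetric

variable {d : ℕ} {A : Type*} [NormedRing A] [NormedAlgebra ℝ A] [CompleteSpace A]

/-- The extension of a function on the unit sphere to a shell, homogeneous of degree zero. -/
def shellExt {A : Type*} [Zero A] (h : E d → A) (w : E d) : A :=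
  open Classical in if 1 / 2 ≤ ‖w‖ ∧ ‖w‖ ≤ 2 then h (‖w‖⁻¹ • w) else 0

theorem norm_inv_smul_self {w : E d} (hw : w ≠ 0) : ‖‖w‖⁻¹ • w‖ = 1 := by
  rw [norm_smul, norm_inv, norm_norm, inv_mul_cancel₀ (norm_ne_zero_iff.mpr hw)]

theorem continuousOn_normalize {A : Type*} [TopologicalSpace A] {h : E d → A}
    (hc : ContinuousOn h (Metric.sphere 0 1)) :
    ContinuousOn (fun w => h (‖w‖⁻¹ • w)) {0}ᶜ := by
  refine hc.comp ?_ ?_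
  · refine ContinuousOn.smul (ContinuousOn.inv₀ continuous_norm.continuousOn ?_) continuousOn_id
    intro w hw
    simpa using hw
  · intro w hw
    simpa using norm_inv_smul_self hw

omit [NormedAlgebra ℝ A] [CompleteSpace A] in
theorem integrable_shellExt {h : E d → A} (hc : ContinuousOn h (Metric.sphere 0 1)) :
    Integrable (shellExt h) := by
  have hs : IsCompact {w : E d | 1 / 2 ≤ ‖w‖ ∧ ‖w‖ ≤ 2} := by
    refine (isCompact_closedBall (0 : E d) 2).of_isClosed_subset ?_ fun w hw => by simpa using hw.2
    exact (isClosed_le continuous_const continuous_norm).inter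
      (isClosed_le continuous_norm continuous_const)
  have h1 : IntegrableOn (fun w => h (‖w‖⁻¹ • w)) {w : E d | 1 / 2 ≤ ‖w‖ ∧ ‖w‖ ≤ 2} := by
    refine ((continuousOn_normalize hc).mono ?_).integrableOn_compact hs
    rintro w ⟨hw, -⟩ h0
    rw [Set.mem_singleton_iff] at h0
    rw [h0, norm_zero] at hw
    norm_num at hw
  refine (h1.integrable_indicator hs.measurableSet).congr (Filter.Eventually.of_forall fun w => ?_)
  simp only [shellExt, Set.indicator, Set.mem_ofPred_eq]

/-- The regularization of a function on the unit sphere by a radial kernel. -/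
def shellAvg (ε : ℝ) (h : E d → A) (u : E d) : A := ∫ t, radialBump ε t • shellExt h (u - t)

omit [CompleteSpace A] in
theorem contDiff_shellAvg {ε : ℝ} (hε : 0 < ε) {h : E d → A}
    (hc : ContinuousOn h (Metric.sphere 0 1)) : ContDiff ℝ ∞ (shellAvg ε h) :=
  (hasCompactSupport_radialBump hε).contDiff_convolution_left (ContinuousLinearMap.lsmul ℝ ℝ)
    (contDiff_radialBump ε) (integrable_shellExt hc).locallyIntegrable

omit [CompleteSpace A] in
theorem integrable_shellAvg {ε : ℝ} (hε : 0 < ε) {h : E d → A}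
    (hc : ContinuousOn h (Metric.sphere 0 1)) (u : E d) :
    Integrable fun t => radialBump ε t • shellExt h (u - t) :=
  ((hasCompactSupport_radialBump hε).convolutionExists_left (ContinuousLinearMap.lsmul ℝ ℝ)
    (contDiff_radialBump ε).continuous (integrable_shellExt hc).locallyIntegrable) u

/-- The map `x ↦ 2 ⟨u, x⟩ u - x`, as a linear isometry. -/
def negRefl (u : E d) (hu : ‖u‖ = 1) : E d ≃ₗᵢ[ℝ] E d where
  toFun x := -refl u x
  invFun x := -refl u x
  map_add' x y := by simp only [refl, inner_add_right]; module
  map_smul' c x := by simp only [refl, inner_smul_right, RingHom.id_apply]; module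
  left_inv x := by
    have h : refl u (-refl u x) = -refl u (refl u x) := by
      simp only [refl, inner_neg_right]; module
    simp only [h, refl_refl hu, neg_neg]
  right_inv x := by
    have h : refl u (-refl u x) = -refl u (refl u x) := by
      simp only [refl, inner_neg_right]; module
    simp only [h, refl_refl hu, neg_neg]
  norm_map' x := by
    change ‖-refl u x‖ = ‖x‖
    rw [norm_neg, norm_refl hu]

theorem negRefl_self {u : E d} (hu : ‖u‖ = 1) : negRefl u hu u = u := by
  change -refl u u = u
  rw [refl, real_inner_self_eq_norm_sq, hu]
  module

omit [NormedAlgebra ℝ A] [CompleteSpace A] in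
theorem shellExt_negRefl {h h' : E d → A} {u : E d} (hu : ‖u‖ = 1)
    (H : ∀ v, ‖v‖ = 1 → h (-refl u v) = h u * h' v * h u) (w : E d) :
    shellExt h (negRefl u hu w) = h u * shellExt h' w * h u := by
  rw [shellExt, shellExt, (negRefl u hu).norm_map]
  split_ifs with hw
  · have hw0 : w ≠ 0 := by
      rintro rfl
      norm_num at hw
    rw [← map_smul]
    exact H _ (norm_inv_smul_self hw0)
  · rw [mul_zero, zero_mul]

omit [CompleteSpace A] in
/-- The regularization inherits the functional equation. -/
theorem shellAvg_eq {ε : ℝ} {h h' : E d → A} {u : E d} (hu : ‖u‖ = 1)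
    (H : ∀ v, ‖v‖ = 1 → h (-refl u v) = h u * h' v * h u) (hε : 0 < ε)
    (hc' : ContinuousOn h' (Metric.sphere 0 1)) :
    shellAvg ε h u = h u * shellAvg ε h' u * h u := by
  have h1 : shellAvg ε h u
      = ∫ t, radialBump ε (negRefl u hu t) • shellExt h (u - negRefl u hu t) :=
    ((negRefl u hu).measurePreserving.integral_comp
      (negRefl u hu).toHomeomorph.measurableEmbedding
      (fun t => radialBump ε t • shellExt h (u - t))).symm
  have h2 : ∀ t, radialBump ε (negRefl u hu t) • shellExt h (u - negRefl u hu t)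
      = h u * (radialBump ε t • shellExt h' (u - t)) * h u := by
    intro t
    nth_rewrite 2 [← negRefl_self hu]
    rw [← map_sub, shellExt_negRefl hu H, radialBump_congr ε ((negRefl u hu).norm_map t),
      mul_smul_comm, smul_mul_assoc]
  rw [h1]
  simp only [h2]
  rw [integral_mul_const_of_integrable, integral_const_mul_of_integrable]
  · rfl
  · exact integrable_shellAvg hε hc' u
  · exact (integrable_shellAvg hε hc' u).const_mul _

/-- If `a h'` is close to one near `u`, then so is the product of `a` with the regularization of
`h'`, up to normalization. -/
theorem norm_mul_shellAvg_sub {ε δ : ℝ} {h' : E d → A} (hε : 0 < ε)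
    (hc' : ContinuousOn h' (Metric.sphere 0 1)) {u : E d} {a : A}
    (hδ : ∀ w, ‖w - u‖ < 2 * ε → ‖a * shellExt h' w - 1‖ ≤ δ) :
    ‖a * shellAvg ε h' u - (∫ x : E d, radialBump ε x) • (1 : A)‖
      ≤ δ * ∫ x : E d, radialBump ε x := by
  have h1 : a * shellAvg ε h' u - (∫ x : E d, radialBump ε x) • (1 : A)
      = ∫ t, radialBump ε t • (a * shellExt h' (u - t) - 1) := by
    rw [shellAvg, ← integral_const_mul_of_integrable (integrable_shellAvg hε hc' u),
      ← integral_smul_const, ← integral_sub ((integrable_shellAvg hε hc' u).const_mul _)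
        ((integrable_radialBump hε).smul_const _)]
    congr 1
    ext t
    rw [smul_sub, mul_smul_comm]
  rw [h1, mul_comm, ← integral_mul_const]
  refine norm_integral_le_of_norm_le ((integrable_radialBump hε).mul_const _)
    (Filter.Eventually.of_forall fun t => ?_)
  rw [norm_smul, Real.norm_of_nonneg (radialBump_nonneg ε t)]
  by_cases ht : radialBump ε t = 0
  · rw [ht, zero_mul, zero_mul]
  · refine mul_le_mul_of_nonneg_left (hδ _ ?_) (radialBump_nonneg ε t)
    have : u - t - u = -t := by abel
    rw [this, norm_neg]
    exact norm_lt_of_radialBump hε ht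

/-- In a Banach algebra there are smooth square roots near one. -/
theorem exists_sqrt (A : Type*) [NormedRing A] [NormedAlgebra ℝ A] [CompleteSpace A] :
    ∃ (g : A → A) (δ : ℝ), 0 < δ ∧ δ < 1 ∧ ∀ x : A, ‖x - 1‖ < δ → g (x * x) = x ∧
      ContDiffAt ℝ ∞ g (x * x) := by
  set f : A → A := fun x => x * x
  have hf : ContDiff ℝ ω f := contDiff_id.mul contDiff_id
  let e : A ≃L[ℝ] A := ContinuousLinearEquiv.smulLeft (Units.mk0 (2 : ℝ) two_ne_zero)
  have hf' : HasFDerivAt f (e : A →L[ℝ] A) 1 := by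
    have := (hasFDerivAt_id (𝕜 := ℝ) (1 : A)).mul' (hasFDerivAt_id (𝕜 := ℝ) (1 : A))
    refine this.congr_fderiv ?_
    ext x
    simp [e, two_smul, Units.smul_def]
  have hn : (ω : WithTop ℕ∞) ≠ 0 := by simp
  set g := hf.contDiffAt.localInverse hf' hn
  have hg : ContDiffAt ℝ ω g (f 1) := hf.contDiffAt.to_localInverse hf' hn
  have h1 : ∀ᶠ x in 𝓝 (1 : A), g (f x) = x :=
    (hf.contDiffAt.hasStrictFDerivAt' hf' hn).eventually_left_inverse
  have h2 : ∀ᶠ x in 𝓝 (1 : A), ContDiffAt ℝ ω g (f x) :=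
    hf.continuous.continuousAt.eventually (hg.eventually (by simp))
  obtain ⟨δ, hδ, h3⟩ := Metric.eventually_nhds_iff.mp (h1.and h2)
  refine ⟨g, min δ (1 / 2), by positivity, by
    exact (min_le_right _ _).trans_lt (by norm_num), fun x hx => ?_⟩
  obtain ⟨h4, h5⟩ := h3 (y := x) (by rw [dist_eq_norm]; exact hx.trans_le (min_le_left _ _))
  exact ⟨h4, h5.of_le le_top⟩

/-- A continuous map from the unit sphere to the units of a Banach algebra which is compatible with
the structures of symmetric spaces is smooth: up to a factor `h⁻¹`, regularization replaces `h` by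
a smooth square. -/
theorem contDiffAt_of_symmetric {h h' : E d → A} (hc : ContinuousOn h (Metric.sphere 0 1))
    (hc' : ContinuousOn h' (Metric.sphere 0 1))
    (hinv : ∀ u, ‖u‖ = 1 → h u * h' u = 1) (hinv' : ∀ u, ‖u‖ = 1 → h' u * h u = 1)
    (H : ∀ u v, ‖u‖ = 1 → ‖v‖ = 1 → h (-refl u v) = h u * h' v * h u) {w₀ : E d}
    (hw₀ : w₀ ≠ 0) : ContDiffAt ℝ ∞ (fun w => h (‖w‖⁻¹ • w)) w₀ := by
  obtain ⟨g, δ, hδ, hδ1, hg⟩ := exists_sqrt A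
  set u₀ := ‖w₀‖⁻¹ • w₀ with hu₀
  have hu₀1 : ‖u₀‖ = 1 := norm_inv_smul_self hw₀
  have hu₀0 : u₀ ≠ 0 := norm_ne_zero_iff.mp (by rw [hu₀1]; exact one_ne_zero)
  -- near `u₀`, the product `h u₀ * h' w` is close to one
  obtain ⟨ε, hε, hε'⟩ : ∃ ε, 0 < ε ∧ ∀ w, ‖w - u₀‖ < 2 * ε →
      ‖h u₀ * shellExt h' w - 1‖ ≤ δ / 2 := by
    have h1 : ContinuousAt (fun w => h u₀ * h' (‖w‖⁻¹ • w)) u₀ :=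
      continuousAt_const.mul
        ((continuousOn_normalize hc').continuousAt (isOpen_compl_singleton.mem_nhds hu₀0))
    have h2 : ∀ᶠ w in 𝓝 u₀, ‖h u₀ * h' (‖w‖⁻¹ • w) - 1‖ < δ / 2 := by
      have := (h1.sub_const 1).norm
      refine this.eventually_lt continuousAt_const ?_
      simp only [hu₀1, inv_one, one_smul, hinv u₀ hu₀1, sub_self, norm_zero]
      positivity
    obtain ⟨r, hr, h3⟩ := Metric.eventually_nhds_iff.mp h2
    refine ⟨min r (1 / 2) / 2, by positivity, fun w hw => ?_⟩
    rw [mul_div_cancel₀ _ (two_ne_zero)] at hw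
    have h4 := h3 (y := w) (by rw [dist_eq_norm]; exact hw.trans_le (min_le_left _ _))
    have h5 := hw.trans_le (min_le_right _ _)
    have h6 : ‖u₀‖ - ‖w‖ ≤ ‖w - u₀‖ := by rw [norm_sub_rev]; exact norm_sub_norm_le _ _
    have h7 : ‖w‖ - ‖u₀‖ ≤ ‖w - u₀‖ := norm_sub_norm_le _ _
    rw [shellExt, if_pos ⟨by linarith, by linarith⟩]
    exact h4.le
  set c := ∫ x : E d, radialBump ε x
  have hcpos : 0 < c := integral_radialBump_pos hε
  set X : E d → A := fun u => c⁻¹ • (h u * shellAvg ε h' u) with hX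
  have hI := contDiff_shellAvg (A := A) hε hc
  have hJ := contDiff_shellAvg (A := A) hε hc'
  have hX1 : ‖X u₀ - 1‖ < δ := by
    have h1 := norm_mul_shellAvg_sub hε hc' hε'
    have h2 : X u₀ - 1 = c⁻¹ • (h u₀ * shellAvg ε h' u₀ - c • 1) := by
      rw [hX, smul_sub, smul_smul, inv_mul_cancel₀ hcpos.ne', one_smul]
    rw [h2, norm_smul, norm_inv, Real.norm_of_nonneg hcpos.le, inv_mul_lt_iff₀ hcpos]
    refine h1.trans_lt ?_
    rw [mul_comm]
    exact mul_lt_mul_of_pos_left (by linarith) hcpos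
  have hX2 : ∀ u, ‖u‖ = 1 → X u * X u = (c⁻¹ * c⁻¹) • (shellAvg ε h u * shellAvg ε h' u) := by
    intro u hu
    rw [shellAvg_eq hu (H u · hu) hε hc', hX, smul_mul_smul_comm]
    simp only [mul_assoc]
  have hXunit : IsUnit (X u₀) := by
    have := isUnit_one_sub_of_norm_lt_one (x := 1 - X u₀)
      (by rw [norm_sub_rev]; exact hX1.trans hδ1)
    rwa [sub_sub_cancel] at this
  have hJunit : IsUnit (shellAvg ε h' u₀) := by
    have : shellAvg ε h' u₀ = h' u₀ * (c • X u₀) := by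
      rw [hX, smul_smul, mul_inv_cancel₀ hcpos.ne', one_smul, ← mul_assoc, hinv' _ hu₀1, one_mul]
    rw [this]
    refine IsUnit.mul ⟨⟨h' u₀, h u₀, hinv' _ hu₀1, hinv _ hu₀1⟩, rfl⟩ ?_
    exact hXunit.smul (Units.mk0 c hcpos.ne')
  -- the smooth function which extends `h` near `u₀`
  set G : E d → A := fun u => c • (g ((c⁻¹ * c⁻¹) • (shellAvg ε h u * shellAvg ε h' u)) *
    Ring.inverse (shellAvg ε h' u)) with hG
  have hnorm : ContDiffAt ℝ ∞ (fun w : E d => ‖w‖⁻¹ • w) w₀ :=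
    ((contDiffAt_norm ℝ hw₀).inv (norm_ne_zero_iff.mpr hw₀)).smul contDiffAt_id
  have hGs : ContDiffAt ℝ ∞ G u₀ := by
    refine ContDiffAt.const_smul c (ContDiffAt.mul ?_ ?_)
    · refine ContDiffAt.comp u₀ (g := g) ?_ (ContDiffAt.const_smul _
        (hI.contDiffAt.mul hJ.contDiffAt))
      rw [← hX2 u₀ hu₀1]
      exact (hg _ hX1).2
    · obtain ⟨j, hj⟩ := hJunit
      refine ContDiffAt.comp u₀ (g := Ring.inverse) ?_ hJ.contDiffAt
      rw [← hj]
      exact contDiffAt_ringInverse ℝ j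
  have e : (fun w => h (‖w‖⁻¹ • w)) =ᶠ[𝓝 w₀] fun w => G (‖w‖⁻¹ • w) := by
    have hcX : ContinuousAt (fun w => X (‖w‖⁻¹ • w)) w₀ := by
      refine continuousAt_const.smul (ContinuousAt.mul ?_ ?_)
      · exact (continuousOn_normalize hc).continuousAt (isOpen_compl_singleton.mem_nhds hw₀)
      · exact ContinuousAt.comp (g := shellAvg ε h') hJ.continuous.continuousAt hnorm.continuousAt
    have e1 : ∀ᶠ w in 𝓝 w₀, ‖X (‖w‖⁻¹ • w) - 1‖ < δ :=
      (hcX.sub_const 1).norm.eventually_lt continuousAt_const hX1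
    have e2 : ∀ᶠ w in 𝓝 w₀, IsUnit (shellAvg ε h' (‖w‖⁻¹ • w)) := by
      have : ContinuousAt (fun w : E d => shellAvg ε h' (‖w‖⁻¹ • w)) w₀ :=
        ContinuousAt.comp (g := shellAvg ε h') hJ.continuous.continuousAt hnorm.continuousAt
      exact this.eventually (Units.isOpen.mem_nhds hJunit)
    filter_upwards [e1, e2, isOpen_compl_singleton.mem_nhds hw₀] with w h1 h2 h3
    have h4 : ‖‖w‖⁻¹ • w‖ = 1 := norm_inv_smul_self h3
    set u := ‖w‖⁻¹ • w
    rw [hG]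
    simp only
    rw [← hX2 u h4, (hg _ h1).1, hX]
    simp only
    rw [smul_mul_assoc, smul_smul, mul_inv_cancel₀ hcpos.ne', one_smul, mul_assoc,
      Ring.mul_inverse_cancel _ h2, mul_one]
  exact (ContDiffAt.comp w₀ (g := G) hGs hnorm).congr_of_eventuallyEq e

end Symmetric

end HypSob

/-! ### Sections supported in the big cell -/

namespace HypSob

/-- The operators of a representation on a finite dimensional space, as bounded operators. -/
def opRep {M W : Type*} [Group M] [NormedAddCommGroup W] [NormedSpace ℂ W] [FiniteDimensional ℂ W]
    (τ : Representation ℂ M W) (b : M) : W →L[ℂ] W := LinearMap.toContinuousLinearMap (τ b)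

section OpRep

variable {M W : Type*} [Group M] [NormedAddCommGroup W] [NormedSpace ℂ W] [FiniteDimensional ℂ W]
    (τ : Representation ℂ M W)

theorem opRep_apply (b : M) (w : W) : opRep τ b w = τ b w := rfl

theorem opRep_mul (b b' : M) : opRep τ (b * b') = opRep τ b * opRep τ b' := by
  ext w
  change τ (b * b') w = τ b (τ b' w)
  rw [map_mul]; rfl

theorem opRep_one : opRep τ (1 : M) = 1 := by
  ext w
  change τ 1 w = w
  rw [map_one]; rfl

theorem opRep_mul_inv (b : M) : opRep τ b * opRep τ b⁻¹ = 1 := by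
  rw [← opRep_mul, mul_inv_cancel, opRep_one]

theorem opRep_inv_mul (b : M) : opRep τ b⁻¹ * opRep τ b = 1 := by
  rw [← opRep_mul, inv_mul_cancel, opRep_one]

/-- The inverse is continuous on the units of a Banach algebra, so that no continuity of the
inverse in the group is required. -/
theorem continuousOn_opRep_inv {Z : Type*} [TopologicalSpace Z] {s : Set Z} {b : Z → M}
    (h : ContinuousOn (fun z => opRep τ (b z)) s) :
    ContinuousOn (fun z => opRep τ (b z)⁻¹) s := by
  intro z hz
  have e : ∀ z, opRep τ (b z)⁻¹ = Ring.inverse (opRep τ (b z)) := fun z =>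
    (Ring.inverse_unit ⟨opRep τ (b z), opRep τ (b z)⁻¹, opRep_mul_inv τ _, opRep_inv_mul τ _⟩).symm
  have := FiniteDimensional.complete ℂ W
  have h1 : ContinuousAt Ring.inverse (opRep τ (b z)) :=
    NormedRing.inverse_continuousAt
      ⟨opRep τ (b z), opRep τ (b z)⁻¹, opRep_mul_inv τ _, opRep_inv_mul τ _⟩
  simp only [e]
  exact ContinuousAt.comp_continuousWithinAt (f := fun z => opRep τ (b z)) h1 (h z hz)

end OpRep

namespace Geom

variable {n : ℕ} {D : CellData (n - 1)} (X : Geom n D)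

open Classical in
/-- The product of two inversions, as an element of `M`. -/
def rot (u v : E (n - 1)) : D.M :=
  if h : ‖u‖ = 1 ∧ ‖v‖ = 1 then
    ⟨D.inversion u * D.inversion (-v), X.inversion_mem u v h.1 h.2⟩ else 1

theorem coe_rot {u v : E (n - 1)} (hu : ‖u‖ = 1) (hv : ‖v‖ = 1) :
    (X.rot u v : D.G) = D.inversion u * D.inversion (-v) := by
  rw [rot, dif_pos ⟨hu, hv⟩]

theorem rot_inv {u v : E (n - 1)} (hu : ‖u‖ = 1) (hv : ‖v‖ = 1) :
    (X.rot u v)⁻¹ = X.rot v u := by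
  apply Subtype.ext
  rw [Subgroup.coe_inv, X.coe_rot hu hv, X.coe_rot hv hu, ← X.inversion_inv hv, mul_inv_rev,
    inv_inv, X.inversion_inv hu]

theorem rot_symm {u v w : E (n - 1)} (hu : ‖u‖ = 1) (hv : ‖v‖ = 1) (hw : ‖w‖ = 1) :
    X.rot (-refl v w) u = X.rot v u * X.rot u w * X.rot v u := by
  apply Subtype.ext
  rw [X.coe_rot (norm_neg_refl hv hw) hu, Subgroup.coe_mul, Subgroup.coe_mul, X.coe_rot hv hu,
    X.coe_rot hu hw, X.inversion_symm v w hv hw, ← X.inversion_inv hu]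
  group

variable {W : Type*} [NormedAddCommGroup W] [NormedSpace ℂ W] [FiniteDimensional ℂ W]
  {τ : Representation ℂ D.M W}

theorem contDiffAt_opRep_rot (hτ : Continuous (opRep τ)) {u w₀ : E (n - 1)} (hu : ‖u‖ = 1)
    (hw₀ : w₀ ≠ 0) : ContDiffAt ℝ ∞ (fun w => opRep τ (X.rot (‖w‖⁻¹ • w) u)) w₀ := by
  have hc : ContinuousOn (fun v => opRep τ (X.rot v u)) (Metric.sphere 0 1) := by
    rw [continuousOn_iff_continuous_domRestrict]
    refine (hτ.comp (X.inversion_cont u hu)).congr fun v => ?_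
    have hv : ‖(v : E (n - 1))‖ = 1 := by simp
    change opRep τ _ = opRep τ _
    congr 1
    apply Subtype.ext
    exact (X.coe_rot hv hu).symm
  have hc' : ContinuousOn (fun v => opRep τ (X.rot u v)) (Metric.sphere 0 1) := by
    refine (continuousOn_opRep_inv τ hc).congr fun v hv => ?_
    have hv : ‖(v : E (n - 1))‖ = 1 := by simpa using hv
    simp only [X.rot_inv hv hu]
  have := FiniteDimensional.complete ℂ W
  refine contDiffAt_of_symmetric (h := fun v => opRep τ (X.rot v u))
    (h' := fun v => opRep τ (X.rot u v)) hc hc' (fun v hv => ?_) (fun v hv => ?_)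
    (fun v w hv hw => ?_) hw₀
  · simp only [← X.rot_inv hv hu, opRep_mul_inv]
  · simp only [← X.rot_inv hv hu, opRep_inv_mul]
  · simp only [X.rot_symm hu hv hw, opRep_mul]

theorem contDiffAt_opRep_mpart (hτ : Continuous (opRep τ)) {γ : D.G} {x₀ : E (n - 1)}
    (h : 0 < X.den (γ * D.opp x₀)) :
    ContDiffAt ℝ ∞ (fun x => opRep τ (X.mpart (γ * D.opp x))⁻¹) x₀ := by
  obtain ⟨b₀, h0 | ⟨u, c, hu, hc, h0⟩⟩ := X.mpart_local h
  · simp only [h0]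
    exact contDiffAt_const
  · have h1 : ContDiffAt ℝ ∞
        (fun x => opRep τ (X.rot (‖c + (x - x₀)‖⁻¹ • (c + (x - x₀))) u)) x₀ := by
      refine ContDiffAt.comp x₀ (g := fun w => opRep τ (X.rot (‖w‖⁻¹ • w) u))
        (X.contDiffAt_opRep_rot hτ hu ?_) ?_
      · rwa [sub_self, add_zero]
      · exact contDiffAt_const.add (contDiffAt_id.sub contDiffAt_const)
    have h2 : ContDiffAt ℝ ∞ (fun x => opRep τ (X.rot (‖c + (x - x₀)‖⁻¹ • (c + (x - x₀))) u)
        * opRep τ b₀⁻¹) x₀ := h1.mul contDiffAt_const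
    refine h2.congr_of_eventuallyEq ?_
    have h3 : ∀ᶠ x in 𝓝 x₀, c + (x - x₀) ≠ 0 := by
      refine ContinuousAt.eventually_ne (g := fun x => c + (x - x₀)) (by fun_prop) ?_
      rwa [sub_self, add_zero]
    filter_upwards [h3] with x hx
    have hv := norm_inv_smul_self hx
    rw [h0 x _ hv ‖c + (x - x₀)‖ (norm_pos_iff.mpr hx) (by
      rw [smul_smul, mul_inv_cancel₀ (norm_ne_zero_iff.mpr hx), one_smul]), mul_inv_rev, opRep_mul,
      ← X.rot_inv hu hv]
    congr 3
    apply Subtype.ext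
    exact (X.coe_rot hu hv).symm

/-! #### The coordinates in the charts -/

theorem null_mul_M (g : D.G) {b : D.G} (hb : b ∈ D.M) : X.null (g * b) = X.null g := by
  rw [null, act_mul_apply, X.act_M_null hb]; rfl

theorem null_mul_a (g : D.G) (t : ℝ) : X.null (g * D.a t) = Real.exp t • X.null g := by
  rw [null, act_mul_apply, act_a_null, map_smul]; rfl

theorem null_mul_nilp (g : D.G) (x : E (n - 1)) : X.null (g * D.nilp x) = X.null g := by
  rw [null, act_mul_apply, act_nilp_null]; rfl

theorem mpart_eq {g : D.G} {b : D.M} {x z : E (n - 1)} {t : ℝ}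
    (h : g = D.opp x * b * D.a t * D.nilp z) : X.mpart g = b := by
  rw [h, X.mpart_cell]

theorem mpart_mul_M {g : D.G} (hg : 0 < X.den g) (b : D.M) :
    X.mpart (g * b) = X.mpart g * b := by
  obtain ⟨z, hz⟩ := X.eq_cell hg
  have h1 := X.M_nilp _ (inv_mem b.2) z
  have h2 : D.nilp z * b = b * D.nilp (X.act (b : D.G)⁻¹ (0, 0, z)).2.2 := by
    rw [← inv_mul_eq_iff_eq_mul, ← mul_assoc, h1, inv_mul_cancel_right]
  refine X.mpart_eq (x := X.pos g) (t := Real.log (X.den g))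
    (z := (X.act (b : D.G)⁻¹ (0, 0, z)).2.2) ?_
  calc g * b = D.opp (X.pos g) * X.mpart g * D.a (Real.log (X.den g)) * (D.nilp z * b) := by
        rw [← mul_assoc, ← hz]
    _ = D.opp (X.pos g) * X.mpart g * (D.a (Real.log (X.den g)) * b)
        * D.nilp (X.act (b : D.G)⁻¹ (0, 0, z)).2.2 := by rw [h2]; simp only [mul_assoc]
    _ = _ := by rw [← X.M_a b b.2, Subgroup.coe_mul]; simp only [mul_assoc]

theorem mpart_mul_a {g : D.G} (hg : 0 < X.den g) (t : ℝ) :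
    X.mpart (g * D.a t) = X.mpart g := by
  obtain ⟨z, hz⟩ := X.eq_cell hg
  have h1 : D.nilp z * D.a t = D.a t * D.nilp (Real.exp (-t) • z) := by
    rw [X.a_nilp, smul_smul, ← Real.exp_add, add_neg_cancel, Real.exp_zero, one_smul]
  refine X.mpart_eq (x := X.pos g) (t := Real.log (X.den g) + t) (z := Real.exp (-t) • z) ?_
  calc g * D.a t = D.opp (X.pos g) * X.mpart g * D.a (Real.log (X.den g))
        * (D.nilp z * D.a t) := by rw [← mul_assoc, ← hz]
    _ = _ := by rw [h1, X.a_add]; simp only [mul_assoc]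

theorem mpart_mul_nilp {g : D.G} (hg : 0 < X.den g) (x : E (n - 1)) :
    X.mpart (g * D.nilp x) = X.mpart g := by
  obtain ⟨z, hz⟩ := X.eq_cell hg
  refine X.mpart_eq (x := X.pos g) (t := Real.log (X.den g)) (z := z + x) ?_
  rw [X.nilp_add, ← mul_assoc, ← hz]

theorem null_mul_opp (γ : D.G) (x : E (n - 1)) : X.null (γ * D.opp x)
    = X.act γ (1 + inner ℝ x x, 1 - inner ℝ x x, (2 : ℝ) • x) := by
  rw [null, act_mul_apply, act_opp_null]

theorem contDiff_null (γ : D.G) : ContDiff ℝ ∞ fun x => X.null (γ * D.opp x) := by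
  have h1 : ContDiff ℝ ∞ fun x : E (n - 1) =>
      ((1 + inner ℝ x x, 1 - inner ℝ x x, (2 : ℝ) • x) : V n) :=
    (contDiff_const.add (contDiff_id.inner ℝ contDiff_id)).prodMk
      ((contDiff_const.sub (contDiff_id.inner ℝ contDiff_id)).prodMk (contDiff_id.const_smul _))
  have h2 := (LinearMap.toContinuousLinearMap (X.act γ : V n →ₗ[ℝ] V n)).contDiff (n := ∞)
  have h3 : (fun x => X.null (γ * D.opp x)) = LinearMap.toContinuousLinearMap
      (X.act γ : V n →ₗ[ℝ] V n) ∘ fun x : E (n - 1) =>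
      ((1 + inner ℝ x x, 1 - inner ℝ x x, (2 : ℝ) • x) : V n) := by
    funext x
    rw [null_mul_opp]; rfl
  rw [h3]
  exact h2.comp h1

theorem contDiff_den (γ : D.G) : ContDiff ℝ ∞ fun x => X.den (γ * D.opp x) :=
  ((X.contDiff_null γ).fst.add (X.contDiff_null γ).snd.fst).div_const 2

/-- The part of the chart at `γ` which belongs to the big cell. -/
def dom (γ : D.G) : Set (E (n - 1)) := {x | 0 < X.den (γ * D.opp x)}

theorem isOpen_dom (γ : D.G) : IsOpen (X.dom γ) :=
  isOpen_lt continuous_const (X.contDiff_den γ).continuous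

theorem contDiffOn_pos (γ : D.G) : ContDiffOn ℝ ∞ (fun x => X.pos (γ * D.opp x)) (X.dom γ) := by
  refine ContDiffOn.smul (ContDiffOn.inv (contDiffOn_const.mul (X.contDiff_den γ).contDiffOn) ?_)
    (X.contDiff_null γ).snd.snd.contDiffOn
  intro x hx
  have : 0 < X.den (γ * D.opp x) := hx
  positivity

theorem inv_mul_opp_pos {γ : D.G} {x : E (n - 1)} (hx : x ∈ X.dom γ) :
    X.pos (γ * D.opp x) ∈ X.dom γ⁻¹ ∧ X.pos (γ⁻¹ * D.opp (X.pos (γ * D.opp x))) = x := by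
  obtain ⟨z, hz⟩ := X.eq_cell hx
  set y := X.pos (γ * D.opp x)
  set b := X.mpart (γ * D.opp x)
  set t := Real.log (X.den (γ * D.opp x))
  have h1 : γ⁻¹ * D.opp y = D.opp x * (D.nilp z)⁻¹ * (D.a t)⁻¹ * (b : D.G)⁻¹ := by
    have : D.opp y = γ * D.opp x * (D.nilp z)⁻¹ * (D.a t)⁻¹ * (b : D.G)⁻¹ := by
      rw [hz]; group
    rw [this]; group
  have h2 : X.null (γ⁻¹ * D.opp y) = Real.exp (-t) • X.null (D.opp x) := by
    rw [h1, X.null_mul_M _ (inv_mem b.2), X.a_inv, null_mul_a, X.nilp_inv, null_mul_nilp]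
  have h3 := X.den_cell (one_mem D.M) x 0 0
  have h4 := X.pos_cell (one_mem D.M) x 0 0
  rw [X.a_zero, X.nilp_zero, mul_one, mul_one, mul_one] at h3 h4
  rw [Real.exp_zero] at h3
  have h5 : X.den (γ⁻¹ * D.opp y) = Real.exp (-t) := by
    have : X.den (γ⁻¹ * D.opp y) = Real.exp (-t) * X.den (D.opp x) := by
      rw [den, h2, den]; simp only [Prod.smul_fst, Prod.smul_snd, smul_eq_mul]; ring
    rw [this, h3, mul_one]
  refine ⟨by rw [dom, Set.mem_ofPred_eq, h5]; positivity, ?_⟩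
  rw [← h4, h4, pos, h5, h2]
  nth_rewrite 2 [← h4]
  rw [pos, h3, Prod.smul_snd, Prod.smul_snd, smul_smul]
  congr 1
  have := (Real.exp_pos (-t)).ne'
  field_simp

/-- The part of the chart at `γ` which belongs to the closed ball of radius `R` in the big cell. -/
def ballDom (γ : D.G) (R : ℝ) : Set (E (n - 1)) :=
  {x | x ∈ X.dom γ ∧ ‖X.pos (γ * D.opp x)‖ ≤ R}

theorem norm_pos_sq {g : D.G} (hg : 0 < X.den g) :
    ‖X.pos g‖ ^ 2 * ((X.null g).1 + (X.null g).2.1) = (X.null g).1 - (X.null g).2.1 := by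
  have h := X.null_Q g
  have hd : (X.null g).1 + (X.null g).2.1 = 2 * X.den g := by rw [den]; ring
  rw [hd, real_inner_self_eq_norm_sq] at h
  rw [pos, norm_smul, norm_inv, Real.norm_of_nonneg (by positivity), hd, mul_pow, h]
  field_simp

theorem isClosed_ballDom (γ : D.G) {R : ℝ} (hR : 0 ≤ R) : IsClosed (X.ballDom γ R) := by
  have h1 : X.ballDom γ R = {x | (X.null (γ * D.opp x)).1 - (X.null (γ * D.opp x)).2.1
      ≤ R ^ 2 * ((X.null (γ * D.opp x)).1 + (X.null (γ * D.opp x)).2.1)} := by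
    ext x
    have hd : (X.null (γ * D.opp x)).1 + (X.null (γ * D.opp x)).2.1
      = 2 * X.den (γ * D.opp x) := by rw [den]; ring
    constructor
    · rintro ⟨h1, h2⟩
      have h1 : 0 < X.den (γ * D.opp x) := h1
      rw [Set.mem_ofPred_eq, ← X.norm_pos_sq h1, hd]
      have : ‖X.pos (γ * D.opp x)‖ ^ 2 ≤ R ^ 2 := pow_le_pow_left₀ (norm_nonneg _) h2 2
      exact mul_le_mul_of_nonneg_right this (by positivity)
    · intro h
      rw [Set.mem_ofPred_eq] at h
      have h3 : 0 < X.den (γ * D.opp x) := by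
        refine lt_of_le_of_ne (X.den_nonneg _) fun h0 => ?_
        rw [hd, ← h0] at h
        have := X.null_pos (γ * D.opp x)
        rw [← h0] at hd
        linarith
      refine ⟨h3, ?_⟩
      rw [← X.norm_pos_sq h3, hd] at h
      exact pow_le_pow_iff_left₀ (norm_nonneg _) hR two_ne_zero |>.mp
        (le_of_mul_le_mul_right h (by positivity))
  rw [h1]
  have h2 := (X.contDiff_null γ).continuous
  exact isClosed_le (h2.fst.sub h2.snd.fst) (continuous_const.mul (h2.fst.add h2.snd.fst))

/-! #### The sections -/

open Classical in
/-- The function on `G` which extends by zero the section over the big cell with the given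
expression in the chart `x ↦ n̄_x P`. -/
def cellFun (τ : Representation ℂ D.M W) (μ : ℂ) (u : E (n - 1) → W) (g : D.G) : W :=
  if 0 < X.den g then
    Complex.exp ((μ - D.rho) * Real.log (X.den g)) • opRep τ (X.mpart g)⁻¹ (u (X.pos g))
  else 0

theorem cellFun_mem (τ : Representation ℂ D.M W) (μ : ℂ) (u : E (n - 1) → W) :
    X.cellFun τ μ u ∈ D.Sec τ μ := by
  refine ⟨fun g b => ?_, fun g t => ?_, fun g x => ?_⟩
  · have hd : X.den (g * b) = X.den g := by rw [den, X.null_mul_M _ b.2, den]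
    have hp : X.pos (g * b) = X.pos g := by rw [pos, hd, X.null_mul_M _ b.2, pos]
    rw [cellFun, cellFun, hd, hp]
    split_ifs with h
    · rw [X.mpart_mul_M h, mul_inv_rev, opRep_mul, map_smul]
      rfl
    · rw [map_zero]
  · have hd : X.den (g * D.a t) = Real.exp t * X.den g := by
      rw [den, X.null_mul_a, den]
      simp only [Prod.smul_fst, Prod.smul_snd, smul_eq_mul]; ring
    have hp : X.pos (g * D.a t) = X.pos g := by
      have := (Real.exp_pos t).ne'
      rw [pos, hd, X.null_mul_a, pos, Prod.smul_snd, Prod.smul_snd, smul_smul]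
      congr 1
      field_simp
    rw [cellFun, cellFun, hp]
    by_cases h : 0 < X.den g
    · rw [if_pos h, if_pos (by rw [hd]; positivity), X.mpart_mul_a h, hd,
        Real.log_mul (Real.exp_pos t).ne' h.ne', Real.log_exp, smul_smul, ← Complex.exp_add]
      push_cast
      ring_nf
    · rw [if_neg h, if_neg (by
        rw [hd]; intro h'; exact h (pos_of_mul_pos_right h' (Real.exp_pos t).le)), smul_zero]
  · have hd : X.den (g * D.nilp x) = X.den g := by rw [den, X.null_mul_nilp, den]
    have hp : X.pos (g * D.nilp x) = X.pos g := by rw [pos, hd, X.null_mul_nilp, pos]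
    rw [cellFun, cellFun, hd, hp]
    split_ifs with h
    · rw [X.mpart_mul_nilp h]
    · rfl

/-- The transition function of the bundle between the charts at `γ` and at `1`. -/
def trans (τ : Representation ℂ D.M W) (μ : ℂ) (γ : D.G) (x : E (n - 1)) : W →L[ℂ] W :=
  Complex.exp ((μ - D.rho) * Real.log (X.den (γ * D.opp x))) •
    opRep τ (X.mpart (γ * D.opp x))⁻¹

theorem chart_cellFun (τ : Representation ℂ D.M W) (μ : ℂ) (u : E (n - 1) → W) {γ : D.G}
    {x : E (n - 1)} (hx : x ∈ X.dom γ) : D.chart (X.cellFun τ μ u) γ x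
      = X.trans τ μ γ x (u (X.pos (γ * D.opp x))) := by
  have hx : 0 < X.den (γ * D.opp x) := hx
  rw [CellData.chart, cellFun, if_pos hx]
  rfl

theorem chart_cellFun_eq_zero (τ : Representation ℂ D.M W) (μ : ℂ) {u : E (n - 1) → W} {R : ℝ}
    (hu : ∀ y, R < ‖y‖ → u y = 0) {γ : D.G} {x : E (n - 1)} (hx : x ∉ X.ballDom γ R) :
    D.chart (X.cellFun τ μ u) γ x = 0 := by
  rw [CellData.chart, cellFun]
  split_ifs with h
  · rw [hu _ (not_le.mp fun h' => hx ⟨h, h'⟩), map_zero, smul_zero]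
  · rfl

theorem contDiffOn_trans (hτ : Continuous (opRep τ)) (μ : ℂ) (γ : D.G) :
    ContDiffOn ℝ ∞ (X.trans τ μ γ) (X.dom γ) := by
  intro x hx
  have h1 : ContDiffAt ℝ ∞ (fun x => Complex.exp
      ((μ - D.rho) * Real.log (X.den (γ * D.opp x)))) x := by
    refine ContDiffAt.cexp (contDiffAt_const.mul ?_)
    exact Complex.ofRealCLM.contDiff.contDiffAt.comp x
      ((X.contDiff_den γ).contDiffAt.log (ne_of_gt hx))
  have h2 := h1.smul (X.contDiffAt_opRep_mpart hτ hx)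
  exact h2.contDiffWithinAt

/-- The extension by zero is smooth in every chart, since the part of the chart which belongs to a
closed ball in the big cell is closed. -/
theorem contDiff_chart_cellFun (hτ : Continuous (opRep τ)) (μ : ℂ) {u : E (n - 1) → W}
    (hu : ContDiff ℝ ∞ u) {R : ℝ} (hR : 0 ≤ R) (huR : ∀ y, R < ‖y‖ → u y = 0) (γ : D.G) :
    ContDiff ℝ ∞ (D.chart (X.cellFun τ μ u) γ) := by
  rw [contDiff_iff_contDiffAt]
  intro x
  by_cases hx : x ∈ X.dom γ
  · have h1 : ContDiffAt ℝ ∞ (fun x => X.trans τ μ γ x (u (X.pos (γ * D.opp x)))) x := by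
      have hn := (X.isOpen_dom γ).mem_nhds hx
      have h2 := (X.contDiffOn_trans hτ μ γ).contDiffAt hn
      have h3 := hu.contDiffAt.comp x ((X.contDiffOn_pos γ).contDiffAt hn)
      have h4 := ContDiffAt.clm_apply
        (((ContinuousLinearMap.restrictScalarsL ℂ W W ℝ ℝ).contDiff.contDiffAt).comp x h2) h3
      exact h4
    refine h1.congr_of_eventuallyEq ?_
    filter_upwards [(X.isOpen_dom γ).mem_nhds hx] with y hy
    exact X.chart_cellFun τ μ u hy
  · have h1 : x ∉ X.ballDom γ R := fun h => hx h.1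
    have h2 : D.chart (X.cellFun τ μ u) γ =ᶠ[𝓝 x] fun _ => 0 := by
      filter_upwards [(X.isClosed_ballDom γ hR).isOpen_compl.mem_nhds h1] with y hy
      exact X.chart_cellFun_eq_zero τ μ huR hy
    exact contDiffAt_const.congr_of_eventuallyEq h2

end Geom

end HypSob

/-! ### Partial derivatives and weak derivatives -/

namespace HypSob

open MeasureTheory

section Partial

variable {d : ℕ} {W : Type*} [NormedAddCommGroup W] [NormedSpace ℝ W]

/-- The partial derivative `∂_i f`. -/
def pd (i : Fin d) (f : E d → W) (x : E d) : W := fderiv ℝ f x (EuclideanSpace.single i 1)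

/-- The iterated partial derivative `∂_{i_1} ⋯ ∂_{i_j} f`, for a list `[i_1, …, i_j]`. -/
def pdl : List (Fin d) → (E d → W) → E d → W
  | [], f => f
  | i :: a, f => pd i (pdl a f)

theorem contDiff_pd (i : Fin d) {f : E d → W} (hf : ContDiff ℝ ∞ f) : ContDiff ℝ ∞ (pd i f) :=
  (hf.fderiv_right (m := ∞) (by simp)).clm_apply contDiff_const

theorem contDiff_pdl (a : List (Fin d)) {f : E d → W} (hf : ContDiff ℝ ∞ f) :
    ContDiff ℝ ∞ (pdl a f) := by
  induction a with
  | nil => exact hf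
  | cons i a ih => exact contDiff_pd i ih

theorem tsupport_pd (i : Fin d) (f : E d → W) : tsupport (pd i f) ⊆ tsupport f := by
  refine (closure_mono ?_).trans (tsupport_fderiv_subset (f := f) ℝ)
  intro x hx h
  apply hx
  rw [pd, h]
  rfl

theorem tsupport_pdl (a : List (Fin d)) (f : E d → W) : tsupport (pdl a f) ⊆ tsupport f := by
  induction a with
  | nil => exact subset_rfl
  | cons i a ih => exact (tsupport_pd i _).trans ih

theorem hasCompactSupport_pdl (a : List (Fin d)) {f : E d → W} (hf : HasCompactSupport f) :
    HasCompactSupport (pdl a f) := hf.of_isClosed_subset (isClosed_tsupport _) (tsupport_pdl a f)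

theorem pd_add (i : Fin d) {f g : E d → W} (hf : ContDiff ℝ ∞ f) (hg : ContDiff ℝ ∞ g) :
    pd i (fun x => f x + g x) = fun x => pd i f x + pd i g x := by
  funext x
  rw [pd, fderiv_fun_add (hf.differentiable (by simp) x) (hg.differentiable (by simp) x)]
  rfl

theorem pdl_add (a : List (Fin d)) {f g : E d → W} (hf : ContDiff ℝ ∞ f) (hg : ContDiff ℝ ∞ g) :
    pdl a (fun x => f x + g x) = fun x => pdl a f x + pdl a g x := by
  induction a with
  | nil => rfl
  | cons i a ih => rw [pdl, ih, pd_add i (contDiff_pdl a hf) (contDiff_pdl a hg)]; rfl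

theorem pd_const_smul (i : Fin d) (c : ℝ) (f : E d → W) :
    pd i (fun x => c • f x) = fun x => c • pd i f x := by
  funext x
  change fderiv ℝ (c • f) x _ = _
  rw [fderiv_const_smul_field]
  rfl

theorem pdl_const_smul (a : List (Fin d)) (c : ℝ) (f : E d → W) :
    pdl a (fun x => c • f x) = fun x => c • pdl a f x := by
  induction a with
  | nil => rfl
  | cons i a ih => rw [pdl, ih, pd_const_smul]; rfl

theorem pdl_sub (a : List (Fin d)) {f g : E d → W} (hf : ContDiff ℝ ∞ f) (hg : ContDiff ℝ ∞ g) :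
    pdl a (fun x => f x - g x) = fun x => pdl a f x - pdl a g x := by
  have h1 : (fun x => f x - g x) = fun x => f x + (-1 : ℝ) • g x := by
    funext x; rw [neg_one_smul, sub_eq_add_neg]
  rw [h1, pdl_add a hf (hg.const_smul _), pdl_const_smul]
  funext x
  simp only
  rw [neg_one_smul, sub_eq_add_neg]

theorem pd_comm (i j : Fin d) {f : E d → W} (hf : ContDiff ℝ ∞ f) :
    pd i (pd j f) = pd j (pd i f) := by
  have h1 : ∀ i j x, pd i (pd j f) x = fderiv ℝ (fderiv ℝ f) x (EuclideanSpace.single i 1)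
      (EuclideanSpace.single j 1) := by
    intro i j x
    have h2 : DifferentiableAt ℝ (fderiv ℝ f) x :=
      (hf.fderiv_right (m := ∞) (by simp)).differentiable (by simp) x
    change fderiv ℝ (fun y => fderiv ℝ f y (EuclideanSpace.single j 1)) x _ = _
    rw [fderiv_clm_apply h2 (differentiableAt_const _)]
    simp
  funext x
  rw [h1, h1]
  exact (hf.contDiffAt.isSymmSndFDerivAt (by
    rw [minSmoothness_of_isRCLikeNormedField]
    exact WithTop.coe_le_coe.mpr (le_top : (2 : ℕ∞) ≤ ⊤))).eq _ _

theorem pdl_pd (a : List (Fin d)) (i : Fin d) {f : E d → W} (hf : ContDiff ℝ ∞ f) :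
    pdl a (pd i f) = pd i (pdl a f) := by
  induction a with
  | nil => rfl
  | cons j a ih => rw [pdl, ih, pd_comm j i (contDiff_pdl a hf)]; rfl

theorem iteratedFDeriv_single {j : ℕ} (a : Fin j → Fin d) {f : E d → W} (hf : ContDiff ℝ ∞ f)
    (x : E d) : iteratedFDeriv ℝ j f x (fun i => EuclideanSpace.single (a i) 1)
      = pdl (List.ofFn a) f x := by
  induction j generalizing x with
  | zero => simp [pdl]
  | succ j ih =>
    rw [iteratedFDeriv_succ_apply_left, List.ofFn_succ, pdl, pd]
    have h1 : DifferentiableAt ℝ (iteratedFDeriv ℝ j f) x :=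
      hf.differentiable_iteratedFDeriv (by exact_mod_cast WithTop.coe_lt_top _) x
    have h2 : pdl (List.ofFn fun i : Fin j => a i.succ) f
        = fun y => iteratedFDeriv ℝ j f y (fun i => EuclideanSpace.single (a i.succ) 1) := by
      funext y
      exact (ih _ y).symm
    rw [h2, fderiv_continuousMultilinear_apply_const_apply h1]
    rfl

theorem norm_pdl_le (a : List (Fin d)) {f : E d → W} (hf : ContDiff ℝ ∞ f) (x : E d) :
    ‖pdl a f x‖ ≤ ‖iteratedFDeriv ℝ a.length f x‖ := by
  have h := iteratedFDeriv_single a.get hf x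
  rw [List.ofFn_get] at h
  rw [← h]
  refine (ContinuousMultilinearMap.le_opNorm _ _).trans_eq ?_
  simp

theorem norm_iteratedFDeriv_le_sum (j : ℕ) {f : E d → W} (hf : ContDiff ℝ ∞ f) (x : E d) :
    ‖iteratedFDeriv ℝ j f x‖ ≤ ∑ a : Fin j → Fin d, ‖pdl (List.ofFn a) f x‖ := by
  refine ContinuousMultilinearMap.opNorm_le_bound (by positivity) fun m => ?_
  have h1 : m = fun i => ∑ c : Fin d, (m i c) • EuclideanSpace.single c (1 : ℝ) := by
    funext i
    ext c
    simp [Finset.sum_apply, Pi.single_apply]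
  nth_rewrite 1 [h1]
  rw [ContinuousMultilinearMap.map_sum, Finset.sum_mul]
  refine norm_sum_le_of_le _ fun a _ => ?_
  rw [ContinuousMultilinearMap.map_smul_univ, iteratedFDeriv_single a hf, norm_smul, mul_comm]
  refine mul_le_mul_of_nonneg_left ?_ (norm_nonneg _)
  rw [norm_prod]
  exact Finset.prod_le_prod (fun _ _ => norm_nonneg _) fun i _ => PiLp.norm_apply_le (m i) (a i)

theorem integrable_smul_of_tsupport {Ω : Set (E d)} {η : E d → ℝ} (hη : Continuous η)
    (hc : HasCompactSupport η) (hs : tsupport η ⊆ Ω) {u : E d → W}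
    (hu : LocallyIntegrableOn u Ω) : Integrable fun x => η x • u x := by
  have h1 : IntegrableOn u (tsupport η) := hu.integrableOn_compact_subset hs hc
  have h2 : IntegrableOn (fun x => η x • u x) (tsupport η) :=
    h1.continuousOn_smul hη.continuousOn hc
  rwa [integrableOn_iff_integrable_of_support_subset] at h2
  intro x hx
  exact subset_tsupport _ fun h0 => hx (by simp only [h0, zero_smul])

theorem integral_pd_smul (i : Fin d) {η : E d → ℝ} (hη : ContDiff ℝ ∞ η)
    (hc : HasCompactSupport η) {u : E d → W} (hu : ContDiff ℝ ∞ u) :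
    ∫ x, pd i η x • u x = - ∫ x, η x • pd i u x := by
  have h1 : ∀ {f : E d → ℝ} {g : E d → W}, ContDiff ℝ ∞ f → ContDiff ℝ ∞ g → HasCompactSupport f →
      Integrable fun x => f x • g x := fun hf hg hfc =>
    (hf.continuous.smul hg.continuous).integrable_of_hasCompactSupport hfc.smul_right
  have h2 := integral_smul_fderiv_eq_neg_fderiv_smul_of_integrable (μ := volume) (f := η) (g := u)
    (v := EuclideanSpace.single i 1)
    (h1 (contDiff_pd i hη) hu (hasCompactSupport_pdl [i] hc)) (h1 hη (contDiff_pd i hu) hc)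
    (h1 hη hu hc) (fun x _ => hη.differentiable (by simp) x)
    (fun x _ => hu.differentiable (by simp) x)
  change ∫ x, pd i η x • u x = - ∫ x, η x • fderiv ℝ u x _
  rw [h2, neg_neg]
  rfl

theorem integral_pdl_smul (a : List (Fin d)) {η : E d → ℝ} (hη : ContDiff ℝ ∞ η)
    (hc : HasCompactSupport η) {u : E d → W} (hu : ContDiff ℝ ∞ u) :
    ∫ x, pdl a η x • u x = (-1 : ℝ) ^ a.length • ∫ x, η x • pdl a u x := by
  induction a generalizing u with
  | nil => simp [pdl]
  | cons i a ih =>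
    rw [pdl, integral_pd_smul i (contDiff_pdl a hη) (hasCompactSupport_pdl a hc) hu,
      ih (contDiff_pd i hu), pdl_pd a i hu, List.length_cons, pow_succ, mul_neg_one, neg_smul]
    rfl

/-- Weak derivatives in terms of lists of indices. -/
def WeakPD (Ω : Set (E d)) (a : List (Fin d)) (u v : E d → W) : Prop :=
  LocallyIntegrableOn u Ω ∧ LocallyIntegrableOn v Ω ∧
    ∀ η : E d → ℝ, ContDiff ℝ ∞ η → HasCompactSupport η → tsupport η ⊆ Ω →
      ∫ x, pdl a η x • u x = (-1 : ℝ) ^ a.length • ∫ x, η x • v x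

theorem weakPD_pdl (Ω : Set (E d)) (a : List (Fin d)) {u : E d → W} (hu : ContDiff ℝ ∞ u) :
    WeakPD Ω a u (pdl a u) :=
  ⟨hu.continuous.locallyIntegrable.locallyIntegrableOn _,
    (contDiff_pdl a hu).continuous.locallyIntegrable.locallyIntegrableOn _,
    fun _ hη hc _ => integral_pdl_smul a hη hc hu⟩

theorem isWeakDeriv_iff {W : Type*} [NormedAddCommGroup W] [NormedSpace ℂ W] {Ω : Set (E d)}
    {j : ℕ} {a : Fin j → Fin d} {u v : E d → W} :
    IsWeakDeriv Ω a u v ↔ WeakPD Ω (List.ofFn a) u v := by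
  rw [IsWeakDeriv, WeakPD, List.length_ofFn]
  refine and_congr_right fun _ => and_congr_right fun _ => forall_congr' fun η =>
    forall_congr' fun hη => ?_
  simp only [iteratedFDeriv_single a hη]

/-- The Leibniz rule in the form which moves a function out of a derivative. -/
theorem exists_leibniz (a : List (Fin d)) {χ : E d → ℝ} (hχ : ContDiff ℝ ∞ χ) :
    ∃ s : List (List (Fin d) × (E d → ℝ)),
      (∀ p ∈ s, p.1.length ≤ a.length ∧ ContDiff ℝ ∞ p.2 ∧ tsupport p.2 ⊆ tsupport χ) ∧
      ∀ η : E d → ℝ, ContDiff ℝ ∞ η → ∀ x,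
        χ x * pdl a η x = (s.map fun p => pdl p.1 (fun y => p.2 y * η y) x).sum := by
  induction a generalizing χ with
  | nil => exact ⟨[([], χ)], by simp [hχ], fun η _ x => by simp [pdl]⟩
  | cons i a ih =>
    obtain ⟨s, hs1, hs2⟩ := ih hχ
    obtain ⟨s', hs1', hs2'⟩ := ih (contDiff_pd i hχ)
    refine ⟨s.map (fun p => (i :: p.1, p.2)) ++ s'.map (fun p => (p.1, fun x => -p.2 x)),
      ?_, fun η hη x => ?_⟩
    · intro p hp
      rw [List.mem_append, List.mem_map, List.mem_map] at hp
      rcases hp with ⟨p, hp, rfl⟩ | ⟨p, hp, rfl⟩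
      · obtain ⟨h1, h2, h3⟩ := hs1 p hp
        exact ⟨by simpa using h1, h2, h3⟩
      · obtain ⟨h1, h2, h3⟩ := hs1' p hp
        refine ⟨by simpa using h1.trans (Nat.le_succ _), h2.neg, ?_⟩
        have : tsupport (fun x => -p.2 x) = tsupport p.2 := by
          rw [tsupport, tsupport, Function.support_fun_neg]
        simp only [this]
        exact h3.trans (tsupport_pd i χ)
    · have e1 : pd i (fun x => χ x * pdl a η x) x
          = pd i χ x * pdl a η x + χ x * pd i (pdl a η) x := by
        rw [pd, fderiv_fun_mul (hχ.differentiable (by simp) x)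
          ((contDiff_pdl a hη).differentiable (by simp) x)]
        simp only [add_apply, smul_apply, smul_eq_mul, pd]
        ring
      have e2 : ∀ s : List (List (Fin d) × (E d → ℝ)), (∀ p ∈ s, ContDiff ℝ ∞ p.2) →
          (pd i (fun x => (s.map fun p => pdl p.1 (fun y => p.2 y * η y) x).sum)
            = fun x => (s.map fun p => pd i (pdl p.1 (fun y => p.2 y * η y)) x).sum) ∧
          ContDiff ℝ ∞ (fun x => (s.map fun p => pdl p.1 (fun y => p.2 y * η y) x).sum) := by
        intro s
        induction s with
        | nil =>
          intro _
          refine ⟨?_, contDiff_const⟩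
          funext x
          simp [pd]
        | cons p s ihs =>
          intro hp
          obtain ⟨h1, h2⟩ := ihs fun p hp' => hp p (List.mem_cons_of_mem _ hp')
          have h3 : ContDiff ℝ ∞ (pdl p.1 (fun y => p.2 y * η y)) :=
            contDiff_pdl _ ((hp p List.mem_cons_self).mul hη)
          simp only [List.map_cons, List.sum_cons]
          exact ⟨by rw [pd_add i h3 h2, h1], h3.add h2⟩
      have e3 : (fun x => χ x * pdl a η x)
          = fun x => (s.map fun p => pdl p.1 (fun y => p.2 y * η y) x).sum :=
        funext fun x => hs2 η hη x
      rw [e3, (e2 s fun p hp => (hs1 p hp).2.1).1, hs2' η hη] at e1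
      rw [pdl, ← sub_eq_iff_eq_add'.mpr e1, List.map_append, List.sum_append, List.map_map,
        List.map_map, sub_eq_add_neg]
      congr 1
      rw [← neg_one_mul, ← List.sum_map_mul_left]
      congr 1
      refine List.map_congr_left fun p _ => ?_
      have : (fun y => -p.2 y * η y) = fun y => (-1 : ℝ) • (p.2 y * η y) := by
        funext y; simp
      simp only [Function.comp, this]
      rw [pdl_const_smul]
      rfl

end Partial

end HypSob

/-! ### Convolutions and `L^q` estimates -/

namespace HypSob

open MeasureTheory

/-- Jensen's inequality for a weight `f`. -/
theorem rpow_lintegral_mul_le {β : Type*} [MeasurableSpace β] {ν : Measure β} {q : ℝ} (hq : 1 < q)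
    {f g : β → ℝ≥0∞} (hf : Measurable f) (hg : AEMeasurable g ν) :
    (∫⁻ y, f y * g y ∂ν) ^ q ≤ (∫⁻ y, f y ∂ν) ^ (q - 1) * ∫⁻ y, f y * g y ^ q ∂ν := by
  have hc : (q.conjExponent).HolderConjugate q := (Real.HolderConjugate.conjExponent hq).symm
  have hq0 : 0 < q := by linarith
  have hp0 : 0 < q.conjExponent := hc.pos
  have h1 := ENNReal.lintegral_mul_le_Lp_mul_Lq ν hc
    (f := fun y => f y ^ (1 / q.conjExponent)) (g := fun y => f y ^ (1 / q) * g y)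
    (hf.pow_const _).aemeasurable ((hf.pow_const _).aemeasurable.mul hg)
  have h2 : ∀ y, f y ^ (1 / q.conjExponent) * (f y ^ (1 / q) * g y) = f y * g y := by
    intro y
    rw [← mul_assoc, ← ENNReal.rpow_add_of_nonneg _ _ (by positivity) (by positivity)]
    have : 1 / q.conjExponent + 1 / q = 1 := by
      rw [one_div, one_div]; exact hc.inv_add_inv_eq_one
    rw [this, ENNReal.rpow_one]
  have h3 : ∀ y, (f y ^ (1 / q.conjExponent)) ^ q.conjExponent = f y := fun y => by
    rw [← ENNReal.rpow_mul, one_div_mul_cancel hp0.ne', ENNReal.rpow_one]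
  have h4 : ∀ y, (f y ^ (1 / q) * g y) ^ q = f y * g y ^ q := fun y => by
    rw [ENNReal.mul_rpow_of_nonneg _ _ hq0.le, ← ENNReal.rpow_mul, one_div_mul_cancel hq0.ne',
      ENNReal.rpow_one]
  simp only [Pi.mul_apply, h2, h3, h4] at h1
  have h5 := ENNReal.rpow_le_rpow h1 hq0.le
  rw [ENNReal.mul_rpow_of_nonneg _ _ hq0.le, ← ENNReal.rpow_mul, ← ENNReal.rpow_mul,
    one_div_mul_cancel hq0.ne', ENNReal.rpow_one] at h5
  have h6 : 1 / q.conjExponent * q = q - 1 := by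
    have := hc.inv_add_inv_eq_one
    have h7 : q.conjExponent⁻¹ = 1 - q⁻¹ := by linarith
    rw [one_div, h7]
    field_simp
  rwa [h6] at h5

/-- Minkowski's integral inequality, for a weight `f` and a family of functions with bounded
norms. -/
theorem eLpNorm_le_of_le_lintegral {α β W W' : Type*} [MeasurableSpace α] [MeasurableSpace β]
    {μ : Measure α} {ν : Measure β} [SFinite μ] [SFinite ν] [NormedAddCommGroup W]
    [NormedAddCommGroup W'] {q : ℝ} (hq : 1 < q) {f : β → ℝ≥0∞} (hf : Measurable f)
    {F : α → β → W'} (hF : AEStronglyMeasurable (Function.uncurry F) (μ.prod ν)) {H : α → W}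
    (hH : ∀ x, ‖H x‖ₑ ≤ ∫⁻ y, f y * ‖F x y‖ₑ ∂ν) {C : ℝ≥0∞}
    (hC : ∀ y, f y ≠ 0 → eLpNorm (fun x => F x y) (ENNReal.ofReal q) μ ≤ C) :
    eLpNorm H (ENNReal.ofReal q) μ ≤ (∫⁻ y, f y ∂ν) * C := by
  have hq0 : 0 < q := by linarith
  have hQ : (ENNReal.ofReal q) ≠ 0 := by simpa using hq0
  have key : ∫⁻ x, ‖H x‖ₑ ^ q ∂μ ≤ ((∫⁻ y, f y ∂ν) * C) ^ q := by
    have hFm : AEMeasurable (Function.uncurry fun x y => ‖F x y‖ₑ) (μ.prod ν) := hF.enorm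
    calc ∫⁻ x, ‖H x‖ₑ ^ q ∂μ
        ≤ ∫⁻ x, (∫⁻ y, f y ∂ν) ^ (q - 1) * ∫⁻ y, f y * ‖F x y‖ₑ ^ q ∂ν ∂μ := by
          have h1 : ∀ᵐ x ∂μ, AEMeasurable (fun y => ‖F x y‖ₑ) ν :=
            hF.prodMk_left.mono fun x hx => hx.enorm
          refine lintegral_mono_ae (h1.mono fun x hx => ?_)
          exact (ENNReal.rpow_le_rpow (hH x) hq0.le).trans (rpow_lintegral_mul_le hq hf hx)
      _ = (∫⁻ y, f y ∂ν) ^ (q - 1) * ∫⁻ y, ∫⁻ x, f y * ‖F x y‖ₑ ^ q ∂μ ∂ν := by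
          have h2 : AEMeasurable (Function.uncurry fun x y => f y * ‖F x y‖ₑ ^ q) (μ.prod ν) :=
            (hf.comp measurable_snd).aemeasurable.mul (hFm.pow_const q)
          have h3 : AEMeasurable (fun x => ∫⁻ y, f y * ‖F x y‖ₑ ^ q ∂ν) μ :=
            h2.lintegral_prod_right'
          rw [lintegral_const_mul'' _ h3, lintegral_lintegral_swap h2]
      _ ≤ (∫⁻ y, f y ∂ν) ^ (q - 1) * ∫⁻ y, f y * C ^ q ∂ν := by
          refine mul_le_mul_right (lintegral_mono_ae ?_) _
          have h1 : ∀ᵐ y ∂ν, AEMeasurable (fun x => ‖F x y‖ₑ) μ :=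
            hF.prod_swap.prodMk_left.mono fun y hy => hy.enorm
          filter_upwards [h1] with y hy
          rw [lintegral_const_mul'' _ (hy.pow_const q)]
          by_cases hy0 : f y = 0
          · rw [hy0, zero_mul, zero_mul]
          · have h3 := hC y hy0
            rw [eLpNorm_eq_lintegral_rpow_enorm_toReal hQ ENNReal.ofReal_ne_top,
              ENNReal.toReal_ofReal hq0.le] at h3
            have h4 := ENNReal.rpow_le_rpow h3 hq0.le
            rw [← ENNReal.rpow_mul, one_div_mul_cancel hq0.ne', ENNReal.rpow_one] at h4
            exact mul_le_mul_right h4 _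
      _ = ((∫⁻ y, f y ∂ν) * C) ^ q := by
          rw [lintegral_mul_const _ hf, ← mul_assoc, ENNReal.mul_rpow_of_nonneg _ _ hq0.le]
          congr 1
          nth_rewrite 2 [← ENNReal.rpow_one (∫⁻ y, f y ∂ν)]
          rw [← ENNReal.rpow_add_of_nonneg _ _ (by linarith) zero_le_one, sub_add_cancel]
  rw [eLpNorm_eq_lintegral_rpow_enorm_toReal hQ ENNReal.ofReal_ne_top, ENNReal.toReal_ofReal hq0.le]
  refine (ENNReal.rpow_le_rpow key (by positivity)).trans_eq ?_
  rw [← ENNReal.rpow_mul, mul_one_div_cancel hq0.ne', ENNReal.rpow_one]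

section Convolution

variable {d : ℕ} {W : Type*} [NormedAddCommGroup W] [NormedSpace ℝ W]

/-- The convolution `f * v`. -/
def conv (f : E d → ℝ) (v : E d → W) (x : E d) : W := ∫ t, f t • v (x - t)

theorem conv_eq (f : E d → ℝ) (v : E d → W) :
    conv f v = convolution f v (ContinuousLinearMap.lsmul ℝ ℝ) volume := rfl

theorem conv_eq_swap (f : E d → ℝ) (v : E d → W) (x : E d) :
    conv f v x = ∫ t, f (x - t) • v t := by
  rw [conv_eq, convolution_eq_swap]; rfl

theorem contDiff_conv {f : E d → ℝ} (hf : ContDiff ℝ ∞ f) (hc : HasCompactSupport f) {v : E d → W}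
    (hv : LocallyIntegrable v) : ContDiff ℝ ∞ (conv f v) :=
  hc.contDiff_convolution_left (ContinuousLinearMap.lsmul ℝ ℝ) hf hv

theorem integrable_conv {f : E d → ℝ} (hf : ContDiff ℝ ∞ f) (hc : HasCompactSupport f)
    {v : E d → W} (hv : LocallyIntegrable v) (x : E d) : Integrable fun t => f t • v (x - t) :=
  hc.convolutionExists_left (ContinuousLinearMap.lsmul ℝ ℝ) hf.continuous hv x

theorem pd_conv (i : Fin d) {f : E d → ℝ} (hf : ContDiff ℝ ∞ f) (hc : HasCompactSupport f)
    {v : E d → W} (hv : LocallyIntegrable v) : pd i (conv f v) = conv (pd i f) v := by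
  funext x
  let L : ℝ →L[ℝ] W →L[ℝ] W := ContinuousLinearMap.lsmul ℝ ℝ
  have h1 := hc.hasFDerivAt_convolution_left L (hf.of_le (by simp)) hv x (μ := volume)
  have h2 : Integrable (fun t => L.precompL (E d) (fderiv ℝ f t) (v (x - t))) :=
    (hc.fderiv ℝ).convolutionExists_left (L.precompL (E d)) (hf.continuous_fderiv (by simp)) hv x
  have h3 : pd i (conv f v) x = (∫ t, L.precompL (E d) (fderiv ℝ f t) (v (x - t)))
      (EuclideanSpace.single i 1) :=
    congrArg (fun l : E d →L[ℝ] W => l (EuclideanSpace.single i 1)) h1.fderiv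
  rw [h3, ContinuousLinearMap.integral_apply h2]
  rfl

theorem pdl_conv (a : List (Fin d)) {f : E d → ℝ} (hf : ContDiff ℝ ∞ f) (hc : HasCompactSupport f)
    {v : E d → W} (hv : LocallyIntegrable v) : pdl a (conv f v) = conv (pdl a f) v := by
  induction a with
  | nil => rfl
  | cons i a ih => rw [pdl, ih, pd_conv i (contDiff_pdl a hf) (hasCompactSupport_pdl a hc) hv]; rfl

theorem pdl_comp_sub (a : List (Fin d)) {f : E d → ℝ} (hf : ContDiff ℝ ∞ f) (x : E d) :
    pdl a (fun t => f (x - t)) = fun t => (-1 : ℝ) ^ a.length * pdl a f (x - t) := by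
  induction a with
  | nil => simp [pdl]
  | cons i a ih =>
    rw [pdl, ih]
    funext t
    have h1 : HasFDerivAt (fun t => pdl a f (x - t))
        ((fderiv ℝ (pdl a f) (x - t)).comp (-ContinuousLinearMap.id ℝ (E d))) t := by
      refine HasFDerivAt.comp t (g := pdl a f)
        ((contDiff_pdl a hf).differentiable (by simp) _).hasFDerivAt ?_
      exact (hasFDerivAt_id t).const_sub x
    rw [pd, (h1.const_mul _).fderiv, pdl, pd, List.length_cons, pow_succ]
    simp

/-- Derivatives of a convolution fall on the second factor if this has weak derivatives. -/
theorem pdl_conv_of_weak {a : List (Fin d)} {f : E d → ℝ} (hf : ContDiff ℝ ∞ f)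
    (hc : HasCompactSupport f) {v v' : E d → W} (h : WeakPD Set.univ a v v') :
    pdl a (conv f v) = conv f v' := by
  obtain ⟨h1, -, h3⟩ := h
  rw [pdl_conv a hf hc (locallyIntegrableOn_univ.mp h1)]
  funext x
  have hc' : HasCompactSupport fun t => f (x - t) :=
    hc.comp_homeomorph (Homeomorph.subLeft x)
  have h4 := h3 (fun t => f (x - t)) (hf.comp (contDiff_const.sub contDiff_id)) hc'
    (Set.subset_univ _)
  rw [pdl_comp_sub a hf] at h4
  rw [conv_eq_swap, conv_eq_swap]
  simp only [← smul_smul] at h4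
  rw [integral_smul] at h4
  exact smul_right_injective W (pow_ne_zero _ (by norm_num : (-1 : ℝ) ≠ 0)) h4

theorem pdl_conv_right (a : List (Fin d)) {f : E d → ℝ} (hf : ContDiff ℝ ∞ f)
    (hc : HasCompactSupport f) {w : E d → W} (hw : ContDiff ℝ ∞ w) :
    pdl a (conv f w) = conv f (pdl a w) :=
  pdl_conv_of_weak hf hc (weakPD_pdl _ a hw)

/-- Young's inequality. -/
theorem eLpNorm_conv_le {q : ℝ} (hq : 1 < q) {f : E d → ℝ} (hf : Continuous f) {v : E d → W}
    (hv : AEStronglyMeasurable v) : eLpNorm (conv f v) (ENNReal.ofReal q)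
      ≤ (∫⁻ t, ‖f t‖ₑ) * eLpNorm v (ENNReal.ofReal q) := by
  refine eLpNorm_le_of_le_lintegral hq hf.measurable.enorm (F := fun x t => v (x - t))
    ?_ (fun x => ?_) fun t _ => ?_
  · exact hv.comp_quasiMeasurePreserving (quasiMeasurePreserving_sub_of_right_invariant _ _)
  · refine (enorm_integral_le_lintegral_enorm _).trans_eq ?_
    simp only [enorm_smul]
  · exact (eLpNorm_comp_measurePreserving hv (measurePreserving_sub_right volume t)).le

/-- The estimate of a difference by the gradient. -/
theorem eLpNorm_sub_translate_le [CompleteSpace W] {q : ℝ} (hq : 1 < q) {w : E d → W}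
    (hw : ContDiff ℝ ∞ w) (t : E d)
    {C : ℝ≥0∞} (hC : ∀ i, eLpNorm (pd i w) (ENNReal.ofReal q) ≤ C) :
    eLpNorm (fun x => w x - w (x - t)) (ENNReal.ofReal q) ≤ ENNReal.ofReal ‖t‖ * (d * C) := by
  have hQ1 : 1 ≤ ENNReal.ofReal q := by simpa using hq.le
  have hg : Continuous fun z => fderiv ℝ w z t := by
    have := hw.continuous_fderiv (by simp)
    fun_prop
  have h1 : ∀ x, w x - w (x - t) = ∫ s in (0 : ℝ)..1, fderiv ℝ w (x - s • t) t := by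
    intro x
    have h2 : ∀ s : ℝ, HasDerivAt (fun s : ℝ => w (x - s • t)) (-fderiv ℝ w (x - s • t) t) s := by
      intro s
      have h3 : HasDerivAt (fun s : ℝ => x - s • t) (-t) s := by
        have := ((hasDerivAt_id s).smul_const t).const_sub x
        simpa using this
      have h4 := ((hw.differentiable (by simp) (x - s • t)).hasFDerivAt).comp_hasDerivAt s h3
      rw [map_neg] at h4
      exact h4
    have hgc : Continuous fun s : ℝ => fderiv ℝ w (x - s • t) t :=
      hg.comp (by fun_prop : Continuous fun s : ℝ => x - s • t)
    have h5 := intervalIntegral.integral_eq_sub_of_hasDerivAt (a := 0) (b := 1)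
      (fun s _ => h2 s) (hgc.neg.intervalIntegrable _ _)
    rw [intervalIntegral.integral_neg] at h5
    rw [← neg_neg (∫ s in (0 : ℝ)..1, _), h5]
    simp
  have h2 : eLpNorm (fun x => w x - w (x - t)) (ENNReal.ofReal q)
      ≤ (∫⁻ s : ℝ, (Set.Ioc (0 : ℝ) 1).indicator 1 s)
        * eLpNorm (fun x => fderiv ℝ w x t) (ENNReal.ofReal q) := by
    refine eLpNorm_le_of_le_lintegral hq
      (measurable_one.indicator measurableSet_Ioc) (F := fun x s => fderiv ℝ w (x - s • t) t)
      (ν := (volume : Measure ℝ)) ?_ (fun x => ?_) fun s _ => ?_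
    · exact (hg.comp (by fun_prop : Continuous fun p : E d × ℝ =>
        p.1 - p.2 • t)).aestronglyMeasurable
    · rw [h1, intervalIntegral.integral_of_le zero_le_one]
      refine (enorm_integral_le_lintegral_enorm _).trans_eq ?_
      rw [← lintegral_indicator measurableSet_Ioc]
      congr 1
      funext s
      by_cases hs : s ∈ Set.Ioc (0 : ℝ) 1 <;> simp [hs]
    · exact (eLpNorm_comp_measurePreserving hg.aestronglyMeasurable
        (measurePreserving_sub_right volume (s • t))).le
  rw [lintegral_indicator_one measurableSet_Ioc, Real.volume_Ioc] at h2
  simp only [sub_zero, ENNReal.ofReal_one, one_mul] at h2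
  refine h2.trans ?_
  have h3 : (fun x => fderiv ℝ w x t) = ∑ i : Fin d, fun x => t i • pd i w x := by
    funext x
    have : t = ∑ i : Fin d, (t i) • EuclideanSpace.single i (1 : ℝ) := by
      ext c
      simp [Finset.sum_apply, Pi.single_apply]
    nth_rewrite 1 [this]
    rw [map_sum, Finset.sum_apply]
    simp only [map_smul, pd]
  rw [h3]
  refine (eLpNorm_sum_le (fun i _ =>
    (((contDiff_pd i hw).continuous.const_smul (t i)).aestronglyMeasurable)) hQ1).trans ?_
  have h4 : ∀ i ∈ (Finset.univ : Finset (Fin d)),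
      eLpNorm (fun x => t i • pd i w x) (ENNReal.ofReal q) ≤ ENNReal.ofReal ‖t‖ * C := by
    intro i _
    refine (eLpNorm_const_smul_le (c := t i) (f := pd i w)).trans ?_
    refine mul_le_mul' ?_ (hC i)
    rw [← ofReal_norm]
    exact ENNReal.ofReal_le_ofReal (PiLp.norm_apply_le t i)
  refine (Finset.sum_le_sum h4).trans_eq ?_
  rw [Finset.sum_const, Finset.card_univ, Fintype.card_fin, nsmul_eq_mul]
  ring

end Convolution

end HypSob

/-! ### Littlewood–Paley decomposition -/

namespace HypSob

open MeasureTheory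

section LittlewoodPaley

variable {d : ℕ} {W : Type*} [NormedAddCommGroup W] [NormedSpace ℝ W]

/-- The mollifier with support in the ball of radius `ε`. -/
def mollKer (d : ℕ) (ε : ℝ) (x : E d) : ℝ :=
  ((∫ y : E d, radialBump (1 / 2) y)⁻¹ * ε⁻¹ ^ d) * radialBump (1 / 2) (ε⁻¹ • x)

theorem contDiff_mollKer (ε : ℝ) : ContDiff ℝ ∞ (mollKer d ε) :=
  contDiff_const.mul ((contDiff_radialBump _).comp (contDiff_id.const_smul _))

theorem mollKer_nonneg {ε : ℝ} (hε : 0 < ε) (x : E d) : 0 ≤ mollKer d ε x := by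
  have h := integral_radialBump_pos (d := d) (ε := 1 / 2) (by norm_num)
  exact mul_nonneg (mul_nonneg (inv_nonneg.mpr h.le) (pow_nonneg (inv_nonneg.mpr hε.le) _))
    (radialBump_nonneg _ _)

theorem mollKer_eq_zero {ε : ℝ} (hε : 0 < ε) {x : E d} (hx : ε ≤ ‖x‖) : mollKer d ε x = 0 := by
  rw [mollKer, radialBump_eq_zero (by norm_num), mul_zero]
  rw [norm_smul, norm_inv, Real.norm_of_nonneg hε.le, mul_one_div_cancel two_ne_zero,
    ← div_eq_inv_mul]
  exact (one_le_div hε).mpr hx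

theorem hasCompactSupport_mollKer {ε : ℝ} (hε : 0 < ε) : HasCompactSupport (mollKer d ε) :=
  HasCompactSupport.intro (isCompact_closedBall (0 : E d) ε) fun x hx =>
    mollKer_eq_zero hε (by simpa using (not_le.mp (by simpa using hx)).le)

theorem mollKer_eq (ε : ℝ) :
    mollKer d ε = fun x => ε⁻¹ ^ d • mollKer d 1 (ε⁻¹ • x) := by
  funext x
  simp only [mollKer, inv_one, one_pow, mul_one, one_smul, smul_eq_mul]
  ring

theorem integral_mollKer {ε : ℝ} (hε : 0 < ε) : ∫ x, mollKer d ε x = 1 := by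
  have h := integral_radialBump_pos (d := d) (ε := 1 / 2) (by norm_num)
  simp only [mollKer]
  rw [integral_const_mul, Measure.integral_comp_inv_smul_of_nonneg _ _ hε.le,
    finrank_euclideanSpace_fin, smul_eq_mul, mul_assoc, ← mul_assoc (ε⁻¹ ^ d), ← mul_pow,
    inv_mul_cancel₀ hε.ne', one_pow, one_mul, inv_mul_cancel₀ h.ne']

theorem integrable_mollKer {ε : ℝ} (hε : 0 < ε) : Integrable (mollKer d ε) :=
  (contDiff_mollKer ε).continuous.integrable_of_hasCompactSupport (hasCompactSupport_mollKer hε)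

theorem lintegral_mollKer {ε : ℝ} (hε : 0 < ε) : ∫⁻ x, ‖mollKer d ε x‖ₑ = 1 := by
  rw [← ofReal_integral_norm_eq_lintegral_enorm (integrable_mollKer hε)]
  simp only [Real.norm_of_nonneg (mollKer_nonneg hε _), integral_mollKer hε, ENNReal.ofReal_one]

theorem pdl_comp_smul (a : List (Fin d)) {f : E d → W} (hf : ContDiff ℝ ∞ f) (c : ℝ) :
    pdl a (fun x => f (c • x)) = fun x => c ^ a.length • pdl a f (c • x) := by
  induction a with
  | nil => simp [pdl]
  | cons i a ih =>
    rw [pdl, ih, pd_const_smul]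
    funext x
    have h1 : HasFDerivAt (fun x => pdl a f (c • x))
        ((fderiv ℝ (pdl a f) (c • x)).comp (c • ContinuousLinearMap.id ℝ (E d))) x := by
      refine HasFDerivAt.comp x (g := pdl a f)
        ((contDiff_pdl a hf).differentiable (by simp) _).hasFDerivAt ?_
      exact (hasFDerivAt_id x).const_smul c
    rw [pd, h1.fderiv, pdl, pd, List.length_cons, pow_succ]
    simp [smul_smul]

/-- The `L¹` norm of the derivatives of the mollifier. -/
theorem exists_lintegral_pdl_mollKer (b : List (Fin d)) : ∃ K : ℝ≥0, ∀ ε : ℝ, 0 < ε →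
    ∫⁻ x, ‖pdl b (mollKer d ε) x‖ₑ ≤ ENNReal.ofReal (ε⁻¹ ^ b.length) * K := by
  have hs := contDiff_pdl b (contDiff_mollKer (d := d) 1)
  have hc := hasCompactSupport_pdl b (hasCompactSupport_mollKer (d := d) one_pos)
  refine ⟨(∫ x, ‖pdl b (mollKer d 1) x‖).toNNReal, fun ε hε => ?_⟩
  have h1 : pdl b (mollKer d ε)
      = fun x => ε⁻¹ ^ d • ε⁻¹ ^ b.length • pdl b (mollKer d 1) (ε⁻¹ • x) := by
    rw [mollKer_eq, pdl_const_smul, pdl_comp_smul b (contDiff_mollKer 1)]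
  have h2 : Integrable (pdl b (mollKer d ε)) :=
    (contDiff_pdl b (contDiff_mollKer ε)).continuous.integrable_of_hasCompactSupport
      (hasCompactSupport_pdl b (hasCompactSupport_mollKer hε))
  rw [← ofReal_integral_norm_eq_lintegral_enorm h2, h1]
  simp only [norm_smul, norm_pow, norm_inv, Real.norm_of_nonneg hε.le]
  rw [integral_const_mul, integral_const_mul,
    Measure.integral_comp_inv_smul_of_nonneg volume (fun x => ‖pdl b (mollKer d 1) x‖) hε.le,
    finrank_euclideanSpace_fin, smul_eq_mul]
  have h3 : ε⁻¹ ^ d * (ε⁻¹ ^ b.length * (ε ^ d * ∫ x, ‖pdl b (mollKer d 1) x‖))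
      = ε⁻¹ ^ b.length * ∫ x, ‖pdl b (mollKer d 1) x‖ := by
    have : ε⁻¹ ^ d * ε ^ d = 1 := by rw [← mul_pow, inv_mul_cancel₀ hε.ne', one_pow]
    linear_combination (ε⁻¹ ^ b.length * ∫ x, ‖pdl b (mollKer d 1) x‖) * this
  rw [h3, ENNReal.ofReal_mul (by positivity)]
  rfl

/-- The mollification of a function. -/
def moll (ε : ℝ) (v : E d → W) : E d → W := conv (mollKer d ε) v

/-- The remainder of the mollification of a function. -/
def res (ε : ℝ) (v : E d → W) (x : E d) : W := v x - moll ε v x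

/-- Smooth approximations of high order: `1 - (1 - C)^L`, where `C` is the mollification. -/
def lpS (L : ℕ) (ε : ℝ) (v : E d → W) (x : E d) : W :=
  ∑ l ∈ Finset.range L, moll ε ((res ε)^[l] v) x

/-- The Littlewood–Paley components. With `S = 1 - R_ε^L` and `S' = 1 - R_{ε/2}^L` this is
`(S' - S)(S' + S)`. Here one factor is smoothing, and the other one is small on functions with
derivatives in `L^q`. -/
def lpP (L : ℕ) (ε : ℝ) (v : E d → W) (x : E d) : W :=
  (res ε)^[L] (fun y => lpS L (ε / 2) v y + lpS L ε v y) x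
    - (res (ε / 2))^[L] (fun y => lpS L (ε / 2) v y + lpS L ε v y) x

variable {ε : ℝ} {v w : E d → W}

theorem contDiff_moll (hε : 0 < ε) (hv : LocallyIntegrable v) : ContDiff ℝ ∞ (moll ε v) :=
  contDiff_conv (contDiff_mollKer ε) (hasCompactSupport_mollKer hε) hv

theorem locallyIntegrable_res (hε : 0 < ε) (hv : LocallyIntegrable v) :
    LocallyIntegrable (res ε v) :=
  hv.sub (contDiff_moll hε hv).continuous.locallyIntegrable

theorem locallyIntegrable_res_iterate (hε : 0 < ε) (hv : LocallyIntegrable v) (l : ℕ) :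
    LocallyIntegrable ((res ε)^[l] v) := by
  induction l with
  | zero => exact hv
  | succ l ih =>
    rw [Function.iterate_succ_apply']
    exact locallyIntegrable_res hε ih

theorem contDiff_res (hε : 0 < ε) (hw : ContDiff ℝ ∞ w) : ContDiff ℝ ∞ (res ε w) :=
  hw.sub (contDiff_moll hε hw.continuous.locallyIntegrable)

theorem contDiff_res_iterate (hε : 0 < ε) (hw : ContDiff ℝ ∞ w) (l : ℕ) :
    ContDiff ℝ ∞ ((res ε)^[l] w) := by
  induction l with
  | zero => exact hw
  | succ l ih =>
    rw [Function.iterate_succ_apply']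
    exact contDiff_res hε ih

theorem contDiff_lpS (L : ℕ) (hε : 0 < ε) (hv : LocallyIntegrable v) :
    ContDiff ℝ ∞ (lpS L ε v) :=
  ContDiff.sum fun l _ => contDiff_moll hε (locallyIntegrable_res_iterate hε hv l)

theorem contDiff_lpP (L : ℕ) (hε : 0 < ε) (hv : LocallyIntegrable v) :
    ContDiff ℝ ∞ (lpP L ε v) := by
  have h := (contDiff_lpS L (half_pos hε) hv).add (contDiff_lpS L hε hv)
  exact (contDiff_res_iterate hε h L).sub (contDiff_res_iterate (half_pos hε) h L)

theorem res_iterate_eq (L : ℕ) (ε : ℝ) (v : E d → W) (x : E d) :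
    (res ε)^[L] v x = v x - lpS L ε v x := by
  induction L with
  | zero => simp [lpS]
  | succ L ih =>
    rw [Function.iterate_succ_apply', res, ih, lpS, lpS, Finset.sum_range_succ]
    abel

/-! #### Supports -/

theorem moll_eq_zero (hε : 0 < ε) {R : ℝ} (hv : ∀ x, R < ‖x‖ → v x = 0) :
    ∀ x, R + ε < ‖x‖ → moll ε v x = 0 := by
  intro x hx
  rw [moll, conv]
  refine integral_eq_zero_of_ae (Filter.Eventually.of_forall fun t => ?_)
  by_cases ht : ε ≤ ‖t‖
  · simp only [mollKer_eq_zero hε ht, zero_smul, Pi.zero_apply]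
  · have h1 : ‖x‖ - ‖t‖ ≤ ‖x - t‖ := norm_sub_norm_le x t
    simp only [hv (x - t) (by linarith), smul_zero, Pi.zero_apply]

theorem res_iterate_eq_zero (hε : 0 < ε) {R : ℝ} (hv : ∀ x, R < ‖x‖ → v x = 0) (l : ℕ) :
    ∀ x, R + l * ε < ‖x‖ → (res ε)^[l] v x = 0 := by
  induction l with
  | zero => simpa using hv
  | succ l ih =>
    intro x hx
    push_cast at hx
    rw [Function.iterate_succ_apply', res, ih x (by linarith),
      moll_eq_zero hε ih x (by linarith), sub_zero]

theorem lpS_eq_zero (hε : 0 < ε) {R : ℝ} (hv : ∀ x, R < ‖x‖ → v x = 0) (L : ℕ) :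
    ∀ x, R + L * ε < ‖x‖ → lpS L ε v x = 0 := by
  intro x hx
  have h1 : 0 ≤ L * ε := by positivity
  have h := res_iterate_eq L ε v x
  rw [res_iterate_eq_zero hε hv L x hx, hv x (by linarith), zero_sub] at h
  exact neg_eq_zero.mp h.symm

theorem lpP_eq_zero (hε : 0 < ε) (hε1 : ε ≤ 1) {R : ℝ} (hv : ∀ x, R < ‖x‖ → v x = 0) (L : ℕ) :
    ∀ x, R + 2 * L < ‖x‖ → lpP L ε v x = 0 := by
  intro x hx
  have h0 : L * ε ≤ L := mul_le_of_le_one_right (by positivity) hε1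
  have h0' : L * (ε / 2) ≤ L := mul_le_of_le_one_right (by positivity) (by linarith)
  have h1 : ∀ x, R + L < ‖x‖ → lpS L (ε / 2) v x + lpS L ε v x = 0 := fun x hx => by
    rw [lpS_eq_zero hε hv L x (by linarith), lpS_eq_zero (half_pos hε) hv L x (by linarith),
      add_zero]
  rw [lpP, res_iterate_eq_zero hε h1 L x (by linarith),
    res_iterate_eq_zero (half_pos hε) h1 L x (by linarith), sub_zero]

/-! #### Estimates -/

variable {q : ℝ}

theorem eLpNorm_moll_le (hq : 1 < q) (hε : 0 < ε) (hv : AEStronglyMeasurable v) :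
    eLpNorm (moll ε v) (ENNReal.ofReal q) ≤ eLpNorm v (ENNReal.ofReal q) := by
  have h := eLpNorm_conv_le hq (contDiff_mollKer (d := d) ε).continuous hv
  rwa [lintegral_mollKer hε, one_mul] at h

theorem eLpNorm_res_le (hq : 1 < q) (hε : 0 < ε) (hv : LocallyIntegrable v) :
    eLpNorm (res ε v) (ENNReal.ofReal q) ≤ 2 * eLpNorm v (ENNReal.ofReal q) := by
  have hQ1 : 1 ≤ ENNReal.ofReal q := by simpa using hq.le
  refine (eLpNorm_sub_le hv.aestronglyMeasurable
    (contDiff_moll hε hv).continuous.aestronglyMeasurable hQ1).trans ?_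
  rw [two_mul]
  exact add_le_add_right (eLpNorm_moll_le hq hε hv.aestronglyMeasurable) _

theorem eLpNorm_res_iterate_le (hq : 1 < q) (hε : 0 < ε) (hv : LocallyIntegrable v) (l : ℕ) :
    eLpNorm ((res ε)^[l] v) (ENNReal.ofReal q) ≤ 2 ^ l * eLpNorm v (ENNReal.ofReal q) := by
  induction l with
  | zero => simp
  | succ l ih =>
    rw [Function.iterate_succ_apply', pow_succ', mul_assoc]
    exact (eLpNorm_res_le hq hε (locallyIntegrable_res_iterate hε hv l)).trans (by gcongr)

/-- One factor `1 - C` gains a power of `ε` at the cost of one derivative. -/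
theorem eLpNorm_res_le_pd [CompleteSpace W] (hq : 1 < q) (hε : 0 < ε) (hw : ContDiff ℝ ∞ w)
    {C : ℝ≥0∞} (hC : ∀ i, eLpNorm (pd i w) (ENNReal.ofReal q) ≤ C) :
    eLpNorm (res ε w) (ENNReal.ofReal q) ≤ ENNReal.ofReal ε * (d * C) := by
  have h1 : ∀ x, res ε w x = ∫ t, mollKer d ε t • (w x - w (x - t)) := by
    intro x
    simp only [smul_sub]
    rw [integral_sub ((integrable_mollKer hε).smul_const _)
      (integrable_conv (contDiff_mollKer ε) (hasCompactSupport_mollKer hε)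
        hw.continuous.locallyIntegrable x), integral_smul_const, integral_mollKer hε, one_smul]
    rfl
  have h2 := eLpNorm_le_of_le_lintegral (μ := (volume : Measure (E d)))
    (ν := (volume : Measure (E d))) hq (contDiff_mollKer (d := d) ε).continuous.measurable.enorm
    (F := fun x t => w x - w (x - t)) (H := res ε w) (C := ENNReal.ofReal ε * (d * C))
    ?_ (fun x => ?_) fun t ht => ?_
  · rwa [lintegral_mollKer hε, one_mul] at h2
  · have := hw.continuous
    exact (by fun_prop : Continuous fun p : E d × E d => w p.1 - w (p.1 - p.2)).aestronglyMeasurable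
  · rw [h1]
    refine (enorm_integral_le_lintegral_enorm _).trans_eq ?_
    simp only [enorm_smul]
  · refine (eLpNorm_sub_translate_le hq hw t hC).trans (mul_le_mul_left ?_ _)
    refine ENNReal.ofReal_le_ofReal ?_
    by_contra h
    exact ht (by rw [mollKer_eq_zero hε (not_le.mp h).le, enorm_zero])

theorem pdl_res (a : List (Fin d)) (hε : 0 < ε) (hw : ContDiff ℝ ∞ w) :
    pdl a (res ε w) = res ε (pdl a w) := by
  have h := pdl_sub a hw (contDiff_moll hε hw.continuous.locallyIntegrable)
  have h2 := pdl_conv_right a (contDiff_mollKer (d := d) ε) (hasCompactSupport_mollKer hε) hw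
  change pdl a (fun x => w x - moll ε w x) = _
  rw [h]
  funext x
  rw [moll, h2, res, moll]

theorem pdl_res_iterate (a : List (Fin d)) (hε : 0 < ε) (hw : ContDiff ℝ ∞ w) (l : ℕ) :
    pdl a ((res ε)^[l] w) = (res ε)^[l] (pdl a w) := by
  induction l with
  | zero => rfl
  | succ l ih =>
    rw [Function.iterate_succ_apply', Function.iterate_succ_apply',
      pdl_res a hε (contDiff_res_iterate hε hw l), ih]

theorem eLpNorm_res_iterate_le_pdl [CompleteSpace W] (hq : 1 < q) (hε : 0 < ε) (κ : ℕ)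
    (hw : ContDiff ℝ ∞ w) {C : ℝ≥0∞}
    (hC : ∀ a : List (Fin d), a.length = κ → eLpNorm (pdl a w) (ENNReal.ofReal q) ≤ C) :
    eLpNorm ((res ε)^[κ] w) (ENNReal.ofReal q) ≤ (ENNReal.ofReal ε * d) ^ κ * C := by
  induction κ generalizing w with
  | zero => simpa [pdl] using hC [] rfl
  | succ κ ih =>
    rw [Function.iterate_succ_apply', pow_succ', mul_assoc, mul_assoc]
    refine eLpNorm_res_le_pd hq hε (contDiff_res_iterate hε hw κ) fun i => ?_
    have h1 : pd i ((res ε)^[κ] w) = (res ε)^[κ] (pd i w) := pdl_res_iterate [i] hε hw κ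
    rw [h1]
    refine ih (contDiff_pd i hw) fun a ha => ?_
    rw [pdl_pd a i hw]
    exact hC (i :: a) (by simp [ha])

theorem eLpNorm_res_iterate_le_pdl' [CompleteSpace W] (hq : 1 < q) (hε : 0 < ε) {κ L : ℕ}
    (hκ : κ ≤ L) (hw : ContDiff ℝ ∞ w) {C : ℝ≥0∞}
    (hC : ∀ a : List (Fin d), a.length = κ → eLpNorm (pdl a w) (ENNReal.ofReal q) ≤ C) :
    eLpNorm ((res ε)^[L] w) (ENNReal.ofReal q) ≤ 2 ^ L * ((ENNReal.ofReal ε * d) ^ κ * C) := by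
  obtain ⟨l, rfl⟩ := Nat.exists_eq_add_of_le' hκ
  rw [Function.iterate_add_apply]
  refine (eLpNorm_res_iterate_le hq hε
    (contDiff_res_iterate hε hw κ).continuous.locallyIntegrable l).trans ?_
  refine mul_le_mul' (pow_le_pow_right₀ (by norm_num) (Nat.le_add_right _ _)) ?_
  exact eLpNorm_res_iterate_le_pdl hq hε κ hw hC

theorem weakPD_res {a : List (Fin d)} {v v' : E d → W} (hε : 0 < ε)
    (h : WeakPD Set.univ a v v') : WeakPD Set.univ a (res ε v) (res ε v') := by
  have hm : pdl a (moll ε v) = moll ε v' :=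
    pdl_conv_of_weak (contDiff_mollKer ε) (hasCompactSupport_mollKer hε) h
  have h1 := locallyIntegrableOn_univ.mp h.1
  have h2 := locallyIntegrableOn_univ.mp h.2.1
  refine ⟨(locallyIntegrable_res hε h1).locallyIntegrableOn _,
    (locallyIntegrable_res hε h2).locallyIntegrableOn _, fun η hη hc hs => ?_⟩
  have h3 := integral_pdl_smul a hη hc (contDiff_moll hε h1)
  rw [hm] at h3
  have hi : ∀ {η : E d → ℝ} {u : E d → W}, Continuous η → HasCompactSupport η →
      LocallyIntegrable u → Integrable fun x => η x • u x := fun h h' h'' =>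
    integrable_smul_of_tsupport h h' (Set.subset_univ _) (h''.locallyIntegrableOn _)
  have hη' := (contDiff_pdl a hη).continuous
  have hc' := hasCompactSupport_pdl a hc
  have m1 := (contDiff_moll hε h1).continuous.locallyIntegrable (μ := volume)
  have m2 := (contDiff_moll hε h2).continuous.locallyIntegrable (μ := volume)
  simp only [res, smul_sub]
  rw [integral_sub (hi hη' hc' h1) (hi hη' hc' m1),
    integral_sub (hi hη.continuous hc h2) (hi hη.continuous hc m2), h.2.2 η hη hc hs, h3, smul_sub]

theorem weakPD_res_iterate {a : List (Fin d)} {v v' : E d → W} (hε : 0 < ε)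
    (h : WeakPD Set.univ a v v') (l : ℕ) :
    WeakPD Set.univ a ((res ε)^[l] v) ((res ε)^[l] v') := by
  induction l with
  | zero => exact h
  | succ l ih =>
    rw [Function.iterate_succ_apply', Function.iterate_succ_apply']
    exact weakPD_res hε ih

theorem pdl_sum (a : List (Fin d)) {ι : Type*} (s : Finset ι) {f : ι → E d → W}
    (hf : ∀ i ∈ s, ContDiff ℝ ∞ (f i)) :
    pdl a (fun x => ∑ i ∈ s, f i x) = fun x => ∑ i ∈ s, pdl a (f i) x := by
  classical
  induction s using Finset.induction_on with
  | empty =>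
    have h0 := pdl_const_smul a (0 : ℝ) (fun _ : E d => (0 : W))
    simpa using h0
  | insert i s hi ih =>
    simp only [Finset.sum_insert hi]
    rw [pdl_add a (hf i (Finset.mem_insert_self _ _))
      (ContDiff.sum fun j hj => hf j (Finset.mem_insert_of_mem hj)),
      ih fun j hj => hf j (Finset.mem_insert_of_mem hj)]

theorem pdl_lpS_of_weak {a : List (Fin d)} {v v' : E d → W} (L : ℕ) (hε : 0 < ε)
    (h : WeakPD Set.univ a v v') : pdl a (lpS L ε v) = lpS L ε v' := by
  have h1 := locallyIntegrableOn_univ.mp h.1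
  change pdl a (fun x => ∑ l ∈ Finset.range L, moll ε ((res ε)^[l] v) x) = _
  rw [pdl_sum a _ fun l _ => contDiff_moll hε (locallyIntegrable_res_iterate hε h1 l)]
  funext x
  refine Finset.sum_congr rfl fun l _ => ?_
  exact congrFun (pdl_conv_of_weak (contDiff_mollKer ε) (hasCompactSupport_mollKer hε)
    (weakPD_res_iterate hε h l)) x

/-- The operators `lpS` are smoothing. -/
theorem exists_eLpNorm_pdl_lpS (hq : 1 < q) (L : ℕ) (b : List (Fin d)) :
    ∃ K : ℝ≥0, ∀ (ε : ℝ), 0 < ε → ∀ v : E d → W, LocallyIntegrable v →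
      eLpNorm (pdl b (lpS L ε v)) (ENNReal.ofReal q)
        ≤ ENNReal.ofReal (ε⁻¹ ^ b.length) * K * eLpNorm v (ENNReal.ofReal q) := by
  have hQ1 : 1 ≤ ENNReal.ofReal q := by simpa using hq.le
  obtain ⟨K, hK⟩ := exists_lintegral_pdl_mollKer b
  refine ⟨K * (L * 2 ^ L), fun ε hε v hv => ?_⟩
  have hl := fun l => locallyIntegrable_res_iterate hε hv l
  have h1 : pdl b (lpS L ε v)
      = ∑ l ∈ Finset.range L, conv (pdl b (mollKer d ε)) ((res ε)^[l] v) := by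
    change pdl b (fun x => ∑ l ∈ Finset.range L, moll ε ((res ε)^[l] v) x) = _
    rw [pdl_sum b _ fun l _ => contDiff_moll hε (hl l)]
    funext x
    rw [Finset.sum_apply]
    refine Finset.sum_congr rfl fun l _ => ?_
    rw [moll, pdl_conv b (contDiff_mollKer ε) (hasCompactSupport_mollKer hε) (hl l)]
  rw [h1]
  refine (eLpNorm_sum_le (fun l _ => (contDiff_conv (contDiff_pdl b (contDiff_mollKer ε))
    (hasCompactSupport_pdl b (hasCompactSupport_mollKer hε))
      (hl l)).continuous.aestronglyMeasurable)
    hQ1).trans ?_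
  have h2 : ∀ l ∈ Finset.range L,
      eLpNorm (conv (pdl b (mollKer d ε)) ((res ε)^[l] v)) (ENNReal.ofReal q)
      ≤ ENNReal.ofReal (ε⁻¹ ^ b.length) * K * (2 ^ L * eLpNorm v (ENNReal.ofReal q)) := by
    intro l hl'
    refine (eLpNorm_conv_le hq (contDiff_pdl b (contDiff_mollKer ε)).continuous
      (hl l).aestronglyMeasurable).trans (mul_le_mul' (hK ε hε) ?_)
    refine (eLpNorm_res_iterate_le hq hε hv l).trans (mul_le_mul_left ?_ _)
    exact pow_le_pow_right₀ (by norm_num) (Finset.mem_range.mp hl').le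
  refine (Finset.sum_le_sum h2).trans_eq ?_
  rw [Finset.sum_const, Finset.card_range, nsmul_eq_mul]
  push_cast
  ring

/-- The basic estimate of the Littlewood–Paley components: derivatives of the component cost
powers of `ε⁻¹`, and derivatives of the function gain powers of `ε`. -/
theorem exists_eLpNorm_pdl_lpP [CompleteSpace W] (hq : 1 < q) {κ L : ℕ} (hκ : κ ≤ L)
    (b : List (Fin d)) : ∃ K : ℝ≥0, ∀ (ε : ℝ), 0 < ε → ∀ (v : E d → W) (B : ℝ≥0∞),
      LocallyIntegrable v → (∀ a : List (Fin d), a.length = κ →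
        ∃ v', WeakPD Set.univ a v v' ∧ eLpNorm v' (ENNReal.ofReal q) ≤ B) →
      eLpNorm (pdl b (lpP L ε v)) (ENNReal.ofReal q)
        ≤ K * (ENNReal.ofReal (ε ^ κ) * ENNReal.ofReal (ε⁻¹ ^ b.length)) * B := by
  have hQ1 : 1 ≤ ENNReal.ofReal q := by simpa using hq.le
  obtain ⟨K, hK⟩ := exists_eLpNorm_pdl_lpS (W := W) hq L b
  refine ⟨2 * (2 ^ L * (d ^ κ * (K * (2 ^ b.length + 1)))), fun ε hε v B hv hB => ?_⟩
  set w : E d → W := fun y => lpS L (ε / 2) v y + lpS L ε v y with hw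
  have s1 := contDiff_lpS L (half_pos hε) hv
  have s2 := contDiff_lpS L hε hv
  have hws : ContDiff ℝ ∞ w := s1.add s2
  set M : ℝ≥0∞ := ENNReal.ofReal (ε⁻¹ ^ b.length) * (K * (2 ^ b.length + 1)) * B with hM
  have h1 : ∀ a : List (Fin d), a.length = κ →
      eLpNorm (pdl a (pdl b w)) (ENNReal.ofReal q) ≤ M := by
    intro a ha
    obtain ⟨v', hv', hB'⟩ := hB a ha
    have hl := locallyIntegrableOn_univ.mp hv'.2.1
    have e1 : pdl a (pdl b w)
        = (fun x => pdl b (lpS L (ε / 2) v') x + pdl b (lpS L ε v') x) := by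
      have e2 : pdl a (pdl b w) = pdl b (pdl a w) := by
        clear hK hB hM M
        induction b with
        | nil => rfl
        | cons i b ih => rw [pdl, pdl_pd a i (contDiff_pdl b hws), ih]; rfl
      rw [e2, hw, pdl_add a s1 s2, pdl_lpS_of_weak L (half_pos hε) hv',
        pdl_lpS_of_weak L hε hv', pdl_add b (contDiff_lpS L (half_pos hε) hl)
          (contDiff_lpS L hε hl)]
    rw [e1]
    refine (eLpNorm_add_le
      (contDiff_pdl b (contDiff_lpS L (half_pos hε) hl)).continuous.aestronglyMeasurable
      (contDiff_pdl b (contDiff_lpS L hε hl)).continuous.aestronglyMeasurable hQ1).trans ?_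
    refine (add_le_add (hK _ (half_pos hε) v' hl) (hK _ hε v' hl)).trans ?_
    have e3 : ENNReal.ofReal ((ε / 2)⁻¹ ^ b.length)
        = 2 ^ b.length * ENNReal.ofReal (ε⁻¹ ^ b.length) := by
      rw [inv_div, div_eq_mul_inv, mul_pow, ENNReal.ofReal_mul (by positivity),
        ENNReal.ofReal_pow (by norm_num), ENNReal.ofReal_ofNat]
    rw [e3, hM]
    calc _ = ENNReal.ofReal (ε⁻¹ ^ b.length) * (K * (2 ^ b.length + 1))
            * eLpNorm v' (ENNReal.ofReal q) := by ring
      _ ≤ _ := by gcongr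
  have hbw := contDiff_pdl b hws
  have e4 : pdl b (lpP L ε v)
      = fun x => (res ε)^[L] (pdl b w) x - (res (ε / 2))^[L] (pdl b w) x := by
    change pdl b (fun x => (res ε)^[L] w x - (res (ε / 2))^[L] w x) = _
    rw [pdl_sub b (contDiff_res_iterate hε hws L) (contDiff_res_iterate (half_pos hε) hws L),
      pdl_res_iterate b hε hws, pdl_res_iterate b (half_pos hε) hws]
  rw [e4]
  refine (eLpNorm_sub_le (contDiff_res_iterate hε hbw L).continuous.aestronglyMeasurable
    (contDiff_res_iterate (half_pos hε) hbw L).continuous.aestronglyMeasurable hQ1).trans ?_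
  have h2 := eLpNorm_res_iterate_le_pdl' hq hε hκ hbw h1
  have h3 := eLpNorm_res_iterate_le_pdl' hq (half_pos hε) hκ hbw h1
  have h4 : ENNReal.ofReal (ε / 2) ≤ ENNReal.ofReal ε := ENNReal.ofReal_le_ofReal (by linarith)
  calc _ ≤ 2 ^ L * ((ENNReal.ofReal ε * d) ^ κ * M) + 2 ^ L * ((ENNReal.ofReal ε * d) ^ κ * M) :=
        add_le_add h2 (h3.trans (by gcongr))
    _ = _ := by
        rw [hM, ENNReal.ofReal_pow hε.le]
        push_cast
        ring

/-! #### The decomposition of smooth functions -/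

theorem conv_sub {f : E d → ℝ} (hf : ContDiff ℝ ∞ f) (hc : HasCompactSupport f)
    (hv : LocallyIntegrable v) (hw : LocallyIntegrable w) :
    conv f (fun x => v x - w x) = fun x => conv f v x - conv f w x := by
  funext x
  simp only [conv, smul_sub]
  exact integral_sub (integrable_conv hf hc hv x) (integrable_conv hf hc hw x)

theorem conv_comm {f g : E d → ℝ} (hf : Continuous f) (hfc : HasCompactSupport f)
    (hg : Continuous g) (hgc : HasCompactSupport g) (hv : Continuous v) :
    conv f (conv g v) = conv g (conv f v) := by
  funext x
  have h1 := integral_integral_swap_of_hasCompactSupport (μ := (volume : Measure (E d)))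
    (ν := (volume : Measure (E d))) (f := fun t s => f t • g s • v (x - t - s)) ?_ ?_
  · simp only [conv, ← integral_smul]
    rw [h1]
    congr 1
    funext s
    congr 1
    funext t
    rw [smul_comm, sub_right_comm]
  · exact (by fun_prop : Continuous fun p : E d × E d => f p.1 • g p.2 • v (x - p.1 - p.2))
  · refine HasCompactSupport.intro (hfc.isCompact.prod hgc.isCompact) ?_
    rintro ⟨t, s⟩ hts
    rw [Set.mem_prod, not_and_or] at hts
    rcases hts with h | h
    · simp [Function.uncurry, image_eq_zero_of_notMem_tsupport h]
    · simp [Function.uncurry, image_eq_zero_of_notMem_tsupport h]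

theorem res_sub (hε : 0 < ε) (hv : LocallyIntegrable v) (hw : LocallyIntegrable w) :
    res ε (fun x => v x - w x) = fun x => res ε v x - res ε w x := by
  funext x
  rw [res, moll, conv_sub (contDiff_mollKer ε) (hasCompactSupport_mollKer hε) hv hw, res, res,
    moll, moll]
  module

theorem res_iterate_sub (hε : 0 < ε) (hv : LocallyIntegrable v) (hw : LocallyIntegrable w)
    (l : ℕ) : (res ε)^[l] (fun x => v x - w x)
      = fun x => (res ε)^[l] v x - (res ε)^[l] w x := by
  induction l with
  | zero => rfl
  | succ l ih =>
    rw [Function.iterate_succ_apply', ih, res_sub hε (locallyIntegrable_res_iterate hε hv l)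
      (locallyIntegrable_res_iterate hε hw l), Function.iterate_succ_apply',
      Function.iterate_succ_apply']

theorem res_comm {δ : ℝ} (hε : 0 < ε) (hδ : 0 < δ) (hv : ContDiff ℝ ∞ v) :
    res ε (res δ v) = res δ (res ε v) := by
  have h1 := hv.continuous.locallyIntegrable (μ := volume)
  have h2 : moll ε (res δ v) = fun x => moll ε v x - moll ε (moll δ v) x :=
    conv_sub (contDiff_mollKer ε) (hasCompactSupport_mollKer hε) h1
      (contDiff_moll hδ h1).continuous.locallyIntegrable
  have h3 : moll δ (res ε v) = fun x => moll δ v x - moll δ (moll ε v) x :=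
    conv_sub (contDiff_mollKer δ) (hasCompactSupport_mollKer hδ) h1
      (contDiff_moll hε h1).continuous.locallyIntegrable
  have h4 : moll ε (moll δ v) = moll δ (moll ε v) :=
    conv_comm (contDiff_mollKer ε).continuous (hasCompactSupport_mollKer hε)
      (contDiff_mollKer δ).continuous (hasCompactSupport_mollKer hδ) hv.continuous
  funext x
  rw [res, res, h2, res, res, h3, h4]
  module

theorem res_iterate_comm {δ : ℝ} (hε : 0 < ε) (hδ : 0 < δ) (hv : ContDiff ℝ ∞ v) (k l : ℕ) :
    (res ε)^[k] ((res δ)^[l] v) = (res δ)^[l] ((res ε)^[k] v) := by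
  have h1 : ∀ l, ∀ v : E d → W, ContDiff ℝ ∞ v →
      res ε ((res δ)^[l] v) = (res δ)^[l] (res ε v) := by
    intro l
    induction l with
    | zero => intro v _; rfl
    | succ l ih =>
      intro v hv
      rw [Function.iterate_succ_apply, ih _ (contDiff_res hδ hv), res_comm hε hδ hv,
        Function.iterate_succ_apply]
  induction k with
  | zero => rfl
  | succ k ih =>
    rw [Function.iterate_succ_apply', ih, h1 _ _ (contDiff_res_iterate hε hv k),
      Function.iterate_succ_apply']

theorem lpS_eq (L : ℕ) (ε : ℝ) (v : E d → W) :
    lpS L ε v = fun x => v x - (res ε)^[L] v x := by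
  funext x
  rw [res_iterate_eq, sub_sub_cancel]

/-- The Littlewood–Paley components telescope. -/
theorem lpP_eq (L : ℕ) (hε : 0 < ε) (hv : ContDiff ℝ ∞ v) (x : E d) :
    lpP L ε v x = lpS L (ε / 2) (lpS L (ε / 2) v) x - lpS L ε (lpS L ε v) x := by
  have hδ := half_pos hε
  set δ := ε / 2
  have l0 : ∀ {v : E d → W}, ContDiff ℝ ∞ v → LocallyIntegrable v := fun h =>
    h.continuous.locallyIntegrable
  have r1 := contDiff_res_iterate hε hv L
  have r2 := contDiff_res_iterate hδ hv L
  have e0 : (fun y => lpS L δ v y + lpS L ε v y)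
      = fun y => (v y - (res δ)^[L] v y) - ((res ε)^[L] v y - v y) := by
    funext y; rw [lpS_eq, lpS_eq]; module
  have e1 : ∀ {ζ : ℝ}, 0 < ζ → (res ζ)^[L] (fun y => lpS L δ v y + lpS L ε v y)
      = fun y => ((res ζ)^[L] v y - (res ζ)^[L] ((res δ)^[L] v) y)
        - ((res ζ)^[L] ((res ε)^[L] v) y - (res ζ)^[L] v y) := by
    intro ζ hζ
    rw [e0, res_iterate_sub hζ (l0 (hv.sub r2)) (l0 (r1.sub hv)),
      res_iterate_sub hζ (l0 hv) (l0 r2),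
      res_iterate_sub hζ (l0 r1) (l0 hv)]
  have e2 : ∀ {ζ : ℝ}, 0 < ζ → lpS L ζ (lpS L ζ v)
      = fun y => v y - (res ζ)^[L] v y - ((res ζ)^[L] v y - (res ζ)^[L] ((res ζ)^[L] v) y) := by
    intro ζ hζ
    rw [lpS_eq, lpS_eq, res_iterate_sub hζ (l0 hv) (l0 (contDiff_res_iterate hζ hv L))]
  rw [lpP, e1 hε, e1 hδ, e2 hε, e2 hδ, res_iterate_comm hε hδ hv]
  module

/-- The approximations converge. -/
theorem exists_eLpNorm_pdl_sub_lpS [CompleteSpace W] (hq : 1 < q) {L : ℕ} (hL : 1 ≤ L) :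
    ∃ K : ℝ≥0, ∀ (ε : ℝ), 0 < ε → ∀ (v : E d → W) (a : List (Fin d)) (B : ℝ≥0∞),
      ContDiff ℝ ∞ v → (∀ i, eLpNorm (pd i (pdl a v)) (ENNReal.ofReal q) ≤ B) →
      eLpNorm (pdl a (fun x => v x - lpS L ε (lpS L ε v) x)) (ENNReal.ofReal q)
        ≤ K * ENNReal.ofReal ε * B := by
  have hQ1 : 1 ≤ ENNReal.ofReal q := by simpa using hq.le
  obtain ⟨K, hK⟩ := exists_eLpNorm_pdl_lpS (W := W) (d := d) hq L []
  refine ⟨2 ^ L * d * (1 + K), fun ε hε v a B hv hB => ?_⟩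
  have hl := hv.continuous.locallyIntegrable (μ := volume)
  have hS := contDiff_lpS L hε hl
  have e1 : (fun x => v x - lpS L ε (lpS L ε v) x)
      = fun x => (res ε)^[L] v x + (res ε)^[L] (lpS L ε v) x := by
    funext x
    rw [res_iterate_eq, res_iterate_eq]
    abel
  have e2 : pdl a (lpS L ε v) = lpS L ε (pdl a v) :=
    pdl_lpS_of_weak L hε (weakPD_pdl _ a hv)
  have ha := contDiff_pdl a hv
  rw [e1, pdl_add a (contDiff_res_iterate hε hv L) (contDiff_res_iterate hε hS L),
    pdl_res_iterate a hε hv, pdl_res_iterate a hε hS, e2]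
  have hS' := contDiff_lpS L hε (ha.continuous.locallyIntegrable (μ := volume))
  have hB' : ∀ b : List (Fin d), b.length = 1 → ∃ i, b = [i] := fun b hb =>
    List.length_eq_one_iff.mp hb
  have b1 := eLpNorm_res_iterate_le_pdl' (C := B) hq hε hL ha fun b hb => by
    obtain ⟨i, rfl⟩ := hB' b hb
    exact hB i
  have b2 := eLpNorm_res_iterate_le_pdl' (C := K * B) hq hε hL hS' fun b hb => by
    obtain ⟨i, rfl⟩ := hB' b hb
    rw [pdl_lpS_of_weak L hε (weakPD_pdl _ [i] ha)]
    have := hK ε hε (pdl [i] (pdl a v))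
      (contDiff_pdl [i] ha).continuous.locallyIntegrable
    simp only [pdl, List.length_nil, pow_zero, ENNReal.ofReal_one, one_mul] at this
    exact this.trans (mul_le_mul_right (hB i) _)
  refine (eLpNorm_add_le (contDiff_res_iterate hε ha L).continuous.aestronglyMeasurable
    (contDiff_res_iterate hε hS' L).continuous.aestronglyMeasurable hQ1).trans ?_
  refine (add_le_add b1 b2).trans_eq ?_
  push_cast
  ring

end LittlewoodPaley

end HypSob

/-! ### Local Sobolev norms -/

namespace HypSob

open MeasureTheory

section Local

variable {d : ℕ} {W : Type*} [NormedAddCommGroup W] [NormedSpace ℂ W]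

theorem localNorm_le_sum (Ω : Set (E d)) (K : ℕ) (q : ℝ) {u : E d → W} (hu : ContDiff ℝ ∞ u) :
    localNorm Ω K q u ≤ ∑ j ∈ Finset.range (K + 1), ∑ a : Fin j → Fin d,
      eLpNorm (pdl (List.ofFn a) u) (ENNReal.ofReal q) (volume.restrict Ω) :=
  Finset.sum_le_sum fun _ _ => Finset.sum_le_sum fun a _ =>
    iInf₂_le (pdl (List.ofFn a) u) (isWeakDeriv_iff.mpr (weakPD_pdl Ω (List.ofFn a) hu))

/-- Functions of finite norm have weak derivatives, which almost realize the norm. -/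
theorem exists_weakPD_of_localNorm {Ω : Set (E d)} {κ : ℕ} {q : ℝ} {u : E d → W}
    (h : localNorm Ω κ q u ≠ ⊤) {δ : ℝ≥0∞} (hδ : δ ≠ 0) {a : List (Fin d)} (ha : a.length ≤ κ) :
    ∃ v, WeakPD Ω a u v ∧
      eLpNorm v (ENNReal.ofReal q) (volume.restrict Ω) ≤ localNorm Ω κ q u + δ := by
  have h1 : ⨅ (v : E d → W) (_ : IsWeakDeriv Ω a.get u v),
      eLpNorm v (ENNReal.ofReal q) (volume.restrict Ω) ≤ localNorm Ω κ q u := by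
    refine le_trans ?_ (Finset.single_le_sum (f := fun j => ∑ a : Fin j → Fin d,
      ⨅ (v : E d → W) (_ : IsWeakDeriv Ω a u v),
        eLpNorm v (ENNReal.ofReal q) (volume.restrict Ω)) (fun _ _ => zero_le)
      (Finset.mem_range.mpr (Nat.lt_succ_of_le ha)))
    exact Finset.single_le_sum (f := fun a : Fin a.length → Fin d =>
      ⨅ (v : E d → W) (_ : IsWeakDeriv Ω a u v),
        eLpNorm v (ENNReal.ofReal q) (volume.restrict Ω)) (fun _ _ => zero_le)
      (Finset.mem_univ a.get)
  have h2 := h1.trans_lt (ENNReal.lt_add_right h hδ)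
  obtain ⟨v, h3⟩ := iInf_lt_iff.mp h2
  obtain ⟨hv, h4⟩ := iInf_lt_iff.mp h3
  rw [isWeakDeriv_iff, List.ofFn_get] at hv
  exact ⟨v, hv, h4.le⟩

theorem locallyIntegrable_cutoff {Ω : Set (E d)} {χ : E d → ℝ} (hχ : ContDiff ℝ ∞ χ)
    (hc : HasCompactSupport χ) (hs : tsupport χ ⊆ Ω) {u : E d → W}
    (hu : LocallyIntegrableOn u Ω) : LocallyIntegrable fun x => χ x • u x :=
  (integrable_smul_of_tsupport hχ.continuous hc hs hu).locallyIntegrable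

omit [NormedSpace ℂ W] in
theorem eLpNorm_list_sum_le {α ι : Type*} [MeasurableSpace α] {μ : Measure α} {p : ℝ≥0∞}
    (hp : 1 ≤ p) (s : List ι) {f : ι → α → W} (hf : ∀ i ∈ s, AEStronglyMeasurable (f i) μ)
    {C : ι → ℝ≥0∞} (hC : ∀ i ∈ s, eLpNorm (f i) p μ ≤ C i) :
    eLpNorm (fun x => (s.map fun i => f i x).sum) p μ ≤ (s.map C).sum ∧
      AEStronglyMeasurable (fun x => (s.map fun i => f i x).sum) μ := by
  induction s with
  | nil => simpa using aestronglyMeasurable_const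
  | cons i s ih =>
    obtain ⟨h1, h2⟩ := ih (fun j hj => hf j (List.mem_cons_of_mem _ hj))
      fun j hj => hC j (List.mem_cons_of_mem _ hj)
    have h3 := hf i List.mem_cons_self
    simp only [List.map_cons, List.sum_cons]
    exact ⟨(eLpNorm_add_le h3 h2 hp).trans (add_le_add (hC i List.mem_cons_self) h1), h3.add h2⟩

/-- Multiplication by a cutoff function turns weak derivatives on an open set into weak
derivatives on the whole space. -/
theorem exists_weakPD_cutoff {Ω : Set (E d)} (hΩ : IsOpen Ω) {χ : E d → ℝ} (hχ : ContDiff ℝ ∞ χ)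
    (hc : HasCompactSupport χ) (hs : tsupport χ ⊆ Ω) {q : ℝ} (hq : 1 < q) (a : List (Fin d)) :
    ∃ C : ℝ≥0, ∀ (u : E d → W) (B : ℝ≥0∞), (∀ b : List (Fin d), b.length ≤ a.length →
      ∃ v, WeakPD Ω b u v ∧ eLpNorm v (ENNReal.ofReal q) (volume.restrict Ω) ≤ B) →
      ∃ w, WeakPD Set.univ a (fun x => χ x • u x) w ∧ eLpNorm w (ENNReal.ofReal q) ≤ C * B := by
  have hQ1 : 1 ≤ ENNReal.ofReal q := by simpa using hq.le
  obtain ⟨s, hs1, hs2⟩ := exists_leibniz a hχ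
  have hcs : ∀ p ∈ s, HasCompactSupport p.2 := fun p hp =>
    hc.of_isClosed_subset (isClosed_tsupport _) (hs1 p hp).2.2
  have hbd : ∀ p ∈ s, ∃ M : ℝ≥0, ∀ x, ‖p.2 x‖ ≤ M := fun p hp => by
    obtain ⟨M, hM⟩ := (hcs p hp).exists_bound_of_continuous (hs1 p hp).2.1.continuous
    exact ⟨M.toNNReal, fun x => (hM x).trans (Real.le_coe_toNNReal M)⟩
  choose! M hM using hbd
  refine ⟨(s.map M).sum, fun u B h => ?_⟩
  have h' : ∀ b : List (Fin d), ∃ v, b.length ≤ a.length → (WeakPD Ω b u v ∧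
      eLpNorm v (ENNReal.ofReal q) (volume.restrict Ω) ≤ B) := fun b => by
    by_cases hb : b.length ≤ a.length
    · obtain ⟨v, hv⟩ := h b hb
      exact ⟨v, fun _ => hv⟩
    · exact ⟨0, fun hb' => absurd hb' hb⟩
  choose v hv using h'
  have hu : LocallyIntegrableOn u Ω := (hv [] (Nat.zero_le _)).1.1
  have hint : ∀ p ∈ s, Integrable fun x => p.2 x • v p.1 x := fun p hp =>
    integrable_smul_of_tsupport (hs1 p hp).2.1.continuous (hcs p hp) ((hs1 p hp).2.2.trans hs)
      (hv p.1 (hs1 p hp).1).1.2.1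
  set c : List (Fin d) × (E d → ℝ) → ℝ := fun p => (-1) ^ a.length * (-1) ^ p.1.length with hcdef
  have hcn : ∀ p, ‖c p‖ = 1 := fun p => by simp [hcdef]
  set w : E d → W := fun x => (s.map fun p => c p • p.2 x • v p.1 x).sum with hw
  have hbound : ∀ p ∈ s, eLpNorm (fun x => c p • p.2 x • v p.1 x) (ENNReal.ofReal q)
      ≤ M p * B := by
    intro p hp
    have e1 : (fun x => c p • p.2 x • v p.1 x)
        = Ω.indicator (fun x => c p • p.2 x • v p.1 x) := by
      refine (Set.indicator_eq_self.mpr fun x hx => ?_).symm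
      refine hs ((hs1 p hp).2.2 (subset_tsupport _ fun h0 => hx ?_))
      simp only [h0, zero_smul, smul_zero]
    rw [e1, eLpNorm_indicator_eq_eLpNorm_restrict hΩ.measurableSet]
    refine (eLpNorm_le_nnreal_smul_eLpNorm_of_ae_le_mul (c := M p) (g := v p.1)
      (Filter.Eventually.of_forall fun x => ?_) _).trans ?_
    · rw [← NNReal.coe_le_coe, NNReal.coe_mul, coe_nnnorm, coe_nnnorm, norm_smul, norm_smul, hcn,
        one_mul]
      exact mul_le_mul_of_nonneg_right (hM p hp x) (norm_nonneg _)
    · rw [ENNReal.smul_def, smul_eq_mul]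
      exact mul_le_mul_right (hv p.1 (hs1 p hp).1).2 _
  have hsum := eLpNorm_list_sum_le (μ := (volume : Measure (E d))) hQ1 s
    (f := fun p x => c p • p.2 x • v p.1 x)
    (fun p hp => ((hint p hp).smul (c p)).aestronglyMeasurable) hbound
  refine ⟨w, ⟨?_, ?_, fun η hη hηc _ => ?_⟩, ?_⟩
  · exact (locallyIntegrable_cutoff hχ hc hs hu).locallyIntegrableOn _
  · have : Integrable w := by
      have key : ∀ s' : List (List (Fin d) × (E d → ℝ)), (∀ p ∈ s', p ∈ s) →
          Integrable fun x => (s'.map fun p => c p • p.2 x • v p.1 x).sum := by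
        intro s'
        induction s' with
        | nil => intro _; simp
        | cons p s' ih =>
          intro hs'
          simp only [List.map_cons, List.sum_cons]
          exact ((hint p (hs' p List.mem_cons_self)).smul (c p)).add
            (ih fun p hp => hs' p (List.mem_cons_of_mem _ hp))
      exact key s fun p hp => hp
    exact this.locallyIntegrable.locallyIntegrableOn _
  · have e1 : ∀ x, pdl a η x • χ x • u x
        = (s.map fun p => pdl p.1 (fun y => p.2 y * η y) x • u x).sum := by
      intro x
      rw [smul_smul, mul_comm, hs2 η hη x]
      have : ∀ s' : List (List (Fin d) × (E d → ℝ)),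
          (s'.map fun p => pdl p.1 (fun y => p.2 y * η y) x).sum • u x
            = (s'.map fun p => pdl p.1 (fun y => p.2 y * η y) x • u x).sum := by
        intro s'
        induction s' with
        | nil => simp
        | cons p s' ih => simp only [List.map_cons, List.sum_cons, add_smul, ih]
      exact this s
    have key : ∀ s' : List (List (Fin d) × (E d → ℝ)), (∀ p ∈ s', p ∈ s) →
        (Integrable fun x => (s'.map fun p => pdl p.1 (fun y => p.2 y * η y) x • u x).sum) ∧
        (Integrable fun x => η x • (s'.map fun p => c p • p.2 x • v p.1 x).sum) ∧
        ∫ x, (s'.map fun p => pdl p.1 (fun y => p.2 y * η y) x • u x).sum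
          = (-1 : ℝ) ^ a.length • ∫ x, η x • (s'.map fun p => c p • p.2 x • v p.1 x).sum := by
      intro s'
      induction s' with
      | nil => intro _; simp
      | cons p s' ih =>
        intro hs'
        have hp := hs' p List.mem_cons_self
        obtain ⟨i1, i2, i3⟩ := ih fun p hp => hs' p (List.mem_cons_of_mem _ hp)
        have hpη : ContDiff ℝ ∞ (fun y => p.2 y * η y) := (hs1 p hp).2.1.mul hη
        have hpc : HasCompactSupport (fun y => p.2 y * η y) := hηc.mul_left
        have hps : tsupport (fun y => p.2 y * η y) ⊆ Ω :=
          ((tsupport_mul_subset_left (f := p.2) (g := η)).trans (hs1 p hp).2.2).trans hs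
        have j1 : Integrable fun x => pdl p.1 (fun y => p.2 y * η y) x • u x :=
          integrable_smul_of_tsupport (contDiff_pdl _ hpη).continuous
            (hasCompactSupport_pdl _ hpc) ((tsupport_pdl _ _).trans hps) hu
        have j2 : Integrable fun x => η x • c p • p.2 x • v p.1 x := by
          have := (integrable_smul_of_tsupport hpη.continuous hpc hps
            (hv p.1 (hs1 p hp).1).1.2.1).smul (c p)
          refine this.congr (Filter.Eventually.of_forall fun x => ?_)
          simp only [Pi.smul_apply, smul_smul]
          congr 1
          ring
        have j3 := (hv p.1 (hs1 p hp).1).1.2.2 _ hpη hpc hps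
        simp only [List.map_cons, List.sum_cons, smul_add]
        refine ⟨j1.add i1, j2.add i2, ?_⟩
        rw [integral_add j1 i1, integral_add j2 i2, i3, j3, smul_add]
        congr 1
        have e2 : (fun x => η x • c p • p.2 x • v p.1 x)
            = fun x => c p • (p.2 x * η x) • v p.1 x := by
          funext x
          simp only [smul_smul]
          congr 1
          ring
        rw [e2, integral_smul, smul_smul, hcdef, ← mul_assoc, ← mul_pow, neg_one_mul, neg_neg,
          one_pow, one_mul]
    simp only [e1]
    exact (key s fun p hp => hp).2.2
  · refine hsum.1.trans_eq ?_
    have : ∀ s' : List (List (Fin d) × (E d → ℝ)),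
        (s'.map fun p => (M p : ℝ≥0∞) * B).sum = ((s'.map M).sum : ℝ≥0) * B := by
      intro s'
      induction s' with
      | nil => simp
      | cons p s' ih => simp only [List.map_cons, List.sum_cons, ih, ENNReal.coe_add, add_mul]
    exact this s

theorem le_mul_of_forall_le_mul_add {x A N : ℝ≥0∞} (hA : A ≠ ⊤)
    (h : ∀ δ : ℝ≥0∞, δ ≠ 0 → x ≤ A * (N + δ)) : x ≤ A * N := by
  have h1 : Filter.Tendsto (fun δ : ℝ≥0∞ => A * (N + δ)) (𝓝[≠] 0) (𝓝 (A * (N + 0))) :=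
    ENNReal.Tendsto.const_mul ((tendsto_const_nhds.add Filter.tendsto_id).mono_left
      nhdsWithin_le_nhds) (Or.inr hA)
  rw [add_zero] at h1
  refine ge_of_tendsto h1 ?_
  filter_upwards [self_mem_nhdsWithin] with δ hδ using h δ hδ

/-- The Littlewood–Paley components of a localized function of finite Sobolev norm. -/
theorem exists_eLpNorm_lpP_cutoff [CompleteSpace W] {Ω : Set (E d)} (hΩ : IsOpen Ω) {χ : E d → ℝ}
    (hχ : ContDiff ℝ ∞ χ) (hc : HasCompactSupport χ) (hs : tsupport χ ⊆ Ω) {q : ℝ} (hq : 1 < q)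
    {κ L : ℕ} (hκ : κ ≤ L) (b : List (Fin d)) : ∃ K : ℝ≥0, ∀ (ε : ℝ), 0 < ε → ∀ u : E d → W,
      localNorm Ω κ q u ≠ ⊤ →
      eLpNorm (pdl b (lpP L ε fun x => χ x • u x)) (ENNReal.ofReal q)
        ≤ K * (ENNReal.ofReal (ε ^ κ) * ENNReal.ofReal (ε⁻¹ ^ b.length)) * localNorm Ω κ q u := by
  obtain ⟨K, hK⟩ := exists_eLpNorm_pdl_lpP (W := W) hq hκ b
  choose C hC using exists_weakPD_cutoff (W := W) hΩ hχ hc hs hq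
  set C' : ℝ≥0 := ∑ a : Fin κ → Fin d, C (List.ofFn a) with hC'
  refine ⟨K * C', fun ε hε u hu => ?_⟩
  refine le_mul_of_forall_le_mul_add (by
    exact ENNReal.mul_ne_top ENNReal.coe_ne_top
      (ENNReal.mul_ne_top ENNReal.ofReal_ne_top ENNReal.ofReal_ne_top)) fun δ hδ => ?_
  obtain ⟨v₀, hv₀, -⟩ := exists_weakPD_of_localNorm hu hδ (a := []) (Nat.zero_le κ)
  refine (hK ε hε _ (C' * (localNorm Ω κ q u + δ))
    (locallyIntegrable_cutoff hχ hc hs hv₀.1) fun a ha => ?_).trans_eq ?_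
  · obtain ⟨w, hw, hw'⟩ := hC a u (localNorm Ω κ q u + δ) fun b hb =>
      exists_weakPD_of_localNorm hu hδ (hb.trans ha.le)
    refine ⟨w, hw, hw'.trans (mul_le_mul_left ?_ _)⟩
    subst ha
    have : C (List.ofFn a.get) ≤ C' :=
      Finset.single_le_sum (f := fun a : Fin a.length → Fin d => C (List.ofFn a))
        (fun _ _ => zero_le) (Finset.mem_univ a.get)
    rw [List.ofFn_get] at this
    exact_mod_cast this
  · push_cast
    ring

end Local

end HypSob

/-! ### Estimates of sections supported in the big cell -/

namespace HypSob

open MeasureTheory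

section Composition

variable {V₀ V₁ W W' : Type*} [NormedAddCommGroup V₀] [NormedSpace ℝ V₀] [NormedAddCommGroup V₁]
  [NormedSpace ℝ V₁] [NormedAddCommGroup W] [NormedSpace ℝ W] [NormedAddCommGroup W']
  [NormedSpace ℝ W']

/-- The derivatives of `x ↦ A(x) u(f(x))` on a compact set are bounded by those of `u`. -/
theorem exists_bound_iteratedFDeriv_comp {U Z : Set V₀} (hU : IsOpen U) (hZ : IsCompact Z)
    (hZU : Z ⊆ U) {A : V₀ → W →L[ℝ] W'} (hA : ContDiffOn ℝ ∞ A U) {f : V₀ → V₁}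
    (hf : ContDiffOn ℝ ∞ f U) (l : ℕ) : ∃ C : ℝ≥0, ∀ (u : V₁ → W) (g : V₀ → W'),
      ContDiff ℝ ∞ u → (∀ x ∈ U, g x = A x (u (f x))) → ∀ x ∈ Z, ∀ j ≤ l,
        ‖iteratedFDeriv ℝ j g x‖
          ≤ C * ∑ i ∈ Finset.range (j + 1), ‖iteratedFDeriv ℝ i u (f x)‖ := by
  have hUD := hU.uniqueDiffOn (𝕜 := ℝ)
  have hle : ∀ i : ℕ, (i : WithTop ℕ∞) ≤ (∞ : WithTop ℕ∞) := fun i => by exact_mod_cast le_top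
  have hbA : ∀ i : ℕ, ∃ M, ∀ x ∈ Z, ‖iteratedFDerivWithin ℝ i A U x‖ ≤ M := fun i =>
    hZ.exists_bound_of_continuousOn ((hA.continuousOn_iteratedFDerivWithin (hle i) hUD).mono hZU)
  have hbf : ∀ i : ℕ, ∃ M, ∀ x ∈ Z, ‖iteratedFDerivWithin ℝ i f U x‖ ≤ M := fun i =>
    hZ.exists_bound_of_continuousOn ((hf.continuousOn_iteratedFDerivWithin (hle i) hUD).mono hZU)
  choose MA hMA using hbA
  choose Mf hMf using hbf
  set M : ℝ := 1 + ∑ i ∈ Finset.range (l + 1), (|MA i| + |Mf i|) with hM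
  have hM1 : 1 ≤ M := by
    rw [hM]
    have : 0 ≤ ∑ i ∈ Finset.range (l + 1), (|MA i| + |Mf i|) :=
      Finset.sum_nonneg fun i _ => by positivity
    linarith
  have hMi : ∀ i ≤ l, |MA i| + |Mf i| ≤ M := fun i hi => by
    have := Finset.single_le_sum (f := fun i => |MA i| + |Mf i|)
      (fun i _ => by positivity) (Finset.mem_range.mpr (Nat.lt_succ_of_le hi))
    rw [hM]
    linarith
  have hC0 : 0 ≤ (l + 1) * (2 ^ l * M * (l.factorial * M ^ l)) := by positivity
  refine ⟨⟨(l + 1) * (2 ^ l * M * (l.factorial * M ^ l)), hC0⟩, fun u g hu hg x hx j hj => ?_⟩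
  have hxU := hZU hx
  set S := ∑ i ∈ Finset.range (j + 1), ‖iteratedFDeriv ℝ i u (f x)‖ with hS
  have hS0 : 0 ≤ S := Finset.sum_nonneg fun i _ => norm_nonneg _
  have huf : ContDiffOn ℝ ∞ (fun x => u (f x)) U := hu.comp_contDiffOn hf
  have e1 : iteratedFDeriv ℝ j g x = iteratedFDerivWithin ℝ j (fun x => A x (u (f x))) U x := by
    rw [← iteratedFDerivWithin_of_isOpen j hU hxU]
    exact iteratedFDerivWithin_congr hg hxU j
  have e2 : ∀ i ≤ j, ‖iteratedFDerivWithin ℝ i (fun x => u (f x)) U x‖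
      ≤ l.factorial * S * M ^ l := by
    intro i hi
    have h1 := norm_iteratedFDerivWithin_comp_le (g := u) (f := f) (n := i) (s := U)
      (t := Set.univ) (N := ∞) (C := S) (D := M) hu.contDiffOn hf (hle i) uniqueDiffOn_univ hUD
      (Set.mapsTo_univ _ _) hxU (fun i' hi' => ?_) (fun i' h1 hi' => ?_)
    · refine h1.trans ?_
      have h2 : ((i.factorial : ℕ) : ℝ) ≤ l.factorial := by
        exact_mod_cast Nat.factorial_le (hi.trans hj)
      have h3 : M ^ i ≤ M ^ l := pow_le_pow_right₀ hM1 (hi.trans hj)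
      gcongr
    · rw [iteratedFDerivWithin_univ]
      exact Finset.single_le_sum (f := fun i => ‖iteratedFDeriv ℝ i u (f x)‖)
        (fun i _ => norm_nonneg _) (Finset.mem_range.mpr (by omega))
    · refine (hMf i' x hx).trans ((le_abs_self _).trans ?_)
      refine le_trans ?_ (le_self_pow₀ hM1 (by omega))
      have := hMi i' (by omega)
      have := abs_nonneg (MA i')
      linarith
  rw [e1]
  refine (norm_iteratedFDerivWithin_clm_apply hA huf hUD hxU (hle j)).trans ?_
  have e3 : ∀ i ∈ Finset.range (j + 1),
      (j.choose i : ℝ) * ‖iteratedFDerivWithin ℝ i A U x‖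
        * ‖iteratedFDerivWithin ℝ (j - i) (fun x => u (f x)) U x‖
      ≤ 2 ^ l * M * (l.factorial * S * M ^ l) := by
    intro i hi
    have hi' : i ≤ j := Nat.lt_succ_iff.mp (Finset.mem_range.mp hi)
    have h1 : (j.choose i : ℝ) ≤ 2 ^ l := by
      have : j.choose i ≤ 2 ^ l :=
        (Nat.choose_le_two_pow j i).trans (Nat.pow_le_pow_right (by norm_num) hj)
      exact_mod_cast this
    have h2 : ‖iteratedFDerivWithin ℝ i A U x‖ ≤ M := by
      have := hMi i (hi'.trans hj)
      have := abs_nonneg (Mf i)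
      exact (hMA i x hx).trans ((le_abs_self _).trans (by linarith))
    have h3 := e2 (j - i) (Nat.sub_le _ _)
    gcongr
  refine (Finset.sum_le_sum e3).trans ?_
  rw [Finset.sum_const, Finset.card_range, nsmul_eq_mul]
  change _ ≤ (l + 1) * (2 ^ l * M * (l.factorial * M ^ l)) * S
  have h4 : ((j + 1 : ℕ) : ℝ) ≤ l + 1 := by exact_mod_cast Nat.succ_le_succ hj
  calc ((j + 1 : ℕ) : ℝ) * (2 ^ l * M * (l.factorial * S * M ^ l))
      ≤ (l + 1) * (2 ^ l * M * (l.factorial * S * M ^ l)) := by gcongr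
    _ = _ := by ring

omit [NormedSpace ℝ W] in
/-- Change of variables on a compact set. -/
theorem exists_eLpNorm_comp_le {d : ℕ} {f : E d → E d} {U Z : Set (E d)} (hU : IsOpen U)
    (hZ : IsCompact Z) (hZU : Z ⊆ U) (hf : ContDiffOn ℝ ∞ f U) (hinj : Set.InjOn f U)
    (hdet : ∀ x ∈ U, (fderiv ℝ f x).det ≠ 0) {q : ℝ} (hq : 1 < q) : ∃ C : ℝ≥0, ∀ w : E d → W,
      eLpNorm (fun x => w (f x)) (ENNReal.ofReal q) (volume.restrict Z)
        ≤ C * eLpNorm w (ENNReal.ofReal q) := by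
  have hq0 : 0 < q := by linarith
  have hQ : (ENNReal.ofReal q) ≠ 0 := by simpa using hq0
  rcases Z.eq_empty_or_nonempty with rfl | hne
  · exact ⟨0, fun w => by simp⟩
  have hcont : ContinuousOn (fun x => |(fderiv ℝ f x).det|) Z := by
    have h1 : ContinuousOn (fderiv ℝ f) U := hf.continuousOn_fderiv_of_isOpen hU (by simp)
    exact (ContinuousLinearMap.continuous_det.comp_continuousOn (h1.mono hZU)).abs
  obtain ⟨x₀, hx₀, hmin⟩ := hZ.exists_isMinOn hne hcont
  set m := |(fderiv ℝ f x₀).det| with hm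
  have hm0 : 0 < m := abs_pos.mpr (hdet x₀ (hZU hx₀))
  refine ⟨(m⁻¹ ^ (1 / q)).toNNReal, fun w => ?_⟩
  have key : ∫⁻ x in Z, ‖w (f x)‖ₑ ^ q ≤ ENNReal.ofReal m⁻¹ * ∫⁻ y, ‖w y‖ₑ ^ q := by
    have h1 := lintegral_image_eq_lintegral_abs_det_fderiv_mul volume hZ.measurableSet
      (f := f) (f' := fderiv ℝ f) (fun x hx => (((hf.contDiffAt
        (hU.mem_nhds (hZU hx))).differentiableAt (by simp)).hasFDerivAt).hasFDerivWithinAt)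
      (hinj.mono hZU) (fun y => ‖w y‖ₑ ^ q)
    calc ∫⁻ x in Z, ‖w (f x)‖ₑ ^ q
        ≤ ∫⁻ x in Z, ENNReal.ofReal m⁻¹ *
            (ENNReal.ofReal |(fderiv ℝ f x).det| * ‖w (f x)‖ₑ ^ q) := by
          refine setLIntegral_mono' hZ.measurableSet fun x hx => ?_
          rw [← mul_assoc, ← ENNReal.ofReal_mul (by positivity)]
          refine le_mul_of_one_le_left zero_le ?_
          rw [ENNReal.one_le_ofReal, ← div_eq_inv_mul, one_le_div hm0]
          exact hmin hx
      _ = ENNReal.ofReal m⁻¹ * ∫⁻ y in f '' Z, ‖w y‖ₑ ^ q := by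
          rw [lintegral_const_mul' _ _ ENNReal.ofReal_ne_top, ← h1]
      _ ≤ _ := mul_le_mul_right (setLIntegral_le_lintegral _ _) _
  rw [eLpNorm_eq_lintegral_rpow_enorm_toReal hQ ENNReal.ofReal_ne_top,
    eLpNorm_eq_lintegral_rpow_enorm_toReal hQ ENNReal.ofReal_ne_top, ENNReal.toReal_ofReal hq0.le]
  refine (ENNReal.rpow_le_rpow key (by positivity)).trans_eq ?_
  rw [ENNReal.mul_rpow_of_nonneg _ _ (by positivity),
    ENNReal.ofReal_rpow_of_pos (by positivity)]
  rfl

end Composition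

/-- The `L^q` norm of the derivatives of order `i`. -/
def derNorm {d : ℕ} {W : Type*} [NormedAddCommGroup W] [NormedSpace ℝ W] (q : ℝ) (i : ℕ)
    (u : E d → W) : ℝ≥0∞ :=
  ∑ a : Fin i → Fin d, eLpNorm (pdl (List.ofFn a) u) (ENNReal.ofReal q)

/-- The smooth functions with compact support. -/
def TestFn (d : ℕ) (W : Type*) [NormedAddCommGroup W] [NormedSpace ℂ W] :
    Submodule ℂ (E d → W) where
  carrier := {u | ContDiff ℝ ∞ u ∧ HasCompactSupport u}
  add_mem' h h' := ⟨h.1.add h'.1, h.2.add h'.2⟩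
  zero_mem' := ⟨contDiff_const, HasCompactSupport.zero⟩
  smul_mem' c _ h := ⟨h.1.const_smul c, h.2.smul_left (f := fun _ => c)⟩

theorem TestFn.exists_radius {d : ℕ} {W : Type*} [NormedAddCommGroup W] [NormedSpace ℂ W]
    (u : TestFn d W) : ∃ R : ℝ, 0 ≤ R ∧ ∀ y, R < ‖y‖ → u.1 y = 0 := by
  obtain ⟨R, hR⟩ := u.2.2.isCompact.isBounded.subset_closedBall 0
  refine ⟨max R 0, le_max_right _ _, fun y hy => ?_⟩
  by_contra h
  have := hR (subset_tsupport _ h)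
  rw [mem_closedBall_zero_iff] at this
  linarith [le_max_left R 0]

namespace Geom

variable {n : ℕ} {D : CellData (n - 1)} (X : Geom n D)
  {W : Type*} [NormedAddCommGroup W] [NormedSpace ℂ W] [FiniteDimensional ℂ W]
  {τ : Representation ℂ D.M W}

theorem injOn_pos (γ : D.G) : Set.InjOn (fun x => X.pos (γ * D.opp x)) (X.dom γ) := by
  intro x hx y hy h
  rw [← (X.inv_mul_opp_pos hx).2, ← (X.inv_mul_opp_pos hy).2]
  simp only at h
  rw [h]

theorem det_fderiv_pos_ne_zero (γ : D.G) {x : E (n - 1)} (hx : x ∈ X.dom γ) :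
    (fderiv ℝ (fun x => X.pos (γ * D.opp x)) x).det ≠ 0 := by
  obtain ⟨h1, h2⟩ := X.inv_mul_opp_pos hx
  have d1 := ((X.contDiffOn_pos γ).contDiffAt ((X.isOpen_dom γ).mem_nhds hx)).differentiableAt
    (by simp)
  have d2 := ((X.contDiffOn_pos γ⁻¹).contDiffAt ((X.isOpen_dom γ⁻¹).mem_nhds h1)).differentiableAt
    (by simp)
  have h3 := d2.hasFDerivAt.comp x d1.hasFDerivAt
  have h4 : HasFDerivAt (fun y => X.pos (γ⁻¹ * D.opp (X.pos (γ * D.opp y))))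
      (ContinuousLinearMap.id ℝ (E (n - 1))) x := by
    refine (hasFDerivAt_id x).congr_of_eventuallyEq ?_
    filter_upwards [(X.isOpen_dom γ).mem_nhds hx] with y hy using (X.inv_mul_opp_pos hy).2
  have h5 := congrArg ContinuousLinearMap.det (h3.unique h4)
  intro h0
  rw [ContinuousLinearMap.det, ContinuousLinearMap.toLinearMap_comp, LinearMap.det_comp] at h5
  rw [ContinuousLinearMap.det] at h0
  rw [h0, mul_zero, ContinuousLinearMap.det, ContinuousLinearMap.coe_id, LinearMap.det_id] at h5
  exact zero_ne_one h5

/-- The norms of a section supported in the big cell, in any chart. -/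
theorem exists_eLpNorm_chart_le (hτ : Continuous (opRep τ)) (μ : ℂ) (γ : D.G) {R : ℝ} (hR : 0 ≤ R)
    {q : ℝ} (hq : 1 < q) (K : ℕ) : ∃ C : ℝ≥0, ∀ u : E (n - 1) → W, ContDiff ℝ ∞ u →
      (∀ y, R < ‖y‖ → u y = 0) → ∀ b : List (Fin (n - 1)), b.length ≤ K →
        eLpNorm (pdl b (D.chart (X.cellFun τ μ u) γ)) (ENNReal.ofReal q)
            (volume.restrict (Metric.ball 0 2))
          ≤ C * ∑ i ∈ Finset.range (K + 1), derNorm q i u := by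
  have hQ1 : 1 ≤ ENNReal.ofReal q := by simpa using hq.le
  set Z := X.ballDom γ R ∩ Metric.closedBall 0 2 with hZdef
  have hZ : IsCompact Z := (isCompact_closedBall _ _).inter_left (X.isClosed_ballDom γ hR)
  have hZU : Z ⊆ X.dom γ := fun x hx => hx.1.1
  have hpos := X.contDiffOn_pos γ
  obtain ⟨C₁, hC₁⟩ := exists_bound_iteratedFDeriv_comp (X.isOpen_dom γ) hZ hZU
    (A := fun x => ContinuousLinearMap.restrictScalarsL ℂ W W ℝ ℝ (X.trans τ μ γ x))
    ((ContinuousLinearMap.restrictScalarsL ℂ W W ℝ ℝ).contDiff.comp_contDiffOn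
      (X.contDiffOn_trans hτ μ γ)) hpos K
  obtain ⟨C₂, hC₂⟩ := exists_eLpNorm_comp_le (W := W) (X.isOpen_dom γ) hZ hZU hpos
    (X.injOn_pos γ) (fun x hx => X.det_fderiv_pos_ne_zero γ hx) hq
  refine ⟨C₁ * C₂, fun u hu huR b hb => ?_⟩
  set f := D.chart (X.cellFun τ μ u) γ with hf
  have hfs : ContDiff ℝ ∞ f := X.contDiff_chart_cellFun hτ μ hu hR huR γ
  have hsupp : tsupport (pdl b f) ⊆ X.ballDom γ R := by
    refine (tsupport_pdl b f).trans (closure_minimal ?_ (X.isClosed_ballDom γ hR))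
    intro x hx
    by_contra h
    exact hx (X.chart_cellFun_eq_zero τ μ huR h)
  have e1 : eLpNorm (pdl b f) (ENNReal.ofReal q) (volume.restrict (Metric.ball 0 2))
      ≤ eLpNorm (pdl b f) (ENNReal.ofReal q) (volume.restrict Z) := by
    rw [← eLpNorm_indicator_eq_eLpNorm_restrict hZ.measurableSet]
    refine le_trans (le_of_eq ?_) (eLpNorm_mono_measure _
      (Measure.restrict_le_self (μ := volume) (s := Metric.ball (0 : E (n - 1)) 2)))
    refine eLpNorm_congr_ae ?_
    filter_upwards [ae_restrict_mem Metric.isOpen_ball.measurableSet] with x hx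
    by_cases hxZ : x ∈ X.ballDom γ R
    · rw [Set.indicator_of_mem (show x ∈ Z from ⟨hxZ, Metric.ball_subset_closedBall hx⟩)]
    · rw [Set.indicator_of_notMem (show x ∉ Z from fun h => hxZ h.1)]
      exact image_eq_zero_of_notMem_tsupport fun h => hxZ (hsupp h)
  refine e1.trans ?_
  set G : (Σ i : ℕ, (Fin i → Fin (n - 1))) → E (n - 1) → ℝ := fun p x =>
    ‖pdl (List.ofFn p.2) u (X.pos (γ * D.opp x))‖ with hG
  set I : Finset (Σ i : ℕ, (Fin i → Fin (n - 1))) :=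
    (Finset.range (K + 1)).sigma fun _ => Finset.univ with hI
  have e2 : ∀ᵐ x ∂volume.restrict Z, ‖pdl b f x‖₊ ≤ C₁ * ‖(∑ p ∈ I, G p) x‖₊ := by
    filter_upwards [ae_restrict_mem hZ.measurableSet] with x hx
    rw [← NNReal.coe_le_coe, NNReal.coe_mul, coe_nnnorm, coe_nnnorm]
    refine (norm_pdl_le b hfs x).trans ((hC₁ u f hu (fun x hx => X.chart_cellFun τ μ u hx) x hx _
      hb).trans (mul_le_mul_of_nonneg_left ?_ C₁.2))
    refine le_trans ?_ (le_abs_self _)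
    rw [Finset.sum_apply, hI, Finset.sum_sigma]
    refine (Finset.sum_le_sum fun i _ => norm_iteratedFDeriv_le_sum i hu _).trans ?_
    exact Finset.sum_le_sum_of_subset_of_nonneg (Finset.range_mono (by omega))
      fun _ _ _ => Finset.sum_nonneg fun _ _ => norm_nonneg _
  refine (eLpNorm_le_nnreal_smul_eLpNorm_of_ae_le_mul e2 _).trans ?_
  rw [ENNReal.smul_def, smul_eq_mul, ENNReal.coe_mul, mul_assoc]
  refine mul_le_mul_right ?_ _
  refine (eLpNorm_sum_le (fun p _ => ?_) hQ1).trans ?_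
  · refine ContinuousOn.aestronglyMeasurable ?_ hZ.measurableSet
    exact ((contDiff_pdl _ hu).continuous.comp_continuousOn (hpos.continuousOn.mono hZU)).norm
  · rw [hI, Finset.sum_sigma, Finset.mul_sum]
    refine Finset.sum_le_sum fun i _ => ?_
    rw [derNorm, Finset.mul_sum]
    refine Finset.sum_le_sum fun a _ => ?_
    rw [hG]
    simp only
    rw [eLpNorm_norm]
    exact hC₂ _

/-- The section which is supported in the translate by `a` of the big cell and has there the given
expression. -/
def cellSec (hτ : Continuous (opRep τ)) (μ : ℂ) (a : D.G) : TestFn (n - 1) W →ₗ[ℂ] D.SmoothSec τ μ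
    where
  toFun u := ⟨⟨fun g => X.cellFun τ μ u.1 (a⁻¹ * g), by
      obtain ⟨h1, h2, h3⟩ := X.cellFun_mem τ μ u.1
      exact ⟨fun g b => by simp only [← mul_assoc, h1], fun g t => by simp only [← mul_assoc, h2],
        fun g x => by simp only [← mul_assoc, h3]⟩⟩, fun g => by
      obtain ⟨R, hR, huR⟩ := TestFn.exists_radius u
      have h := X.contDiff_chart_cellFun hτ μ u.2.1 hR huR (a⁻¹ * g)
      have e : D.chart (fun g => X.cellFun τ μ u.1 (a⁻¹ * g)) g
          = D.chart (X.cellFun τ μ u.1) (a⁻¹ * g) := by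
        funext x
        simp only [CellData.chart, mul_assoc]
      exact e ▸ h⟩
  map_add' u v := by
    refine Subtype.ext (Subtype.ext (funext fun g => ?_))
    change X.cellFun τ μ _ _ = X.cellFun τ μ _ _ + X.cellFun τ μ _ _
    simp only [cellFun, Submodule.coe_add, Pi.add_apply, map_add]
    split_ifs
    · rw [smul_add]
    · rw [add_zero]
  map_smul' c u := by
    refine Subtype.ext (Subtype.ext (funext fun g => ?_))
    change X.cellFun τ μ _ _ = c • X.cellFun τ μ _ _
    simp only [cellFun, Submodule.coe_smul, Pi.smul_apply, map_smul]
    split_ifs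
    · rw [smul_comm]
    · rw [smul_zero]

theorem cellSec_apply (hτ : Continuous (opRep τ)) (μ : ℂ) (a : D.G) (u : TestFn (n - 1) W)
    (g : D.G) : (X.cellSec hτ μ a u).1.1 g = X.cellFun τ μ u.1 (a⁻¹ * g) := rfl

/-- The integral Sobolev norms of a section supported in a fixed part of a cell are bounded by those
of its expression. -/
theorem exists_intNorm_cellSec_le (hτ : Continuous (opRep τ)) (μ : ℂ) (a : D.G) {R : ℝ}
    (hR : 0 ≤ R) {q : ℝ} (hq : 1 < q) (K : ℕ) : ∃ C : ℝ≥0, ∀ u : TestFn (n - 1) W,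
      (∀ y, R < ‖y‖ → u.1 y = 0) →
        intNorm D τ μ q K (X.cellSec hτ μ a u).1
          ≤ C * ∑ i ∈ Finset.range (K + 1), derNorm q i u.1 := by
  have key : ∀ γ : D.G, ∃ C : ℝ≥0, ∀ u : TestFn (n - 1) W, (∀ y, R < ‖y‖ → u.1 y = 0) →
      localNorm (Metric.ball 0 2) K q (D.chart (X.cellSec hτ μ a u).1.1 γ)
        ≤ C * ∑ i ∈ Finset.range (K + 1), derNorm q i u.1 := by
    intro γ
    obtain ⟨C, hC⟩ := X.exists_eLpNorm_chart_le hτ μ (a⁻¹ * γ) hR hq K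
    refine ⟨∑ j ∈ Finset.range (K + 1), ∑ _b : Fin j → Fin (n - 1), C, fun u huR => ?_⟩
    have e : D.chart (X.cellSec hτ μ a u).1.1 γ = D.chart (X.cellFun τ μ u.1) (a⁻¹ * γ) := by
      funext x
      simp only [CellData.chart, mul_assoc, cellSec_apply]
    refine (localNorm_le_sum _ K q ((X.cellSec hτ μ a u).2 γ)).trans ?_
    rw [e]
    push_cast
    rw [Finset.sum_mul]
    refine Finset.sum_le_sum fun j hj => ?_
    rw [Finset.sum_mul]
    refine Finset.sum_le_sum fun b _ => ?_
    refine hC u.1 u.2.1 huR _ ?_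
    rw [List.length_ofFn]
    exact Nat.lt_succ_iff.mp (Finset.mem_range.mp hj)
  obtain ⟨C₁, h₁⟩ := key 1
  obtain ⟨C₂, h₂⟩ := key D.weyl
  refine ⟨C₁ + C₂, fun u huR => ?_⟩
  rw [ENNReal.coe_add, add_mul]
  exact add_le_add (h₁ u huR) (h₂ u huR)

end Geom

end HypSob

/-! ### Complex interpolation -/

namespace HypSob

open MeasureTheory

section Interpolation

variable {S : Type*} [AddCommGroup S] [Module ℂ S] {N₀ N₁ : S → ℝ≥0∞} {θ : ℝ}

theorem enorm_le_sumNorm {ℓ : S →ₗ[ℂ] ℂ} {C₀ C₁ : ℝ≥0} (hC₀ : C₀ ≠ 0) (h₀ : ∀ u, ‖ℓ u‖ₑ ≤ C₀ * N₀ u)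
    (h₁ : ∀ u, ‖ℓ u‖ₑ ≤ C₁ * N₁ u) (u : S) :
    ‖ℓ u‖ₑ ≤ ((C₀ + C₁ : ℝ≥0) : ℝ≥0∞) * sumNorm N₀ N₁ u := by
  have hC : ((C₀ + C₁ : ℝ≥0) : ℝ≥0∞) ≠ 0 := by
    rw [ENNReal.coe_ne_zero]
    exact (add_pos_of_pos_of_nonneg (pos_iff_ne_zero.mpr hC₀) zero_le).ne'
  rw [sumNorm, ← ENNReal.div_le_iff' hC ENNReal.coe_ne_top]
  refine le_iInf fun y => ?_
  rw [ENNReal.div_le_iff' hC ENNReal.coe_ne_top]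
  have e : ℓ u = ℓ y + ℓ (u - y) := by rw [← map_add, add_sub_cancel]
  rw [e, ENNReal.coe_add, add_mul, mul_add, mul_add]
  refine (enorm_add_le _ _).trans ((add_le_add (h₀ y) (h₁ (u - y))).trans ?_)
  exact add_le_add le_self_add le_add_self

/-- The interpolation property for functionals, by the three lines theorem. -/
theorem enorm_le_interpNorm (hθ₀ : 0 < θ) (hθ₁ : θ < 1) {ℓ : S →ₗ[ℂ] ℂ} {C₀ C₁ : ℝ≥0}
    (hC₀ : C₀ ≠ 0) (hC₁ : C₁ ≠ 0) (h₀ : ∀ u, ‖ℓ u‖ₑ ≤ C₀ * N₀ u)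
    (h₁ : ∀ u, ‖ℓ u‖ₑ ≤ C₁ * N₁ u) (u : S) :
    ‖ℓ u‖ₑ ≤ ((C₀ ^ (1 - θ) * C₁ ^ θ : ℝ≥0) : ℝ≥0∞) * interpNorm N₀ N₁ θ u := by
  have hS := enorm_le_sumNorm hC₀ h₀ h₁
  set M : ℝ≥0 := C₀ + C₁
  have hC : ((C₀ ^ (1 - θ) * C₁ ^ θ : ℝ≥0) : ℝ≥0∞) ≠ 0 := by
    rw [ENNReal.coe_ne_zero]
    exact (mul_pos (NNReal.rpow_pos (pos_iff_ne_zero.mpr hC₀))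
      (NNReal.rpow_pos (pos_iff_ne_zero.mpr hC₁))).ne'
  have hcase : ∀ h : ℂ → S, IsInterpFun N₀ N₁ h → h θ = u →
      ‖ℓ u‖ₑ ≤ ((C₀ ^ (1 - θ) * C₁ ^ θ : ℝ≥0) : ℝ≥0∞) *
        ⨆ t : ℝ, max (N₀ (h (t * Complex.I))) (N₁ (h (1 + t * Complex.I))) := by
    intro h hh hu
    set s := ⨆ t : ℝ, max (N₀ (h (t * Complex.I))) (N₁ (h (1 + t * Complex.I))) with hs
    have hst : s ≠ ⊤ := by
      obtain ⟨B₀, hB₀⟩ := hh.left_bounded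
      obtain ⟨B₁, hB₁⟩ := hh.right_bounded
      refine ne_top_of_le_ne_top (b := ((max B₀ B₁ : ℝ≥0) : ℝ≥0∞)) ENNReal.coe_ne_top ?_
      refine iSup_le fun t => max_le ((hB₀ t).trans ?_) ((hB₁ t).trans ?_)
      · exact_mod_cast le_max_left _ _
      · exact_mod_cast le_max_right _ _
    clear_value s
    lift s to ℝ≥0 using hst
    have hb₀ : ∀ t : ℝ, N₀ (h (t * Complex.I)) ≤ s := fun t => by
      rw [hs]
      exact (le_max_left _ _).trans
        (le_iSup (fun t : ℝ => max (N₀ (h (t * Complex.I))) (N₁ (h (1 + t * Complex.I)))) t)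
    have hb₁ : ∀ t : ℝ, N₁ (h (1 + t * Complex.I)) ≤ s := fun t => by
      rw [hs]
      exact (le_max_right _ _).trans
        (le_iSup (fun t : ℝ => max (N₀ (h (t * Complex.I))) (N₁ (h (1 + t * Complex.I)))) t)
    have hlim : ∀ {ι : Type} {l : Filter ι} {w : ι → S},
        Filter.Tendsto (fun i => sumNorm N₀ N₁ (w i)) l (𝓝 0) →
        Filter.Tendsto (fun i => ℓ (w i)) l (𝓝 0) := by
      intro ι l w hw
      rw [tendsto_zero_iff_enorm_tendsto_zero]
      have h3 := ENNReal.Tendsto.const_mul (a := (M : ℝ≥0∞)) hw (Or.inr ENNReal.coe_ne_top)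
      rw [mul_zero] at h3
      exact tendsto_of_tendsto_of_tendsto_of_le_of_le tendsto_const_nhds h3
        (fun _ => zero_le) fun i => hS _
    have hcl : closure (Complex.HadamardThreeLines.verticalStrip 0 1)
        = {z : ℂ | 0 ≤ z.re ∧ z.re ≤ 1} := by
      rw [Complex.HadamardThreeLines.verticalStrip, Complex.closure_preimage_re,
        closure_Ioo zero_ne_one]
      rfl
    have hd : DiffContOnCl ℂ (fun z => ℓ (h z))
        (Complex.HadamardThreeLines.verticalStrip 0 1) := by
      constructor
      · intro z hz
        obtain ⟨h', -, h2⟩ := hh.holomorphic z hz.1 hz.2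
        have h3 := hlim h2
        refine (HasDerivAt.differentiableAt (f' := ℓ h') ?_).differentiableWithinAt
        rw [hasDerivAt_iff_tendsto_slope, ← tendsto_sub_nhds_zero_iff]
        refine h3.congr fun z' => ?_
        simp only [map_sub, map_smul, slope, vsub_eq_sub, smul_eq_mul]
      · rw [hcl]
        intro z hz
        have h3 := hlim (hh.continuous z hz.1 hz.2)
        rw [ContinuousWithinAt, ← tendsto_sub_nhds_zero_iff]
        simpa only [map_sub] using h3
    have hbd : BddAbove ((norm ∘ fun z => ℓ (h z)) ''
        Complex.HadamardThreeLines.verticalClosedStrip 0 1) := by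
      obtain ⟨B, hB⟩ := hh.bounded
      refine ⟨M * B, ?_⟩
      rintro _ ⟨z, hz, rfl⟩
      have h3 := (hS (h z)).trans (mul_le_mul_right (hB z hz.1 hz.2) _)
      rw [← ENNReal.coe_mul, enorm_eq_nnnorm, ENNReal.coe_le_coe] at h3
      exact_mod_cast h3
    have hre : (θ : ℂ) ∈ Complex.HadamardThreeLines.verticalClosedStrip 0 1 := by
      change ((θ : ℂ)).re ∈ Set.Icc (0 : ℝ) 1
      rw [Complex.ofReal_re]
      exact ⟨hθ₀.le, hθ₁.le⟩
    have key := Complex.HadamardThreeLines.norm_le_interp_of_mem_verticalClosedStrip₀₁'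
      (fun z => ℓ (h z)) (a := C₀ * s) (b := C₁ * s) hre hd hbd ?_ ?_
    · rw [Complex.ofReal_re, hu] at key
      rw [← ENNReal.coe_mul, enorm_eq_nnnorm, ENNReal.coe_le_coe, ← NNReal.coe_le_coe]
      refine key.trans_eq ?_
      push_cast
      rw [Real.mul_rpow (NNReal.coe_nonneg _) (NNReal.coe_nonneg _),
        Real.mul_rpow (NNReal.coe_nonneg _) (NNReal.coe_nonneg _)]
      have e : (s : ℝ) ^ (1 - θ) * (s : ℝ) ^ θ = s := by
        rw [← Real.rpow_add_of_nonneg (NNReal.coe_nonneg _) (by linarith) hθ₀.le,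
          sub_add_cancel, Real.rpow_one]
      linear_combination ((C₀ : ℝ) ^ (1 - θ) * (C₁ : ℝ) ^ θ) * e
    · intro z hz
      have e : z = (z.im : ℂ) * Complex.I := by
        apply Complex.ext
        · simpa using hz
        · simp
      have h4 := hb₀ z.im
      rw [← e] at h4
      have h3 := (h₀ (h z)).trans (mul_le_mul_right h4 _)
      rw [← ENNReal.coe_mul, enorm_eq_nnnorm, ENNReal.coe_le_coe] at h3
      exact_mod_cast h3
    · intro z hz
      have e : z = 1 + (z.im : ℂ) * Complex.I := by
        apply Complex.ext
        · simpa using hz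
        · simp
      have h4 := hb₁ z.im
      rw [← e] at h4
      have h3 := (h₁ (h z)).trans (mul_le_mul_right h4 _)
      rw [← ENNReal.coe_mul, enorm_eq_nnnorm, ENNReal.coe_le_coe] at h3
      exact_mod_cast h3
  rw [interpNorm, ← ENNReal.div_le_iff' hC ENNReal.coe_ne_top]
  refine le_iInf fun h => le_iInf fun hh => le_iInf fun hu => ?_
  rw [ENNReal.div_le_iff' hC ENNReal.coe_ne_top]
  exact hcase h hh hu

/-- The logarithmic convexity of the interpolation norm. -/
theorem interpNorm_le {A B : ℝ} (hA : 0 < A) (hB : 0 < B) {Y : ℝ≥0} {u : S}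
    (h₀ : ∀ c : ℂ, N₀ (c • u) ≤ ‖c‖ₑ * (ENNReal.ofReal A * Y))
    (h₁ : ∀ c : ℂ, N₁ (c • u) ≤ ‖c‖ₑ * (ENNReal.ofReal B * Y)) :
    interpNorm N₀ N₁ θ u ≤ ENNReal.ofReal (A ^ (1 - θ) * B ^ θ) * Y := by
  set w : ℂ := ((Real.log (A / B) : ℝ) : ℂ) with hw
  set e : ℂ → ℂ := fun z => Complex.exp ((z - θ) * w) with he
  have hec : Continuous e := by fun_prop
  have hnorm : ∀ z, ‖e z‖ₑ = ENNReal.ofReal ((A / B) ^ (z.re - θ)) := fun z => by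
    rw [← ofReal_norm, he]
    simp only
    rw [Complex.norm_exp, hw, Complex.re_mul_ofReal, Complex.sub_re, Complex.ofReal_re,
      Real.rpow_def_of_pos (div_pos hA hB), mul_comm]
  have hz1 : N₁ 0 = 0 := by
    have := h₁ 0
    rw [zero_smul, enorm_zero, zero_mul] at this
    exact le_antisymm this zero_le
  have hsum : ∀ c : ℂ, sumNorm N₀ N₁ (c • u) ≤ ‖c‖ₑ * (ENNReal.ofReal A * Y) := fun c => by
    refine (iInf_le _ (c • u)).trans ?_
    rw [sub_self, hz1, add_zero]
    exact h₀ c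
  have hlim : ∀ {ι : Type} {l : Filter ι} {c : ι → ℂ} {N : S → ℝ≥0∞} {D : ℝ≥0∞}, D ≠ ⊤ →
      (∀ c : ℂ, N (c • u) ≤ ‖c‖ₑ * D) → Filter.Tendsto c l (𝓝 0) →
      Filter.Tendsto (fun i => N (c i • u)) l (𝓝 0) := by
    intro ι l c N D hD hN hc
    have h3 := ENNReal.Tendsto.mul_const (b := D) (tendsto_zero_iff_enorm_tendsto_zero.mp hc)
      (Or.inr hD)
    rw [zero_mul] at h3
    exact tendsto_of_tendsto_of_tendsto_of_le_of_le tendsto_const_nhds h3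
      (fun _ => zero_le) fun i => hN _
  have hDA : ENNReal.ofReal A * Y ≠ ⊤ := ENNReal.mul_ne_top ENNReal.ofReal_ne_top
    ENNReal.coe_ne_top
  have hDB : ENNReal.ofReal B * Y ≠ ⊤ := ENNReal.mul_ne_top ENNReal.ofReal_ne_top
    ENNReal.coe_ne_top
  have hAB : ∀ C : ℝ, 0 < C → ∀ x : ℝ, ENNReal.ofReal ((A / B) ^ (x - θ)) * (ENNReal.ofReal C * Y)
      = ENNReal.ofReal ((A / B) ^ (x - θ) * C) * Y := fun C hC x => by
    rw [← mul_assoc, ENNReal.ofReal_mul (by positivity)]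
  have hl : ∀ t : ℝ, N₀ (e (t * Complex.I) • u) ≤ ENNReal.ofReal (A ^ (1 - θ) * B ^ θ) * Y := by
    intro t
    refine (h₀ _).trans_eq ?_
    rw [hnorm, hAB A hA]
    congr 2
    simp only [Complex.mul_re, Complex.ofReal_re, Complex.I_re, mul_zero, Complex.ofReal_im,
      Complex.I_im, sub_zero, zero_sub, zero_mul]
    rw [Real.div_rpow hA.le hB.le, Real.rpow_neg hB.le, div_inv_eq_mul, mul_right_comm,
      ← Real.rpow_add_one hA.ne', neg_add_eq_sub]
  have hr : ∀ t : ℝ, N₁ (e (1 + t * Complex.I) • u)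
      ≤ ENNReal.ofReal (A ^ (1 - θ) * B ^ θ) * Y := by
    intro t
    refine (h₁ _).trans_eq ?_
    rw [hnorm, hAB B hB]
    congr 2
    simp only [Complex.add_re, Complex.one_re, Complex.mul_re, Complex.ofReal_re, Complex.I_re,
      mul_zero, Complex.ofReal_im, Complex.I_im, sub_zero, zero_mul, add_zero]
    rw [Real.div_rpow hA.le hB.le, div_mul_eq_mul_div, mul_div_assoc, Real.rpow_sub hB,
      Real.rpow_one, div_div_eq_mul_div, mul_div_cancel_left₀ _ hB.ne']
  refine (iInf_le _ fun z => e z • u).trans ?_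
  refine (iInf_le _ ?_).trans ((iInf_le _ ?_).trans (iSup_le fun t => max_le (hl t) (hr t)))
  · have hfin : ENNReal.ofReal (A ^ (1 - θ) * B ^ θ) * Y ≠ ⊤ :=
      ENNReal.mul_ne_top ENNReal.ofReal_ne_top ENNReal.coe_ne_top
    refine ⟨?_, ?_, ?_, ⟨(ENNReal.ofReal (A ^ (1 - θ) * B ^ θ) * Y).toNNReal, fun t => ?_⟩,
      ⟨(ENNReal.ofReal (A ^ (1 - θ) * B ^ θ) * Y).toNNReal, fun t => ?_⟩, ?_, ?_⟩
    · obtain ⟨M, hM⟩ := isCompact_Icc.exists_bound_of_continuousOn (s := Set.Icc (0 : ℝ) 1)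
        (f := fun x => (A / B) ^ (x - θ)) (Continuous.continuousOn (by
          have := (div_pos hA hB).ne'
          fun_prop (disch := assumption)))
      refine ⟨(ENNReal.ofReal M * (ENNReal.ofReal A * Y)).toNNReal, fun z h1 h2 => ?_⟩
      rw [ENNReal.coe_toNNReal (ENNReal.mul_ne_top ENNReal.ofReal_ne_top hDA)]
      refine (hsum _).trans (mul_le_mul_left ?_ _)
      rw [hnorm]
      exact ENNReal.ofReal_le_ofReal ((le_abs_self _).trans (hM z.re ⟨h1, h2⟩))
    · intro z _ _
      simp only [← sub_smul]
      refine hlim hDA hsum ?_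
      exact tendsto_sub_nhds_zero_iff.mpr (hec.continuousAt.mono_left nhdsWithin_le_nhds)
    · intro z _ _
      refine ⟨(e z * w) • u, (hsum _).trans_lt (ENNReal.mul_lt_top enorm_lt_top hDA.lt_top), ?_⟩
      simp only [← sub_smul, smul_smul]
      refine hlim hDA hsum ?_
      have h3 : HasDerivAt e (e z * w) z := by
        have h4 := (((hasDerivAt_id z).sub_const (θ : ℂ)).mul_const w).cexp
        simpa [he] using h4
      rw [hasDerivAt_iff_tendsto_slope, ← tendsto_sub_nhds_zero_iff] at h3
      exact h3
    · rw [ENNReal.coe_toNNReal hfin]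
      exact hl t
    · rw [ENNReal.coe_toNNReal hfin]
      exact hr t
    · intro t
      simp only [← sub_smul]
      refine hlim hDA h₀ (tendsto_sub_nhds_zero_iff.mpr ?_)
      exact Continuous.tendsto (f := fun t : ℝ => e (t * Complex.I)) (by fun_prop) t
    · intro t
      simp only [← sub_smul]
      refine hlim hDB h₁ (tendsto_sub_nhds_zero_iff.mpr ?_)
      exact Continuous.tendsto (f := fun t : ℝ => e (1 + t * Complex.I)) (by fun_prop) t
  · simp [he]

end Interpolation

section LinOp

variable {d : ℕ} {W : Type*} [NormedAddCommGroup W] [NormedSpace ℂ W]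

/-- Operators which are defined and linear on all locally integrable functions. -/
def IsLinOp (Θ : (E d → W) → E d → W) : Prop :=
  (∀ v, LocallyIntegrable v → LocallyIntegrable (Θ v)) ∧
  ∀ (c : ℂ) (v w : E d → W), LocallyIntegrable v → LocallyIntegrable w →
    Θ (c • v + w) = c • Θ v + Θ w

theorem IsLinOp.comp {Θ Θ' : (E d → W) → E d → W} (h : IsLinOp Θ) (h' : IsLinOp Θ') :
    IsLinOp fun v => Θ (Θ' v) :=
  ⟨fun v hv => h.1 _ (h'.1 v hv), fun c v w hv hw => by
    simp only [h'.2 c v w hv hw, h.2 c _ _ (h'.1 v hv) (h'.1 w hw)]⟩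

theorem IsLinOp.add {Θ Θ' : (E d → W) → E d → W} (h : IsLinOp Θ) (h' : IsLinOp Θ') :
    IsLinOp fun v x => Θ v x + Θ' v x :=
  ⟨fun v hv => (h.1 v hv).add (h'.1 v hv), fun c v w hv hw => by
    funext x
    simp only [h.2 c v w hv hw, h'.2 c v w hv hw, Pi.add_apply, Pi.smul_apply]
    module⟩

theorem IsLinOp.sub {Θ Θ' : (E d → W) → E d → W} (h : IsLinOp Θ) (h' : IsLinOp Θ') :
    IsLinOp fun v x => Θ v x - Θ' v x :=
  ⟨fun v hv => (h.1 v hv).sub (h'.1 v hv), fun c v w hv hw => by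
    funext x
    simp only [h.2 c v w hv hw, h'.2 c v w hv hw, Pi.add_apply, Pi.smul_apply]
    module⟩

theorem isLinOp_id : IsLinOp fun v : E d → W => v := ⟨fun _ h => h, fun _ _ _ _ _ => rfl⟩

theorem isLinOp_moll {ε : ℝ} (hε : 0 < ε) : IsLinOp (moll ε : (E d → W) → E d → W) := by
  refine ⟨fun v hv => (contDiff_moll hε hv).continuous.locallyIntegrable,
    fun c v w hv hw => funext fun x => ?_⟩
  have h1 := integrable_conv (contDiff_mollKer ε) (hasCompactSupport_mollKer hε) hv x
  have h2 := integrable_conv (contDiff_mollKer ε) (hasCompactSupport_mollKer hε) hw x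
  simp only [moll, conv, Pi.add_apply, Pi.smul_apply, smul_add]
  simp only [smul_comm _ c]
  rw [← integral_smul]
  exact integral_add (h1.smul c) h2

theorem isLinOp_res_iterate {ε : ℝ} (hε : 0 < ε) (l : ℕ) :
    IsLinOp ((res ε)^[l] : (E d → W) → E d → W) := by
  induction l with
  | zero => exact isLinOp_id
  | succ l ih =>
    rw [Function.iterate_succ']
    exact (isLinOp_id.sub (isLinOp_moll hε)).comp ih

theorem isLinOp_lpS (L : ℕ) {ε : ℝ} (hε : 0 < ε) : IsLinOp (lpS L ε : (E d → W) → E d → W) := by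
  have := isLinOp_id.sub (isLinOp_res_iterate (d := d) (W := W) hε L)
  have e : (lpS L ε : (E d → W) → E d → W) = fun v x => v x - (res ε)^[L] v x :=
    funext fun v => lpS_eq L ε v
  rwa [e]

theorem isLinOp_lpP (L : ℕ) {ε : ℝ} (hε : 0 < ε) : IsLinOp (lpP L ε : (E d → W) → E d → W) := by
  have h := (isLinOp_lpS (d := d) (W := W) L (half_pos hε)).add (isLinOp_lpS L hε)
  exact ((isLinOp_res_iterate hε L).comp h).sub ((isLinOp_res_iterate (half_pos hε) L).comp h)

end LinOp

end HypSob

/-! ### Extension off the submanifold -/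

namespace HypSob

open MeasureTheory

section Extension

variable {k d : ℕ}

/-- The component of a vector of `ℝ^d` which is orthogonal to `ℝ^k`. -/
def perp (k d : ℕ) : E d →L[ℝ] E d :=
  LinearMap.toContinuousLinearMap (LinearMap.id - pad k d ∘ₗ pad d k)

theorem perp_apply (x : E d) : perp k d x = x - pad k d (pad d k x) := rfl

theorem perp_pad (h : k ≤ d) (x : E k) : perp k d (pad k d x) = 0 := by
  rw [perp_apply, pad_pad h, sub_self]

theorem isClosed_norm_perp_le (δ : ℝ) : IsClosed {x : E d | ‖perp k d x‖ ≤ 2 * δ} :=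
  isClosed_le (perp k d).continuous.norm continuous_const

/-- The integral of a function on `ℝ^k` over a neighbourhood of `ℝ^k` in `ℝ^d`. -/
theorem exists_lintegral_comp_pad_le (h : k ≤ d) : ∃ C : ℝ≥0, ∀ (δ : ℝ), 0 < δ →
    ∀ f : E k → ℝ≥0∞, Measurable f →
      ∫⁻ x in {x : E d | ‖perp k d x‖ ≤ 2 * δ}, f (pad d k x)
        ≤ C * ENNReal.ofReal (δ ^ (d - k)) * ∫⁻ y, f y := by
  obtain ⟨c, rfl⟩ := Nat.exists_eq_add_of_le h
  set e : E (k + c) ≃L[ℝ] E k × E c := EuclideanSpace.finAddEquivProd with he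
  have e1 : ∀ x, (e x).1 = pad (k + c) k x := by
    intro x
    ext i
    simp [he, pad, EuclideanSpace.finAddEquivProd, EuclideanSpace.sumEquivProd]
    rw [dif_pos (by omega)]
    rfl
  have e2 : ∀ y, (e (pad k (k + c) y)).2 = 0 := by
    intro x
    ext i
    simp [he, pad, EuclideanSpace.finAddEquivProd, EuclideanSpace.sumEquivProd]
  set J : E (k + c) →L[ℝ] E c := (ContinuousLinearMap.snd ℝ (E k) (E c)).comp
    (e : E (k + c) →L[ℝ] E k × E c) with hJ
  have e3 : ∀ x, (e x).2 = J (perp k (k + c) x) := by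
    intro x
    rw [perp_apply, map_sub]
    change _ = (e x).2 - (e (pad k (k + c) _)).2
    rw [e2, sub_zero]
  set ν : Measure (E k × E c) := Measure.map e volume with hν
  have hνH : ν.IsAddHaarMeasure := e.isAddHaarMeasure_map volume
  have hH : (volume : Measure (E k × E c)).IsAddHaarMeasure :=
    Measure.prod.instIsAddHaarMeasure (volume : Measure (E k)) (volume : Measure (E c))
  obtain ⟨a, hat⟩ : ∃ a : ℝ≥0, ν = a • (volume : Measure (E k × E c)) :=
    ⟨_, Measure.isAddLeftInvariant_eq_smul ν volume⟩
  have ha : (a : ℝ≥0∞) ≠ ⊤ := ENNReal.coe_ne_top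
  set B := volume (Metric.ball (0 : E c) 1) with hB
  have hBt : B ≠ ⊤ := measure_ball_lt_top.ne
  refine ⟨(a * (ENNReal.ofReal ((2 * ‖J‖) ^ c) * B)).toNNReal, fun δ hδ f hf => ?_⟩
  rw [ENNReal.coe_toNNReal (ENNReal.mul_ne_top ha (ENNReal.mul_ne_top ENNReal.ofReal_ne_top hBt))]
  set b : E c → ℝ≥0∞ := (Metric.closedBall (0 : E c) (2 * ‖J‖ * δ)).indicator 1 with hb
  have hbm : Measurable b := measurable_one.indicator Metric.isClosed_closedBall.measurableSet
  calc ∫⁻ x in {x : E (k + c) | ‖perp k (k + c) x‖ ≤ 2 * δ}, f (pad (k + c) k x)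
      ≤ ∫⁻ x : E (k + c), f (e x).1 * b (e x).2 := by
        rw [← lintegral_indicator (isClosed_norm_perp_le δ).measurableSet]
        refine lintegral_mono fun x => ?_
        by_cases hx : x ∈ {x : E (k + c) | ‖perp k (k + c) x‖ ≤ 2 * δ}
        · have h1 : (e x).2 ∈ Metric.closedBall (0 : E c) (2 * ‖J‖ * δ) := by
            rw [mem_closedBall_zero_iff, e3]
            refine (J.le_opNorm _).trans ?_
            have := mul_le_mul_of_nonneg_left hx (norm_nonneg J)
            linarith
          rw [Set.indicator_of_mem hx, hb, Set.indicator_of_mem h1, Pi.one_apply, mul_one, e1]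
        · rw [Set.indicator_of_notMem hx]
          exact zero_le
    _ = ∫⁻ z, f z.1 * b z.2 ∂ν := by
        rw [hν]
        exact (lintegral_map ((hf.comp measurable_fst).mul (hbm.comp measurable_snd))
          e.continuous.measurable).symm
    _ = a * ((∫⁻ y, f y) * volume (Metric.closedBall (0 : E c) (2 * ‖J‖ * δ))) := by
        rw [hat, lintegral_smul_measure, ENNReal.smul_def, smul_eq_mul, Measure.volume_eq_prod,
          lintegral_prod_mul hf.aemeasurable hbm.aemeasurable, hb,
          lintegral_indicator_one Metric.isClosed_closedBall.measurableSet]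
    _ = _ := by
        rw [Measure.addHaar_closedBall _ _ (by positivity), finrank_euclideanSpace_fin,
          add_tsub_cancel_left, mul_pow, ENNReal.ofReal_mul (by positivity)]
        ring

theorem exists_eLpNorm_comp_pad_le {W : Type*} [NormedAddCommGroup W] (h : k ≤ d) {q : ℝ}
    (hq : 1 < q) : ∃ C : ℝ≥0, ∀ (δ : ℝ), 0 < δ → ∀ w : E k → W, Continuous w →
      eLpNorm (fun x => w (pad d k x)) (ENNReal.ofReal q)
          (volume.restrict {x : E d | ‖perp k d x‖ ≤ 2 * δ})
        ≤ C * ENNReal.ofReal (δ ^ (((d - k : ℕ) : ℝ) / q)) * eLpNorm w (ENNReal.ofReal q) := by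
  have hq0 : 0 < q := by linarith
  have hQ : ENNReal.ofReal q ≠ 0 := by simpa using hq0
  obtain ⟨C, hC⟩ := exists_lintegral_comp_pad_le h
  refine ⟨C ^ (1 / q), fun δ hδ w hw => ?_⟩
  rw [eLpNorm_eq_lintegral_rpow_enorm_toReal hQ ENNReal.ofReal_ne_top,
    eLpNorm_eq_lintegral_rpow_enorm_toReal hQ ENNReal.ofReal_ne_top, ENNReal.toReal_ofReal hq0.le]
  have h1 := hC δ hδ (fun y => ‖w y‖ₑ ^ q) (hw.enorm.measurable.pow_const q)
  refine (ENNReal.rpow_le_rpow h1 (by positivity)).trans_eq ?_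
  rw [ENNReal.mul_rpow_of_nonneg _ _ (by positivity),
    ENNReal.mul_rpow_of_nonneg _ _ (by positivity),
    ENNReal.ofReal_rpow_of_nonneg (by positivity) (by positivity), ← Real.rpow_natCast,
    ← Real.rpow_mul hδ.le, mul_one_div, ENNReal.coe_rpow_of_nonneg _ (by positivity)]

variable {W₁ W₂ : Type*} [NormedAddCommGroup W₁] [NormedSpace ℂ W₁] [NormedAddCommGroup W₂]
  [NormedSpace ℂ W₂]

/-- The extension of a function on `ℝ^k` to `ℝ^d` which is supported in the neighbourhood of
radius `2 δ` of `ℝ^k`. -/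
def extFun (d : ℕ) (L : W₁ →L[ℂ] W₂) (δ : ℝ) (v : E k → W₁) (x : E d) : W₂ :=
  radialBump 1 (δ⁻¹ • perp k d x) • L (v (pad d k x))

theorem extFun_pad (h : k ≤ d) (L : W₁ →L[ℂ] W₂) (δ : ℝ) (v : E k → W₁) (y : E k) :
    extFun d L δ v (pad k d y) = L (v y) := by
  rw [extFun, perp_pad h, smul_zero, radialBump_eq_one one_pos (by simp), one_smul, pad_pad h]

theorem extFun_eq_zero {L : W₁ →L[ℂ] W₂} {δ : ℝ} (hδ : 0 < δ) {v : E k → W₁} {x : E d}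
    (hx : x ∉ {x : E d | ‖perp k d x‖ ≤ 2 * δ}) : extFun d L δ v x = 0 := by
  rw [extFun, radialBump_eq_zero one_pos, zero_smul]
  rw [norm_smul, norm_inv, Real.norm_of_nonneg hδ.le, mul_one, ← div_eq_inv_mul, le_div_iff₀ hδ]
  exact (not_le.mp hx).le

theorem extFun_eq_zero_of_radius {L : W₁ →L[ℂ] W₂} {δ : ℝ} (hδ : 0 < δ) (hδ1 : δ ≤ 1)
    (h : k ≤ d) {R : ℝ} {v : E k → W₁} (hv : ∀ y, R < ‖y‖ → v y = 0) {x : E d}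
    (hx : R + 2 < ‖x‖) : extFun d L δ v x = 0 := by
  by_contra h0
  have h1 : ‖perp k d x‖ ≤ 2 * δ := by
    by_contra h1
    exact h0 (extFun_eq_zero hδ h1)
  have h2 : ‖pad d k x‖ ≤ R := by
    by_contra h2
    exact h0 (by rw [extFun, hv _ (not_le.mp h2), map_zero, smul_zero])
  have h3 : x = perp k d x + pad k d (pad d k x) := by rw [perp_apply, sub_add_cancel]
  have h4 := norm_add_le (perp k d x) (pad k d (pad d k x))
  rw [← h3, norm_pad h] at h4
  linarith

theorem contDiff_extFun (L : W₁ →L[ℂ] W₂) (δ : ℝ) {v : E k → W₁} (hv : ContDiff ℝ ∞ v) :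
    ContDiff ℝ ∞ (extFun d L δ v) :=
  ((contDiff_radialBump 1).comp ((perp k d).contDiff.const_smul δ⁻¹)).smul
    (contDiff_aux L (LinearMap.toContinuousLinearMap (pad d k)) hv)

/-- The extension as a map of test functions. -/
def extTest (h : k ≤ d) (L : W₁ →L[ℂ] W₂) {δ : ℝ} (hδ : 0 < δ) (hδ1 : δ ≤ 1)
    (v : TestFn k W₁) : TestFn d W₂ :=
  ⟨extFun d L δ v.1, contDiff_extFun L δ v.2.1, by
    obtain ⟨R, -, hR⟩ := TestFn.exists_radius v
    refine HasCompactSupport.intro (isCompact_closedBall (0 : E d) (R + 2)) fun x hx => ?_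
    exact extFun_eq_zero_of_radius hδ hδ1 h hR (by simpa using hx)⟩

theorem extTest_smul (h : k ≤ d) (L : W₁ →L[ℂ] W₂) {δ : ℝ} (hδ : 0 < δ) (hδ1 : δ ≤ 1) (c : ℂ)
    (v : TestFn k W₁) : extTest h L hδ hδ1 (c • v) = c • extTest h L hδ hδ1 v := by
  refine Subtype.ext (funext fun x => ?_)
  change extFun d L δ (c • v.1) x = c • extFun d L δ v.1 x
  rw [extFun, extFun, Pi.smul_apply, map_smul, smul_comm]

theorem exists_norm_iteratedFDeriv_bump_le (k d i : ℕ) : ∃ M : ℝ≥0, ∀ δ : ℝ, 0 < δ → ∀ l ≤ i, ∀ x,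
    ‖iteratedFDeriv ℝ l (fun x : E d => radialBump 1 (δ⁻¹ • perp k d x)) x‖ ≤ M * δ⁻¹ ^ l := by
  have hb : ∀ l : ℕ, ∃ M : ℝ, ∀ x : E d, ‖iteratedFDeriv ℝ l (radialBump 1 : E d → ℝ) x‖ ≤ M :=
    fun l => ((hasCompactSupport_radialBump one_pos).iteratedFDeriv l).exists_bound_of_continuous
      ((contDiff_radialBump 1).continuous_iteratedFDeriv (by exact_mod_cast le_top))
  choose M hM using hb
  have h0 : ∀ l, 0 ≤ M l := fun l => (norm_nonneg _).trans (hM l 0)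
  refine ⟨∑ l ∈ Finset.range (i + 1), (M l * ‖perp k d‖ ^ l).toNNReal, fun δ hδ l hl x => ?_⟩
  have h1 := ContinuousLinearMap.iteratedFDeriv_comp_right (δ⁻¹ • perp k d)
    (contDiff_radialBump (d := d) 1) x (i := l) (by exact_mod_cast le_top)
  have h2 : ‖iteratedFDeriv ℝ l (fun x : E d => radialBump 1 (δ⁻¹ • perp k d x)) x‖
      ≤ M l * ‖perp k d‖ ^ l * δ⁻¹ ^ l := by
    change ‖iteratedFDeriv ℝ l ((radialBump 1 : E d → ℝ) ∘ ⇑(δ⁻¹ • perp k d)) x‖ ≤ _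
    rw [h1]
    refine (ContinuousMultilinearMap.norm_compContinuousLinearMap_le _ _).trans ?_
    rw [Finset.prod_const, Finset.card_univ, Fintype.card_fin, norm_smul, norm_inv,
      Real.norm_of_nonneg hδ.le, mul_pow, mul_comm (δ⁻¹ ^ l), ← mul_assoc]
    gcongr
    exact hM l _
  refine h2.trans (mul_le_mul_of_nonneg_right ?_ (by positivity))
  have h3 : (M l * ‖perp k d‖ ^ l).toNNReal
      ≤ ∑ l ∈ Finset.range (i + 1), (M l * ‖perp k d‖ ^ l).toNNReal :=
    Finset.single_le_sum (f := fun l => (M l * ‖perp k d‖ ^ l).toNNReal) (fun _ _ => zero_le)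
      (Finset.mem_range.mpr (Nat.lt_succ_of_le hl))
  exact (Real.le_coe_toNNReal _).trans (NNReal.coe_le_coe.mpr h3)

theorem exists_norm_pdl_extFun_le (L : W₁ →L[ℂ] W₂) (i : ℕ) :
    ∃ C : ℝ≥0, ∀ δ : ℝ, 0 < δ → ∀ v : E k → W₁, ContDiff ℝ ∞ v → ∀ a : Fin i → Fin d, ∀ x : E d,
      ‖pdl (List.ofFn a) (extFun d L δ v) x‖ ≤ C * ∑ l ∈ Finset.range (i + 1),
        ∑ b : Fin l → Fin k, δ⁻¹ ^ i * δ ^ l * ‖pdl (List.ofFn b) v (pad d k x)‖ := by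
  obtain ⟨M, hM⟩ := exists_norm_iteratedFDeriv_bump_le k d i
  set P := LinearMap.toContinuousLinearMap (pad d k) with hP
  refine ⟨2 ^ i * M * (‖L‖₊ * max 1 ‖P‖₊ ^ i), fun δ hδ v hv a x => ?_⟩
  have hη : ContDiff ℝ ∞ (fun x : E d => radialBump 1 (δ⁻¹ • perp k d x)) :=
    (contDiff_radialBump 1).comp ((perp k d).contDiff.const_smul δ⁻¹)
  have hLv := contDiff_aux L P hv
  refine (norm_pdl_le _ (contDiff_extFun L δ hv) x).trans ?_
  rw [List.length_ofFn]
  refine (norm_iteratedFDeriv_smul_le hη hLv x (n := i) (by exact_mod_cast le_top)).trans ?_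
  have hterm : ∀ l ∈ Finset.range (i + 1),
      (i.choose l : ℝ) * ‖iteratedFDeriv ℝ l (fun x : E d => radialBump 1 (δ⁻¹ • perp k d x)) x‖
        * ‖iteratedFDeriv ℝ (i - l) (fun x => L (v (P x))) x‖
      ≤ (2 ^ i * M * (‖L‖₊ * max 1 ‖P‖₊ ^ i) : ℝ≥0) *
        (δ⁻¹ ^ i * δ ^ (i - l) * ‖iteratedFDeriv ℝ (i - l) v (P x)‖) := by
    intro l hl
    have hl' : l ≤ i := Nat.lt_succ_iff.mp (Finset.mem_range.mp hl)
    have h1 : (i.choose l : ℝ) ≤ 2 ^ i := by exact_mod_cast Nat.choose_le_two_pow i l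
    have h2 := hM δ hδ l hl' x
    have h3 := norm_iteratedFDeriv_aux L P hv (i - l) x
    have h4 : ‖P‖ ^ (i - l) ≤ max 1 ‖P‖ ^ i :=
      (pow_le_pow_left₀ (norm_nonneg _) (le_max_right _ _) _).trans
        (pow_le_pow_right₀ (le_max_left _ _) (Nat.sub_le _ _))
    have h5 : δ⁻¹ ^ i * δ ^ (i - l) = δ⁻¹ ^ l := by
      have : δ⁻¹ ^ i = δ⁻¹ ^ l * δ⁻¹ ^ (i - l) := by rw [← pow_add]; congr 1; omega
      rw [this, mul_assoc, ← mul_pow, inv_mul_cancel₀ hδ.ne', one_pow, mul_one]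
    rw [h5]
    calc _ ≤ 2 ^ i * (M * δ⁻¹ ^ l)
            * (‖L‖ * (max 1 ‖P‖ ^ i * ‖iteratedFDeriv ℝ (i - l) v (P x)‖)) := by
          have : ‖iteratedFDeriv ℝ (i - l) (fun x => L (v (P x))) x‖
              ≤ ‖L‖ * (max 1 ‖P‖ ^ i * ‖iteratedFDeriv ℝ (i - l) v (P x)‖) :=
            h3.trans (by gcongr)
          gcongr
      _ = _ := by push_cast; ring
  refine (Finset.sum_le_sum hterm).trans ?_
  rw [← Finset.mul_sum]
  refine mul_le_mul_of_nonneg_left ?_ (NNReal.coe_nonneg _)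
  rw [Finset.sum_flip (fun l => δ⁻¹ ^ i * δ ^ l * ‖iteratedFDeriv ℝ l v (P x)‖)]
  refine Finset.sum_le_sum fun l _ => ?_
  rw [← Finset.mul_sum]
  exact mul_le_mul_of_nonneg_left (norm_iteratedFDeriv_le_sum l hv _) (by positivity)

/-- The norms of the extension. The factor `δ^{(d-k)/q}` is due to the small support. -/
theorem exists_derNorm_extFun_le (h : k ≤ d) (L : W₁ →L[ℂ] W₂) {q : ℝ} (hq : 1 < q) (i : ℕ) :
    ∃ C : ℝ≥0, ∀ δ : ℝ, 0 < δ → ∀ v : E k → W₁, ContDiff ℝ ∞ v →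
      derNorm q i (extFun d L δ v)
        ≤ C * ENNReal.ofReal (δ ^ (((d - k : ℕ) : ℝ) / q) * δ⁻¹ ^ i) *
          ∑ l ∈ Finset.range (i + 1), ENNReal.ofReal (δ ^ l) * derNorm q l v := by
  have hQ1 : 1 ≤ ENNReal.ofReal q := by simpa using hq.le
  obtain ⟨C₁, h₁⟩ := exists_norm_pdl_extFun_le (d := d) L i
  obtain ⟨C₂, h₂⟩ := exists_eLpNorm_comp_pad_le (W := W₁) h hq
  refine ⟨(∑ _a : Fin i → Fin d, C₁) * C₂, fun δ hδ v hv => ?_⟩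
  set Z := {x : E d | ‖perp k d x‖ ≤ 2 * δ} with hZ
  have hZc : IsClosed Z := isClosed_norm_perp_le δ
  rw [derNorm]
  push_cast
  rw [Finset.sum_mul, Finset.sum_mul, Finset.sum_mul]
  refine Finset.sum_le_sum fun a _ => ?_
  have hsupp : tsupport (pdl (List.ofFn a) (extFun d L δ v)) ⊆ Z := by
    refine (tsupport_pdl _ _).trans (closure_minimal ?_ hZc)
    intro x hx
    by_contra h0
    exact hx (extFun_eq_zero hδ h0)
  have e1 : pdl (List.ofFn a) (extFun d L δ v)
      = Z.indicator (pdl (List.ofFn a) (extFun d L δ v)) :=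
    (Set.indicator_eq_self.mpr ((subset_tsupport _).trans hsupp)).symm
  rw [e1, eLpNorm_indicator_eq_eLpNorm_restrict hZc.measurableSet]
  set G : (Σ l : ℕ, (Fin l → Fin k)) → E d → ℝ := fun p x =>
    (δ⁻¹ ^ i * δ ^ p.1) * ‖pdl (List.ofFn p.2) v (pad d k x)‖ with hG
  set I : Finset (Σ l : ℕ, (Fin l → Fin k)) :=
    (Finset.range (i + 1)).sigma fun _ => Finset.univ with hI
  have hPc : Continuous (pad d k) := (LinearMap.toContinuousLinearMap (pad d k)).continuous
  have e2 : ∀ᵐ x ∂volume.restrict Z,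
      ‖pdl (List.ofFn a) (extFun d L δ v) x‖₊ ≤ C₁ * ‖(∑ p ∈ I, G p) x‖₊ := by
    refine Filter.Eventually.of_forall fun x => ?_
    rw [← NNReal.coe_le_coe, NNReal.coe_mul, coe_nnnorm, coe_nnnorm]
    refine (h₁ δ hδ v hv a x).trans (mul_le_mul_of_nonneg_left ?_ C₁.2)
    refine le_trans ?_ (le_abs_self _)
    rw [Finset.sum_apply, hI, Finset.sum_sigma]
  refine (eLpNorm_le_nnreal_smul_eLpNorm_of_ae_le_mul e2 _).trans ?_
  rw [ENNReal.smul_def, smul_eq_mul, mul_assoc, mul_assoc]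
  refine mul_le_mul_right ?_ _
  have hcont : ∀ p : (Σ l : ℕ, (Fin l → Fin k)), Continuous
      (fun x => pdl (List.ofFn p.2) v (pad d k x)) := fun p =>
    (contDiff_pdl _ hv).continuous.comp hPc
  refine (eLpNorm_sum_le (fun p _ => ?_) hQ1).trans ?_
  · exact (continuous_const.mul (hcont p).norm).aestronglyMeasurable
  · rw [hI, Finset.sum_sigma, Finset.mul_sum, Finset.mul_sum]
    refine Finset.sum_le_sum fun l _ => ?_
    rw [derNorm, Finset.mul_sum, Finset.mul_sum, Finset.mul_sum]
    refine Finset.sum_le_sum fun b _ => ?_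
    have e3 : eLpNorm (G ⟨l, b⟩) (ENNReal.ofReal q) (volume.restrict Z)
        = ENNReal.ofReal (δ⁻¹ ^ i * δ ^ l) * eLpNorm (fun x => pdl (List.ofFn b) v (pad d k x))
          (ENNReal.ofReal q) (volume.restrict Z) := by
      have := eLpNorm_const_smul (δ⁻¹ ^ i * δ ^ l)
        (fun x => ‖pdl (List.ofFn b) v (pad d k x)‖) (ENNReal.ofReal q) (volume.restrict Z)
      rw [eLpNorm_norm, Real.enorm_of_nonneg (by positivity)] at this
      exact this
    rw [e3]
    refine (mul_le_mul_right (h₂ δ hδ _ (contDiff_pdl _ hv).continuous) _).trans_eq ?_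
    rw [ENNReal.ofReal_mul (by positivity), ENNReal.ofReal_mul (by positivity)]
    ring

end Extension

end HypSob

/-! ### Restriction to the submanifold, and localization -/

namespace HypSob

open MeasureTheory

section Dual

variable {V F : Type*} [NormedAddCommGroup V] [NormedSpace ℂ V] [FiniteDimensional ℂ V]
  [NormedAddCommGroup F] [NormedSpace ℂ F] [FiniteDimensional ℂ F]

instance : FiniteDimensional ℂ (DualFibre V F) :=
  inferInstanceAs (FiniteDimensional ℂ (V →L[ℂ] F →L[ℂ] ℂ))

theorem continuous_opRep_dualRep {M : Type*} [Group M] [TopologicalSpace M]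
    {σ : Representation ℂ M V} (hc : ∀ v, Continuous fun b => σ b v) :
    Continuous (opRep (dualRep F σ)) := by
  have h1 : Continuous (opRep σ) := continuous_clm_apply.mpr hc
  have h2 : Continuous fun b => opRep σ b⁻¹ :=
    continuousOn_univ.mp (continuousOn_opRep_inv σ (b := id) h1.continuousOn)
  refine continuous_clm_apply.mpr fun B => ?_
  change Continuous fun b => (dualRep F σ b B).eval
  refine continuous_clm_apply.mpr fun v => ?_
  exact B.eval.continuous.comp (continuous_clm_apply.mp h2 v)

end Dual

section Pullback

variable {m n : ℕ} {D : CellData (m - 1)} {D' : CellData (n - 1)}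

theorem CellHom.map_inversion (i : CellHom D D') (u : E (m - 1)) :
    i.hom (D.inversion u) = D'.inversion (i.inc u) := by
  simp only [CellData.inversion, map_mul, i.map_nilp, i.map_opp, map_neg]

theorem CellHom.den_pos_mpart (i : CellHom D D') (X : Geom m D) (X' : Geom n D') {g : D.G}
    (hg : 0 < X.den g) : X'.den (i.hom g) = X.den g ∧ X'.pos (i.hom g) = i.inc (X.pos g) ∧
      X'.mpart (i.hom g) = ⟨i.hom (X.mpart g), i.map_M _ (X.mpart g).2⟩ := by
  obtain ⟨z, hz⟩ := X.eq_cell hg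
  have e : i.hom g = D'.opp (i.inc (X.pos g)) * i.hom (X.mpart g)
      * D'.a (Real.log (X.den g)) * D'.nilp (i.inc z) := by
    conv_lhs => rw [hz]
    simp only [map_mul, i.map_opp, i.map_a, i.map_nilp]
  have hM := i.map_M _ (X.mpart g).2
  refine ⟨?_, ?_, ?_⟩
  · rw [e, X'.den_cell hM, Real.exp_log hg]
  · rw [e, X'.pos_cell hM]
  · rw [e]
    exact X'.mpart_cell ⟨_, hM⟩ _ _ _

theorem CellHom.den_eq_zero (i : CellHom D D') (X : Geom m D) (X' : Geom n D')
    (hi : ∀ x, ‖i.inc x‖ = ‖x‖) {u : E (m - 1)} (hu : ‖u‖ = 1) {g : D.G} (hg : X.den g = 0) :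
    X'.den (i.hom g) = 0 := by
  obtain ⟨h1, h2⟩ := X.den_inversion_inv_mul hu hg
  obtain ⟨h3, h4, -⟩ := i.den_pos_mpart X X' h1
  have hu' : ‖i.inc u‖ = 1 := (hi u).trans hu
  rw [← h3] at h1
  rw [h2, map_zero] at h4
  have hN : X'.null (i.hom ((D.inversion u)⁻¹ * g)) = ((X'.null (i.hom g)).1,
      -(X'.null (i.hom g)).2.1, refl (i.inc u) (X'.null (i.hom g)).2.2) := by
    rw [map_mul, map_inv, i.map_inversion, X'.null_inversion_inv_mul hu']
  rw [Geom.pos, smul_eq_zero, or_iff_right (inv_ne_zero (by positivity)), hN] at h4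
  rw [Geom.den, hN] at h1
  simp only at h1 h4
  have h5 : (X'.null (i.hom g)).2.2 = 0 := by
    rw [← norm_eq_zero, ← norm_refl hu', h4, norm_zero]
  have h6 := X'.null_Q (i.hom g)
  rw [h5, inner_zero_left] at h6
  rcases mul_eq_zero.mp h6.symm with h7 | h7
  · linarith
  · rw [Geom.den, h7, zero_div]

variable {V₁ V₂ F : Type*} [NormedAddCommGroup V₁] [NormedSpace ℂ V₁] [FiniteDimensional ℂ V₁]
  [NormedAddCommGroup V₂] [NormedSpace ℂ V₂] [FiniteDimensional ℂ V₂]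
  [NormedAddCommGroup F] [NormedSpace ℂ F] [FiniteDimensional ℂ F]

/-- The restriction of a section supported in a cell is determined by the restriction of its
expression in that cell. -/
theorem pullback_cellSec (i : CellHom D D') (X : Geom m D) (X' : Geom n D')
    (hi : ∀ x, ‖i.inc x‖ = ‖x‖) {e : E (m - 1)} (he : ‖e‖ = 1)
    {σ₁ : Representation ℂ D.M V₁} {σ₂ : Representation ℂ D'.M V₂} (lam : ℂ) {T : V₁ →ₗ[ℂ] V₂}
    (hT : ∀ (b : D.M) (v : V₁), T (σ₁ b v) = σ₂ ⟨i.hom b, i.map_M b b.2⟩ (T v))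
    (h₁ : Continuous (opRep (dualRep F σ₁))) (h₂ : Continuous (opRep (dualRep F σ₂))) (a : D.G)
    {u : TestFn (m - 1) (DualFibre V₁ F)} {u' : TestFn (n - 1) (DualFibre V₂ F)}
    (hu : ∀ y, precomp F T (u'.1 (i.inc y)) = u.1 y) :
    pullback F i σ₁ σ₂ lam T hT (X'.cellSec h₂ (-(lam + D.rho - D'.rho)) (i.hom a) u')
      = X.cellSec h₁ (-lam) a u := by
  refine Subtype.ext (Subtype.ext (funext fun g => ?_))
  change precomp F T (X'.cellFun _ _ u'.1 ((i.hom a)⁻¹ * i.hom g)) = X.cellFun _ _ u.1 (a⁻¹ * g)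
  rw [← map_inv, ← map_mul]
  set h := a⁻¹ * g
  rcases (X.den_nonneg h).lt_or_eq with hh | hh
  · obtain ⟨e1, e2, e3⟩ := i.den_pos_mpart X X' hh
    rw [Geom.cellFun, Geom.cellFun, e1, if_pos hh, if_pos hh, e2, e3, map_smul, ← hu]
    congr 1
    · congr 2
      ring
    · refine ContinuousLinearMap.ext (f := (_ : DualFibre V₁ F).eval) fun v => ?_
      change _ = DualFibre.eval _ v
      rw [precomp_apply, opRep_apply, dualRep_apply, opRep_apply, dualRep_apply, precomp_apply,
        inv_inv, inv_inv, hT]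
  · rw [Geom.cellFun, Geom.cellFun,
      if_neg (by rw [i.den_eq_zero X X' hi he hh.symm]; exact lt_irrefl _),
      if_neg (by rw [← hh]; exact lt_irrefl _), map_zero]

end Pullback

section Cutoff

variable {d : ℕ}

/-- A radial cutoff function with `χ(x) + χ(y) = 1` for `|x| |y| = 1`. -/
def cutoff (x : E d) : ℝ := Real.smoothTransition ((2 - ‖x‖ ^ 2) / (1 + ‖x‖ ^ 2))

theorem contDiff_cutoff : ContDiff ℝ ∞ (cutoff : E d → ℝ) := by
  have h : ContDiff ℝ ∞ fun x : E d => ‖x‖ ^ 2 := contDiff_norm_sq ℝ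
  exact Real.smoothTransition.contDiff.comp ((contDiff_const.sub h).div (contDiff_const.add h)
    fun x => by positivity)

theorem cutoff_eq_zero {x : E d} (hx : 3 / 2 < ‖x‖) : cutoff x = 0 := by
  apply Real.smoothTransition.zero_of_nonpos
  refine div_nonpos_of_nonpos_of_nonneg ?_ (by positivity)
  nlinarith

theorem hasCompactSupport_cutoff : HasCompactSupport (cutoff : E d → ℝ) :=
  HasCompactSupport.intro (isCompact_closedBall (0 : E d) (3 / 2)) fun x hx =>
    cutoff_eq_zero (by simpa using hx)

theorem tsupport_cutoff : tsupport (cutoff : E d → ℝ) ⊆ Metric.ball 0 2 := by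
  refine (closure_minimal (t := Metric.closedBall 0 (3 / 2)) (fun x hx => ?_)
    Metric.isClosed_closedBall).trans (Metric.closedBall_subset_ball (by norm_num))
  by_contra h
  exact hx (cutoff_eq_zero (by simpa using h))

theorem cutoff_zero : cutoff (0 : E d) = 1 :=
  Real.smoothTransition.one_of_one_le (by simp)

theorem cutoff_add_inv {x y : E d} (hx : x ≠ 0) (hy : ‖y‖ = ‖x‖⁻¹) : cutoff x + cutoff y = 1 := by
  have h0 : 0 < ‖x‖ := norm_pos_iff.mpr hx
  have e : (2 - ‖y‖ ^ 2) / (1 + ‖y‖ ^ 2) = 1 - (2 - ‖x‖ ^ 2) / (1 + ‖x‖ ^ 2) := by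
    rw [hy]
    field_simp
    ring
  rw [cutoff, cutoff, e]
  set s := (2 - ‖x‖ ^ 2) / (1 + ‖x‖ ^ 2)
  have h1 := (Real.smoothTransition.pos_denom s).ne'
  rw [Real.smoothTransition, Real.smoothTransition, sub_sub_cancel,
    add_comm (expNegInvGlue (1 - s)) (expNegInvGlue s), ← add_div, div_self h1]

variable {D : CellData d} {W : Type*} [NormedAddCommGroup W] [NormedSpace ℂ W]
  {τ : Representation ℂ D.M W} {μ : ℂ}

/-- The expression of a section in the chart at `a`, cut off. -/
def locTest (f : D.SmoothSec τ μ) (a : D.G) : TestFn d W :=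
  ⟨fun x => cutoff x • D.chart f.1.1 a x, contDiff_cutoff.smul (f.2 a),
    hasCompactSupport_cutoff.smul_right⟩

theorem locTest_eq_zero (f : D.SmoothSec τ μ) (a : D.G) {y : E d} (hy : 3 / 2 < ‖y‖) :
    (locTest f a).1 y = 0 := by
  change cutoff y • _ = _
  rw [cutoff_eq_zero hy, zero_smul]

end Cutoff

section Localization

variable {n : ℕ} {D : CellData (n - 1)} (X : Geom n D)
  {W : Type*} [NormedAddCommGroup W] [NormedSpace ℂ W] [FiniteDimensional ℂ W]
  {τ : Representation ℂ D.M W} {μ : ℂ}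

/-- The unit vector in the definition of the Weyl group representative. -/
def weylVec (d : ℕ) : E d := WithLp.toLp 2 fun i => if i.val = 0 then 1 else 0

theorem norm_weylVec {d : ℕ} (hd : 0 < d) : ‖weylVec d‖ = 1 := by
  have e : weylVec d = EuclideanSpace.single ⟨0, hd⟩ 1 := by
    ext i
    simp [weylVec, Fin.ext_iff]
  rw [e]
  simp

theorem weyl_eq_inversion {d : ℕ} (D : CellData d) : D.weyl = D.inversion (weylVec d) := rfl

open Classical in
theorem Geom.cellFun_smul_chart {f : D.G → W} (hf : f ∈ D.Sec τ μ) (a h : D.G)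
    (χ : E (n - 1) → ℝ) : X.cellFun τ μ (fun x => χ x • D.chart f a x) h
      = if 0 < X.den h then χ (X.pos h) • f (a * h) else 0 := by
  rw [Geom.cellFun]
  split_ifs with hh
  · obtain ⟨z, hz⟩ := X.eq_cell hh
    obtain ⟨f1, f2, f3⟩ := hf
    have e : f (a * h) = Complex.exp ((μ - D.rho) * Real.log (X.den h)) •
        τ (X.mpart h)⁻¹ (f (a * D.opp (X.pos h))) := by
      conv_lhs => rw [hz, ← mul_assoc, ← mul_assoc, ← mul_assoc, f3, f2, f1]
    rw [e, ContinuousLinearMap.map_smul_of_tower, smul_comm]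
    rfl
  · rfl

/-- The partition of a section into pieces supported in the two standard cells. -/
theorem Geom.eq_add_cellSec (hn : 0 < n - 1) (hτ : Continuous (opRep τ)) (f : D.SmoothSec τ μ) :
    f = X.cellSec hτ μ 1 (locTest f 1) + X.cellSec hτ μ D.weyl (locTest f D.weyl) := by
  have hu := norm_weylVec hn
  refine Subtype.ext (Subtype.ext (funext fun g => ?_))
  change f.1.1 g = X.cellFun τ μ _ (1⁻¹ * g) + X.cellFun τ μ _ (D.weyl⁻¹ * g)
  rw [locTest, locTest, X.cellFun_smul_chart f.1.2, X.cellFun_smul_chart f.1.2, inv_one, one_mul,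
    one_mul, mul_inv_cancel_left, weyl_eq_inversion]
  rcases (X.den_nonneg g).lt_or_eq with hg | hg
  · rw [if_pos hg]
    -- `w⁻¹ g` and `w⁻¹ n̄_x` define the same point
    have hnull : X.null ((D.inversion (weylVec (n - 1)))⁻¹ * g)
        = X.den g • X.null ((D.inversion (weylVec (n - 1)))⁻¹ * D.opp (X.pos g)) := by
      obtain ⟨z, hz⟩ := X.eq_cell hg
      conv_lhs => rw [hz, ← mul_assoc, ← mul_assoc, ← mul_assoc, X.null_mul_nilp, X.null_mul_a,
        X.null_mul_M _ (X.mpart g).2, Real.exp_log hg]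
    have hden : X.den ((D.inversion (weylVec (n - 1)))⁻¹ * g)
        = X.den g * X.den ((D.inversion (weylVec (n - 1)))⁻¹ * D.opp (X.pos g)) := by
      rw [Geom.den, hnull, Geom.den]
      simp only [Prod.smul_fst, Prod.smul_snd, smul_eq_mul]
      rw [Geom.den]
      ring
    by_cases hx : X.pos g = 0
    · rw [hden, hx, X.opp_zero, mul_one, X.den_inversion_inv hu, mul_zero,
        if_neg (lt_irrefl _), cutoff_zero, one_smul, add_zero]
    · obtain ⟨h1, h2⟩ := X.inversion_inv_opp hu hx
      have hpos : X.pos ((D.inversion (weylVec (n - 1)))⁻¹ * g)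
          = X.pos ((D.inversion (weylVec (n - 1)))⁻¹ * D.opp (X.pos g)) := by
        rw [Geom.pos, hden, hnull, Geom.pos]
        simp only [Prod.smul_snd, smul_smul]
        congr 1
        field_simp
      rw [hden, if_pos (mul_pos hg h1), hpos, ← add_smul, cutoff_add_inv hx h2, one_smul]
  · obtain ⟨h1, h2⟩ := X.den_inversion_inv_mul hu hg.symm
    rw [if_neg (by rw [← hg]; exact lt_irrefl _), if_pos h1, h2, cutoff_zero, one_smul, zero_add]

end Localization

end HypSob

/-! ### The dyadic decomposition of functionals -/

namespace HypSob

open MeasureTheory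

section Dyadic

variable {d : ℕ} {W : Type*} [NormedAddCommGroup W] [NormedSpace ℂ W]

theorem pdl_const_smul_complex (a : List (Fin d)) (c : ℂ) {f : E d → W} (hf : ContDiff ℝ ∞ f) :
    pdl a (c • f) = c • pdl a f := by
  induction a with
  | nil => rfl
  | cons i a ih =>
    rw [pdl, ih]
    funext x
    have h := fderiv_const_smul (((contDiff_pdl a hf).differentiable (by simp)) x) c
    rw [pd, h]
    rfl

theorem derNorm_const_smul (q : ℝ) (i : ℕ) (c : ℂ) {f : E d → W} (hf : ContDiff ℝ ∞ f) :
    derNorm q i (c • f) = ‖c‖ₑ * derNorm q i f := by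
  rw [derNorm, derNorm, Finset.mul_sum]
  refine Finset.sum_congr rfl fun a _ => ?_
  rw [pdl_const_smul_complex _ c hf, eLpNorm_const_smul]

theorem eLpNorm_pdl_ne_top (q : ℝ) (a : List (Fin d)) (v : TestFn d W) :
    eLpNorm (pdl a v.1) (ENNReal.ofReal q) ≠ ⊤ :=
  ((contDiff_pdl a v.2.1).continuous.memLp_of_hasCompactSupport
    (hasCompactSupport_pdl a v.2.2)).eLpNorm_ne_top

theorem derNorm_ne_top (q : ℝ) (i : ℕ) (v : TestFn d W) : derNorm q i v.1 ≠ ⊤ :=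
  ENNReal.sum_ne_top.mpr fun _ _ => eLpNorm_pdl_ne_top q _ v

/-- The operators of the dyadic decomposition of functions: a smooth approximation and the
Littlewood–Paley components at the scales `2^{-j}`. -/
def dyadicOp (L : ℕ) : ℕ → (E d → W) → E d → W
  | 0, v => lpS L 1 (lpS L 1 v)
  | j + 1, v => lpP L ((1 / 2) ^ j) v

/-- The scale of the operator `dyadicOp L j`. -/
def dyadicScale (j : ℕ) : ℝ := (1 / 2) ^ (j - 1)

theorem dyadicScale_pos (j : ℕ) : 0 < dyadicScale j := by
  rw [dyadicScale]; positivity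

theorem dyadicScale_le_one (j : ℕ) : dyadicScale j ≤ 1 :=
  pow_le_one₀ (by norm_num) (by norm_num)

theorem isLinOp_dyadicOp (L j : ℕ) : IsLinOp (dyadicOp L j : (E d → W) → E d → W) := by
  cases j with
  | zero => exact (isLinOp_lpS L one_pos).comp (isLinOp_lpS L one_pos)
  | succ j => exact isLinOp_lpP L (by positivity)

theorem contDiff_dyadicOp (L j : ℕ) {v : E d → W} (hv : LocallyIntegrable v) :
    ContDiff ℝ ∞ (dyadicOp L j v) := by
  cases j with
  | zero => exact contDiff_lpS L one_pos ((isLinOp_lpS L one_pos).1 v hv)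
  | succ j => exact contDiff_lpP L (by positivity) hv

theorem lpS_lpS_eq_zero {ε : ℝ} (hε : 0 < ε) (hε1 : ε ≤ 1) {R : ℝ} {v : E d → W}
    (hv : ∀ x, R < ‖x‖ → v x = 0) (L : ℕ) :
    ∀ x, R + 2 * L < ‖x‖ → lpS L ε (lpS L ε v) x = 0 := by
  intro x hx
  have h : L * ε ≤ L := mul_le_of_le_one_right (by positivity) hε1
  exact lpS_eq_zero hε (lpS_eq_zero hε hv L) L x (by linarith)

theorem dyadicOp_eq_zero (L j : ℕ) {R : ℝ} {v : E d → W} (hv : ∀ x, R < ‖x‖ → v x = 0) :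
    ∀ x, R + 2 * L < ‖x‖ → dyadicOp L j v x = 0 := by
  cases j with
  | zero => exact lpS_lpS_eq_zero one_pos le_rfl hv L
  | succ j => exact lpP_eq_zero (by positivity) (pow_le_one₀ (by norm_num) (by norm_num)) hv L

/-- The partial sums of the dyadic decomposition telescope. -/
theorem sum_dyadicOp (L J : ℕ) {v : E d → W} (hv : ContDiff ℝ ∞ v) (x : E d) :
    ∑ j ∈ Finset.range (J + 1), dyadicOp L j v x
      = lpS L ((1 / 2) ^ J) (lpS L ((1 / 2) ^ J) v) x := by
  induction J with
  | zero => simp [dyadicOp]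
  | succ J ih =>
    have e : ((1 : ℝ) / 2) ^ J / 2 = (1 / 2) ^ (J + 1) := by rw [pow_succ]; ring
    rw [Finset.sum_range_succ, ih, dyadicOp, lpP_eq L (by positivity) hv, e, add_sub_cancel]

theorem exists_eLpNorm_dyadicOp_cutoff [CompleteSpace W] {Ω : Set (E d)} (hΩ : IsOpen Ω)
    {χ : E d → ℝ} (hχ : ContDiff ℝ ∞ χ) (hc : HasCompactSupport χ) (hs : tsupport χ ⊆ Ω) {q : ℝ}
    (hq : 1 < q) {κ L : ℕ} (hκ : κ ≤ L) (b : List (Fin d)) : ∃ K : ℝ≥0, ∀ (j : ℕ) (u : E d → W),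
      localNorm Ω κ q u ≠ ⊤ →
      eLpNorm (pdl b (dyadicOp L j fun x => χ x • u x)) (ENNReal.ofReal q)
        ≤ K * (ENNReal.ofReal (dyadicScale j ^ κ) * ENNReal.ofReal ((dyadicScale j)⁻¹ ^ b.length))
          * localNorm Ω κ q u := by
  obtain ⟨K₁, h₁⟩ := exists_eLpNorm_lpP_cutoff (W := W) hΩ hχ hc hs hq hκ b
  obtain ⟨K₂, h₂⟩ := exists_eLpNorm_pdl_lpS (W := W) hq L b
  obtain ⟨K₃, h₃⟩ := exists_eLpNorm_pdl_lpS (W := W) (d := d) hq L []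
  obtain ⟨C, hC⟩ := exists_weakPD_cutoff (W := W) hΩ hχ hc hs hq []
  refine ⟨K₁ + K₂ * K₃ * C, fun j u hu => ?_⟩
  cases j with
  | zero =>
    simp only [dyadicScale, zero_tsub, pow_zero, one_pow, inv_one, ENNReal.ofReal_one, mul_one]
    refine le_trans ?_ (mul_le_mul_left (ENNReal.coe_le_coe.mpr le_add_self) _)
    refine le_mul_of_forall_le_mul_add ENNReal.coe_ne_top fun δ hδ => ?_
    obtain ⟨w, hw, hw'⟩ := hC u (localNorm Ω κ q u + δ) fun b hb =>
      exists_weakPD_of_localNorm hu hδ (hb.trans (Nat.zero_le _))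
    have hlw : LocallyIntegrable w := locallyIntegrableOn_univ.mp hw.2.1
    have e : lpS L 1 (fun x => χ x • u x) = lpS L 1 w := pdl_lpS_of_weak L one_pos hw
    rw [dyadicOp, e]
    have e2 := h₂ 1 one_pos _ ((isLinOp_lpS L one_pos).1 w hlw)
    have e3 := h₃ 1 one_pos w hlw
    simp only [inv_one, one_pow, ENNReal.ofReal_one, one_mul] at e2 e3
    refine e2.trans ((mul_le_mul_right (e3.trans (mul_le_mul_right hw' _)) _).trans_eq ?_)
    push_cast
    ring
  | succ j =>
    refine (h₁ ((1 / 2) ^ j) (by positivity) u hu).trans ?_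
    simp only [dyadicScale, Nat.add_sub_cancel]
    gcongr
    exact le_self_add

end Dyadic

section Functional

variable {d : ℕ} {D : CellData d} {W : Type*} [NormedAddCommGroup W] [NormedSpace ℂ W]
  [CompleteSpace W] {τ : Representation ℂ D.M W} {μ : ℂ}

omit [CompleteSpace W] in
/-- The functional `f ↦ Ψ(Θ(χ f_a))`. It is extended arbitrarily to those sections which are not
locally integrable. -/
theorem exists_functional (Ψ : TestFn d W →ₗ[ℂ] ℂ) {Θ : (E d → W) → E d → W} (hΘ : IsLinOp Θ)
    (hΘT : ∀ v, LocallyIntegrable v → (∀ x, 3 / 2 < ‖x‖ → v x = 0) → Θ v ∈ TestFn d W) (a : D.G) :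
    ∃ ℓ : D.Sec τ μ →ₗ[ℂ] ℂ, ∀ (f : D.Sec τ μ)
      (h : LocallyIntegrable fun x => cutoff x • D.chart f.1 a x),
        ℓ f = Ψ ⟨Θ fun x => cutoff x • D.chart f.1 a x,
          hΘT _ h fun x hx => by rw [cutoff_eq_zero hx, zero_smul]⟩ := by
  set p : Submodule ℂ (D.Sec τ μ) :=
    { carrier := {f | LocallyIntegrable fun x => cutoff x • D.chart f.1 a x}
      add_mem' := fun {f g} hf hg => by
        have e : (fun x => cutoff x • D.chart (f + g).1 a x)
            = (fun x => cutoff x • D.chart f.1 a x) + fun x => cutoff x • D.chart g.1 a x :=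
          funext fun x => smul_add _ _ _
        rw [Set.mem_ofPred_eq, e]
        exact LocallyIntegrable.add hf hg
      zero_mem' := by
        have e : (fun x => cutoff x • D.chart (0 : D.Sec τ μ).1 a x) = 0 :=
          funext fun x => smul_zero _
        rw [Set.mem_ofPred_eq, e]
        exact locallyIntegrable_zero
      smul_mem' := fun c f hf => by
        have e : (fun x => cutoff x • D.chart (c • f).1 a x)
            = c • fun x => cutoff x • D.chart f.1 a x :=
          funext fun x => smul_comm _ _ _
        rw [Set.mem_ofPred_eq, e]
        exact LocallyIntegrable.smul hf c } with hp
  have key : ∀ (c : ℂ) (f g : p), (Θ fun x => cutoff x • D.chart (c • f + g).1.1 a x)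
      = c • (Θ fun x => cutoff x • D.chart f.1.1 a x)
        + Θ fun x => cutoff x • D.chart g.1.1 a x := by
    intro c f g
    rw [← hΘ.2 c _ _ f.2 g.2]
    congr 1
    funext x
    change cutoff x • (c • D.chart f.1.1 a x + D.chart g.1.1 a x) = _
    rw [smul_add, smul_comm]
    rfl
  obtain ⟨ℓ, hℓ⟩ := LinearMap.exists_extend (p := p) (Ψ ∘ₗ
    { toFun := fun f => (⟨Θ fun x => cutoff x • D.chart f.1.1 a x,
        hΘT _ f.2 fun x hx => by rw [cutoff_eq_zero hx, zero_smul]⟩ : TestFn d W)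
      map_add' := fun f g => Subtype.ext (by
        have := key 1 f g
        rw [one_smul, one_smul] at this
        exact this)
      map_smul' := fun c f => Subtype.ext (by
        have := key c f 0
        have h0 := key 0 0 0
        have h1 := key 1 0 0
        rw [one_smul, one_smul, add_zero] at h1
        rw [add_zero] at this
        rw [left_eq_add.mp h1, add_zero] at this
        exact this) })
  exact ⟨ℓ, fun f h => LinearMap.congr_fun hℓ ⟨f, h⟩⟩

end Functional

end HypSob

/-! ### Boundedness of functionals which satisfy scaled estimates -/

namespace HypSob

open MeasureTheory

section Functional

variable {d : ℕ} {D : CellData d} {W : Type*} [NormedAddCommGroup W] [NormedSpace ℂ W]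
  [CompleteSpace W] {τ : Representation ℂ D.M W} {μ : ℂ}

/-- Functionals on test functions which satisfy, for all scales `δ ≤ 1`, the bound
`|Ψ(v)| ≤ C δ^e ∑_{l<N} δ^l ‖D^l v‖_q`, with a constant depending only on the support of `v`. -/
def ScaledBound (Ψ : TestFn d W →ₗ[ℂ] ℂ) (q e : ℝ) (N : ℕ) : Prop :=
  ∀ R : ℝ, 0 ≤ R → ∃ C : ℝ≥0, ∀ δ : ℝ, 0 < δ → δ ≤ 1 → ∀ v : TestFn d W,
    (∀ y, R < ‖y‖ → v.1 y = 0) → ‖Ψ v‖ₑ ≤ C * ENNReal.ofReal (δ ^ e) *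
      ∑ l ∈ Finset.range N, ENNReal.ofReal (δ ^ l) * derNorm q l v.1

omit [CompleteSpace W] in
theorem dyadicOp_mem (L j : ℕ) {v : E d → W} (hv : LocallyIntegrable v)
    (hs : ∀ x, 3 / 2 < ‖x‖ → v x = 0) : dyadicOp L j v ∈ TestFn d W :=
  ⟨contDiff_dyadicOp L j hv,
    HasCompactSupport.intro (isCompact_closedBall (0 : E d) (3 / 2 + 2 * L)) fun x hx =>
      dyadicOp_eq_zero L j hs x (by simpa using hx)⟩

omit [CompleteSpace W] in
theorem localNorm_chart_le {a : D.G} (ha : a = 1 ∨ a = D.weyl) (q : ℝ) (κ : ℕ)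
    (f : D.Sec τ μ) : localNorm (Metric.ball 0 2) κ q (D.chart f.1 a) ≤ intNorm D τ μ q κ f := by
  rcases ha with rfl | rfl
  · exact le_self_add
  · exact le_add_self

/-- The functional of a dyadic component, on Sobolev spaces of integral order. -/
theorem ScaledBound.exists_enorm_le {Ψ : TestFn d W →ₗ[ℂ] ℂ} {q e : ℝ} {N : ℕ}
    (hΨ : ScaledBound Ψ q e N) (hq : 1 < q) {κ L : ℕ} (hκ : κ ≤ L) {a : D.G}
    (ha : a = 1 ∨ a = D.weyl) : ∃ C : ℝ≥0, C ≠ 0 ∧ ∀ (j : ℕ) (ℓ : D.Sec τ μ →ₗ[ℂ] ℂ),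
      (∀ (f : D.Sec τ μ) (h : LocallyIntegrable fun x => cutoff x • D.chart f.1 a x),
        ℓ f = Ψ ⟨dyadicOp L j fun x => cutoff x • D.chart f.1 a x,
          dyadicOp_mem L j h fun x hx => by rw [cutoff_eq_zero hx, zero_smul]⟩) →
      ∀ f, ‖ℓ f‖ₑ ≤ ((C * (dyadicScale j ^ (e + κ)).toNNReal : ℝ≥0) : ℝ≥0∞)
        * intNorm D τ μ q κ f := by
  have hK := exists_eLpNorm_dyadicOp_cutoff (W := W) Metric.isOpen_ball contDiff_cutoff
    (hasCompactSupport_cutoff (d := d)) tsupport_cutoff hq hκ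
  choose K hK using hK
  obtain ⟨C, hC⟩ := hΨ (3 / 2 + 2 * L) (by positivity)
  set M : ℝ≥0 := ∑ l ∈ Finset.range N, ∑ b : Fin l → Fin d, K (List.ofFn b) with hM
  refine ⟨C * M + 1, by positivity, fun j ℓ hℓ f => ?_⟩
  have hs := dyadicScale_pos j
  by_cases hf : intNorm D τ μ q κ f = ⊤
  · rw [hf, ENNReal.mul_top]
    · exact le_top
    · rw [ENNReal.coe_ne_zero]
      have : 0 < (dyadicScale j ^ (e + κ)).toNNReal := Real.toNNReal_pos.mpr (by positivity)
      positivity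
  have hle := localNorm_chart_le ha q κ f
  have hloc : localNorm (Metric.ball 0 2) κ q (D.chart f.1 a) ≠ ⊤ := ne_top_of_le_ne_top hf hle
  obtain ⟨v₀, hv₀, -⟩ := exists_weakPD_of_localNorm hloc one_ne_zero (a := []) (Nat.zero_le κ)
  have hl := locallyIntegrable_cutoff contDiff_cutoff (hasCompactSupport_cutoff (d := d))
    tsupport_cutoff hv₀.1
  rw [hℓ f hl]
  refine (hC (dyadicScale j) hs (dyadicScale_le_one j) _ (dyadicOp_eq_zero L j fun x hx => by
    rw [cutoff_eq_zero hx, zero_smul])).trans ?_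
  have h1 : ∑ l ∈ Finset.range N, ENNReal.ofReal (dyadicScale j ^ l)
        * derNorm q l (dyadicOp L j fun x => cutoff x • D.chart f.1 a x)
      ≤ M * ENNReal.ofReal (dyadicScale j ^ κ) * intNorm D τ μ q κ f := by
    rw [hM]
    push_cast
    rw [Finset.sum_mul, Finset.sum_mul]
    refine Finset.sum_le_sum fun l _ => ?_
    rw [derNorm, Finset.mul_sum, Finset.sum_mul, Finset.sum_mul]
    refine Finset.sum_le_sum fun b _ => ?_
    have h2 := hK (List.ofFn b) j (D.chart f.1 a) hloc
    rw [List.length_ofFn] at h2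
    have h3 : ENNReal.ofReal (dyadicScale j ^ l) * ENNReal.ofReal ((dyadicScale j)⁻¹ ^ l) = 1 := by
      rw [← ENNReal.ofReal_mul (by positivity), ← mul_pow, mul_inv_cancel₀ hs.ne', one_pow,
        ENNReal.ofReal_one]
    calc _ ≤ ENNReal.ofReal (dyadicScale j ^ l) * (K (List.ofFn b) *
            (ENNReal.ofReal (dyadicScale j ^ κ) * ENNReal.ofReal ((dyadicScale j)⁻¹ ^ l))
            * localNorm (Metric.ball 0 2) κ q (D.chart f.1 a)) := mul_le_mul_right h2 _
      _ = (ENNReal.ofReal (dyadicScale j ^ l) * ENNReal.ofReal ((dyadicScale j)⁻¹ ^ l)) *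
            (K (List.ofFn b) * ENNReal.ofReal (dyadicScale j ^ κ)
            * localNorm (Metric.ball 0 2) κ q (D.chart f.1 a)) := by ring
      _ ≤ _ := by
          rw [h3, one_mul]
          exact mul_le_mul_right hle _
  refine (mul_le_mul_right h1 _).trans ?_
  have h4 : ((dyadicScale j ^ (e + κ)).toNNReal : ℝ≥0∞)
      = ENNReal.ofReal (dyadicScale j ^ e) * ENNReal.ofReal (dyadicScale j ^ κ) := by
    rw [← ENNReal.ofReal_mul (by positivity), ← Real.rpow_add_natCast hs.ne']
    rfl
  rw [ENNReal.coe_mul, h4]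
  calc _ = ((C * M : ℝ≥0) : ℝ≥0∞) * (ENNReal.ofReal (dyadicScale j ^ e)
        * ENNReal.ofReal (dyadicScale j ^ κ)) * intNorm D τ μ q κ f := by push_cast; ring
    _ ≤ _ := by
        refine mul_le_mul_left (mul_le_mul_left ?_ _) _
        exact ENNReal.coe_le_coe.mpr le_self_add

omit [CompleteSpace W] in
/-- By interpolation, bounds for integral orders imply bounds for real orders. -/
theorem enorm_le_sobolevNorm {q t e : ℝ} (ht : 0 ≤ t) {C₀ C₁ : ℝ≥0} (hC₀ : C₀ ≠ 0) (hC₁ : C₁ ≠ 0)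
    {s : ℝ} (hs : 0 < s) {ℓ : D.Sec τ μ →ₗ[ℂ] ℂ}
    (h₀ : ∀ f, ‖ℓ f‖ₑ ≤ ((C₀ * (s ^ (e + ⌊t⌋₊)).toNNReal : ℝ≥0) : ℝ≥0∞)
      * intNorm D τ μ q ⌊t⌋₊ f)
    (h₁ : ∀ f, ‖ℓ f‖ₑ ≤ ((C₁ * (s ^ (e + (⌊t⌋₊ + 1 : ℕ))).toNNReal : ℝ≥0) : ℝ≥0∞)
      * intNorm D τ μ q (⌊t⌋₊ + 1) f) (f : D.Sec τ μ) :
    ‖ℓ f‖ₑ ≤ ((C₀ ^ (1 - Int.fract t) * C₁ ^ Int.fract t : ℝ≥0) : ℝ≥0∞)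
      * ENNReal.ofReal (s ^ (e + t)) * sobolevNorm D τ μ q t f := by
  have hfl : (⌊t⌋₊ : ℝ) + Int.fract t = t := by
    rw [natCast_floor_eq_intCast_floor ht, Int.floor_add_fract]
  rw [sobolevNorm]
  split_ifs with hfr
  · rw [hfr, add_zero] at hfl
    rw [hfr, sub_zero, NNReal.rpow_one, NNReal.rpow_zero, mul_one]
    refine (h₀ f).trans_eq ?_
    rw [hfl, ENNReal.coe_mul]
    rfl
  · have hθ₀ : 0 < Int.fract t := lt_of_le_of_ne (Int.fract_nonneg t) (Ne.symm hfr)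
    have hp : ∀ x : ℝ, (s ^ x).toNNReal ≠ 0 := fun x =>
      (Real.toNNReal_pos.mpr (Real.rpow_pos_of_pos hs x)).ne'
    refine (enorm_le_interpNorm hθ₀ (Int.fract_lt_one t) (mul_ne_zero hC₀ (hp _))
      (mul_ne_zero hC₁ (hp _)) h₀ h₁ f).trans_eq ?_
    congr 1
    rw [NNReal.mul_rpow, NNReal.mul_rpow, ENNReal.ofReal, ← ENNReal.coe_mul]
    congr 1
    have h2 : (s ^ (e + ⌊t⌋₊)).toNNReal ^ (1 - Int.fract t)
        * (s ^ (e + (⌊t⌋₊ + 1 : ℕ))).toNNReal ^ Int.fract t = (s ^ (e + t)).toNNReal := by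
      rw [← Real.toNNReal_rpow_of_nonneg (by positivity),
        ← Real.toNNReal_rpow_of_nonneg (by positivity), ← Real.rpow_mul hs.le,
        ← Real.rpow_mul hs.le, ← Real.toNNReal_mul (by positivity), ← Real.rpow_add hs]
      congr 2
      push_cast
      linear_combination hfl
    rw [← h2]
    ring

/-- The approximations of a test function converge together with their derivatives in `L^q`. -/
theorem exists_sum_derNorm_sub_lpS_le {q : ℝ} (hq : 1 < q) {L : ℕ} (hL : 1 ≤ L) (N : ℕ)
    (v : TestFn d W) : ∃ B : ℝ≥0∞, B ≠ ⊤ ∧ ∀ ε : ℝ, 0 < ε → ∑ l ∈ Finset.range N,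
      derNorm q l (fun x => v.1 x - lpS L ε (lpS L ε v.1) x) ≤ ENNReal.ofReal ε * B := by
  obtain ⟨K, hK⟩ := exists_eLpNorm_pdl_sub_lpS (W := W) (d := d) hq hL
  refine ⟨∑ l ∈ Finset.range N, ∑ b : Fin l → Fin d,
    (K : ℝ≥0∞) * ∑ i : Fin d, eLpNorm (pd i (pdl (List.ofFn b) v.1)) (ENNReal.ofReal q), ?_, ?_⟩
  · refine ENNReal.sum_ne_top.mpr fun l _ => ENNReal.sum_ne_top.mpr fun b _ => ?_
    exact ENNReal.mul_ne_top ENNReal.coe_ne_top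
      (ENNReal.sum_ne_top.mpr fun i _ => eLpNorm_pdl_ne_top q (i :: List.ofFn b) v)
  · intro ε hε
    rw [Finset.mul_sum]
    refine Finset.sum_le_sum fun l _ => ?_
    rw [derNorm, Finset.mul_sum]
    refine Finset.sum_le_sum fun b _ => ?_
    set g : Fin d → ℝ≥0∞ := fun i =>
      eLpNorm (pd i (pdl (List.ofFn b) v.1)) (ENNReal.ofReal q)
    have hg : ∀ i, g i ≤ ∑ i, g i := fun i =>
      Finset.single_le_sum (fun _ _ => zero_le) (Finset.mem_univ i)
    have h := hK ε hε v.1 (List.ofFn b) _ v.2.1 hg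
    refine h.trans_eq ?_
    rw [mul_assoc, mul_left_comm]

/-- Functionals with a scaled bound of exponent `e > -t` are bounded on localized sections in terms
of the Sobolev norm of order `t`: the component of scale `2^{-j}` contributes at most a multiple of
`2^{-j (e + t)}`, and these numbers are summable. -/
theorem ScaledBound.exists_enorm_le_sobolevNorm {Ψ : TestFn d W →ₗ[ℂ] ℂ} {q e : ℝ} {N : ℕ}
    (hΨ : ScaledBound Ψ q e N) (hq : 1 < q) {t : ℝ} (ht : 0 ≤ t) (het : 0 < e + t) {a : D.G}
    (ha : a = 1 ∨ a = D.weyl) : ∃ C : ℝ≥0, ∀ f : D.SmoothSec τ μ,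
      ‖Ψ (locTest f a)‖ₑ ≤ C * sobolevNorm D τ μ q t f.1 := by
  set L := ⌊t⌋₊ + 1 with hL
  obtain ⟨C₀, hC₀, h₀⟩ := hΨ.exists_enorm_le (τ := τ) (μ := μ) hq (κ := ⌊t⌋₊) (L := L)
    (Nat.le_succ _) ha
  obtain ⟨C₁, hC₁, h₁⟩ := hΨ.exists_enorm_le (τ := τ) (μ := μ) hq (κ := L) (L := L) le_rfl ha
  have hfun := fun j => exists_functional (D := D) (τ := τ) (μ := μ) Ψ (isLinOp_dyadicOp L j)
    (fun v hv hs => dyadicOp_mem L j hv hs) a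
  choose ℓ hℓ using hfun
  set C : ℝ≥0 := C₀ ^ (1 - Int.fract t) * C₁ ^ Int.fract t with hC
  have hbound : ∀ j f, ‖ℓ j f‖ₑ ≤ C * ENNReal.ofReal (dyadicScale j ^ (e + t))
      * sobolevNorm D τ μ q t f := fun j f =>
    enorm_le_sobolevNorm ht hC₀ hC₁ (dyadicScale_pos j) (h₀ j (ℓ j) (hℓ j)) (h₁ j (ℓ j) (hℓ j)) f
  -- the geometric series
  obtain ⟨G, hG⟩ : ∃ G : ℝ≥0, ∀ J, ∑ j ∈ Finset.range J,
      ENNReal.ofReal (dyadicScale j ^ (e + t)) ≤ G := by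
    set ρ : ℝ := (1 / 2) ^ (e + t) with hρ
    have hρ0 : 0 < ρ := by positivity
    have hρ1 : ρ < 1 := Real.rpow_lt_one (by norm_num) (by norm_num) het
    have hsum : Summable fun j : ℕ => ρ ^ (j - 1) := by
      rw [← summable_nat_add_iff 1]
      simpa using summable_geometric_of_lt_one hρ0.le hρ1
    refine ⟨(∑' j : ℕ, ρ ^ (j - 1)).toNNReal, fun J => ?_⟩
    have e1 : ∀ j, dyadicScale j ^ (e + t) = ρ ^ (j - 1) := fun j => by
      rw [dyadicScale, hρ, ← Real.rpow_natCast, ← Real.rpow_natCast, ← Real.rpow_mul (by norm_num),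
        ← Real.rpow_mul (by norm_num), mul_comm]
    simp only [e1]
    rw [← ENNReal.ofReal_sum_of_nonneg fun j _ => by positivity]
    exact ENNReal.ofReal_le_ofReal (hsum.sum_le_tsum _ fun j _ => by positivity)
  obtain ⟨C', hC'⟩ := hΨ (3 / 2 + 2 * L) (by positivity)
  refine ⟨C * G, fun f => ?_⟩
  set v := locTest f a with hv
  have hvs : ∀ x, 3 / 2 < ‖x‖ → v.1 x = 0 := fun x hx => locTest_eq_zero f a hx
  have hvl : LocallyIntegrable v.1 := v.2.1.continuous.locallyIntegrable
  set P : ℕ → TestFn d W := fun j => ⟨dyadicOp L j v.1, dyadicOp_mem L j hvl hvs⟩ with hP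
  have hPℓ : ∀ j, Ψ (P j) = ℓ j f.1 := fun j => (hℓ j f.1 hvl).symm
  set r : ℕ → TestFn d W := fun J => v - ∑ j ∈ Finset.range (J + 1), P j with hr
  have hrv : ∀ J x, (r J).1 x
      = v.1 x - lpS L ((1 / 2) ^ J) (lpS L ((1 / 2) ^ J) v.1) x := by
    intro J x
    rw [← sum_dyadicOp L J v.2.1]
    simp only [hr, hP, Submodule.coe_sub, Submodule.coe_sum, Pi.sub_apply, Finset.sum_apply]
  have hrs : ∀ J x, 3 / 2 + 2 * L < ‖x‖ → (r J).1 x = 0 := by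
    intro J x hx
    have h0 : (0 : ℝ) ≤ 2 * L := by positivity
    rw [hrv, hvs x (by linarith), lpS_lpS_eq_zero (by positivity)
      (pow_le_one₀ (by norm_num) (by norm_num)) hvs L x hx, sub_zero]
  obtain ⟨B, hBt, hB⟩ := exists_sum_derNorm_sub_lpS_le hq (L := L) (by omega) N v
  have hrb : ∀ J, ‖Ψ (r J)‖ₑ ≤ ENNReal.ofReal ((1 / 2) ^ J) * (C' * B) := by
    intro J
    have h2 := hC' 1 one_pos le_rfl (r J) (hrs J)
    simp only [Real.one_rpow, one_pow, ENNReal.ofReal_one, mul_one, one_mul] at h2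
    refine h2.trans ?_
    rw [mul_left_comm]
    have e2 : (r J).1 = fun x => v.1 x - lpS L ((1 / 2) ^ J) (lpS L ((1 / 2) ^ J) v.1) x :=
      funext (hrv J)
    rw [e2]
    exact mul_le_mul_right (hB _ (by positivity)) _
  have hmain : ∀ J, ‖Ψ v‖ₑ ≤ ENNReal.ofReal ((1 / 2) ^ J) * (C' * B)
      + ((C * G : ℝ≥0) : ℝ≥0∞) * sobolevNorm D τ μ q t f.1 := by
    intro J
    have e3 : Ψ v = Ψ (r J) + ∑ j ∈ Finset.range (J + 1), Ψ (P j) := by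
      simp only [hr, map_sub, map_sum, sub_add_cancel]
    rw [e3]
    refine (enorm_add_le _ _).trans (add_le_add (hrb J) ?_)
    refine (enorm_sum_le _ _).trans ?_
    refine (Finset.sum_le_sum fun j _ => (by rw [hPℓ]; exact hbound j f.1 :
      ‖Ψ (P j)‖ₑ ≤ C * ENNReal.ofReal (dyadicScale j ^ (e + t))
        * sobolevNorm D τ μ q t f.1)).trans ?_
    rw [← Finset.sum_mul, ← Finset.mul_sum, ENNReal.coe_mul]
    exact mul_le_mul_left (mul_le_mul_right (hG _) _) _
  have hlim : Filter.Tendsto (fun J : ℕ => ENNReal.ofReal ((1 / 2) ^ J) * (C' * B)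
      + ((C * G : ℝ≥0) : ℝ≥0∞) * sobolevNorm D τ μ q t f.1) Filter.atTop
      (𝓝 (0 * (C' * B) + ((C * G : ℝ≥0) : ℝ≥0∞) * sobolevNorm D τ μ q t f.1)) := by
    refine Filter.Tendsto.add (ENNReal.Tendsto.mul_const ?_
      (Or.inr (ENNReal.mul_ne_top ENNReal.coe_ne_top hBt))) tendsto_const_nhds
    rw [← ENNReal.ofReal_zero]
    exact ENNReal.tendsto_ofReal
      (tendsto_pow_atTop_nhds_zero_of_lt_one (by norm_num) (by norm_num))
  rw [zero_mul, zero_add] at hlim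
  exact ge_of_tendsto' hlim hmain

end Functional

end HypSob

/-! ### Distributions with regular push-forward -/

namespace HypSob

open MeasureTheory

section Extension

variable {k d : ℕ} {W₁ W₂ : Type*} [NormedAddCommGroup W₁] [NormedSpace ℂ W₁]
  [NormedAddCommGroup W₂] [NormedSpace ℂ W₂]

/-- The Sobolev norm of the extension, in terms of scaled derivatives. -/
theorem exists_sum_derNorm_extFun_le (h : k ≤ d) (L : W₁ →L[ℂ] W₂) {q : ℝ} (hq : 1 < q)
    {K N : ℕ} (hKN : K < N) : ∃ C : ℝ≥0, ∀ δ : ℝ, 0 < δ → δ ≤ 1 → ∀ v : E k → W₁, ContDiff ℝ ∞ v →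
      ∑ i ∈ Finset.range (K + 1), derNorm q i (extFun d L δ v)
        ≤ C * ENNReal.ofReal (δ ^ (((d - k : ℕ) : ℝ) / q) * δ⁻¹ ^ K) *
          ∑ l ∈ Finset.range N, ENNReal.ofReal (δ ^ l) * derNorm q l v := by
  choose C hC using exists_derNorm_extFun_le h L hq
  refine ⟨∑ i ∈ Finset.range (K + 1), C i, fun δ hδ hδ1 v hv => ?_⟩
  push_cast
  rw [Finset.sum_mul, Finset.sum_mul]
  refine Finset.sum_le_sum fun i hi => ?_
  have hi' : i ≤ K := Nat.lt_succ_iff.mp (Finset.mem_range.mp hi)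
  refine (hC i δ hδ v hv).trans ?_
  have h1 : δ⁻¹ ^ i ≤ δ⁻¹ ^ K := pow_le_pow_right₀ ((one_le_inv₀ hδ).mpr hδ1) hi'
  refine mul_le_mul' (mul_le_mul_right (ENNReal.ofReal_le_ofReal ?_) _) ?_
  · exact mul_le_mul_of_nonneg_left h1 (by positivity)
  · exact Finset.sum_le_sum_of_subset_of_nonneg (Finset.range_mono (by omega))
      fun _ _ _ => zero_le

end Extension

section Pushforward

variable {m n : ℕ} {D : CellData (m - 1)} {D' : CellData (n - 1)}
  {V₁ V₂ F : Type*} [NormedAddCommGroup V₁] [NormedSpace ℂ V₁] [FiniteDimensional ℂ V₁]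
  [NormedAddCommGroup V₂] [NormedSpace ℂ V₂] [FiniteDimensional ℂ V₂]
  [NormedAddCommGroup F] [NormedSpace ℂ F] [FiniteDimensional ℂ F]

/-- An injective `T` has a left inverse, hence `T^* ⊗ 1` has a right inverse. -/
theorem exists_precomp_rightInverse (F : Type*) [NormedAddCommGroup F] [NormedSpace ℂ F]
    {T : V₁ →ₗ[ℂ] V₂} (hT : Function.Injective T) :
    ∃ L : DualFibre V₁ F →L[ℂ] DualFibre V₂ F, ∀ B, precomp F T (L B) = B := by
  obtain ⟨S, hS⟩ := T.exists_leftInverse_of_injective (LinearMap.ker_eq_bot.mpr hT)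
  refine ⟨precomp F S, fun B => ?_⟩
  refine ContinuousLinearMap.ext (f := (_ : DualFibre V₁ F).eval) fun v => ?_
  change _ = DualFibre.eval _ v
  rw [precomp_apply, precomp_apply]
  exact congrArg _ (LinearMap.congr_fun hS v)

/-- A bound for the push-forward of a distribution gives scaled bounds for the distribution: a
section supported in a cell is the restriction of sections supported near the submanifold. -/
theorem scaledBound_of_pushforward (i : CellHom D D') (X : Geom m D) (X' : Geom n D')
    (hmn : m - 1 ≤ n - 1) (hm : 0 < m - 1) (hi : i.inc = pad (m - 1) (n - 1))
    {σ₁ : Representation ℂ D.M V₁} {σ₂ : Representation ℂ D'.M V₂} (lam : ℂ) {T : V₁ →ₗ[ℂ] V₂}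
    (hTinj : Function.Injective T)
    (hT : ∀ (b : D.M) (v : V₁), T (σ₁ b v) = σ₂ ⟨i.hom b, i.map_M b b.2⟩ (T v))
    (h₁ : Continuous (opRep (dualRep F σ₁))) (h₂ : Continuous (opRep (dualRep F σ₂)))
    {φ : Distr F D σ₁ lam} {p S : ℝ} (hp : 1 < p.conjExponent) (hS : 0 ≤ S)
    (hfr : Int.fract S ≠ 0) (hφ : MemH F p (-S) (pushforward F i σ₁ σ₂ lam T hT φ)) (a : D.G) :
    ScaledBound (φ.toLin ∘ₗ X.cellSec h₁ (-lam) a) p.conjExponent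
      (((n - 1 - (m - 1) : ℕ) : ℝ) / p.conjExponent - S) (⌊S⌋₊ + 2) := by
  intro R hR
  set q := p.conjExponent with hq
  set K := ⌊S⌋₊ with hK
  set N := K + 2 with hN
  obtain ⟨L, hL⟩ := exists_precomp_rightInverse F hTinj
  obtain ⟨A, hA⟩ := hφ
  obtain ⟨I₀, hI₀⟩ := X'.exists_intNorm_cellSec_le h₂ (-(lam + D.rho - D'.rho)) (i.hom a)
    (R := R + 2) (by linarith) hp K
  obtain ⟨I₁, hI₁⟩ := X'.exists_intNorm_cellSec_le h₂ (-(lam + D.rho - D'.rho)) (i.hom a)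
    (R := R + 2) (by linarith) hp (K + 1)
  obtain ⟨J₀, hJ₀⟩ := exists_sum_derNorm_extFun_le hmn L hp (K := K) (N := N) (by omega)
  obtain ⟨J₁, hJ₁⟩ := exists_sum_derNorm_extFun_le hmn L hp (K := K + 1) (N := N) (by omega)
  refine ⟨A * (I₀ * J₀ + I₁ * J₁), fun δ hδ hδ1 v hv => ?_⟩
  set Y : ℝ≥0∞ := ∑ l ∈ Finset.range N, ENNReal.ofReal (δ ^ l) * derNorm q l v.1 with hY
  have hYt : Y ≠ ⊤ := ENNReal.sum_ne_top.mpr fun l _ =>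
    ENNReal.mul_ne_top ENNReal.ofReal_ne_top (derNorm_ne_top q l v)
  set f := X'.cellSec h₂ (-(lam + D.rho - D'.rho)) (i.hom a) (extTest hmn L hδ hδ1 v) with hf
  have hpull : pullback F i σ₁ σ₂ lam T hT f = X.cellSec h₁ (-lam) a v := by
    refine pullback_cellSec i X X' (fun x => by rw [hi, norm_pad hmn]) (norm_weylVec hm) lam hT
      h₁ h₂ a fun y => ?_
    rw [hi]
    change precomp F T (extFun (n - 1) L δ v.1 (pad (m - 1) (n - 1) y)) = _
    rw [extFun_pad hmn, hL]
  have hcf : ∀ c : ℂ, c • f.1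
      = (X'.cellSec h₂ (-(lam + D.rho - D'.rho)) (i.hom a) (extTest hmn L hδ hδ1 (c • v))).1 :=
    fun c => by rw [extTest_smul, map_smul]; rfl
  have hYc : ∀ c : ℂ, ∑ l ∈ Finset.range N, ENNReal.ofReal (δ ^ l) * derNorm q l (c • v).1
      = ‖c‖ₑ * Y := by
    intro c
    rw [hY, Finset.mul_sum]
    refine Finset.sum_congr rfl fun l _ => ?_
    rw [mul_left_comm]
    exact congrArg _ (derNorm_const_smul q l c v.2.1)
  have hsupp : ∀ (c : ℂ) (y : E (n - 1)), R + 2 < ‖y‖ →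
      (extTest hmn L hδ hδ1 (c • v)).1 y = 0 := fun c y hy =>
    extFun_eq_zero_of_radius hδ hδ1 hmn (fun x hx => by
      change c • v.1 x = 0
      rw [hv x hx, smul_zero]) hy
  set s : ℝ := δ ^ (((n - 1 - (m - 1) : ℕ) : ℝ) / q) with hs
  have hs0 : 0 < s := by positivity
  set y : ℝ≥0 := (I₀ * J₀ + I₁ * J₁) * Y.toNNReal with hy
  have hyY : (y : ℝ≥0∞) = ((I₀ * J₀ + I₁ * J₁ : ℝ≥0) : ℝ≥0∞) * Y := by
    rw [hy, ENNReal.coe_mul, ENNReal.coe_toNNReal hYt]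
  have hb₀ : ∀ c : ℂ, intNorm D' _ _ q K (c • f.1)
      ≤ ‖c‖ₑ * (ENNReal.ofReal (s * δ⁻¹ ^ K) * y) := by
    intro c
    rw [hcf]
    refine (hI₀ _ (hsupp c)).trans ?_
    refine (mul_le_mul_right (hJ₀ δ hδ hδ1 _ (c • v).2.1) _).trans ?_
    rw [hYc, hyY]
    calc _ = ‖c‖ₑ * (ENNReal.ofReal (s * δ⁻¹ ^ K) * (((I₀ * J₀ : ℝ≥0) : ℝ≥0∞) * Y)) := by
          push_cast; ring
      _ ≤ _ := by gcongr; exact le_self_add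
  have hb₁ : ∀ c : ℂ, intNorm D' _ _ q (K + 1) (c • f.1)
      ≤ ‖c‖ₑ * (ENNReal.ofReal (s * δ⁻¹ ^ (K + 1)) * y) := by
    intro c
    rw [hcf]
    refine (hI₁ _ (hsupp c)).trans ?_
    refine (mul_le_mul_right (hJ₁ δ hδ hδ1 _ (c • v).2.1) _).trans ?_
    rw [hYc, hyY]
    calc _ = ‖c‖ₑ * (ENNReal.ofReal (s * δ⁻¹ ^ (K + 1)) * (((I₁ * J₁ : ℝ≥0) : ℝ≥0∞) * Y)) := by
          push_cast; ring
      _ ≤ _ := by gcongr; exact le_add_self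
  have hint := interpNorm_le (N₀ := intNorm D' (dualRep F σ₂) (-(lam + D.rho - D'.rho)) q K)
    (N₁ := intNorm D' (dualRep F σ₂) (-(lam + D.rho - D'.rho)) q (K + 1)) (u := f.1) (Y := y)
    (θ := Int.fract S) (mul_pos hs0 (pow_pos (inv_pos.mpr hδ) K))
    (mul_pos hs0 (pow_pos (inv_pos.mpr hδ) (K + 1))) hb₀ hb₁
  have hexp : (s * δ⁻¹ ^ K) ^ (1 - Int.fract S) * (s * δ⁻¹ ^ (K + 1)) ^ Int.fract S
      = δ ^ (((n - 1 - (m - 1) : ℕ) : ℝ) / q - S) := by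
    have hfl : (K : ℝ) + Int.fract S = S := by
      rw [hK, natCast_floor_eq_intCast_floor hS, Int.floor_add_fract]
    have e1 : ∀ j : ℕ, s * δ⁻¹ ^ j = δ ^ (((n - 1 - (m - 1) : ℕ) : ℝ) / q - j) := fun j => by
      rw [hs, inv_pow, ← Real.rpow_natCast, ← Real.rpow_neg hδ.le, ← Real.rpow_add hδ,
        sub_eq_add_neg]
    rw [e1, e1, ← Real.rpow_mul hδ.le, ← Real.rpow_mul hδ.le, ← Real.rpow_add hδ]
    congr 1
    push_cast
    linear_combination -hfl
  rw [hexp] at hint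
  have hAf := hA f
  rw [neg_neg, sobolevNorm, if_neg hfr] at hAf
  have e2 : (φ.toLin ∘ₗ X.cellSec h₁ (-lam) a) v
      = (pushforward F i σ₁ σ₂ lam T hT φ).toLin f := by
    change φ.toLin _ = φ.toLin _
    rw [hpull]
  rw [e2]
  refine hAf.trans ((mul_le_mul_right hint _).trans_eq ?_)
  rw [hyY]
  push_cast
  ring

/-- If the push-forward of `φ` to a manifold in codimension `c` has the regularity `-S`, then `φ`
has every regularity `-t` with `S < t + c / q`. The order `S` is required to be non-integral, so
that the norm of order `S` is an interpolation norm. -/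
theorem memH_of_pushforward (i : CellHom D D') (X : Geom m D) (X' : Geom n D')
    (hmn : m - 1 ≤ n - 1) (hm : 0 < m - 1) (hi : i.inc = pad (m - 1) (n - 1))
    {σ₁ : Representation ℂ D.M V₁} {σ₂ : Representation ℂ D'.M V₂} (lam : ℂ) {T : V₁ →ₗ[ℂ] V₂}
    (hTinj : Function.Injective T)
    (hT : ∀ (b : D.M) (v : V₁), T (σ₁ b v) = σ₂ ⟨i.hom b, i.map_M b b.2⟩ (T v))
    (hc₁ : ∀ v, Continuous fun b => σ₁ b v) (hc₂ : ∀ v, Continuous fun b => σ₂ b v)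
    {φ : Distr F D σ₁ lam} {p S t : ℝ} (hp : 1 < p.conjExponent) (ht : 0 ≤ t) (hS : 0 ≤ S)
    (hfr : Int.fract S ≠ 0)
    (hSt : S < t + ((n - 1 - (m - 1) : ℕ) : ℝ) / p.conjExponent)
    (hφ : MemH F p (-S) (pushforward F i σ₁ σ₂ lam T hT φ)) : MemH F p (-t) φ := by
  have h₁ := continuous_opRep_dualRep (F := F) hc₁
  have h₂ := continuous_opRep_dualRep (F := F) hc₂
  have hcomplete : CompleteSpace (DualFibre V₁ F) := FiniteDimensional.complete ℂ _
  have key := fun a => scaledBound_of_pushforward i X X' hmn hm hi lam hTinj hT h₁ h₂ hp hS hfr hφ a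
  obtain ⟨C₁, hC₁⟩ := (key 1).exists_enorm_le_sobolevNorm (D := D) (τ := dualRep F σ₁) (μ := -lam)
    hp ht (by linarith) (Or.inl rfl)
  obtain ⟨C₂, hC₂⟩ := (key D.weyl).exists_enorm_le_sobolevNorm (D := D) (τ := dualRep F σ₁)
    (μ := -lam) hp ht (by linarith) (Or.inr rfl)
  refine ⟨C₁ + C₂, fun f => ?_⟩
  rw [neg_neg, ENNReal.coe_add, add_mul]
  conv_lhs => rw [X.eq_add_cellSec hm h₁ f, map_add]
  exact (enorm_add_le _ _).trans (add_le_add (hC₁ f) (hC₂ f))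

end Pushforward

end HypSob

theorem mainTheorem12 (κ : HypSob.Kind) {m n : ℕ} (hm : 2 ≤ m) (hmn : m < n)
    {V₁ V₂ F : Type*}
    [NormedAddCommGroup V₁] [NormedSpace ℂ V₁] [FiniteDimensional ℂ V₁]
    [NormedAddCommGroup V₂] [NormedSpace ℂ V₂] [FiniteDimensional ℂ V₂]
    [NormedAddCommGroup F] [NormedSpace ℂ F] [FiniteDimensional ℂ F]
    (σ₁ : Representation ℂ (HypSob.cell κ m).M V₁) (hσ₁ : σ₁.IsIrreducible)
    (hc₁ : ∀ v, Continuous fun b => σ₁ b v)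
    (σ₂ : Representation ℂ (HypSob.cell κ n).M V₂) (hσ₂ : σ₂.IsIrreducible)
    (hc₂ : ∀ v, Continuous fun b => σ₂ b v)
    (T : V₁ →ₗ[ℂ] V₂) (hTinj : Function.Injective T)
    (hT : ∀ (b : (HypSob.cell κ m).M) (v : V₁), T (σ₁ b v) =
      σ₂ ⟨(HypSob.incl κ hmn.le).hom b, (HypSob.incl κ hmn.le).map_M b b.2⟩ (T v))
    (lam : ℂ) {p q r : ℝ} (hp : 1 < p) (hpq : 1 / p + 1 / q = 1) (hr : r ≤ 0)
    (φ : HypSob.Distr F (HypSob.cell κ m) σ₁ lam)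
    (hφ : HypSob.MemHLt F p (r - ((n : ℝ) - (m : ℝ)) / q)
      (HypSob.pushforward F (HypSob.incl κ hmn.le) σ₁ σ₂ lam T hT φ)) :
    HypSob.MemHLt F p r φ := by
  intro s hs
  have hq : p.conjExponent = q := by
    have hp0 : p ≠ 0 := by positivity
    have hp1 : p - 1 ≠ 0 := (sub_pos.mpr hp).ne'
    have hq0 : q ≠ 0 := by
      rintro rfl
      rw [div_zero, add_zero, div_eq_one_iff_eq hp0] at hpq
      exact hp.ne hpq
    rw [Real.conjExponent, div_eq_iff hp1]
    field_simp at hpq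
    linarith
  have hq1 : 1 < p.conjExponent := (Real.HolderConjugate.conjExponent hp).symm.lt
  have hc : ((n - 1 - (m - 1) : ℕ) : ℝ) = n - m := by
    rw [show n - 1 - (m - 1) = n - m by omega, Nat.cast_sub hmn.le]
  have hcq : 0 ≤ ((n : ℝ) - m) / q :=
    div_nonneg (sub_nonneg.mpr (by exact_mod_cast hmn.le)) (hq ▸ zero_le_one.trans hq1.le)
  -- a non-integral order, so that the norm of order `S` is an interpolation norm
  obtain ⟨S, hS, hSl, hSu⟩ :=
    exists_irrational_btwn (show -r + ((n : ℝ) - m) / q < -s + ((n : ℝ) - m) / q by linarith)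
  have hfr : Int.fract S ≠ 0 := fun h => hS.ne_int ⌊S⌋ (by rw [← Int.self_sub_floor] at h; linarith)
  have := HypSob.memH_of_pushforward (HypSob.incl κ hmn.le) (HypSob.geom κ m) (HypSob.geom κ n)
    (by omega) (by omega) (by cases κ <;> rfl) lam hTinj hT hc₁ hc₂ (t := -s) hq1 (by linarith)
    (by linarith) hfr (by rw [hc, hq]; exact hSu) (hφ (-S) (by linarith))
  rwa [neg_neg] at this
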